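/- For graphs $H$ and $F$, let $\mathrm{ex}_{\mathcal P}(n,H,F)$ denote the maximum number of (not necessarily induced) copies of $H$, i.e. subgraphs isomorphic to $H$, in an $n$-vertex planar graph that contains no subgraph isomorphic to $F$; the graphs attaining this maximum are called extremal. For $n\ge 5$ let $\mathcal J_n$ be the class of all $n$-vertex planar graphs that can be obtained (up to isomorphism) as follows: take a pentagon $x\,u\,y\,z\,v$; replace the vertex $x$ by an independent set $C$, each vertex of which is joined to both $u$ and $v$; and replace the edge $yz$ opposite to $x$ by a tree with color classes $A$ and $B$, where $u$ is joined to every vertex of $A$ and $v$ is joined to every vertex of $B$; here $|C|$ and $|A\cup B|-1$ are as equal as possible, i.e. they differ by at most $1$. (Planarity of the resulting graph is part of the definition of $\mathcal J_n$.) Theorem. For every $n\ge 5$, $$\mathrm{ex}_{\mathcal P}(n,C_5,C_3)=\left\lfloor\frac{n-3}{2}\right\rfloor\cdot\left\lceil\frac{n-3}{2}\right\rceil,$$ and $\mathcal J_n$ is, up to isomorphism, exactly the set of all extremal graphs for $\mathrm{ex}_{\mathcal P}(n,C_5,C_3)$, that is, of the $n$-vertex triangle-free planar graphs with the maximum number of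 $5$-cycles. -/

import Mathlib

/-- A rotation system of a graph: at each vertex, a cyclic order of the darts (edges directed
away from that vertex) leaving it. `rot d` is the dart that follows `d` around `d.fst`. -/
structure RotationSystem {V : Type*} (G : SimpleGraph V) where
  rot : Equiv.Perm G.Dart
  fst_rot : ∀ d : G.Dart, (rot d).fst = d.fst
  sameCycle_rot : ∀ d e : G.Dart, d.fst = e.fst → rot.SameCycle d e

namespace RotationSystem

variable {V : Type*} {G : SimpleGraph V}

/-- Face tracing: traverse the dart `d` and then leave its end-vertex along the next dart. -/
def facePerm (R : RotationSystem G) : Equiv.Perm G.Dart :=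
  (Function.Involutive.toPerm SimpleGraph.Dart.symm SimpleGraph.Dart.symm_involutive).trans R.rot

/-- The faces, when each connected component is drawn on a surface of its own: the closed facial
walks (the orbits of face tracing), together with one face for every isolated vertex. -/
abbrev Face (R : RotationSystem G) : Type _ :=
  Quotient (Equiv.Perm.SameCycle.setoid R.facePerm) ⊕ {v : V // G.IsIsolated v}

/-- Euler's formula `V - E + F = 2` holds for the drawing, summed over the connected components.
As a component of genus `g` contributes `2 - 2 g ≤ 2` to `V - E + F`, this says that every
component is drawn on a sphere. -/
def IsSpherical (R : RotationSystem G) : Prop :=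
  Nat.card V + Nat.card R.Face = Nat.card G.edgeSet + 2 * Nat.card G.ConnectedComponent

end RotationSystem

/-- A finite graph is planar if it has a combinatorial embedding (a rotation system) in the sphere,
that is, one of genus zero. -/
def IsPlanar {V : Type*} [Finite V] (G : SimpleGraph V) : Prop :=
  ∃ R : RotationSystem G, R.IsSpherical

/-- The numbers of (not necessarily induced, unlabelled) copies of `H` in the `n`-vertex `F`-free
planar graphs. Their maximum is the generalized planar Turán number of `n`, `H`, `F`. -/
def planarCopyCounts {W U : Type*} (n : ℕ) (H : SimpleGraph W) (F : SimpleGraph U) : Set ℕ :=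
  {k | ∃ G : SimpleGraph (Fin n), IsPlanar G ∧ F.Free G ∧ G.copyCount H = k}

/-- The generalized planar Turán number. -/
noncomputable def planarTuran {W U : Type*} (n : ℕ) (H : SimpleGraph W) (F : SimpleGraph U) : ℕ :=
  sSup (planarCopyCounts n H F)

/-- `G` is an `n`-vertex `F`-free planar graph with the maximum number of copies of `H`. -/
def IsPlanarExtremal {W U : Type*} {n : ℕ} (H : SimpleGraph W) (F : SimpleGraph U)
    (G : SimpleGraph (Fin n)) : Prop :=
  IsPlanar G ∧ F.Free G ∧ G.copyCount H = planarTuran n H F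

/-- The pentagon `x u y z v` with the vertex `x` replaced by the independent set `C` and the opposite
edge `y z` replaced by the tree `T`. The vertices `u`, `v` are `Sum.inl false`, `Sum.inl true`. Both
are joined to all of `C`, and each of them is joined to one of the two color classes of `T`. -/
def pentagonBlowup {W : Type*} (T : SimpleGraph W) (col : T.Coloring Bool) (C : Type*) :
    SimpleGraph (Bool ⊕ W ⊕ C) :=
  SimpleGraph.fromRel fun a b => match a, b with
    | .inl p, .inr (.inl w) => col w = p
    | .inl _, .inr (.inr _) => True
    | .inr (.inl w), .inr (.inl w') => T.Adj w w'
    | _, _ => False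

/-- The class `𝒥ₙ` of `n`-vertex planar graphs, closed under isomorphism: blow-ups of the pentagon by
a tree on `m` vertices and an independent set of size `c`, with `c` and `m - 1` as equal as
possible. Planarity is a requirement, as it fails for some trees. -/
def IsJ (n : ℕ) (G : SimpleGraph (Fin n)) : Prop :=
  IsPlanar G ∧
    ∃ (m c : ℕ) (T : SimpleGraph (Fin m)) (col : T.Coloring Bool),
      T.IsTree ∧ |(c : ℤ) - ((m : ℤ) - 1)| ≤ 1 ∧
        Nonempty (G ≃g pentagonBlowup T col (Fin c))

/-!
Planarity enters the upper bound only through *cut systems*: in a plane graph, an edge function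
with values in `ZMod 2` has sum zero around every face exactly if it is a cut. An embedding of Euler
characteristic two gives such a system (`IsPlanar.hasCutSystem`), and a cut system is inherited by
minors (`HasCutSystem.minor`). Counting dimensions yields the edge bound of triangle-free planar
graphs, with one edge less if the graph is not bipartite (`HasCutSystem.deg2_le`), and excludes the
minors `K₃,₃` and `K₅` (`PT.noK33`, `HasCutSystem.noK5`).

Let `a`, `b` be nonadjacent vertices of a set `S`, with `c ≥ 1` common neighbours and `p ≥ 1` paths
of length three between them. There are `c * p` pentagons through both (`PT.card_pents_pair`). The
inner vertices of the paths of length three span a forest with `p` edges, so `c + p + 3 ≤ |S|`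
(`PT.cn_add_pp_le`), with equality exactly if this forest is a tree and `S` has no further vertices,
that is, if `S` spans a blow-up of the pentagon (`Blow`). The vertices `a` and `b` (the hubs), their
common neighbours and the forest form the *frame* of the pair.

With `M` the largest value of `p`, the number of pentagons in `S` is at most `M * (|S| - 3 - M)`
(`PT.concl`), where for `|S| ≤ 2 * M + 4` only blow-ups attain equality. This is shown by induction
on `S`. In a minimal counterexample (`Irr`) with a frame attaining `M`, some vertices lie outside
the frame. Deleting vertices of degree at most two and parts with a small attachment
(`Irr.no_light_vertex`, `Irr.exists_adj_leaf`, `Irr.no_small_attachment`) restricts how the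
components outside the frame are attached to it (`Irr.touched_cases`). For `M ≥ 2` this leaves a
single common neighbour (`Irr.card_cn`), a forest that is not a tree (`Irr.not_linked`), and for
each tree of the forest a connected rest (`Irr.linked_compl`). Three trees would then give a minor
`K₃,₃` or `K₅` (`PT.theta`), and two trees are single edges (`Irr.item_edge`), which is a small case
(`Irr.false_of_two_le`). For `M = 1` each edge lies in at most two pentagons
(`Irr.card_pents_edge`), and the edge bound concludes (`Irr.false_of_one`).

Maximizing `M * (n - 3 - M)` gives the upper bound (`PT.card_pents_le`). A graph attaining it is a
blow-up whose two parameters differ by at most one, and these are the graphs of the class to be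
described (`PT.blow_iso`, `PT.blow_of_iso`, `PT.isJ_iff`). That they exist is shown by an explicit
drawing of the blow-up with a star as its tree (`BlowStar.isPlanar`, `BlowStar.blow`).
-/

section
open scoped Classical

/-! ### Cycle spaces of rotation systems -/

namespace RotationSystem

section
variable {V : Type*} {G : SimpleGraph V}

/-- The dart of an edge given by the chosen representative of the unordered pair. -/
noncomputable def outDart (e : G.edgeSet) : G.Dart :=
  ⟨Quot.out e.1, by
    have h := e.2
    rwa [← Quot.out_eq e.1] at h⟩

theorem edge_outDart (e : G.edgeSet) : (outDart e).edge = e.1 := Quot.out_eq e.1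

theorem eq_outDart_or (d : G.Dart) :
    d = outDart ⟨d.edge, d.edge_mem⟩ ∨ d = (outDart ⟨d.edge, d.edge_mem⟩).symm :=
  (SimpleGraph.dart_edge_eq_iff _ _).1 (edge_outDart ⟨d.edge, d.edge_mem⟩).symm

theorem sum_dart [Fintype V] {M : Type*} [AddCommMonoid M] (f : G.Dart → M) :
    ∑ d, f d = ∑ e : G.edgeSet, (f (outDart e) + f (outDart e).symm) := by
  rw [← Finset.sum_fiberwise Finset.univ (fun d : G.Dart => (⟨d.edge, d.edge_mem⟩ : G.edgeSet)) f]
  refine Finset.sum_congr rfl fun e _ => ?_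
  have : (Finset.univ.filter fun d : G.Dart => (⟨d.edge, d.edge_mem⟩ : G.edgeSet) = e)
      = {outDart e, (outDart e).symm} := by
    ext d
    simp only [Finset.mem_filter, Finset.mem_univ, true_and, Finset.mem_insert,
      Finset.mem_singleton]
    constructor
    · rintro rfl
      exact eq_outDart_or d
    · rintro (rfl | rfl)
      · exact Subtype.ext (edge_outDart e)
      · exact Subtype.ext ((SimpleGraph.Dart.edge_symm _).trans (edge_outDart e))
  rw [this, Finset.sum_pair (SimpleGraph.Dart.symm_ne _).symm]

/-- The face on one side of a dart. -/
def faceOf (R : RotationSystem G) (d : G.Dart) : R.Face :=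
  .inl (Quotient.mk (Equiv.Perm.SameCycle.setoid R.facePerm) d)

variable (R : RotationSystem G)

theorem faceOf_eq_iff {d d' : G.Dart} : R.faceOf d = R.faceOf d' ↔ R.facePerm.SameCycle d d' := by
  unfold faceOf
  rw [Sum.inl.injEq]
  exact Quotient.eq (r := Equiv.Perm.SameCycle.setoid R.facePerm)

theorem faceOf_facePerm (d : G.Dart) : R.faceOf (R.facePerm d) = R.faceOf d :=
  R.faceOf_eq_iff.2 (Equiv.Perm.sameCycle_apply_left.2 (Equiv.Perm.SameCycle.refl _ _))

theorem facePerm_apply (d : G.Dart) : R.facePerm d = R.rot d.symm := rfl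

theorem facePerm_fst (d : G.Dart) : (R.facePerm d).fst = d.snd := by
  rw [facePerm_apply, R.fst_rot]; rfl

theorem faceOf_rot (d : G.Dart) : R.faceOf (R.rot d) = R.faceOf d.symm := by
  rw [← R.faceOf_facePerm d.symm, facePerm_apply, SimpleGraph.Dart.symm_symm]

theorem not_isIsolated_fst (d : G.Dart) : ¬ G.IsIsolated d.fst := fun h => h _ d.adj

theorem reach_eq {α : Type*} {s : V → α} (h : ∀ u v, G.Adj u v → s u = s v) {u v : V}
    (huv : G.Reachable u v) : s u = s v := by
  obtain ⟨w⟩ := huv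
  induction w with
  | nil => rfl
  | cons hd _ ih => exact (h _ _ hd).trans ih

theorem eq_of_isIsolated {u v : V} (hu : G.IsIsolated u) (h : G.Reachable u v) : v = u := by
  obtain ⟨w⟩ := h
  cases w with
  | nil => rfl
  | cons h _ => exact (hu _ h).elim

variable [Fintype V]

noncomputable instance : Fintype R.Face := Fintype.ofFinite _

/-- The coboundary of vertex functions. -/
noncomputable def cob (G : SimpleGraph V) : (V → ZMod 2) →ₗ[ZMod 2] (G.edgeSet → ZMod 2) where
  toFun s e := s (outDart e).fst + s (outDart e).snd
  map_add' s t := by ext e; simp only [Pi.add_apply]; ring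
  map_smul' r s := by ext e; simp only [Pi.smul_apply, smul_eq_mul, RingHom.id_apply]; ring

/-- The face-edge incidence matrix: edges bordering a face on both sides count twice. -/
noncomputable def incMat : Matrix R.Face G.edgeSet (ZMod 2) := fun f e =>
  (if R.faceOf (outDart e) = f then 1 else 0) + (if R.faceOf (outDart e).symm = f then 1 else 0)

theorem cob_mem_ker (s : V → ZMod 2) : (R.incMat.mulVec (cob G s)) = 0 := by
  ext f
  have key : (R.incMat.mulVec (cob G s)) f =
      ∑ d : G.Dart, (if R.faceOf d = f then s d.fst + s d.snd else 0) := by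
    rw [sum_dart]
    simp only [Matrix.mulVec, dotProduct, incMat, cob, LinearMap.coe_mk, AddHom.coe_mk]
    refine Finset.sum_congr rfl fun e _ => ?_
    have h1 : (outDart e).symm.fst = (outDart e).snd := rfl
    have h2 : (outDart e).symm.snd = (outDart e).fst := rfl
    rw [h1, h2]
    split_ifs <;> ring
  have h2 : ∑ d : G.Dart, (if R.faceOf d = f then s d.snd else 0) =
      ∑ d : G.Dart, (if R.faceOf d = f then s d.fst else 0) := by
    refine Fintype.sum_equiv R.facePerm _ _ fun d => ?_
    rw [faceOf_facePerm, facePerm_fst]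
  have h3 : ∑ d : G.Dart, (if R.faceOf d = f then s d.fst + s d.snd else 0) =
      ∑ d : G.Dart, (if R.faceOf d = f then s d.fst else 0) +
      ∑ d : G.Dart, (if R.faceOf d = f then s d.snd else 0) := by
    rw [← Finset.sum_add_distrib]
    refine Finset.sum_congr rfl fun d _ => ?_
    split_ifs <;> simp
  rw [key, h3, h2, CharTwo.add_self_eq_zero]; rfl

/-- Functions on the vertices with coboundary zero are constant on components, so the cuts span a
space of dimension at least the number of vertices minus the number of components. -/
theorem card_le_finrank_cob (G : SimpleGraph V) :
    Nat.card V ≤ Module.finrank (ZMod 2) (LinearMap.range (cob G)) +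
      Nat.card G.ConnectedComponent := by
  have h := LinearMap.finrank_range_add_finrank_ker (cob G)
  rw [Module.finrank_pi] at h
  let Φ : LinearMap.ker (cob G) →ₗ[ZMod 2] (G.ConnectedComponent → ZMod 2) :=
    { toFun := fun s C => s.1 C.out
      map_add' := fun _ _ => rfl
      map_smul' := fun _ _ => rfl }
  have hΦ : Function.Injective Φ := by
    rw [← LinearMap.ker_eq_bot, LinearMap.ker_eq_bot']
    intro s hs
    ext v
    have hs1 : ∀ u w, G.Adj u w → s.1 u = s.1 w := by
      intro u w huw
      have h0 := s.2
      rw [LinearMap.mem_ker] at h0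
      have h1 := congrFun h0 ⟨s(u, w), huw⟩
      have h2 : s.1 (outDart ⟨s(u, w), huw⟩).fst + s.1 (outDart ⟨s(u, w), huw⟩).snd = 0 := h1
      rcases eq_outDart_or (⟨(u, w), huw⟩ : G.Dart) with h3 | h3
      · have : (outDart ⟨s(u, w), huw⟩ : G.Dart) = ⟨(u, w), huw⟩ := h3.symm
        rw [this] at h2
        exact CharTwo.add_eq_zero.1 h2
      · have : (outDart ⟨s(u, w), huw⟩ : G.Dart) = (⟨(u, w), huw⟩ : G.Dart).symm := by
          rw [h3, SimpleGraph.Dart.symm_symm]; rfl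
        rw [this] at h2
        exact (CharTwo.add_eq_zero.1 h2).symm
    have hv : G.Reachable (G.connectedComponentMk v).out v :=
      SimpleGraph.ConnectedComponent.exact (Quot.out_eq _)
    rw [← reach_eq hs1 hv]
    exact congrFun hs (G.connectedComponentMk v)
  have h5 := LinearMap.finrank_le_finrank_of_injective hΦ
  rw [Module.finrank_pi] at h5
  rw [Nat.card_eq_fintype_card, Nat.card_eq_fintype_card]
  omega

/-- Dually to `card_le_finrank_cob`, functions on the faces in the left kernel of the incidence
matrix are constant on components. -/
theorem card_face_le_rank :
    Nat.card R.Face ≤ R.incMat.rank + Nat.card G.ConnectedComponent := by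
  have h := LinearMap.finrank_range_add_finrank_ker (R.incMat.transpose.mulVecLin)
  rw [Module.finrank_pi] at h
  have hr : Module.finrank (ZMod 2) (LinearMap.range R.incMat.transpose.mulVecLin)
      = R.incMat.rank := by
    rw [← Matrix.rank_transpose R.incMat]; rfl
  rw [hr] at h
  -- a face at a chosen vertex of each component
  let ρ : G.ConnectedComponent → R.Face := fun C =>
    if hi : G.IsIsolated C.out then .inr ⟨C.out, hi⟩
    else R.faceOf ⟨(C.out, _), not_not.1 (not_forall.1 hi).choose_spec⟩
  have hρ : ∀ d : G.Dart, d.fst = (G.connectedComponentMk d.fst).out →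
      ∃ d' : G.Dart, d'.fst = d.fst ∧ ρ (G.connectedComponentMk d.fst) = R.faceOf d' := by
    intro d hd
    have hi : ¬ G.IsIsolated (G.connectedComponentMk d.fst).out := by
      rw [← hd]; exact not_isIsolated_fst d
    refine ⟨⟨((G.connectedComponentMk d.fst).out, _), not_not.1 (not_forall.1 hi).choose_spec⟩,
      hd.symm, ?_⟩
    simp only [ρ, dif_neg hi]
  let Φ : LinearMap.ker R.incMat.transpose.mulVecLin →ₗ[ZMod 2]
      (G.ConnectedComponent → ZMod 2) :=
    { toFun := fun s C => s.1 (ρ C)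
      map_add' := fun _ _ => rfl
      map_smul' := fun _ _ => rfl }
  have hΦ : Function.Injective Φ := by
    rw [← LinearMap.ker_eq_bot, LinearMap.ker_eq_bot']
    intro s hs
    have hout : ∀ e : G.edgeSet, s.1 (R.faceOf (outDart e)) = s.1 (R.faceOf (outDart e).symm) := by
      intro e
      have h0 := s.2
      rw [LinearMap.mem_ker] at h0
      have h1 := congrFun h0 e
      simp only [Matrix.mulVecLin_apply, Matrix.mulVec, dotProduct, Matrix.transpose_apply,
        incMat, Pi.zero_apply, add_mul, ite_mul, one_mul, zero_mul, Finset.sum_add_distrib,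
        Finset.sum_ite_eq, Finset.mem_univ, if_true] at h1
      exact CharTwo.add_eq_zero.1 h1
    have hsymm : ∀ d : G.Dart, s.1 (R.faceOf d) = s.1 (R.faceOf d.symm) := by
      intro d
      rcases eq_outDart_or d with h3 | h3
      · rw [h3]; exact hout _
      · rw [h3, SimpleGraph.Dart.symm_symm]; exact (hout _).symm
    -- the faces around a vertex have the same value, as have the faces on the two sides of an edge
    have hrot : ∀ d : G.Dart, s.1 (R.faceOf (R.rot d)) = s.1 (R.faceOf d) := by
      intro d; rw [faceOf_rot, hsymm d]
    have hfst : ∀ d d' : G.Dart, d.fst = d'.fst → s.1 (R.faceOf d) = s.1 (R.faceOf d') := by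
      intro d d' hdd
      obtain ⟨i, -, hi⟩ := (R.sameCycle_rot d d' hdd).exists_pow_eq'
      rw [← hi]
      clear hi
      induction i with
      | zero => rfl
      | succ k ih => rw [pow_succ', Equiv.Perm.mul_apply, hrot]; exact ih
    let t : V → ZMod 2 := fun v => if h : ∃ d : G.Dart, d.fst = v then s.1 (R.faceOf h.choose) else 0
    have ht : ∀ d : G.Dart, t d.fst = s.1 (R.faceOf d) := by
      intro d
      have h : ∃ d' : G.Dart, d'.fst = d.fst := ⟨d, rfl⟩
      simp only [t, dif_pos h]
      exact hfst _ _ h.choose_spec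
    have htadj : ∀ u v, G.Adj u v → t u = t v := by
      intro u v huv
      have h1 := ht ⟨(u, v), huv⟩
      have h2 := ht (⟨(u, v), huv⟩ : G.Dart).symm
      rw [hsymm] at h1
      exact h1.trans h2.symm
    have hzero : ∀ d : G.Dart, s.1 (R.faceOf d) = 0 := by
      intro d
      have hv : G.Reachable (G.connectedComponentMk d.fst).out d.fst :=
        SimpleGraph.ConnectedComponent.exact (Quot.out_eq _)
      rw [← ht, ← reach_eq htadj hv]
      have hi : ¬ G.IsIsolated (G.connectedComponentMk d.fst).out := by
        intro hi
        have := eq_of_isIsolated hi hv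
        rw [← this] at hi
        exact not_isIsolated_fst d hi
      have h4 := congrFun hs (G.connectedComponentMk d.fst)
      have h5 : s.1 (ρ (G.connectedComponentMk d.fst)) = 0 := h4
      simp only [ρ, dif_neg hi] at h5
      rw [← h5]
      exact ht ⟨((G.connectedComponentMk d.fst).out, _),
        not_not.1 (not_forall.1 hi).choose_spec⟩
    ext f
    rcases f with f | ⟨v, hv⟩
    · induction f using Quotient.inductionOn with
      | _ d => exact hzero d
    · have hv' : G.Reachable v (G.connectedComponentMk v).out :=
        (SimpleGraph.ConnectedComponent.exact (Quot.out_eq _)).symm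
      have hvv : (G.connectedComponentMk v).out = v := eq_of_isIsolated hv hv'
      have h5 : s.1 (ρ (G.connectedComponentMk v)) = 0 := congrFun hs (G.connectedComponentMk v)
      have hi : G.IsIsolated (G.connectedComponentMk v).out := by rw [hvv]; exact hv
      simp only [ρ, dif_pos hi] at h5
      simp only [hvv] at h5
      exact h5
  have h5 := LinearMap.finrank_le_finrank_of_injective hΦ
  rw [Module.finrank_pi] at h5
  rw [Nat.card_eq_fintype_card, Nat.card_eq_fintype_card]
  omega

theorem range_cob_le_ker : LinearMap.range (cob G) ≤ LinearMap.ker R.incMat.mulVecLin := by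
  rintro _ ⟨s, rfl⟩
  exact R.cob_mem_ker s

/-- Every rotation system has nonnegative genus. -/
theorem euler_le : Nat.card V + Nat.card R.Face ≤
    Nat.card G.edgeSet + 2 * Nat.card G.ConnectedComponent := by
  have h1 := card_le_finrank_cob G
  have h2 := R.card_face_le_rank
  have h3 := Submodule.finrank_mono R.range_cob_le_ker
  have h4 := LinearMap.finrank_range_add_finrank_ker R.incMat.mulVecLin
  rw [Module.finrank_pi, ← Nat.card_eq_fintype_card] at h4
  change R.incMat.rank + _ = _ at h4
  omega

/-- On the sphere the two inclusions between cuts and face-wise even edge sets agree. -/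
theorem IsSpherical.range_cob_eq {R : RotationSystem G} (hR : R.IsSpherical) :
    LinearMap.range (cob G) = LinearMap.ker R.incMat.mulVecLin := by
  apply Submodule.eq_of_le_of_finrank_le R.range_cob_le_ker
  have h1 := card_le_finrank_cob G
  have h2 := R.card_face_le_rank
  have h4 := LinearMap.finrank_range_add_finrank_ker R.incMat.mulVecLin
  rw [Module.finrank_pi, ← Nat.card_eq_fintype_card] at h4
  change R.incMat.rank + _ = _ at h4
  unfold IsSpherical at hR
  omega

end
end RotationSystem

/-! ### Cut systems: an algebraic trace of planarity -/

section
variable {V X F : Type}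

/-- The value on an unordered pair of the coboundary of a function on the vertices. -/
def cutVal (s : V → ZMod 2) : Sym2 V → ZMod 2 :=
  Sym2.lift ⟨fun u v => s u + s v, fun _ _ => add_comm _ _⟩

@[simp] theorem cutVal_mk (s : V → ZMod 2) (u v : V) : cutVal s s(u, v) = s u + s v := rfl

/-- `L` and `R` attach two faces to each edge in such a way that the edge functions (mod 2) with
zero sum around each face are exactly the cuts. Face sums are tested against all face functions. -/
def IsCutSystem (E : Finset (Sym2 V)) (L R : Sym2 V → F) : Prop :=
  ∀ D : Sym2 V → ZMod 2, (∀ g : F → ZMod 2, ∑ e ∈ E, D e * (g (L e) + g (R e)) = 0) ↔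
    ∃ s : V → ZMod 2, ∀ e ∈ E, D e = cutVal s e

theorem two_eq_zero_zmod : (2 : ZMod 2) = 0 := rfl

/-- Deleting an edge merges the two faces at that edge. -/
theorem IsCutSystem.erase {E : Finset (Sym2 V)} {L R : Sym2 V → F} (h : IsCutSystem E L R)
    {e₀ : Sym2 V} (he₀ : e₀ ∈ E) : ∃ L' R' : Sym2 V → F, IsCutSystem (E.erase e₀) L' R' := by
  let m : F → F := fun f => if f = L e₀ then R e₀ else f
  have hmL : m (L e₀) = R e₀ := if_pos rfl
  have hmR : m (R e₀) = R e₀ := by by_cases hh : R e₀ = L e₀ <;> simp [m, hh]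
  refine ⟨m ∘ L, m ∘ R, fun D => ⟨fun hD => ?_, ?_⟩⟩
  · let x := ∑ e ∈ E.erase e₀, D e *
      ((if L e = L e₀ then 1 else 0) + (if R e = L e₀ then 1 else 0))
    have hg : ∀ (g : F → ZMod 2) f,
        g f = g (m f) + (g (L e₀) + g (R e₀)) * (if f = L e₀ then 1 else 0) := by
      intro g f
      by_cases hf : f = L e₀
      · rw [if_pos hf, hf, hmL]; linear_combination -(g (R e₀)) * two_eq_zero_zmod
      · simp [m, hf]
    obtain ⟨s, hs⟩ := (h (Function.update D e₀ x)).1 fun g => by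
      rw [← Finset.add_sum_erase _ _ he₀, Function.update_self]
      have h1 : ∑ e ∈ E.erase e₀, Function.update D e₀ x e * (g (L e) + g (R e)) =
          ∑ e ∈ E.erase e₀, D e * (g ((m ∘ L) e) + g ((m ∘ R) e)) + (g (L e₀) + g (R e₀)) * x := by
        rw [Finset.mul_sum, ← Finset.sum_add_distrib]
        refine Finset.sum_congr rfl fun e he => ?_
        rw [Function.update_of_ne (Finset.ne_of_mem_erase he), hg g (L e), hg g (R e)]
        simp only [Function.comp]
        ring
      rw [h1, hD g]
      linear_combination (g (L e₀) + g (R e₀)) * x * two_eq_zero_zmod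
    refine ⟨s, fun e he => ?_⟩
    rw [← hs e (Finset.mem_of_mem_erase he),
      Function.update_of_ne (Finset.ne_of_mem_erase he)]
  · rintro ⟨s, hs⟩ g
    have h1 := (h (cutVal s)).2 ⟨s, fun _ _ => rfl⟩ (g ∘ m)
    rw [← Finset.add_sum_erase _ _ he₀] at h1
    simp only [Function.comp, hmL, hmR] at h1
    rw [CharTwo.add_self_eq_zero, mul_zero, zero_add] at h1
    rw [← h1]
    exact Finset.sum_congr rfl fun e he => by rw [hs e he]; rfl

theorem IsCutSystem.subset {E E' : Finset (Sym2 V)} {L R : Sym2 V → F} (h : IsCutSystem E L R)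
    (hE : E' ⊆ E) : ∃ L' R' : Sym2 V → F, IsCutSystem E' L' R' := by
  induction hn : (E \ E').card generalizing E L R with
  | zero =>
    have : E' = E := Finset.Subset.antisymm hE (by
      rwa [Finset.card_eq_zero, Finset.sdiff_eq_empty_iff_subset] at hn)
    exact ⟨L, R, this ▸ h⟩
  | succ n ih =>
    obtain ⟨e, he⟩ : (E \ E').Nonempty := Finset.card_pos.1 (by omega)
    rw [Finset.mem_sdiff] at he
    obtain ⟨L', R', h'⟩ := h.erase he.1
    refine ih h' (fun x hx => Finset.mem_erase.2 ⟨fun hxe => he.2 (hxe ▸ hx), hE hx⟩) ?_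
    rw [Finset.erase_sdiff_comm, Finset.card_erase_of_mem (Finset.mem_sdiff.2 he)]
    omega

variable [Fintype V] [Fintype X]

/-- Some choice of faces makes the edges of `G` a cut system. -/
def HasCutSystem (G : SimpleGraph V) : Prop :=
  ∃ (F : Type) (_ : Fintype F) (L R : Sym2 V → F), IsCutSystem G.edgeFinset L R

/-- Planarity enters the argument through this lemma only. -/
theorem IsPlanar.hasCutSystem {G : SimpleGraph V} (h : IsPlanar G) : HasCutSystem G := by
  obtain ⟨R, hR⟩ := h
  let f0 : Sym2 V → Option R.Face := fun e =>
    if h : e ∈ G.edgeSet then some (R.faceOf (RotationSystem.outDart ⟨e, h⟩)) else none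
  let f1 : Sym2 V → Option R.Face := fun e =>
    if h : e ∈ G.edgeSet then some (R.faceOf (RotationSystem.outDart ⟨e, h⟩).symm) else none
  refine ⟨Option R.Face, inferInstance, f0, f1, fun D => ?_⟩
  have hs : ∀ g : Option R.Face → ZMod 2, ∑ e ∈ G.edgeFinset, D e * (g (f0 e) + g (f1 e)) =
      ∑ e : G.edgeSet, D e * (g (some (R.faceOf (RotationSystem.outDart e)))
        + g (some (R.faceOf (RotationSystem.outDart e).symm))) := by
    intro g
    rw [← Finset.sum_coe_sort]
    refine Fintype.sum_equiv (Equiv.subtypeEquivRight fun e => SimpleGraph.mem_edgeFinset) _ _ ?_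
    rintro ⟨e, he⟩
    have he' : e ∈ G.edgeSet := SimpleGraph.mem_edgeFinset.1 he
    simp only [f0, f1, dif_pos he']
    rfl
  have hcut : ∀ (s : V → ZMod 2) (e : G.edgeSet), RotationSystem.cob G s e = cutVal s e.1 := by
    intro s e
    rw [← RotationSystem.edge_outDart e]
    rfl
  have hker : (∀ g : Option R.Face → ZMod 2, ∑ e ∈ G.edgeFinset, D e * (g (f0 e) + g (f1 e)) = 0)
      ↔ (fun e : G.edgeSet => D e.1) ∈ LinearMap.ker R.incMat.mulVecLin := by
    rw [LinearMap.mem_ker]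
    constructor
    · intro h
      ext f
      obtain ⟨g₀, hg₀⟩ : ∃ g₀ : Option R.Face → ZMod 2, ∀ x, g₀ (some x) = if x = f then 1 else 0 :=
        ⟨fun x => if x = some f then 1 else 0, fun x => by simp⟩
      refine Eq.trans ?_ ((hs g₀).symm.trans (h g₀))
      simp only [hg₀]
      rw [Matrix.mulVecLin_apply, Matrix.mulVec, dotProduct]
      refine Finset.sum_congr rfl fun e _ => ?_
      unfold RotationSystem.incMat
      ring
    · intro h g
      rw [hs]
      have h1 : ∀ f, ∑ e : G.edgeSet, R.incMat f e * D e = 0 := fun f => congrFun h f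
      have h2 : ∑ f, g (some f) * ∑ e : G.edgeSet, R.incMat f e * D e = 0 :=
        Finset.sum_eq_zero fun f _ => by rw [h1, mul_zero]
      simp only [Finset.mul_sum] at h2
      rw [Finset.sum_comm] at h2
      rw [← h2]
      refine Finset.sum_congr rfl fun e _ => ?_
      simp only [RotationSystem.incMat, add_mul, mul_add, ite_mul, one_mul, zero_mul, mul_ite,
        mul_zero, Finset.sum_add_distrib, Finset.sum_ite_eq, Finset.mem_univ, if_true]
      ring
  rw [hker, ← hR.range_cob_eq, LinearMap.mem_range]
  constructor
  · rintro ⟨s, hs⟩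
    refine ⟨s, fun e he => ?_⟩
    rw [← hcut s ⟨e, SimpleGraph.mem_edgeFinset.1 he⟩, hs]
  · rintro ⟨s, hs⟩
    refine ⟨s, ?_⟩
    ext e
    rw [hcut, hs e.1 (SimpleGraph.mem_edgeFinset.2 e.2)]

/-- Cut systems pass to minors: the vertices of `H` correspond to the nonempty fibres of `φ`, each
connected in the sense that functions constant along its edges are constant. -/
theorem HasCutSystem.minor {G : SimpleGraph V} (h : HasCutSystem G) (H : SimpleGraph X)
    (φ : V → Option X)
    (hlink : ∀ s : V → ZMod 2, (∀ u v, G.Adj u v → φ u = φ v → (φ u).isSome → s u = s v) →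
      ∀ u v, φ u = φ v → (φ u).isSome → s u = s v)
    (hadj : ∀ x y, H.Adj x y → ∃ u v, φ u = some x ∧ φ v = some y ∧ G.Adj u v) :
    HasCutSystem H := by
  obtain ⟨F, _, L, R, h⟩ := h
  rcases isEmpty_or_nonempty V with hV | hV
  · have : H.edgeFinset = ∅ := by
      ext e
      induction e with
      | _ x y =>
        simp only [SimpleGraph.mem_edgeFinset, SimpleGraph.mem_edgeSet, Finset.notMem_empty,
          iff_false]
        intro hxy
        obtain ⟨u, -⟩ := hadj x y hxy
        exact hV.elim u
    refine ⟨Unit, inferInstance, fun _ => (), fun _ => (), fun D => ?_⟩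
    rw [this]
    exact ⟨fun _ => ⟨0, by simp⟩, fun _ => by simp⟩
  have hc : ∀ e : Sym2 X, ∃ e' : Sym2 V, e ∈ H.edgeFinset →
      e' ∈ G.edgeFinset ∧ e'.map φ = e.map some := by
    intro e
    by_cases he : e ∈ H.edgeFinset
    · induction e with
      | _ x y =>
        obtain ⟨u, v, hu, hv, huv⟩ := hadj x y (by simpa using he)
        exact ⟨s(u, v), fun _ => ⟨by simpa using huv, by simp [hu, hv]⟩⟩
    · exact ⟨s(hV.some, hV.some), fun h => absurd h he⟩
  choose c hc using hc
  have hcinj : ∀ e ∈ H.edgeFinset, ∀ e' ∈ H.edgeFinset, c e = c e' → e = e' := by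
    intro e he e' he' hee
    have h1 := (hc e he).2
    rw [hee, (hc e' he').2] at h1
    exact (Sym2.map.injective (Option.some_injective X) h1).symm
  -- keep the edges `I` inside the fibres of `φ`, and one edge `c e` of `G` for each edge `e` of `H`
  let I : Finset (Sym2 V) := G.edgeFinset.filter fun e => ∃ x : X, e.map φ = s(some x, some x)
  let E₁ : Finset (Sym2 V) := H.edgeFinset.image c
  have hI1 : ∀ e ∈ H.edgeFinset, c e ∉ I := by
    intro e he hI
    obtain ⟨x, hx⟩ := (Finset.mem_filter.1 hI).2
    rw [(hc e he).2] at hx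
    induction e with
    | _ a b =>
      have hab : H.Adj a b := by simpa using he
      have : a = x ∧ b = x := by simpa using hx
      exact hab.ne (this.1.trans this.2.symm)
  have hdisj : Disjoint I E₁ := by
    rw [Finset.disjoint_right]
    intro e he
    obtain ⟨e', he', rfl⟩ := Finset.mem_image.1 he
    exact hI1 e' he'
  obtain ⟨L', R', h'⟩ := h.subset (E' := I ∪ E₁) (by
    apply Finset.union_subset (Finset.filter_subset _ _)
    intro e he
    obtain ⟨e', he', rfl⟩ := Finset.mem_image.1 he
    exact (hc e' he').1)
  refine ⟨F, inferInstance, L' ∘ c, R' ∘ c, fun D => ⟨fun hD => ?_, ?_⟩⟩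
  -- a function on the edges of `H` is extended by zero on `I`; a cut vanishing on `I` is constant
  -- on the fibres, so it descends to `H`
  · let D' : Sym2 V → ZMod 2 := fun e' => ∑ e ∈ H.edgeFinset with c e = e', D e
    have hDI : ∀ e ∈ I, D' e = 0 := by
      intro e he
      apply Finset.sum_eq_zero
      intro e' he'
      rw [Finset.mem_filter] at he'
      exact absurd he (he'.2 ▸ hI1 e' he'.1)
    have hDc : ∀ e ∈ H.edgeFinset, D' (c e) = D e := by
      intro e he
      have : (H.edgeFinset.filter fun e' => c e' = c e) = {e} := by
        ext e'
        simp only [Finset.mem_filter, Finset.mem_singleton]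
        exact ⟨fun h => hcinj _ h.1 _ he h.2, fun h => ⟨h ▸ he, h ▸ rfl⟩⟩
      simp only [D', this, Finset.sum_singleton]
    obtain ⟨s, hs⟩ := (h' D').1 fun g => by
      rw [Finset.sum_union hdisj, Finset.sum_eq_zero fun e he => by rw [hDI e he, zero_mul],
        zero_add, Finset.sum_image hcinj, ← hD g]
      exact Finset.sum_congr rfl fun e he => by rw [hDc e he]; rfl
    have hsl : ∀ u v, φ u = φ v → (φ u).isSome → s u = s v := by
      apply hlink
      intro u v huv hφ hso
      obtain ⟨x, hx⟩ := Option.isSome_iff_exists.1 hso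
      have hmem : s(u, v) ∈ I := by
        refine Finset.mem_filter.2 ⟨by simpa using huv, x, ?_⟩
        simp [← hφ, hx]
      have h1 := hs _ (Finset.mem_union_left _ hmem)
      rw [hDI _ hmem, cutVal_mk] at h1
      exact CharTwo.add_eq_zero.1 h1.symm
    refine ⟨fun x => if h : ∃ u, φ u = some x then s h.choose else 0, fun e he => ?_⟩
    have hce := (hc e he).2
    have h1 := hs _ (Finset.mem_union_right _ (Finset.mem_image_of_mem c he))
    rw [hDc e he] at h1
    rw [h1]
    have key : ∀ u x, φ u = some x →
        s u = (if h : ∃ u, φ u = some x then s h.choose else 0) := by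
      intro u x hu
      have h : ∃ u, φ u = some x := ⟨u, hu⟩
      rw [dif_pos h]
      exact hsl _ _ (hu.trans h.choose_spec.symm) (by simp [hu])
    generalize c e = e' at hce
    induction e with
    | _ a b =>
      induction e' with
      | _ u v =>
        rw [Sym2.map_mk, Sym2.map_mk, Sym2.eq_iff] at hce
        rw [cutVal_mk, cutVal_mk]
        rcases hce with ⟨hu, hv⟩ | ⟨hu, hv⟩
        · rw [key u a hu, key v b hv]
        · rw [key u b hu, key v a hv, add_comm]
  · rintro ⟨t, ht⟩ g
    let s : V → ZMod 2 := fun v => (φ v).elim 0 t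
    have h1 := (h' (cutVal s)).2 ⟨s, fun _ _ => rfl⟩ g
    rw [Finset.sum_union hdisj, Finset.sum_image hcinj, Finset.sum_eq_zero, zero_add] at h1
    · rw [← h1]
      refine Finset.sum_congr rfl fun e he => ?_
      have hce := (hc e he).2
      rw [ht e he]
      congr 1
      generalize c e = e' at hce
      induction e with
      | _ a b =>
        induction e' with
        | _ u v =>
          rw [Sym2.map_mk, Sym2.map_mk, Sym2.eq_iff] at hce
          rw [cutVal_mk, cutVal_mk]
          rcases hce with ⟨hu, hv⟩ | ⟨hu, hv⟩
          · simp [s, hu, hv]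
          · simp [s, hu, hv, add_comm]
    · intro e he
      obtain ⟨x, hx⟩ := (Finset.mem_filter.1 he).2
      induction e with
      | _ u v =>
        have : φ u = some x ∧ φ v = some x := by simpa using hx
        rw [cutVal_mk]
        simp only [s, this.1, this.2, Option.elim_some]
        rw [CharTwo.add_self_eq_zero, zero_mul]
end

/-! ### Edge bounds -/

section
variable {V X F : Type}

/-- The edges having the face `f` on exactly one side. -/
noncomputable def faceRow (E : Finset (Sym2 V)) (L R : Sym2 V → F) (f : F) : Finset (Sym2 V) :=
  E.filter fun e => ¬ (L e = f ↔ R e = f)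

theorem sum_faceRow (E : Finset (Sym2 V)) (L R : Sym2 V → F) (f : F) (D : Sym2 V → ZMod 2) :
    ∑ e ∈ faceRow E L R f, D e =
      ∑ e ∈ E, D e * ((if L e = f then 1 else 0) + (if R e = f then 1 else 0)) := by
  rw [faceRow, Finset.sum_filter]
  refine Finset.sum_congr rfl fun e _ => ?_
  by_cases h1 : L e = f <;> by_cases h2 : R e = f <;> simp [h1, h2, CharTwo.add_self_eq_zero]

theorem sum_card_faceRow [Fintype F] (E : Finset (Sym2 V)) (L R : Sym2 V → F) :
    ∑ f, (faceRow E L R f).card = 2 * (E.filter fun e => L e ≠ R e).card := by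
  simp only [faceRow, Finset.card_filter]
  rw [Finset.sum_comm, Finset.mul_sum]
  refine Finset.sum_congr rfl fun e _ => ?_
  rw [← Finset.card_filter]
  by_cases h : L e = R e
  · simp [h]
  · rw [if_pos h, mul_one, ← Finset.card_pair h]
    congr 1
    ext f
    simp only [Finset.mem_filter, Finset.mem_univ, true_and, Finset.mem_insert,
      Finset.mem_singleton]
    constructor
    · intro hf
      by_contra hcon
      push Not at hcon
      exact hf ⟨fun h => (hcon.1 h.symm).elim, fun h => (hcon.2 h.symm).elim⟩
    · rintro (rfl | rfl)
      · exact fun hh => h (hh.1 rfl).symm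
      · exact fun hh => h (hh.2 rfl)

/-- An edge function with all face sums zero is a cut. -/
theorem IsCutSystem.of_faceRow {E : Finset (Sym2 V)} {L R : Sym2 V → F} [Fintype F]
    (h : IsCutSystem E L R) {D : Sym2 V → ZMod 2} (hD : ∀ f, ∑ e ∈ faceRow E L R f, D e = 0) :
    ∃ s : V → ZMod 2, ∀ e ∈ E, D e = cutVal s e := by
  refine (h D).1 fun g => ?_
  have h2 : ∑ f, g f * ∑ e ∈ faceRow E L R f, D e = 0 :=
    Finset.sum_eq_zero fun f _ => by rw [hD, mul_zero]
  simp only [sum_faceRow, Finset.mul_sum] at h2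
  rw [Finset.sum_comm] at h2
  rw [← h2]
  refine Finset.sum_congr rfl fun e _ => ?_
  simp only [mul_add, mul_ite, mul_one, mul_zero, Finset.sum_add_distrib, Finset.sum_ite_eq,
    Finset.mem_univ, if_true]
  ring

/-- The star of `v` is a cut, so it has an even number of edges on each face. -/
theorem IsCutSystem.even_faceRow {E : Finset (Sym2 V)} {L R : Sym2 V → F}
    (h : IsCutSystem E L R) (hE : ∀ e ∈ E, ¬ e.IsDiag) (f : F) (v : V) :
    Even ((faceRow E L R f).filter fun e => v ∈ e).card := by
  have h1 := (h (cutVal fun u => if u = v then 1 else 0)).2 ⟨_, fun _ _ => rfl⟩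
    (fun x => if x = f then 1 else 0)
  rw [← sum_faceRow] at h1
  rw [← ZMod.natCast_eq_zero_iff_even, ← h1, Finset.card_filter, Nat.cast_sum]
  refine Finset.sum_congr rfl fun e he => ?_
  have hd := hE e (Finset.filter_subset _ _ he)
  induction e with
  | _ a b =>
    have hab : a ≠ b := by simpa using hd
    rw [cutVal_mk]
    by_cases h1 : a = v
    · subst h1
      simp [hab.symm]
    · by_cases h2 : b = v
      · subst h2; simp [h1]
      · simp [h1, h2, Ne.symm h1, Ne.symm h2]

/-- The rank count: a cut system with `k` nonempty face rows has at most `|V| + k - 2` edges. -/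
theorem IsCutSystem.card_le [Fintype V] [Nonempty V] [Fintype F] {E : Finset (Sym2 V)}
    {L R : Sym2 V → F} (h : IsCutSystem E L R) :
    (E.card + 1 ≤ Fintype.card V ∧ ∀ f, faceRow E L R f = ∅) ∨
    ((∃ f, (faceRow E L R f).Nonempty) ∧ E.card + 2 ≤ Fintype.card V +
      (Finset.univ.filter fun f => (faceRow E L R f).Nonempty).card) := by
  obtain ⟨v₀⟩ := ‹Nonempty V›
  let S := Finset.univ.filter fun f => (faceRow E L R f).Nonempty
  -- the cut of a vertex function, normalised to vanish at `v₀`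
  let δ₀ : ({v : V // v ≠ v₀} → ZMod 2) →ₗ[ZMod 2] (E → ZMod 2) :=
    { toFun := fun s e => cutVal (fun v => if h : v ≠ v₀ then s ⟨v, h⟩ else 0) e.1
      map_add' := by
        intro s t
        ext ⟨e, he⟩
        induction e with
        | _ a b =>
          simp only [cutVal_mk, Pi.add_apply]
          split_ifs <;> ring
      map_smul' := by
        intro c s
        ext ⟨e, he⟩
        induction e with
        | _ a b =>
          simp only [cutVal_mk, Pi.smul_apply, smul_eq_mul, RingHom.id_apply]
          split_ifs <;> ring }
  have hcut : ∀ D : E → ZMod 2,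
      (∀ f, ∑ e ∈ (Finset.univ.filter fun e : E => e.1 ∈ faceRow E L R f), D e = 0) →
      D ∈ LinearMap.range δ₀ := by
    intro D hD
    obtain ⟨s, hs⟩ := h.of_faceRow (D := fun e => if h : e ∈ E then D ⟨e, h⟩ else 0) fun f => by
      rw [← hD f]
      symm
      refine Finset.sum_bij (fun e _ => e.1) (fun e he => (Finset.mem_filter.1 he).2)
        (fun _ _ _ _ h => Subtype.ext h)
        (fun e he => ⟨⟨e, Finset.filter_subset _ _ he⟩, by simpa using he, rfl⟩) ?_
      rintro ⟨e, he⟩ _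
      rw [dif_pos he]
    refine ⟨fun v => s v + s v₀, ?_⟩
    ext ⟨e, he⟩
    have := hs e he
    rw [dif_pos he] at this
    rw [this]
    change cutVal _ e = _
    have hext : (fun v => if h : v ≠ v₀ then s v + s v₀ else 0) = fun v => s v + s v₀ := by
      ext v
      by_cases hv : v = v₀
      · simp [hv, CharTwo.add_self_eq_zero]
      · simp [hv]
    rw [hext]
    induction e with
    | _ a b =>
      rw [cutVal_mk, cutVal_mk]
      linear_combination s v₀ * two_eq_zero_zmod
  have hδ₀ : Module.finrank (ZMod 2) (LinearMap.range δ₀) + 1 ≤ Fintype.card V := by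
    have h1 := LinearMap.finrank_range_le δ₀
    rw [Module.finrank_pi, Fintype.card_subtype_compl, Fintype.card_subtype_eq] at h1
    have := Fintype.card_pos_iff.2 ⟨v₀⟩
    omega
  by_cases hS : ∃ f₀, (faceRow E L R f₀).Nonempty
  · right
    refine ⟨hS, ?_⟩
    obtain ⟨f₀, hf₀⟩ := hS
    -- the sums over nonempty faces other than `f₀`; they determine the sum over `f₀`, as each edge
    -- counts twice in the total
    let δ₁ : (E → ZMod 2) →ₗ[ZMod 2] ({f // f ∈ S.erase f₀} → ZMod 2) :=
      { toFun := fun D f => ∑ e ∈ (Finset.univ.filter fun e : E => e.1 ∈ faceRow E L R f.1), D e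
        map_add' := fun D D' => by
          ext f; simp only [Pi.add_apply, Finset.sum_add_distrib]
        map_smul' := fun c D => by
          ext f; simp only [Pi.smul_apply, Finset.smul_sum, RingHom.id_apply] }
    have hker : LinearMap.ker δ₁ ≤ LinearMap.range δ₀ := by
      intro D hD
      apply hcut
      have h1 : ∀ f, f ≠ f₀ →
          ∑ e ∈ (Finset.univ.filter fun e : E => e.1 ∈ faceRow E L R f), D e = 0 := by
        intro f hf
        by_cases hfS : f ∈ S
        · exact congrFun (LinearMap.mem_ker.1 hD) ⟨f, Finset.mem_erase.2 ⟨hf, hfS⟩⟩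
        · have : faceRow E L R f = ∅ := by simpa [S] using hfS
          simp [this]
      have htot : ∑ f, ∑ e ∈ (Finset.univ.filter fun e : E => e.1 ∈ faceRow E L R f), D e = 0 := by
        simp only [Finset.sum_filter]
        rw [Finset.sum_comm]
        refine Finset.sum_eq_zero fun e _ => ?_
        have : ∀ f, (if e.1 ∈ faceRow E L R f then D e else 0) =
            (if L e = f then D e else 0) + (if R e = f then D e else 0) := by
          intro f
          by_cases h1 : L e = f <;> by_cases h2 : R e = f <;>
            simp [faceRow, h1, h2, e.2, CharTwo.add_self_eq_zero]
        simp only [this, Finset.sum_add_distrib, Finset.sum_ite_eq, Finset.mem_univ, if_true,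
          CharTwo.add_self_eq_zero]
      intro f
      by_cases hf : f = f₀
      · subst hf
        rw [← Finset.add_sum_erase _ _ (Finset.mem_univ f),
          Finset.sum_eq_zero (s := Finset.univ.erase f)
            (fun f' hf' => h1 f' (Finset.ne_of_mem_erase hf')), add_zero] at htot
        exact htot
      · exact h1 f hf
    have h2 := LinearMap.finrank_range_add_finrank_ker δ₁
    have h3 := Submodule.finrank_mono hker
    have h4 : Module.finrank (ZMod 2) (LinearMap.range δ₁) ≤ _ := Submodule.finrank_le _
    rw [Module.finrank_pi] at h2 h4
    rw [Fintype.card_coe] at h2 h4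
    have h6 : f₀ ∈ S := by simpa [S] using hf₀
    rw [Finset.card_erase_of_mem h6] at h4
    have := Finset.card_pos.2 ⟨f₀, h6⟩
    change _ ≤ _ + S.card
    omega
  · left
    push Not at hS
    refine ⟨?_, hS⟩
    have h3 : (⊤ : Submodule (ZMod 2) (E → ZMod 2)) ≤ LinearMap.range δ₀ := by
      intro D _
      apply hcut
      intro f
      simp [hS f]
    have h5 := Submodule.finrank_mono h3
    rw [finrank_top, Module.finrank_pi, Fintype.card_coe] at h5
    omega

/-- In a set of edges with even degrees one can continue past each edge. -/
theorem exists_next {Q : Finset (Sym2 V)} (hQ : ∀ v, Even (Q.filter fun e => v ∈ e).card)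
    {u v : V} (h : s(u, v) ∈ Q) : ∃ w, w ≠ u ∧ s(v, w) ∈ Q := by
  have h1 : s(u, v) ∈ Q.filter fun e => v ∈ e := Finset.mem_filter.2 ⟨h, by simp⟩
  have h2 : 1 < (Q.filter fun e => v ∈ e).card := by
    have := Finset.card_pos.2 ⟨_, h1⟩
    obtain ⟨k, hk⟩ := hQ v
    omega
  obtain ⟨e, he, hne⟩ := Finset.exists_mem_ne h2 s(u, v)
  rw [Finset.mem_filter] at he
  obtain ⟨w, rfl⟩ := he.2
  exact ⟨w, fun hw => hne (hw ▸ Sym2.eq_swap), he.1⟩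

theorem three_le_card_of_even {Q : Finset (Sym2 V)} (hd : ∀ e ∈ Q, ¬ e.IsDiag)
    (hQ : ∀ v, Even (Q.filter fun e => v ∈ e).card) (hne : Q.Nonempty) : 3 ≤ Q.card := by
  obtain ⟨e, he⟩ := hne
  induction e with
  | _ u v =>
    obtain ⟨w, hw, hvw⟩ := exists_next hQ he
    obtain ⟨t, ht, hwt⟩ := exists_next hQ hvw
    have h1 : u ≠ v := by simpa using hd _ he
    have h2 : v ≠ w := by simpa using hd _ hvw
    have h3 : w ≠ t := by simpa using hd _ hwt
    have : ({s(u, v), s(v, w), s(w, t)} : Finset (Sym2 V)) ⊆ Q := by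
      intro x hx
      simp only [Finset.mem_insert, Finset.mem_singleton] at hx
      rcases hx with rfl | rfl | rfl <;> assumption
    refine le_trans (Eq.ge ?_) (Finset.card_le_card this)
    rw [Finset.card_eq_three]
    refine ⟨_, _, _, ?_, ?_, ?_, rfl⟩ <;> simp only [ne_eq, Sym2.eq_iff] <;> grind

theorem four_le_card_of_even {Q : Finset (Sym2 V)} (hd : ∀ e ∈ Q, ¬ e.IsDiag)
    (hQ : ∀ v, Even (Q.filter fun e => v ∈ e).card) (hne : Q.Nonempty)
    (htri : ∀ u v w, s(u, v) ∈ Q → s(v, w) ∈ Q → s(w, u) ∈ Q → False) : 4 ≤ Q.card := by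
  obtain ⟨e, he⟩ := hne
  induction e with
  | _ u v =>
    obtain ⟨w, hw, hvw⟩ := exists_next hQ he
    obtain ⟨t, ht, hwt⟩ := exists_next hQ hvw
    obtain ⟨x, hx, hux⟩ := exists_next hQ (Sym2.eq_swap ▸ he : s(v, u) ∈ Q)
    have h1 : u ≠ v := by simpa using hd _ he
    have h2 : v ≠ w := by simpa using hd _ hvw
    have h3 : w ≠ t := by simpa using hd _ hwt
    have h4 : u ≠ x := by simpa using hd _ hux
    have h5 : t ≠ u := fun h => htri u v w he hvw (h ▸ hwt)
    have : ({s(u, v), s(v, w), s(w, t), s(u, x)} : Finset (Sym2 V)) ⊆ Q := by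
      intro x hx
      simp only [Finset.mem_insert, Finset.mem_singleton] at hx
      rcases hx with rfl | rfl | rfl | rfl <;> assumption
    refine le_trans (Eq.ge ?_) (Finset.card_le_card this)
    rw [Finset.card_insert_of_notMem, Finset.card_insert_of_notMem, Finset.card_pair] <;>
      simp only [ne_eq, Finset.mem_insert, Finset.mem_singleton, Sym2.eq_iff] <;> grind

variable [Fintype V] [Fintype X] {G : SimpleGraph V}

theorem HasCutSystem.card_edgeFinset_le (h : HasCutSystem G) (hV : 3 ≤ Fintype.card V) :
    G.edgeFinset.card + 6 ≤ 3 * Fintype.card V := by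
  obtain ⟨F, _, L, R, h⟩ := h
  have : Nonempty V := Fintype.card_pos_iff.1 (by omega)
  have hd : ∀ e ∈ G.edgeFinset, ¬ e.IsDiag := fun e he =>
    G.not_isDiag_of_mem_edgeSet (SimpleGraph.mem_edgeFinset.1 he)
  rcases h.card_le with h1 | ⟨-, h1⟩
  · omega
  · have h2 := sum_card_faceRow G.edgeFinset L R
    have h3 : (G.edgeFinset.filter fun e => L e ≠ R e).card ≤ G.edgeFinset.card :=
      Finset.card_filter_le _ _
    have h4 : (Finset.univ.filter fun f => (faceRow G.edgeFinset L R f).Nonempty).card * 3 ≤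
        ∑ f, (faceRow G.edgeFinset L R f).card := by
      rw [← smul_eq_mul]
      refine (Finset.card_nsmul_le_sum _ _ _ fun f hf => ?_).trans
        (Finset.sum_le_sum_of_subset (Finset.subset_univ _))
      exact three_le_card_of_even (fun e he => hd e (Finset.filter_subset _ _ he))
        (h.even_faceRow hd f) (Finset.mem_filter.1 hf).2
    omega

/-- Every nonempty face row has at least four edges, and each edge lies on at most two rows. If the
graph is not bipartite, some row is odd, hence two are; these have at least five edges, which
improves the bound by one. -/
theorem HasCutSystem.card_edgeFinset_le_of_triangleFree (h : HasCutSystem G)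
    (hV : 3 ≤ Fintype.card V) (htri : ∀ u v w, G.Adj u v → G.Adj v w → G.Adj w u → False) :
    G.edgeFinset.card + 4 ≤ 2 * Fintype.card V ∧
    ((∃ s : V → ZMod 2, ∀ u v, G.Adj u v → s u ≠ s v) ∨
      G.edgeFinset.card + 5 ≤ 2 * Fintype.card V) := by
  obtain ⟨F, _, L, R, h⟩ := h
  have : Nonempty V := Fintype.card_pos_iff.1 (by omega)
  have hd : ∀ e ∈ G.edgeFinset, ¬ e.IsDiag := fun e he =>
    G.not_isDiag_of_mem_edgeSet (SimpleGraph.mem_edgeFinset.1 he)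
  have h2 := sum_card_faceRow G.edgeFinset L R
  have h3 : (G.edgeFinset.filter fun e => L e ≠ R e).card ≤ G.edgeFinset.card :=
    Finset.card_filter_le _ _
  have hrow : ∀ f, (faceRow G.edgeFinset L R f).Nonempty → 4 ≤ (faceRow G.edgeFinset L R f).card :=
    fun f hf => four_le_card_of_even (fun e he => hd e (Finset.filter_subset _ _ he))
      (h.even_faceRow hd f) hf fun u v w h1 h2 h3 => htri u v w
        (by simpa using Finset.filter_subset _ _ h1) (by simpa using Finset.filter_subset _ _ h2)
        (by simpa using Finset.filter_subset _ _ h3)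
  -- if all rows are even, the all-one function is a cut, which is a proper two-colouring
  have hone : (∀ f, Even (faceRow G.edgeFinset L R f).card) →
      ∃ s : V → ZMod 2, ∀ u v, G.Adj u v → s u ≠ s v := by
    intro hev
    obtain ⟨s, hs⟩ := h.of_faceRow (D := fun _ => 1) fun f => by
      rw [Finset.sum_const, nsmul_eq_mul, mul_one]
      exact (ZMod.natCast_eq_zero_iff_even).2 (hev f)
    refine ⟨s, fun u v huv heq => ?_⟩
    have := hs s(u, v) (by simpa using huv)
    rw [cutVal_mk, heq, CharTwo.add_self_eq_zero] at this
    exact one_ne_zero this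
  set S := Finset.univ.filter fun f => (faceRow G.edgeFinset L R f).Nonempty with hS
  have hsum : ∑ f ∈ S, (faceRow G.edgeFinset L R f).card =
      ∑ f, (faceRow G.edgeFinset L R f).card := by
    refine Finset.sum_subset (Finset.subset_univ _) fun f _ hf => ?_
    have : faceRow G.edgeFinset L R f = ∅ := by simpa [hS] using hf
    simp [this]
  have h4 : S.card * 4 ≤ ∑ f ∈ S, (faceRow G.edgeFinset L R f).card := by
    rw [← smul_eq_mul]
    exact Finset.card_nsmul_le_sum _ _ _ fun f hf => hrow f (Finset.mem_filter.1 hf).2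
  rcases h.card_le with ⟨h1, h5⟩ | ⟨-, h1⟩
  · exact ⟨by omega, Or.inl (hone fun f => by simp [h5 f])⟩
  · change _ ≤ _ + S.card at h1
    refine ⟨by omega, or_iff_not_imp_left.2 fun hcol => ?_⟩
    have hex : ∃ f, Odd (faceRow G.edgeFinset L R f).card := by
      by_contra hcon
      push Not at hcon
      exact hcol (hone fun f => by simpa using hcon f)
    obtain ⟨f, hf⟩ := hex
    have hfS : f ∈ S := Finset.mem_filter.2 ⟨Finset.mem_univ _, Finset.card_pos.1 hf.pos⟩
    -- the sum of the sizes of the rows is even, so there is a second odd row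
    have hrest : ∃ f' ∈ S.erase f, Odd (faceRow G.edgeFinset L R f').card := by
      by_contra hcon
      push Not at hcon
      have h6 : Even (∑ f' ∈ S.erase f, (faceRow G.edgeFinset L R f').card) :=
        Finset.even_sum _ fun f' hf' => by simpa using hcon f' hf'
      rw [← hsum, ← Finset.add_sum_erase _ _ hfS] at h2
      obtain ⟨a, ha⟩ := h6
      obtain ⟨b, hb⟩ := hf
      omega
    obtain ⟨f', hf', hodd⟩ := hrest
    have h7 : ((S.erase f).erase f').card * 4 ≤
        ∑ f ∈ (S.erase f).erase f', (faceRow G.edgeFinset L R f).card := by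
      rw [← smul_eq_mul]
      exact Finset.card_nsmul_le_sum _ _ _ fun x hx => hrow x (Finset.mem_filter.1
        (Finset.mem_of_mem_erase (Finset.mem_of_mem_erase hx))).2
    rw [← hsum, ← Finset.add_sum_erase _ _ hfS, ← Finset.add_sum_erase _ _ hf'] at h2
    rw [Finset.card_erase_of_mem hf', Finset.card_erase_of_mem hfS] at h7
    have h8 := Finset.card_pos.2 ⟨_, hf'⟩
    rw [Finset.card_erase_of_mem hfS] at h8
    have h9 := hrow f (Finset.card_pos.1 hf.pos)
    have h10 := hrow f' (Finset.card_pos.1 hodd.pos)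
    obtain ⟨a, ha⟩ := hf
    obtain ⟨b, hb⟩ := hodd
    omega
end

/-! ### Linked vertex sets and excluded minors -/

section
variable {V X : Type} {G : SimpleGraph V}

/-- `Y` spans a connected subgraph (or is empty): a property that propagates along the edges inside
`Y` propagates to all of `Y`. -/
def Linked (G : SimpleGraph V) (Y : Finset V) : Prop :=
  ∀ s : V → Prop, (∀ u ∈ Y, ∀ v ∈ Y, G.Adj u v → s u → s v) → ∀ u ∈ Y, ∀ v ∈ Y, s u → s v

/-- Some edge joins `Y` and `Z`. -/
def Touch (G : SimpleGraph V) (Y Z : Finset V) : Prop := ∃ y ∈ Y, ∃ z ∈ Z, G.Adj y z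

theorem Touch.symm {Y Z : Finset V} (h : Touch G Y Z) : Touch G Z Y := by
  obtain ⟨y, hy, z, hz, h⟩ := h
  exact ⟨z, hz, y, hy, h.symm⟩

theorem Touch.mono {Y Z Y' Z' : Finset V} (h : Touch G Y Z) (hY : Y ⊆ Y') (hZ : Z ⊆ Z') :
    Touch G Y' Z' := by
  obtain ⟨y, hy, z, hz, h⟩ := h
  exact ⟨y, hY hy, z, hZ hz, h⟩

theorem linked_singleton (v : V) : Linked G {v} := by
  intro s _ u hu w hw
  rw [Finset.mem_singleton] at hu hw
  subst hu; subst hw; exact id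

theorem Linked.union {Y Z : Finset V} (hY : Linked G Y) (hZ : Linked G Z)
    (h : (∃ y ∈ Y, y ∈ Z) ∨ Touch G Y Z) : Linked G (Y ∪ Z) := by
  intro s hs u hu v hv hsu
  have hY' := hY s fun a ha b hb => hs a (Finset.mem_union_left _ ha) b (Finset.mem_union_left _ hb)
  have hZ' := hZ s fun a ha b hb =>
    hs a (Finset.mem_union_right _ ha) b (Finset.mem_union_right _ hb)
  have hbr : ∃ y ∈ Y, ∃ z ∈ Z, (s y ↔ s z) := by
    rcases h with ⟨y, hy, hz⟩ | ⟨y, hy, z, hz, hyz⟩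
    · exact ⟨y, hy, y, hz, Iff.rfl⟩
    · exact ⟨y, hy, z, hz, hs _ (Finset.mem_union_left _ hy) _ (Finset.mem_union_right _ hz) hyz,
        hs _ (Finset.mem_union_right _ hz) _ (Finset.mem_union_left _ hy) hyz.symm⟩
  obtain ⟨y, hy, z, hz, hyz⟩ := hbr
  rw [Finset.mem_union] at hu hv
  rcases hu with hu | hu <;> rcases hv with hv | hv
  · exact hY' u hu v hv hsu
  · exact hZ' z hz v hv (hyz.1 (hY' u hu y hy hsu))
  · exact hY' y hy v hv (hyz.2 (hZ' u hu z hz hsu))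
  · exact hZ' u hu v hv hsu

theorem Linked.insert {Y : Finset V} (hY : Linked G Y) {v y : V} (hy : y ∈ Y) (h : G.Adj v y) :
    Linked G (insert v Y) := by
  rw [Finset.insert_eq]
  exact (linked_singleton v).union hY (Or.inr ⟨v, Finset.mem_singleton_self v, y, hy, h⟩)

theorem linked_pair {u v : V} (h : G.Adj u v) : Linked G {u, v} :=
  (linked_singleton v).insert (Finset.mem_singleton_self v) h

/-- A set with a vertex adjacent to all others is linked. -/
theorem linked_star {Y : Finset V} {c : V} (hY : ∀ y ∈ Y, G.Adj c y) : Linked G (insert c Y) := by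
  intro s hs u hu v hv hsu
  have hc := Finset.mem_insert_self c Y
  have h1 : s c := by
    rcases Finset.mem_insert.1 hu with rfl | hu'
    · exact hsu
    · exact hs u hu c hc (hY u hu').symm hsu
  rcases Finset.mem_insert.1 hv with rfl | hv'
  · exact h1
  · exact hs c hc v hv (hY v hv') h1

/-- The component of `w` in the subgraph spanned by `W`; it is empty if `w` is not in `W`. -/
noncomputable def comp (G : SimpleGraph V) (W : Finset V) (w : V) : Finset V :=
  W.filter fun v => w ∈ W ∧ Relation.ReflTransGen (fun u v => G.Adj u v ∧ v ∈ W) w v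

theorem comp_subset (W : Finset V) (w : V) : comp G W w ⊆ W := Finset.filter_subset _ _

theorem mem_comp_self {W : Finset V} {w : V} (h : w ∈ W) : w ∈ comp G W w :=
  Finset.mem_filter.2 ⟨h, h, Relation.ReflTransGen.refl⟩

theorem comp_closed {W : Finset V} {w u v : V} (hu : u ∈ comp G W w) (hv : v ∈ W)
    (h : G.Adj u v) : v ∈ comp G W w :=
  Finset.mem_filter.2 ⟨hv, (Finset.mem_filter.1 hu).2.1, (Finset.mem_filter.1 hu).2.2.tail ⟨h, hv⟩⟩

theorem comp_induction {W : Finset V} {w : V} {s : V → Prop} (hw : s w)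
    (hs : ∀ u ∈ comp G W w, ∀ v ∈ comp G W w, G.Adj u v → s u → s v) (hwW : w ∈ W) :
    ∀ v ∈ comp G W w, s v := by
  intro v hv
  have h := (Finset.mem_filter.1 hv).2.2
  have : s v ∧ v ∈ comp G W w := by
    induction h with
    | refl => exact ⟨hw, mem_comp_self hwW⟩
    | tail h1 h2 ih =>
      have hb := ih (Finset.mem_filter.2 ⟨by
        rcases h1.cases_tail with h3 | ⟨_, _, h3⟩
        · exact h3 ▸ hwW
        · exact h3.2, hwW, h1⟩)
      have hc := comp_closed hb.2 h2.2 h2.1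
      exact ⟨hs _ hb.2 _ hc h2.1 hb.1, hc⟩
  exact this.1

theorem linked_comp (W : Finset V) (w : V) : Linked G (comp G W w) := by
  intro s hs u hu v hv hsu
  by_cases hw : w ∈ W
  · have h1 : s w := by
      by_contra hcon
      exact comp_induction (s := fun x => ¬ s x) hcon
        (fun a ha b hb hab hsa hsb => hsa (hs b hb a ha hab.symm hsb)) hw u hu hsu
    exact comp_induction h1 hs hw v hv
  · exact absurd (Finset.mem_filter.1 hu).2.1 hw

theorem Linked.subset_comp {W Y : Finset V} {w : V} (hY : Linked G Y) (hYW : Y ⊆ W) (hw : w ∈ Y) :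
    Y ⊆ comp G W w := fun v hv =>
  hY (· ∈ comp G W w) (fun _ _ _ hb hab ha => comp_closed ha (hYW hb) hab) w hw v hv
    (mem_comp_self (hYW hw))

theorem comp_eq_of_mem {W : Finset V} {w v : V} (hw : w ∈ W) (hv : v ∈ comp G W w) :
    comp G W v = comp G W w := by
  have h1 : comp G W w ⊆ comp G W v := (linked_comp W w).subset_comp (comp_subset W w) hv
  exact Finset.Subset.antisymm ((linked_comp W v).subset_comp (comp_subset W v)
    (h1 (mem_comp_self hw))) h1

theorem comp_disjoint {W : Finset V} {w v : V} (hw : w ∈ W) (hv : v ∈ W) (h : v ∉ comp G W w) :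
    Disjoint (comp G W w) (comp G W v) := by
  rw [Finset.disjoint_left]
  intro x hx hx'
  apply h
  rw [← comp_eq_of_mem hw hx, comp_eq_of_mem hv hx']
  exact mem_comp_self hv

theorem linked_iff_comp {W : Finset V} {w : V} (hw : w ∈ W) : Linked G W ↔ comp G W w = W :=
  ⟨fun h => Finset.Subset.antisymm (comp_subset W w) (h.subset_comp (Finset.Subset.refl _) hw),
    fun h => h ▸ linked_comp W w⟩

/-- A vertex of a linked set has a neighbour in every component of what remains. -/
theorem Linked.exists_adj_comp {D : Finset V} (hD : Linked G D) {u v : V} (hu : u ∈ D) (hv : v ∈ D)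
    (huv : u ≠ v) : ∃ t ∈ comp G (D.erase v) u, G.Adj v t := by
  by_contra hcon
  push Not at hcon
  have hu' : u ∈ D.erase v := Finset.mem_erase.2 ⟨huv, hu⟩
  have := hD (· ∈ comp G (D.erase v) u) (fun a ha b hb hab hac => by
    by_cases hbv : b = v
    · subst hbv; exact absurd hab.symm (hcon a hac)
    · exact comp_closed hac (Finset.mem_erase.2 ⟨hbv, hb⟩) hab) u hu v hv (mem_comp_self hu')
  exact Finset.notMem_erase v D (comp_subset _ _ this)

/-- Nonadjacent vertices of a linked set are joined through a linked set. -/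
theorem Linked.exists_mid {D : Finset V} (hD : Linked G D) {x y : V} (hx : x ∈ D) (hy : y ∈ D)
    (hxy : x ≠ y) (hadj : ¬ G.Adj x y) : ∃ M ⊆ D, x ∉ M ∧ y ∉ M ∧ Linked G M ∧
      (∃ m ∈ M, G.Adj x m) ∧ ∃ m ∈ M, G.Adj y m := by
  obtain ⟨t, ht, hyt⟩ := hD.exists_adj_comp hx hy hxy
  have htx : t ≠ x := by rintro rfl; exact hadj hyt.symm
  have hx' : x ∈ D.erase y := Finset.mem_erase.2 ⟨hxy, hx⟩
  obtain ⟨m, hm, hxm⟩ := (linked_comp (G := G) (D.erase y) x).exists_adj_comp ht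
    (mem_comp_self hx') htx
  have hsub := (comp_subset (G := G) ((comp G (D.erase y) x).erase x) t)
  refine ⟨comp G ((comp G (D.erase y) x).erase x) t, fun z hz => ?_, fun h => ?_, fun h => ?_,
    linked_comp _ _, ⟨m, hm, hxm⟩, t, mem_comp_self (Finset.mem_erase.2 ⟨htx, ht⟩), hyt⟩
  · exact Finset.mem_of_mem_erase (comp_subset _ _ (Finset.mem_of_mem_erase (hsub hz)))
  · exact Finset.notMem_erase _ _ (hsub h)
  · exact Finset.notMem_erase _ _ (comp_subset _ _ (Finset.mem_of_mem_erase (hsub h)))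

/-- A set that is not linked splits. -/
theorem exists_split {Y : Finset V} (h : ¬ Linked G Y) : ∃ Y₁ Y₂ : Finset V, Y₁.Nonempty ∧
    Y₂.Nonempty ∧ Disjoint Y₁ Y₂ ∧ Y₁ ∪ Y₂ = Y ∧ ∀ u ∈ Y₁, ∀ v ∈ Y₂, ¬ G.Adj u v := by
  unfold Linked at h
  push Not at h
  obtain ⟨s, hs, u, hu, v, hv, hsu, hsv⟩ := h
  refine ⟨Y.filter s, Y.filter fun x => ¬ s x, ⟨u, by simp [hu, hsu]⟩, ⟨v, by simp [hv, hsv]⟩,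
    Finset.disjoint_filter_filter_not _ _ _, Finset.filter_union_filter_not_eq _ _, ?_⟩
  intro a ha b hb hab
  rw [Finset.mem_filter] at ha hb
  exact hb.2 (hs a ha.1 b hb.1 hab ha.2)

variable [Fintype V] [Fintype X]

/-- Cut systems pass to a minor given by disjoint connected branch sets `P x`. -/
theorem HasCutSystem.of_parts (h : HasCutSystem G) (H : SimpleGraph X) (P : X → Finset V)
    (hdisj : ∀ x y, x ≠ y → Disjoint (P x) (P y)) (hlink : ∀ x, Linked G (P x))
    (hadj : ∀ x y, H.Adj x y → Touch G (P x) (P y)) : HasCutSystem H := by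
  let φ : V → Option X := fun v => if h : ∃ x, v ∈ P x then some h.choose else none
  have hφ : ∀ v x, φ v = some x ↔ v ∈ P x := by
    intro v x
    constructor
    · intro hv
      by_cases hex : ∃ x, v ∈ P x
      · simp only [φ, dif_pos hex, Option.some.injEq] at hv
        exact hv ▸ hex.choose_spec
      · simp [φ, dif_neg hex] at hv
    · intro hv
      have hex : ∃ x, v ∈ P x := ⟨x, hv⟩
      simp only [φ, dif_pos hex, Option.some.injEq]
      by_contra hne
      exact Finset.disjoint_left.1 (hdisj _ _ hne) hex.choose_spec hv
  refine h.minor H φ ?_ ?_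
  · intro s hs u v huv hu
    obtain ⟨x, hx⟩ := Option.isSome_iff_exists.1 hu
    have hu' := (hφ u x).1 hx
    have hv' := (hφ v x).1 (huv ▸ hx)
    refine (hlink x (fun z => s u = s z) ?_ u hu' v hv' rfl)
    intro a ha b hb hab hsa
    have ha' := (hφ a x).2 ha
    have hb' := (hφ b x).2 hb
    exact hsa.trans (hs a b hab (ha'.trans hb'.symm) (by simp [ha']))
  · intro x y hxy
    obtain ⟨u, hu, v, hv, huv⟩ := hadj x y hxy
    exact ⟨u, v, (hφ u x).2 hu, (hφ v y).2 hv, huv⟩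

omit [Fintype V] in
theorem card_edgeFinset_eq_natCard (G : SimpleGraph V) [Fintype G.edgeSet] :
    G.edgeFinset.card = Nat.card G.edgeSet := by
  rw [Nat.card_eq_fintype_card, SimpleGraph.edgeFinset_card]

/-- No `K₃,₃` minor. -/
theorem HasCutSystem.noK33 (h : HasCutSystem G) {X₁ X₂ X₃ Y₁ Y₂ Y₃ : Finset V}
    (hd : [X₁, X₂, X₃, Y₁, Y₂, Y₃].Pairwise Disjoint)
    (hl : ∀ Z ∈ [X₁, X₂, X₃, Y₁, Y₂, Y₃], Linked G Z)
    (ht : ∀ X ∈ [X₁, X₂, X₃], ∀ Y ∈ [Y₁, Y₂, Y₃], Touch G X Y) : False := by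
  let H : SimpleGraph (Fin 6) := SimpleGraph.fromRel fun i j => i < 3 ∧ 3 ≤ j
  have hH : HasCutSystem H := by
    refine h.of_parts H [X₁, X₂, X₃, Y₁, Y₂, Y₃].get ?_ (fun i => hl _ (List.get_mem _ _)) ?_
    · intro i j hij
      rw [List.pairwise_iff_get] at hd
      rcases lt_or_gt_of_ne hij with h1 | h1
      · exact hd i j h1
      · exact (hd j i h1).symm
    · have key : ∀ i j : Fin 6, i < 3 → 3 ≤ j → Touch G ([X₁, X₂, X₃, Y₁, Y₂, Y₃].get i)
          ([X₁, X₂, X₃, Y₁, Y₂, Y₃].get j) := by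
        intro i j hi hj
        apply ht
        · fin_cases i <;> first | (simp; done) | (exfalso; revert hi; decide)
        · fin_cases j <;> first | (simp; done) | (exfalso; revert hj; decide)
      intro i j hij
      rcases hij with ⟨_, h1 | h1⟩
      · exact key i j h1.1 h1.2
      · exact (key j i h1.1 h1.2).symm
  have h1 := (hH.card_edgeFinset_le_of_triangleFree (by simp) (by decide)).1
  have h2 : H.edgeFinset.card = 9 := by
    have h3 := H.sum_degrees_eq_twice_card_edges
    have h4 : ∀ i, H.degree i = 3 := by
      intro i
      rw [← SimpleGraph.card_neighborFinset_eq_degree]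
      have : H.neighborFinset i = Finset.univ.filter fun j => i ≠ j ∧ ((i < 3 ∧ 3 ≤ j) ∨
          (j < 3 ∧ 3 ≤ i)) := by ext j; simp [H]
      rw [this]
      revert i
      decide
    simp only [h4] at h3
    simp at h3
    omega
  rw [card_edgeFinset_eq_natCard] at h1 h2
  rw [h2] at h1
  simp at h1

/-- No `K₅` minor. -/
theorem HasCutSystem.noK5 (h : HasCutSystem G) {X₁ X₂ X₃ X₄ X₅ : Finset V}
    (hd : [X₁, X₂, X₃, X₄, X₅].Pairwise Disjoint)
    (hl : ∀ Z ∈ [X₁, X₂, X₃, X₄, X₅], Linked G Z)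
    (ht : [X₁, X₂, X₃, X₄, X₅].Pairwise (Touch G)) : False := by
  have hH : HasCutSystem (⊤ : SimpleGraph (Fin 5)) := by
    refine h.of_parts _ [X₁, X₂, X₃, X₄, X₅].get ?_ (fun i => hl _ (List.get_mem _ _)) ?_
    · intro i j hij
      rw [List.pairwise_iff_get] at hd
      rcases lt_or_gt_of_ne hij with h1 | h1
      · exact hd i j h1
      · exact (hd j i h1).symm
    · intro i j hij
      rw [List.pairwise_iff_get] at ht
      rcases lt_or_gt_of_ne hij.ne with h1 | h1
      · exact ht i j h1
      · exact (ht j i h1).symm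
  have h1 := hH.card_edgeFinset_le (by simp)
  have h2 := SimpleGraph.card_edgeFinset_top_eq_card_choose_two (V := Fin 5)
  rw [card_edgeFinset_eq_natCard] at h1 h2
  rw [h2] at h1
  revert h1
  decide

/-- Neighbours inside `S`. -/
noncomputable def nb (G : SimpleGraph V) (S : Finset V) (v : V) : Finset V := S.filter (G.Adj v)

omit [Fintype V] in
theorem mem_nb {S : Finset V} {u v : V} : u ∈ nb G S v ↔ u ∈ S ∧ G.Adj v u := Finset.mem_filter

/-- Twice the number of edges inside `S`. -/
noncomputable def deg2 (G : SimpleGraph V) (S : Finset V) : ℕ := ∑ v ∈ S, (nb G S v).card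

omit [Fintype V] in
theorem deg2_eq (S : Finset V) :
    deg2 G S = 2 * (G.induce (S : Set V)).edgeFinset.card := by
  rw [← SimpleGraph.sum_degrees_eq_twice_card_edges, deg2, ← Finset.sum_coe_sort]
  refine Finset.sum_congr rfl fun v _ => ?_
  rw [← SimpleGraph.card_neighborFinset_eq_degree]
  symm
  refine Finset.card_bij (fun u _ => u.1) ?_ (fun _ _ _ _ h => Subtype.ext h) ?_
  · intro u hu
    exact mem_nb.2 ⟨u.2, by simpa using hu⟩
  · intro u hu
    rw [mem_nb] at hu
    exact ⟨⟨u, hu.1⟩, by simpa using hu.2, rfl⟩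

/-- The edge bound of triangle-free planar graphs for the subgraph spanned by `S`, improved by one
edge if this subgraph is not bipartite. Both are doubled, as `deg2` counts edges twice. -/
theorem HasCutSystem.deg2_le (h : HasCutSystem G)
    (htri : ∀ u v w, G.Adj u v → G.Adj v w → G.Adj w u → False) {S : Finset V} (hS : 3 ≤ S.card) :
    deg2 G S + 8 ≤ 4 * S.card ∧
      ((∃ s : V → ZMod 2, ∀ u ∈ S, ∀ v ∈ S, G.Adj u v → s u ≠ s v) ∨
        deg2 G S + 10 ≤ 4 * S.card) := by
  have h1 : HasCutSystem (G.induce (S : Set V)) := by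
    refine h.of_parts _ (fun v => {v.1}) ?_ (fun _ => linked_singleton _) ?_
    · intro x y hxy
      rw [Finset.disjoint_singleton]
      exact fun h => hxy (Subtype.ext h)
    · intro x y hxy
      exact ⟨x.1, by simp, y.1, by simp, hxy⟩
  have h2 : Fintype.card (S : Set V) = S.card := by simp
  obtain ⟨h3, h4⟩ := h1.card_edgeFinset_le_of_triangleFree (by rw [h2]; exact hS)
    fun u v w huv hvw hwu => htri u.1 v.1 w.1 huv hvw hwu
  rw [h2, card_edgeFinset_eq_natCard] at h3 h4
  rw [deg2_eq, card_edgeFinset_eq_natCard]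
  refine ⟨by omega, h4.imp ?_ (fun h => by omega)⟩
  rintro ⟨s, hs⟩
  refine ⟨fun v => if h : v ∈ S then s ⟨v, h⟩ else 0, fun u hu v hv huv => ?_⟩
  simp only [dif_pos hu, dif_pos hv]
  exact hs ⟨u, hu⟩ ⟨v, hv⟩ huv

omit [Fintype V] in
/-- A connected graph on `S` has at least `|S| - 1` edges. -/
theorem Linked.card_le {S : Finset V} (h : Linked G S) : 2 * S.card ≤ deg2 G S + 2 := by
  rcases S.eq_empty_or_nonempty with rfl | ⟨v, hv⟩
  · simp
  · have hc : (G.induce (S : Set V)).Connected := by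
      refine (SimpleGraph.connected_iff _).2 ⟨fun x y => ?_, ⟨v, hv⟩⟩
      have := h (fun z => ∃ hz : z ∈ S, (G.induce (S : Set V)).Reachable x ⟨z, hz⟩)
        (by
          rintro a ha b hb hab ⟨_, hr⟩
          exact ⟨hb, hr.trans (SimpleGraph.Adj.reachable (G := G.induce (S : Set V))
            (u := ⟨a, ha⟩) (v := ⟨b, hb⟩) hab)⟩) x.1 x.2 y.1 y.2
        ⟨x.2, SimpleGraph.Reachable.refl _⟩
      exact this.2
    have h1 := hc.card_vert_le_card_edgeSet_add_one
    rw [deg2_eq, card_edgeFinset_eq_natCard]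
    have h2 : Nat.card (S : Set V) = S.card := by simp
    omega
end

/-! ### Counting pentagons -/

section
variable {V : Type} {G : SimpleGraph V}

/-- The algebraic trace of planarity, together with triangle-freeness. -/
structure PT [Fintype V] (G : SimpleGraph V) : Prop where
  cut : HasCutSystem G
  tri : ∀ u v w, G.Adj u v → G.Adj v w → G.Adj w u → False

/-- The number of edges between `X` and `Y` (for disjoint sets). -/
noncomputable def ee (G : SimpleGraph V) (X Y : Finset V) : ℕ :=
  ((X ×ˢ Y).filter fun p => G.Adj p.1 p.2).card

/-- The common neighbours of `a` and `b` inside `S`. -/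
noncomputable def cn (G : SimpleGraph V) (S : Finset V) (a b : V) : Finset V :=
  S.filter fun v => G.Adj a v ∧ G.Adj b v

/-- The number of paths `a y z b` of length three with inner vertices in `S`. -/
noncomputable def pp (G : SimpleGraph V) (S : Finset V) (a b : V) : ℕ := ee G (nb G S a) (nb G S b)

/-- `Q` is the vertex set of a pentagon. In a triangle-free graph the five vertices are
automatically distinct and the pentagon is induced, so pentagons and their vertex sets match. -/
def IsPent (G : SimpleGraph V) (Q : Finset V) : Prop :=
  ∃ a b c d e, Q = {a, b, c, d, e} ∧ G.Adj a b ∧ G.Adj b c ∧ G.Adj c d ∧ G.Adj d e ∧ G.Adj e a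

/-- The pentagons inside `S`. -/
noncomputable def pents (G : SimpleGraph V) (S : Finset V) : Finset (Finset V) :=
  S.powerset.filter (IsPent G)

theorem mem_pents {S Q : Finset V} : Q ∈ pents G S ↔ Q ⊆ S ∧ IsPent G Q := by
  simp [pents]

theorem mem_cn {S : Finset V} {a b v : V} : v ∈ cn G S a b ↔ v ∈ S ∧ G.Adj a v ∧ G.Adj b v :=
  Finset.mem_filter

theorem cn_symm (S : Finset V) (a b : V) : cn G S a b = cn G S b a := by
  ext; simp only [mem_cn]; tauto

theorem ee_symm (X Y : Finset V) : ee G X Y = ee G Y X := by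
  unfold ee
  refine Finset.card_bij (fun p _ => p.swap) ?_ (fun _ _ _ _ h => Prod.swap_injective h) ?_
  · rintro ⟨x, y⟩ h
    simp only [Finset.mem_filter, Finset.mem_product, Prod.swap] at h ⊢
    exact ⟨h.1.symm, h.2.symm⟩
  · rintro ⟨x, y⟩ h
    simp only [Finset.mem_filter, Finset.mem_product] at h
    exact ⟨(y, x), by simpa using ⟨h.1.symm, h.2.symm⟩, rfl⟩

theorem ee_mono {X Y X' Y' : Finset V} (hX : X ⊆ X') (hY : Y ⊆ Y') : ee G X Y ≤ ee G X' Y' :=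
  Finset.card_le_card (Finset.filter_subset_filter _ (Finset.product_subset_product hX hY))

theorem ee_eq_sum (X Y : Finset V) : ee G X Y = ∑ x ∈ X, (nb G Y x).card := by
  rw [ee, Finset.card_filter, Finset.sum_product]
  refine Finset.sum_congr rfl fun x _ => ?_
  rw [nb, Finset.card_filter]

theorem ee_union_left {X X' : Finset V} (Y : Finset V) (h : Disjoint X X') :
    ee G (X ∪ X') Y = ee G X Y + ee G X' Y := by
  simp only [ee_eq_sum, Finset.sum_union h]

theorem ee_union_right {X X' : Finset V} (Y : Finset V) (h : Disjoint X X') :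
    ee G Y (X ∪ X') = ee G Y X + ee G Y X' := by
  rw [ee_symm, ee_union_left _ h, ee_symm, ee_symm X']

theorem ee_eq_zero {X Y : Finset V} (h : ∀ x ∈ X, ∀ y ∈ Y, ¬ G.Adj x y) : ee G X Y = 0 := by
  rw [ee, Finset.card_eq_zero, Finset.filter_eq_empty_iff]
  rintro ⟨x, y⟩ hxy
  rw [Finset.mem_product] at hxy
  exact h x hxy.1 y hxy.2

theorem ee_pos {X Y : Finset V} {x y : V} (hx : x ∈ X) (hy : y ∈ Y) (h : G.Adj x y) :
    0 < ee G X Y :=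
  Finset.card_pos.2 ⟨(x, y), Finset.mem_filter.2 ⟨Finset.mem_product.2 ⟨hx, hy⟩, h⟩⟩

theorem exists_of_ee_pos {X Y : Finset V} (h : 0 < ee G X Y) : ∃ x ∈ X, ∃ y ∈ Y, G.Adj x y := by
  obtain ⟨⟨x, y⟩, hxy⟩ := Finset.card_pos.1 h
  simp only [Finset.mem_filter, Finset.mem_product] at hxy
  exact ⟨x, hxy.1.1, y, hxy.1.2, hxy.2⟩

theorem card_le_ee {X Y : Finset V} (h : ∀ y ∈ Y, ∃ x ∈ X, G.Adj x y) : Y.card ≤ ee G X Y := by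
  rw [ee_symm, ee_eq_sum, Finset.card_eq_sum_ones]
  refine Finset.sum_le_sum fun y hy => Finset.card_pos.2 ?_
  obtain ⟨x, hx, hxy⟩ := h y hy
  exact ⟨x, mem_nb.2 ⟨hx, hxy.symm⟩⟩

theorem ee_singleton (x : V) (Y : Finset V) : ee G {x} Y = (nb G Y x).card := by
  rw [ee_eq_sum, Finset.sum_singleton]

theorem deg2_eq_ee (S : Finset V) : deg2 G S = ee G S S := (ee_eq_sum S S).symm

theorem deg2_union {X Y : Finset V} (h : Disjoint X Y) :
    deg2 G (X ∪ Y) = deg2 G X + deg2 G Y + 2 * ee G X Y := by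
  rw [deg2_eq_ee, deg2_eq_ee, deg2_eq_ee, ee_union_left _ h, ee_union_right _ h,
    ee_union_right _ h, ee_symm Y X]
  ring

theorem deg2_insert {X : Finset V} {v : V} (h : v ∉ X) :
    deg2 G (insert v X) = deg2 G X + 2 * (nb G X v).card := by
  rw [Finset.insert_eq, deg2_union (Finset.disjoint_singleton_left.2 h), ee_singleton,
    deg2_eq_ee {v}, ee_eq_zero]
  · ring
  · intro x hx y hy
    rw [Finset.mem_singleton] at hx hy
    subst hx; subst hy
    exact G.irrefl

theorem deg2_of_indep {X : Finset V} (h : ∀ x ∈ X, ∀ y ∈ X, ¬ G.Adj x y) : deg2 G X = 0 := by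
  rw [deg2_eq_ee, ee_eq_zero h]

theorem nb_mono {S S' : Finset V} (h : S ⊆ S') (v : V) : nb G S v ⊆ nb G S' v :=
  Finset.filter_subset_filter _ h

theorem pp_symm (S : Finset V) (a b : V) : pp G S a b = pp G S b a := ee_symm _ _

theorem pp_mono {S S' : Finset V} (h : S ⊆ S') (a b : V) : pp G S a b ≤ pp G S' a b :=
  ee_mono (nb_mono h a) (nb_mono h b)

theorem cn_mono {S S' : Finset V} (h : S ⊆ S') (a b : V) : cn G S a b ⊆ cn G S' a b :=
  Finset.filter_subset_filter _ h

theorem pp_pos {S : Finset V} {a b y z : V} (hy : y ∈ S) (hz : z ∈ S) (h1 : G.Adj a y)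
    (h2 : G.Adj y z) (h3 : G.Adj z b) : 0 < pp G S a b :=
  ee_pos (mem_nb.2 ⟨hy, h1⟩) (mem_nb.2 ⟨hz, h3.symm⟩) h2

theorem exists_of_pp_pos {S : Finset V} {a b : V} (h : 0 < pp G S a b) :
    ∃ y ∈ S, ∃ z ∈ S, G.Adj a y ∧ G.Adj y z ∧ G.Adj z b := by
  obtain ⟨y, hy, z, hz, hyz⟩ := exists_of_ee_pos h
  rw [mem_nb] at hy hz
  exact ⟨y, hy.1, z, hz.1, hy.2, hyz, hz.2.symm⟩

/-- A pentagon can be traversed starting at each of its vertices. -/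
theorem IsPent.rotate {Q : Finset V} (h : IsPent G Q) {w : V} (hw : w ∈ Q) :
    ∃ p y z q, Q = {w, p, y, z, q} ∧ G.Adj w p ∧ G.Adj p y ∧ G.Adj y z ∧ G.Adj z q ∧ G.Adj q w := by
  obtain ⟨a, b, c, d, e, rfl, h1, h2, h3, h4, h5⟩ := h
  simp only [Finset.mem_insert, Finset.mem_singleton] at hw
  rcases hw with rfl | rfl | rfl | rfl | rfl
  · exact ⟨b, c, d, e, rfl, h1, h2, h3, h4, h5⟩
  · exact ⟨c, d, e, a, by ext; simp only [Finset.mem_insert, Finset.mem_singleton]; tauto,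
      h2, h3, h4, h5, h1⟩
  · exact ⟨d, e, a, b, by ext; simp only [Finset.mem_insert, Finset.mem_singleton]; tauto,
      h3, h4, h5, h1, h2⟩
  · exact ⟨e, a, b, c, by ext; simp only [Finset.mem_insert, Finset.mem_singleton]; tauto,
      h4, h5, h1, h2, h3⟩
  · exact ⟨a, b, c, d, by ext; simp only [Finset.mem_insert, Finset.mem_singleton]; tauto,
      h5, h1, h2, h3, h4⟩

/-- A pentagon through two nonadjacent vertices consists of a path of length two and one of length
three joining them. -/
theorem IsPent.pair {Q : Finset V} (h : IsPent G Q) {a b : V} (ha : a ∈ Q) (hb : b ∈ Q)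
    (hab : a ≠ b) (hadj : ¬ G.Adj a b) : ∃ x y z, Q = {x, a, y, z, b} ∧ G.Adj a x ∧ G.Adj b x ∧
      G.Adj a y ∧ G.Adj y z ∧ G.Adj z b := by
  obtain ⟨p, y, z, q, rfl, h1, h2, h3, h4, h5⟩ := h.rotate ha
  simp only [Finset.mem_insert, Finset.mem_singleton] at hb
  rcases hb with rfl | rfl | rfl | rfl | rfl
  · exact absurd rfl hab
  · exact absurd h1 hadj
  · exact ⟨p, q, z, by ext; simp only [Finset.mem_insert, Finset.mem_singleton]; tauto,
      h1, h2.symm, h5.symm, h4.symm, h3.symm⟩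
  · exact ⟨q, p, y, by ext; simp only [Finset.mem_insert, Finset.mem_singleton]; tauto,
      h5.symm, h4, h1, h2, h3⟩
  · exact absurd h5.symm hadj

variable [Fintype V]

/-- Vertices at distance two on a closed walk of length five are distinct and nonadjacent. -/
theorem PT.ne (hG : PT G) {a b c d e : V} (h1 : G.Adj a b) (h2 : G.Adj b c) (h3 : G.Adj c d)
    (h4 : G.Adj d e) (h5 : G.Adj e a) : a ≠ c ∧ ¬ G.Adj a c := by
  refine ⟨?_, fun h => hG.tri a b c h1 h2 h.symm⟩
  rintro rfl
  exact hG.tri a d e h3 h4 h5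

theorem PT.card_pent (hG : PT G) {Q : Finset V} (h : IsPent G Q) : Q.card = 5 := by
  obtain ⟨a, b, c, d, e, rfl, h1, h2, h3, h4, h5⟩ := h
  have := (hG.ne h1 h2 h3 h4 h5).1
  have := (hG.ne h2 h3 h4 h5 h1).1
  have := (hG.ne h3 h4 h5 h1 h2).1
  have := (hG.ne h4 h5 h1 h2 h3).1
  have := (hG.ne h5 h1 h2 h3 h4).1
  have := h1.ne
  have := h2.ne
  have := h3.ne
  have := h4.ne
  have := h5.ne
  rw [Finset.card_insert_of_notMem, Finset.card_insert_of_notMem, Finset.card_insert_of_notMem,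
    Finset.card_pair] <;> grind

/-- Through two vertices at distance two there is one pentagon for each choice of a common neighbour
and of a path of length three. -/
theorem PT.card_pents_pair (hG : PT G) {S : Finset V} {a b : V} (ha : a ∈ S) (hb : b ∈ S)
    (hab : a ≠ b) (hc : (cn G S a b).Nonempty) :
    ((pents G S).filter fun Q => a ∈ Q ∧ b ∈ Q).card = (cn G S a b).card * pp G S a b := by
  have hadj : ¬ G.Adj a b := by
    obtain ⟨x, hx⟩ := hc
    rw [mem_cn] at hx
    exact fun h => hG.tri a b x h hx.2.2 hx.2.1.symm
  rw [pp, ee, ← Finset.card_product]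
  symm
  refine Finset.card_bij (fun p _ => {p.1, a, p.2.1, p.2.2, b}) ?_ ?_ ?_
  · rintro ⟨x, y, z⟩ h
    simp only [Finset.mem_product, Finset.mem_filter, mem_cn, mem_nb] at h
    obtain ⟨⟨hx, hax, hbx⟩, ⟨⟨hy, hay⟩, hz, hbz⟩, hyz⟩ := h
    simp only [Finset.mem_filter, mem_pents]
    refine ⟨⟨?_, x, a, y, z, b, rfl, hax.symm, hay, hyz, hbz.symm, hbx⟩, by simp, by simp⟩
    intro v hv
    simp only [Finset.mem_insert, Finset.mem_singleton] at hv
    rcases hv with rfl | rfl | rfl | rfl | rfl <;> assumption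
  · rintro ⟨x, y, z⟩ h ⟨x', y', z'⟩ h' heq
    simp only [Finset.mem_product, Finset.mem_filter, mem_cn, mem_nb] at h h'
    obtain ⟨⟨hx, hax, hbx⟩, ⟨⟨hy, hay⟩, hz, hbz⟩, hyz⟩ := h
    obtain ⟨⟨hx', hax', hbx'⟩, ⟨⟨hy', hay'⟩, hz', hbz'⟩, hyz'⟩ := h'
    have key : ∀ v, (v = x ∨ v = a ∨ v = y ∨ v = z ∨ v = b) ↔
        (v = x' ∨ v = a ∨ v = y' ∨ v = z' ∨ v = b) := by
      intro v
      have := congrArg (v ∈ ·) heq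
      simpa using this
    have hby : ¬ G.Adj b y := fun h => hG.tri b y z h hyz hbz.symm
    have hby' : ¬ G.Adj b y' := fun h => hG.tri b y' z' h hyz' hbz'.symm
    have haz : ¬ G.Adj a z := fun h => hG.tri a y z hay hyz h.symm
    have haz' : ¬ G.Adj a z' := fun h => hG.tri a y' z' hay' hyz' h.symm
    have haa : ¬ G.Adj a a := G.irrefl
    have hbb : ¬ G.Adj b b := G.irrefl
    have e1 : x = x' := by
      rcases (key x).1 (Or.inl rfl) with h | h | h | h | h
      · exact h
      · exact absurd (h ▸ hax) haa
      · exact absurd (h ▸ hbx) hby'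
      · exact absurd (h ▸ hax) haz'
      · exact absurd (h ▸ hbx) hbb
    have e2 : y = y' := by
      rcases (key y).1 (by simp) with h | h | h | h | h
      · exact absurd (h ▸ hbx') hby
      · exact absurd (h ▸ hay) haa
      · exact h
      · exact absurd (h ▸ hay) haz'
      · exact absurd (h ▸ hay) hadj
    have e3 : z = z' := by
      rcases (key z).1 (by simp) with h | h | h | h | h
      · exact absurd (h ▸ hax') haz
      · exact absurd (h ▸ hbz) (fun h => hadj h.symm)
      · exact absurd (h ▸ hay') haz
      · exact h
      · exact absurd (h ▸ hbz) hbb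
    rw [e1, e2, e3]
  · intro Q hQ
    simp only [Finset.mem_filter, mem_pents] at hQ
    obtain ⟨⟨hQS, hQ⟩, haQ, hbQ⟩ := hQ
    obtain ⟨x, y, z, rfl, h1, h2, h3, h4, h5⟩ := hQ.pair haQ hbQ hab hadj
    have hs : ∀ v ∈ ({x, a, y, z, b} : Finset V), v ∈ S := fun v hv => hQS hv
    refine ⟨(x, y, z), ?_, rfl⟩
    simp only [Finset.mem_product, Finset.mem_filter, mem_cn, mem_nb]
    exact ⟨⟨hs x (by simp), h1, h2⟩, ⟨⟨hs y (by simp), h3⟩, hs z (by simp), h5.symm⟩, h4⟩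

/-- Deleting a vertex `w` whose neighbours are among `p` and `q` loses at most one pentagon for each
path of length three between `p` and `q`. -/
theorem PT.card_pents_erase (hG : PT G) {S : Finset V} {w p q : V} (hn : nb G S w ⊆ {p, q}) :
    (pents G S).card ≤ (pents G (S.erase w)).card + pp G (S.erase w) p q := by
  have h1 : pents G S ⊆ pents G (S.erase w) ∪
      (((nb G (S.erase w) p) ×ˢ (nb G (S.erase w) q)).filter fun e => G.Adj e.1 e.2).image
        fun e => {w, p, e.1, e.2, q} := by
    intro Q hQ
    rw [mem_pents] at hQ
    obtain ⟨hQS, hQ⟩ := hQ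
    rw [Finset.mem_union]
    by_cases hw : w ∈ Q
    · right
      obtain ⟨p', y, z, q', rfl, h1, h2, h3, h4, h5⟩ := hQ.rotate hw
      have hs : ∀ v ∈ ({w, p', y, z, q'} : Finset V), v ∈ S := fun v hv => hQS hv
      have hp' := hn (mem_nb.2 ⟨hs p' (by simp), h1⟩)
      have hq' := hn (mem_nb.2 ⟨hs q' (by simp), h5.symm⟩)
      have hpq : p' ≠ q' := (hG.ne h2 h3 h4 h5 h1).1 ∘ fun h => by
        exfalso; subst h; exact hG.tri _ _ _ h2 h3 h4
      have hyw : y ≠ w := (hG.ne h1 h2 h3 h4 h5).1.symm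
      have hzw : z ≠ w := (hG.ne h3 h4 h5 h1 h2).1 ∘ fun h => by
        exfalso; subst h; exact hG.tri _ _ _ h1 h2 h3
      have hy : y ∈ S.erase w := Finset.mem_erase.2 ⟨hyw, hs y (by simp)⟩
      have hz : z ∈ S.erase w := Finset.mem_erase.2 ⟨hzw, hs z (by simp)⟩
      simp only [Finset.mem_insert, Finset.mem_singleton] at hp' hq'
      rw [Finset.mem_image]
      rcases hp' with rfl | rfl <;> rcases hq' with rfl | rfl
      · exact absurd rfl hpq
      · refine ⟨(y, z), ?_, rfl⟩
        simp only [Finset.mem_filter, Finset.mem_product, mem_nb]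
        exact ⟨⟨⟨hy, h2⟩, hz, h4.symm⟩, h3⟩
      · refine ⟨(z, y), ?_, by
          ext; simp only [Finset.mem_insert, Finset.mem_singleton]; tauto⟩
        simp only [Finset.mem_filter, Finset.mem_product, mem_nb]
        exact ⟨⟨⟨hz, h4.symm⟩, hy, h2⟩, h3.symm⟩
      · exact absurd rfl hpq
    · left
      rw [mem_pents]
      exact ⟨fun v hv => Finset.mem_erase.2 ⟨fun h => hw (h ▸ hv), hQS hv⟩, hQ⟩
  refine (Finset.card_le_card h1).trans ((Finset.card_union_le _ _).trans ?_)
  exact Nat.add_le_add_left Finset.card_image_le _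

theorem PT.pp_self (hG : PT G) (S : Finset V) (a : V) : pp G S a a = 0 :=
  ee_eq_zero fun _ hy _ hz hyz => hG.tri _ _ _ (mem_nb.1 hy).2 hyz (mem_nb.1 hz).2.symm

end

/-! ### The frame of a pair of vertices -/

section
variable {V : Type} {G : SimpleGraph V}

/-- `a` and `b` are vertices of `S` joined by a path of length two and by one of length three. -/
structure Good (G : SimpleGraph V) (S : Finset V) (a b : V) : Prop where
  ha : a ∈ S
  hb : b ∈ S
  c : (cn G S a b).Nonempty
  p : 0 < pp G S a b

/-- The neighbours of `a` on paths of length three to `b`. -/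
noncomputable def sA (G : SimpleGraph V) (S : Finset V) (a b : V) : Finset V :=
  S.filter fun y => G.Adj a y ∧ ∃ z ∈ S, G.Adj y z ∧ G.Adj z b

/-- The inner vertices of paths of length three between `a` and `b`. -/
noncomputable def sT (G : SimpleGraph V) (S : Finset V) (a b : V) : Finset V :=
  sA G S a b ∪ sA G S b a

/-- The inner vertices of paths of length two or three between `a` and `b`. -/
noncomputable def sI (G : SimpleGraph V) (S : Finset V) (a b : V) : Finset V :=
  cn G S a b ∪ sT G S a b

/-- The vertices outside all paths of length two or three between `a` and `b`. -/
noncomputable def sW (G : SimpleGraph V) (S : Finset V) (a b : V) : Finset V :=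
  S.filter fun w => w ≠ a ∧ w ≠ b ∧ w ∉ sI G S a b

theorem mem_sA {S : Finset V} {a b y : V} :
    y ∈ sA G S a b ↔ y ∈ S ∧ G.Adj a y ∧ ∃ z ∈ S, G.Adj y z ∧ G.Adj z b := Finset.mem_filter

theorem mem_sT {S : Finset V} {a b y : V} :
    y ∈ sT G S a b ↔ y ∈ sA G S a b ∨ y ∈ sA G S b a := Finset.mem_union

theorem mem_sI {S : Finset V} {a b y : V} :
    y ∈ sI G S a b ↔ y ∈ cn G S a b ∨ y ∈ sT G S a b := Finset.mem_union

theorem mem_sW {S : Finset V} {a b w : V} :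
    w ∈ sW G S a b ↔ w ∈ S ∧ w ≠ a ∧ w ≠ b ∧ w ∉ sI G S a b := Finset.mem_filter

theorem sT_symm (S : Finset V) (a b : V) : sT G S a b = sT G S b a := Finset.union_comm _ _

theorem sI_symm (S : Finset V) (a b : V) : sI G S a b = sI G S b a := by
  rw [sI, sI, sT_symm, cn_symm]

theorem sW_symm (S : Finset V) (a b : V) : sW G S a b = sW G S b a := by
  ext; rw [mem_sW, mem_sW, sI_symm]; tauto

theorem Good.symm {S : Finset V} {a b : V} (g : Good G S a b) : Good G S b a :=
  ⟨g.hb, g.ha, cn_symm S a b ▸ g.c, pp_symm S a b ▸ g.p⟩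

theorem sA_sub (S : Finset V) (a b : V) : sA G S a b ⊆ S := Finset.filter_subset _ _
theorem sT_sub (S : Finset V) (a b : V) : sT G S a b ⊆ S := by
  intro y hy; rcases mem_sT.1 hy with h | h <;> exact sA_sub _ _ _ h
theorem cn_sub (S : Finset V) (a b : V) : cn G S a b ⊆ S := Finset.filter_subset _ _
theorem sI_sub (S : Finset V) (a b : V) : sI G S a b ⊆ S :=
  Finset.union_subset (cn_sub _ _ _) (sT_sub _ _ _)
theorem sW_sub (S : Finset V) (a b : V) : sW G S a b ⊆ S := Finset.filter_subset _ _
theorem sA_sub_sT (S : Finset V) (a b : V) : sA G S a b ⊆ sT G S a b := Finset.subset_union_left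
theorem sB_sub_sT (S : Finset V) (a b : V) : sA G S b a ⊆ sT G S a b := Finset.subset_union_right
theorem sT_sub_sI (S : Finset V) (a b : V) : sT G S a b ⊆ sI G S a b := Finset.subset_union_right
theorem cn_sub_sI (S : Finset V) (a b : V) : cn G S a b ⊆ sI G S a b := Finset.subset_union_left

theorem mem_cases {S : Finset V} {a b v : V} (hv : v ∈ S) :
    v = a ∨ v = b ∨ v ∈ sI G S a b ∨ v ∈ sW G S a b := by
  rw [mem_sW]; tauto

theorem not_mem_sI_of_sW {S : Finset V} {a b w : V} (hw : w ∈ sW G S a b) : w ∉ sI G S a b :=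
  (mem_sW.1 hw).2.2.2

theorem sB_of_adj {S : Finset V} {a b y z : V} (hy : y ∈ S) (hz : z ∈ S) (h1 : G.Adj a y)
    (h2 : G.Adj y z) (h3 : G.Adj z b) : y ∈ sA G S a b ∧ z ∈ sA G S b a :=
  ⟨mem_sA.2 ⟨hy, h1, z, hz, h2, h3⟩, mem_sA.2 ⟨hz, h3.symm, y, hy, h2.symm, h1.symm⟩⟩

theorem exists_sB {S : Finset V} {a b y : V} (hy : y ∈ sA G S a b) :
    ∃ z ∈ sA G S b a, G.Adj y z := by
  obtain ⟨hyS, hay, z, hz, hyz, hzb⟩ := mem_sA.1 hy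
  exact ⟨z, (sB_of_adj hyS hz hay hyz hzb).2, hyz⟩

theorem pp_eq_ee (S : Finset V) (a b : V) : pp G S a b = ee G (sA G S a b) (sA G S b a) := by
  unfold pp ee
  congr 1
  ext ⟨y, z⟩
  simp only [Finset.mem_filter, Finset.mem_product, mem_nb]
  constructor
  · rintro ⟨⟨⟨hy, hay⟩, hz, hbz⟩, hyz⟩
    exact ⟨sB_of_adj hy hz hay hyz hbz.symm, hyz⟩
  · rintro ⟨⟨hy, hz⟩, hyz⟩
    rw [mem_sA] at hy hz
    exact ⟨⟨⟨hy.1, hy.2.1⟩, hz.1, hz.2.1⟩, hyz⟩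

theorem no_two_coloring {s : V → ZMod 2} {a b c d e : V} (h1 : s a ≠ s b) (h2 : s b ≠ s c)
    (h3 : s c ≠ s d) (h4 : s d ≠ s e) (h5 : s e ≠ s a) : False := by
  generalize s a = a at *
  generalize s b = b at *
  generalize s c = c at *
  generalize s d = d at *
  generalize s e = e at *
  revert a b c d e
  decide

/-- The pentagons in `S` meeting `U`. -/
noncomputable def meet (G : SimpleGraph V) (S U : Finset V) : Finset (Finset V) :=
  (pents G S).filter fun Q => ∃ w ∈ Q, w ∈ U

theorem mem_meet {S U Q : Finset V} :
    Q ∈ meet G S U ↔ Q ⊆ S ∧ IsPent G Q ∧ ∃ w ∈ Q, w ∈ U := by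
  rw [meet, Finset.mem_filter, mem_pents, and_assoc]

theorem card_pents_sdiff (S U : Finset V) :
    (pents G S).card = (pents G (S \ U)).card + (meet G S U).card := by
  rw [meet, ← Finset.card_filter_add_card_filter_not (s := pents G S) fun Q => ∃ w ∈ Q, w ∈ U,
    add_comm]
  congr 2
  ext Q
  simp only [Finset.mem_filter, mem_pents, Finset.subset_iff, Finset.mem_sdiff]
  grind

/-- `U` is a union of components of `W`. -/
def Closed (G : SimpleGraph V) (W U : Finset V) : Prop :=
  U ⊆ W ∧ ∀ u ∈ U, ∀ v ∈ W, G.Adj u v → v ∈ U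

theorem closed_comp (W : Finset V) (w : V) : Closed G W (comp G W w) :=
  ⟨comp_subset W w, fun _ hu _ hv huv => comp_closed hu hv huv⟩

variable [Fintype V] {S : Finset V} {a b : V}

theorem PT.good_ne (hG : PT G) (g : Good G S a b) : a ≠ b := by
  rintro rfl
  have := g.p
  rw [hG.pp_self] at this
  omega

theorem PT.good_nadj (hG : PT G) (g : Good G S a b) : ¬ G.Adj a b := by
  obtain ⟨x, hx⟩ := g.c
  rw [mem_cn] at hx
  exact fun h => hG.tri a b x h hx.2.2 hx.2.1.symm

/-- Two neighbours of a vertex are not adjacent. -/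
theorem PT.indep (hG : PT G) {v u w : V} (hu : G.Adj v u) (hw : G.Adj v w) : ¬ G.Adj u w :=
  fun h => hG.tri v u w hu h hw.symm

theorem PT.sA_nadj (hG : PT G) {y : V} (hy : y ∈ sA G S a b) : ¬ G.Adj b y := by
  obtain ⟨-, -, z, -, hyz, hzb⟩ := mem_sA.1 hy
  exact fun h => hG.tri b y z h hyz hzb

theorem PT.not_sA_sB (hG : PT G) {y : V} (hy : y ∈ sA G S a b) : y ∉ sA G S b a :=
  fun h => hG.sA_nadj hy (mem_sA.1 h).2.1

theorem PT.disjoint_sA (hG : PT G) (S : Finset V) (a b : V) :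
    Disjoint (sA G S a b) (sA G S b a) :=
  Finset.disjoint_left.2 fun _ hy => hG.not_sA_sB hy

theorem PT.not_cn_sT (hG : PT G) {y : V} (hy : y ∈ sT G S a b) : y ∉ cn G S a b := by
  intro h
  rw [mem_cn] at h
  rcases mem_sT.1 hy with h1 | h1
  · exact hG.sA_nadj h1 h.2.2
  · exact hG.sA_nadj h1 h.2.1

theorem PT.disjoint_cn_sT (hG : PT G) (S : Finset V) (a b : V) :
    Disjoint (cn G S a b) (sT G S a b) :=
  Finset.disjoint_right.2 fun _ hy => hG.not_cn_sT hy

/-- Adjacent inner vertices lie in `sA S a b` and `sA S b a`, respectively. -/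
theorem PT.adj_sI (hG : PT G) {r s : V} (hr : r ∈ sI G S a b) (hs : s ∈ sI G S a b)
    (h : G.Adj r s) : (r ∈ sA G S a b ∧ s ∈ sA G S b a) ∨ (r ∈ sA G S b a ∧ s ∈ sA G S a b) := by
  simp only [mem_sI, mem_sT] at hr hs
  have hA : ∀ {v}, v ∈ sA G S a b → G.Adj a v := fun hv => (mem_sA.1 hv).2.1
  have hB : ∀ {v}, v ∈ sA G S b a → G.Adj b v := fun hv => (mem_sA.1 hv).2.1
  have hC : ∀ {v}, v ∈ cn G S a b → G.Adj a v ∧ G.Adj b v := fun hv => (mem_cn.1 hv).2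
  rcases hr with hr | hr | hr <;> rcases hs with hs | hs | hs
  · exact absurd h (hG.indep (hC hr).1 (hC hs).1)
  · exact absurd h (hG.indep (hC hr).1 (hA hs))
  · exact absurd h (hG.indep (hC hr).2 (hB hs))
  · exact absurd h (hG.indep (hA hr) (hC hs).1)
  · exact absurd h (hG.indep (hA hr) (hA hs))
  · exact Or.inl ⟨hr, hs⟩
  · exact absurd h (hG.indep (hB hr) (hC hs).2)
  · exact Or.inr ⟨hr, hs⟩
  · exact absurd h (hG.indep (hB hr) (hB hs))

theorem PT.sI_ne (hG : PT G) (g : Good G S a b) {r : V} (hr : r ∈ sI G S a b) : r ≠ a ∧ r ≠ b := by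
  have h1 := hG.good_nadj g
  have h2 : ∀ {v a b : V}, v ∈ sA G S a b → G.Adj a v := fun hv => (mem_sA.1 hv).2.1
  simp only [mem_sI, mem_sT, mem_cn] at hr
  rcases hr with hr | hr | hr
  · exact ⟨hr.2.1.ne', hr.2.2.ne'⟩
  · exact ⟨(h2 hr).ne', fun h => h1 (h ▸ h2 hr)⟩
  · exact ⟨fun h => h1 (h ▸ h2 hr).symm, (h2 hr).ne'⟩

/-- A vertex outside the frame that is adjacent to `a` has no other neighbour in the frame. -/
theorem PT.sW_adj_left (hG : PT G) (g : Good G S a b) {w r : V} (hw : w ∈ sW G S a b)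
    (hwa : G.Adj a w) (hr : r ∈ S) (hrW : r ∉ sW G S a b) (h : G.Adj w r) : r = a := by
  obtain ⟨hwS, hwa', hwb', hwI⟩ := mem_sW.1 hw
  rcases mem_cases (G := G) (a := a) (b := b) hr with rfl | rfl | hr' | hr'
  · rfl
  · exact absurd (mem_sI.2 (Or.inl (mem_cn.2 ⟨hwS, hwa, h.symm⟩))) hwI
  · simp only [mem_sI, mem_sT] at hr'
    rcases hr' with hr' | hr' | hr'
    · exact absurd h (hG.indep hwa (mem_cn.1 hr').2.1)
    · exact absurd h (hG.indep hwa (mem_sA.1 hr').2.1)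
    · exact absurd (mem_sI.2 (Or.inr (mem_sT.2 (Or.inl
        (sB_of_adj hwS hr hwa h (mem_sA.1 hr').2.1.symm).1)))) hwI
  · exact absurd hr' hrW

theorem PT.sW_adj_right (hG : PT G) (g : Good G S a b) {w r : V} (hw : w ∈ sW G S a b)
    (hwb : G.Adj b w) (hr : r ∈ S) (hrW : r ∉ sW G S a b) (h : G.Adj w r) : r = b :=
  hG.sW_adj_left g.symm (sW_symm S a b ▸ hw) hwb hr (sW_symm S a b ▸ hrW) h

/-- A vertex outside the frame with two neighbours in the frame is adjacent to neither `a` nor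
`b`. -/
theorem PT.sW_two_nbrs (hG : PT G) (g : Good G S a b) {w r r' : V} (hw : w ∈ sW G S a b)
    (hr : r ∈ S) (hrW : r ∉ sW G S a b) (hr' : r' ∈ S) (hrW' : r' ∉ sW G S a b) (hne : r ≠ r')
    (h : G.Adj w r) (h' : G.Adj w r') : r ∈ sI G S a b ∧ r' ∈ sI G S a b := by
  have key : ∀ {r r'}, r ∈ S → r ∉ sW G S a b → r' ∈ S → r' ∉ sW G S a b → r ≠ r' →
      G.Adj w r → G.Adj w r' → r ∈ sI G S a b := by
    intro r r' hr hrW hr' hrW' hne h h'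
    rcases mem_cases (G := G) (a := a) (b := b) hr with rfl | rfl | h1 | h1
    · exact absurd (hG.sW_adj_left g hw h.symm hr' hrW' h').symm hne
    · exact absurd (hG.sW_adj_right g hw h.symm hr' hrW' h').symm hne
    · exact h1
    · exact absurd h1 hrW
  exact ⟨key hr hrW hr' hrW' hne h h', key hr' hrW' hr hrW hne.symm h' h⟩

theorem PT.card_eq (hG : PT G) (g : Good G S a b) : S.card =
    2 + (cn G S a b).card + (sT G S a b).card + (sW G S a b).card := by
  have h1 : S = ({a, b} ∪ (cn G S a b ∪ sT G S a b)) ∪ sW G S a b := by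
    ext v
    simp only [Finset.mem_union, Finset.mem_insert, Finset.mem_singleton]
    constructor
    · intro hv
      rcases mem_cases (G := G) (a := a) (b := b) hv with h | h | h | h
      · tauto
      · tauto
      · rw [mem_sI] at h; tauto
      · tauto
    · rintro (((rfl | rfl) | h | h) | h)
      · exact g.ha
      · exact g.hb
      · exact cn_sub _ _ _ h
      · exact sT_sub _ _ _ h
      · exact sW_sub _ _ _ h
  conv_lhs => rw [h1]
  rw [Finset.card_union_of_disjoint, Finset.card_union_of_disjoint,
    Finset.card_union_of_disjoint (hG.disjoint_cn_sT S a b), Finset.card_pair (hG.good_ne g)]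
  · ring
  · rw [Finset.disjoint_left]
    intro v hv hv'
    have := hG.sI_ne g (mem_sI.2 (Finset.mem_union.1 hv'))
    simp only [Finset.mem_insert, Finset.mem_singleton] at hv
    tauto
  · rw [Finset.disjoint_left]
    intro v hv hv'
    have := mem_sW.1 hv'
    simp only [Finset.mem_union, Finset.mem_insert, Finset.mem_singleton] at hv
    rw [mem_sI] at this
    tauto

theorem PT.card_sT (hG : PT G) (S : Finset V) (a b : V) :
    (sT G S a b).card = (sA G S a b).card + (sA G S b a).card :=
  Finset.card_union_of_disjoint (hG.disjoint_sA S a b)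

/-- Subsets of `sT` span forests. -/
theorem PT.deg2_forest (hG : PT G) (g : Good G S a b) {Y : Finset V} (hY : Y ⊆ sT G S a b)
    (hne : Y.Nonempty) : deg2 G Y + 2 ≤ 2 * Y.card := by
  obtain ⟨x, hx⟩ := g.c
  have hxI := cn_sub_sI _ _ _ hx
  have hxY : x ∉ Y := fun h => hG.not_cn_sT (hY h) hx
  rw [mem_cn] at hx
  have hYa : a ∉ Y := fun h => (hG.sI_ne g (sT_sub_sI _ _ _ (hY h))).1 rfl
  have hYb : b ∉ Y := fun h => (hG.sI_ne g (sT_sub_sI _ _ _ (hY h))).2 rfl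
  have hYpos := Finset.card_pos.2 hne
  rcases Nat.eq_zero_or_pos (deg2 G Y) with h0 | h0
  · omega
  · rw [deg2_eq_ee] at h0
    obtain ⟨y, hy, z, hz, hyz⟩ := exists_of_ee_pos h0
    have hyz' : ∃ y ∈ Y, ∃ z ∈ Y, G.Adj a y ∧ G.Adj y z ∧ G.Adj z b := by
      rcases hG.adj_sI (sT_sub_sI _ _ _ (hY hy)) (sT_sub_sI _ _ _ (hY hz)) hyz with h | h
      · exact ⟨y, hy, z, hz, (mem_sA.1 h.1).2.1, hyz, (mem_sA.1 h.2).2.1.symm⟩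
      · exact ⟨z, hz, y, hy, (mem_sA.1 h.2).2.1, hyz.symm, (mem_sA.1 h.1).2.1.symm⟩
    obtain ⟨y, hy, z, hz, hay, hyz, hzb⟩ := hyz'
    have hab := hG.good_ne g
    have hd : Disjoint (insert x {a, b}) Y := by
      rw [Finset.disjoint_left]
      intro v hv
      simp only [Finset.mem_insert, Finset.mem_singleton] at hv
      rcases hv with rfl | rfl | rfl <;> assumption
    have hxab : x ∉ ({a, b} : Finset V) := by
      simp [(hG.sI_ne g hxI).1, (hG.sI_ne g hxI).2]
    have hcard : (insert x {a, b} ∪ Y).card = 3 + Y.card := by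
      rw [Finset.card_union_of_disjoint hd, Finset.card_insert_of_notMem hxab,
        Finset.card_pair hab]
    -- the edge bound is applied to `Y` with `a`, `b` and `x`, which contains a pentagon as `Y` has
    -- an edge
    obtain ⟨-, h1⟩ := hG.cut.deg2_le hG.tri (S := insert x {a, b} ∪ Y) (by omega)
    have h2 := h1.resolve_left (by
      rintro ⟨s, hs⟩
      exact no_two_coloring (s := s) (hs x (by simp) a (by simp) hx.2.1.symm)
        (hs a (by simp) y (by simp [hy]) hay) (hs y (by simp [hy]) z (by simp [hz]) hyz)
        (hs z (by simp [hz]) b (by simp) hzb) (hs b (by simp) x (by simp) hx.2.2))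
    rw [hcard, deg2_union hd, deg2_insert hxab] at h2
    have h3 : nb G {a, b} x = {a, b} := by
      ext v
      rw [mem_nb]
      simp only [Finset.mem_insert, Finset.mem_singleton, and_iff_left_iff_imp]
      rintro (rfl | rfl)
      · exact hx.2.1.symm
      · exact hx.2.2.symm
    rw [h3, Finset.card_pair hab] at h2
    have h4 : Y.card ≤ ee G (insert x {a, b}) Y := by
      refine card_le_ee fun v hv => ?_
      rcases mem_sT.1 (hY hv) with h | h
      · exact ⟨a, by simp, (mem_sA.1 h).2.1⟩
      · exact ⟨b, by simp, (mem_sA.1 h).2.1⟩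
    omega

theorem PT.deg2_sT (hG : PT G) (S : Finset V) (a b : V) :
    deg2 G (sT G S a b) = 2 * pp G S a b := by
  rw [sT, deg2_union (hG.disjoint_sA S a b), ← pp_eq_ee, deg2_of_indep, deg2_of_indep]
  · ring
  · exact fun u hu v hv => hG.indep (mem_sA.1 hu).2.1 (mem_sA.1 hv).2.1
  · exact fun u hu v hv => hG.indep (mem_sA.1 hu).2.1 (mem_sA.1 hv).2.1

omit [Fintype V] in
theorem Good.exists_path (g : Good G S a b) : ∃ y ∈ sA G S a b, ∃ z ∈ sA G S b a, G.Adj y z := by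
  have := g.p
  rw [pp_eq_ee] at this
  exact exists_of_ee_pos this

theorem PT.pp_lt (hG : PT G) (g : Good G S a b) : pp G S a b + 1 ≤ (sT G S a b).card := by
  obtain ⟨y, hy, -⟩ := g.exists_path
  have := hG.deg2_forest g (Finset.Subset.refl _) ⟨y, sA_sub_sT _ _ _ hy⟩
  rw [hG.deg2_sT] at this
  omega

/-- The tree part is connected exactly if it has one more vertex than edges. -/
theorem PT.linked_sT_iff (hG : PT G) (g : Good G S a b) :
    Linked G (sT G S a b) ↔ (sT G S a b).card = pp G S a b + 1 := by
  constructor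
  · intro h
    have h1 := h.card_le
    rw [hG.deg2_sT] at h1
    have := hG.pp_lt g
    omega
  · intro h
    by_contra hl
    obtain ⟨Y₁, Y₂, hn1, hn2, hd, hu, hadj⟩ := exists_split hl
    have h1 := hG.deg2_forest g (Y := Y₁) (hu ▸ Finset.subset_union_left) hn1
    have h2 := hG.deg2_forest g (Y := Y₂) (hu ▸ Finset.subset_union_right) hn2
    have h3 := hG.deg2_sT S a b
    rw [← hu, deg2_union hd, ee_eq_zero hadj] at h3
    rw [← hu, Finset.card_union_of_disjoint hd] at h
    omega

/-- The tree part is a forest, and its edges are the middle edges of the paths of length three, so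
it has more vertices than there are such paths. -/
theorem PT.cn_add_pp_le (hG : PT G) (g : Good G S a b) :
    (cn G S a b).card + pp G S a b + 3 ≤ S.card := by
  have := hG.card_eq g
  have := hG.pp_lt g
  omega

/-- A pentagon contains both hubs exactly if it stays in the frame: without one of the hubs the
frame is bipartite. -/
theorem PT.pent_of_mem (hG : PT G) (g : Good G S a b) {Q : Finset V} (hQS : Q ⊆ S)
    (hQ : IsPent G Q) : (a ∈ Q ∧ b ∈ Q) ↔ ¬ ∃ w ∈ Q, w ∈ sW G S a b := by
  constructor
  · rintro ⟨ha, hb⟩ ⟨w, hwQ, hw⟩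
    obtain ⟨x, y, z, rfl, h1, h2, h3, h4, h5⟩ := hQ.pair ha hb (hG.good_ne g) (hG.good_nadj g)
    have hs : ∀ v ∈ ({x, a, y, z, b} : Finset V), v ∈ S := fun v hv => hQS hv
    have hyz := sB_of_adj (hs y (by simp)) (hs z (by simp)) h3 h4 h5
    have hx : x ∈ cn G S a b := mem_cn.2 ⟨hs x (by simp), h1, h2⟩
    obtain ⟨-, hwa, hwb, hwI⟩ := mem_sW.1 hw
    simp only [mem_sI, mem_sT] at hwI
    simp only [Finset.mem_insert, Finset.mem_singleton] at hwQ
    rcases hwQ with rfl | rfl | rfl | rfl | rfl <;> tauto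
  · intro hW
    push Not at hW
    -- away from `a` the frame is bipartite, and pentagons are not
    have key : ∀ a b, Good G S a b → (∀ w ∈ Q, w ∉ sW G S a b) → a ∈ Q := by
      intro a b g hW
      by_contra ha
      have hcl : ∀ v ∈ Q, v = b ∨ v ∈ sI G S a b := by
        intro v hv
        rcases mem_cases (G := G) (a := a) (b := b) (hQS hv) with h | h | h | h
        · exact absurd (h ▸ hv) ha
        · exact Or.inl h
        · exact Or.inr h
        · exact absurd h (hW v hv)
      have hcol : ∀ u ∈ Q, ∀ v ∈ Q, G.Adj u v →
          (if u = b ∨ u ∈ sA G S a b then (0 : ZMod 2) else 1) ≠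
          (if v = b ∨ v ∈ sA G S a b then (0 : ZMod 2) else 1) := by
        have hbb : ∀ v, v ∈ sA G S a b → ¬ G.Adj b v := fun v hv => hG.sA_nadj hv
        intro u hu v hv huv
        rcases hcl u hu with rfl | hu' <;> rcases hcl v hv with rfl | hv'
        · exact absurd huv G.irrefl
        · have : v ∉ sA G S a u := fun h => hbb v h huv
          simp [this, huv.ne']
        · have : u ∉ sA G S a v := fun h => hbb u h huv.symm
          simp [this, huv.ne]
        · have h1 := (hG.sI_ne g hu').2
          have h2 := (hG.sI_ne g hv').2
          rcases hG.adj_sI hu' hv' huv with h | h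
          · have : v ∉ sA G S a b := fun h' => hG.not_sA_sB h' h.2
            simp [h.1, this, h2]
          · have : u ∉ sA G S a b := fun h' => hG.not_sA_sB h' h.1
            simp [h.2, this, h1]
      obtain ⟨p, q, r, s, t, rfl, h1, h2, h3, h4, h5⟩ := hQ
      exact no_two_coloring (s := fun v => if v = b ∨ v ∈ sA G S a b then (0 : ZMod 2) else 1)
        (hcol p (by simp) q (by simp) h1) (hcol q (by simp) r (by simp) h2)
        (hcol r (by simp) s (by simp) h3) (hcol s (by simp) t (by simp) h4)
        (hcol t (by simp) p (by simp) h5)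
    exact ⟨key a b g hW, key b a g.symm fun w hw => sW_symm S a b ▸ hW w hw⟩

/-- Pentagons inside the frame are counted by `cn * pp`. -/
theorem PT.card_pents_eq (hG : PT G) (g : Good G S a b) : (pents G S).card =
    (cn G S a b).card * pp G S a b + (meet G S (sW G S a b)).card := by
  rw [← hG.card_pents_pair g.ha g.hb (hG.good_ne g) g.c,
    ← Finset.card_filter_add_card_filter_not (s := pents G S) fun Q => a ∈ Q ∧ b ∈ Q, meet]
  congr 2
  refine Finset.filter_congr fun Q hQ => ?_
  rw [mem_pents] at hQ
  rw [hG.pent_of_mem g hQ.1 hQ.2, not_not]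

end

section
variable {V : Type} {G : SimpleGraph V} {S S' U : Finset V} {a b : V}

/-! ### Subframes and crossing pentagons -/

theorem cn_inter (h : S' ⊆ S) : cn G S' a b = cn G S a b ∩ S' := by
  ext v
  rw [Finset.mem_inter, mem_cn, mem_cn]
  exact ⟨fun hv => ⟨⟨h hv.1, hv.2⟩, hv.1⟩, fun hv => ⟨hv.2, hv.1.2⟩⟩

theorem sA_inter (h : S' ⊆ S)
    (hcl : ∀ y ∈ S', y ∈ sT G S a b → ∀ z ∈ sT G S a b, G.Adj y z → z ∈ S') :
    sA G S' a b = sA G S a b ∩ S' := by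
  ext y
  rw [Finset.mem_inter]
  constructor
  · intro hy
    obtain ⟨hy, hay, z, hz, hyz, hzb⟩ := mem_sA.1 hy
    exact ⟨mem_sA.2 ⟨h hy, hay, z, h hz, hyz, hzb⟩, hy⟩
  · rintro ⟨hy, hyS'⟩
    obtain ⟨z, hz, hyz⟩ := exists_sB hy
    exact mem_sA.2 ⟨hyS', (mem_sA.1 hy).2.1, z,
      hcl y hyS' (sA_sub_sT _ _ _ hy) z (sB_sub_sT _ _ _ hz) hyz, hyz, (mem_sA.1 hz).2.1.symm⟩

theorem sT_inter (h : S' ⊆ S)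
    (hcl : ∀ y ∈ S', y ∈ sT G S a b → ∀ z ∈ sT G S a b, G.Adj y z → z ∈ S') :
    sT G S' a b = sT G S a b ∩ S' := by
  rw [sT, sT, sA_inter h hcl, sA_inter h (sT_symm (G := G) S a b ▸ hcl), Finset.union_inter_distrib_right]

theorem sI_inter (h : S' ⊆ S)
    (hcl : ∀ y ∈ S', y ∈ sT G S a b → ∀ z ∈ sT G S a b, G.Adj y z → z ∈ S') :
    sI G S' a b = sI G S a b ∩ S' := by
  rw [sI, sI, sT_inter h hcl, cn_inter h, Finset.union_inter_distrib_right]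

theorem sW_inter (h : S' ⊆ S)
    (hcl : ∀ y ∈ S', y ∈ sT G S a b → ∀ z ∈ sT G S a b, G.Adj y z → z ∈ S') :
    sW G S' a b = sW G S a b ∩ S' := by
  ext v
  rw [Finset.mem_inter, mem_sW, mem_sW, sI_inter h hcl, Finset.mem_inter]
  have := @h v
  tauto

variable [Fintype V]

/-- The shape of a pentagon meeting two different unions of components outside the frame. -/
theorem PT.cross (hG : PT G) (g : Good G S a b) (hU : Closed G (sW G S a b) U) {Q : Finset V}
    (hQS : Q ⊆ S) (hQ : IsPent G Q) (h₀ : ∃ w ∈ Q, w ∈ U) (h₁ : ∃ w ∈ Q, w ∈ sW G S a b ∧ w ∉ U) :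
    ∃ w ∈ U, ∃ w' ∈ sW G S a b \ U, ∃ r ∈ sI G S a b, G.Adj w r ∧ G.Adj w' r ∧
      ((∃ r' ∈ sI G S a b, r' ≠ r ∧ ¬ G.Adj r r' ∧
        ((G.Adj w r' ∧ ∃ s' ∈ sW G S a b \ U, G.Adj w' s' ∧ G.Adj s' r') ∨
          (G.Adj w' r' ∧ ∃ s ∈ U, G.Adj w s ∧ G.Adj s r'))) ∨
      ∃ r₁ ∈ sI G S a b, ∃ r₂ ∈ sI G S a b, G.Adj w r₁ ∧ G.Adj w' r₂ ∧ G.Adj r₁ r₂ ∧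
        ¬ G.Adj r r₁ ∧ ¬ G.Adj r r₂ ∧ r ≠ r₁ ∧ r ≠ r₂) := by
  obtain ⟨w, hwQ, hwU⟩ := h₀
  obtain ⟨w', hwQ', hwW', hwU'⟩ := h₁
  have hne : w ≠ w' := fun h => hwU' (h ▸ hwU)
  have hww : ¬ G.Adj w w' := fun h => hwU' (hU.2 w hwU w' hwW' h)
  obtain ⟨r, y, z, rfl, h1, h2, h3, h4, h5⟩ := hQ.pair hwQ hwQ' hne hww
  have hs : ∀ v ∈ ({r, w, y, z, w'} : Finset V), v ∈ S := fun v hv => hQS hv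
  have hrS := hs r (by simp)
  have hyS := hs y (by simp)
  have hzS := hs z (by simp)
  have hrW : r ∉ sW G S a b := fun hr =>
    hwU' (hU.2 r (hU.2 w hwU r hr h1) w' hwW' h2.symm)
  have hyU : y ∈ sW G S a b → y ∈ U := fun hy => hU.2 w hwU y hy h3
  have hzU : z ∈ sW G S a b → z ∉ U := fun hz hzU => hwU' (hU.2 z hzU w' hwW' h5)
  have hry : r ≠ y := by rintro rfl; exact hG.tri _ _ _ h4 h5 h2
  have hrz : r ≠ z := by rintro rfl; exact hG.tri _ _ _ h1 h4.symm h3.symm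
  refine ⟨w, hwU, w', Finset.mem_sdiff.2 ⟨hwW', hwU'⟩, r, ?_⟩
  by_cases hy : y ∈ sW G S a b <;> by_cases hz : z ∈ sW G S a b
  · exact absurd (hU.2 y (hyU hy) z hz h4) (hzU hz)
  · obtain ⟨hrI, hzI⟩ := hG.sW_two_nbrs g hwW' hrS hrW hzS hz hrz h2 h5.symm
    exact ⟨hrI, h1, h2, Or.inl ⟨z, hzI, hrz.symm, hG.indep h2 h5.symm, Or.inr
      ⟨h5.symm, y, hyU hy, h3, h4⟩⟩⟩
  · obtain ⟨hrI, hyI⟩ := hG.sW_two_nbrs g (hU.1 hwU) hrS hrW hyS hy hry h1 h3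
    exact ⟨hrI, h1, h2, Or.inl ⟨y, hyI, hry.symm, hG.indep h1 h3, Or.inl
      ⟨h3, z, Finset.mem_sdiff.2 ⟨hz, hzU hz⟩, h5.symm, h4.symm⟩⟩⟩
  · obtain ⟨hrI, hyI⟩ := hG.sW_two_nbrs g (hU.1 hwU) hrS hrW hyS hy hry h1 h3
    obtain ⟨-, hzI⟩ := hG.sW_two_nbrs g hwW' hrS hrW hzS hz hrz h2 h5.symm
    exact ⟨hrI, h1, h2, Or.inr ⟨y, hyI, z, hzI, h3, h5.symm, h4, hG.indep h1 h3,
      hG.indep h2 h5.symm, hry, hrz⟩⟩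

/-- Every pentagon meeting `U` avoids the rest of the vertices outside the frame. -/
def PentClosed (G : SimpleGraph V) (S : Finset V) (a b : V) (U : Finset V) : Prop :=
  ∀ Q ⊆ S, IsPent G Q → (∃ w ∈ Q, w ∈ U) → ∀ w ∈ Q, w ∈ sW G S a b → w ∈ U

/-- Pentagons meeting `U` stay inside any `S'` that contains `a`, `b`, `U`, the neighbours of `U`
among the inner vertices, and with each inner vertex its neighbouring inner vertices. -/
theorem PT.meet_eq (hG : PT G) (g : Good G S a b) (hUW : U ⊆ sW G S a b)
    (hpc : PentClosed G S a b U) (hS : S' ⊆ S) (ha : a ∈ S') (hb : b ∈ S') (hUS : U ⊆ S')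
    (hJ : ∀ u ∈ U, ∀ r ∈ sI G S a b, G.Adj u r → r ∈ S')
    (hcl : ∀ y ∈ S', y ∈ sT G S a b → ∀ z ∈ sT G S a b, G.Adj y z → z ∈ S') :
    meet G S U = meet G S' U := by
  ext Q
  rw [mem_meet, mem_meet]
  refine ⟨?_, fun ⟨h1, h2⟩ => ⟨h1.trans hS, h2⟩⟩
  rintro ⟨hQS, hQ, hQU⟩
  refine ⟨?_, hQ, hQU⟩
  have hQU' := hpc Q hQS hQ hQU
  obtain ⟨w, hwQ, hwU⟩ := hQU
  have hwab := mem_sW.1 (hUW hwU)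
  -- an edge of `Q` that avoids the hubs does not leave `S'`
  have step : ∀ u ∈ Q, ∀ v ∈ Q, u ≠ a → u ≠ b → v ≠ a → v ≠ b → G.Adj u v → u ∈ S' → v ∈ S' := by
    intro u hu v hv hua hub hva hvb huv huS
    rcases mem_cases (G := G) (a := a) (b := b) (hQS hv) with h | h | h | h
    · exact absurd h hva
    · exact absurd h hvb
    · rcases mem_cases (G := G) (a := a) (b := b) (hQS hu) with h' | h' | h' | h'
      · exact absurd h' hua
      · exact absurd h' hub
      · rcases hG.adj_sI h' h huv with h3 | h3
        · exact hcl u huS (sA_sub_sT _ _ _ h3.1) v (sB_sub_sT _ _ _ h3.2) huv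
        · exact hcl u huS (sB_sub_sT _ _ _ h3.1) v (sA_sub_sT _ _ _ h3.2) huv
      · exact hJ u (hQU' u hu h') v h huv
    · exact hUS (hQU' v hv h)
  -- the rest of `Q` after deleting one vertex is a path, so it lies in `S'` if it avoids the hubs
  -- and meets `S'`
  have hub : ∀ h ∈ Q, (∀ v ∈ Q, v ≠ h → v ≠ a ∧ v ≠ b) → (∃ w ∈ Q, w ≠ h ∧ w ∈ S') →
      ∀ v ∈ Q, v ≠ h → v ∈ S' := by
    intro h hh hne hex
    obtain ⟨p, y, z, q, rfl, h1, h2, h3, h4, h5⟩ := hQ.rotate hh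
    have np := h1.ne'
    have nq := h5.ne
    have ny : y ≠ h := by rintro rfl; exact hG.tri _ _ _ h3 h4 h5
    have nz : z ≠ h := by rintro rfl; exact hG.tri _ _ _ h1 h2 h3
    have st : ∀ u ∈ ({h, p, y, z, q} : Finset V), ∀ v ∈ ({h, p, y, z, q} : Finset V), u ≠ h →
        v ≠ h → G.Adj u v → (u ∈ S' ↔ v ∈ S') := fun u hu v hv hu' hv' huv =>
      ⟨step u hu v hv (hne u hu hu').1 (hne u hu hu').2 (hne v hv hv').1 (hne v hv hv').2 huv,
        step v hv u hu (hne v hv hv').1 (hne v hv hv').2 (hne u hu hu').1 (hne u hu hu').2 huv.symm⟩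
    have e1 := st p (by simp) y (by simp) np ny h2
    have e2 := st y (by simp) z (by simp) ny nz h3
    have e3 := st z (by simp) q (by simp) nz nq h4
    simp only [Finset.mem_insert, Finset.mem_singleton] at hex ⊢
    obtain ⟨w, hw, hwh, hwS⟩ := hex
    have hp : p ∈ S' := by
      rcases hw with rfl | rfl | rfl | rfl | rfl
      · exact absurd rfl hwh
      · exact hwS
      · exact e1.2 hwS
      · exact e1.2 (e2.2 hwS)
      · exact e1.2 (e2.2 (e3.2 hwS))
    have hy := e1.1 hp
    have hz := e2.1 hy
    have hq := e3.1 hz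
    rintro v (rfl | rfl | rfl | rfl | rfl) hv
    · exact absurd rfl hv
    · exact hp
    · exact hy
    · exact hz
    · exact hq
  have hnot : ¬ (a ∈ Q ∧ b ∈ Q) := fun h => (hG.pent_of_mem g hQS hQ).1 h ⟨w, hwQ, hUW hwU⟩
  intro v hv
  by_cases haQ : a ∈ Q
  · by_cases hva : v = a
    · exact hva ▸ ha
    · exact hub a haQ (fun v hv hva => ⟨hva, fun h => hnot ⟨haQ, h ▸ hv⟩⟩)
        ⟨w, hwQ, hwab.2.1, hUS hwU⟩ v hv hva
  · by_cases hbQ : b ∈ Q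
    · by_cases hvb : v = b
      · exact hvb ▸ hb
      · exact hub b hbQ (fun v hv hvb => ⟨fun h => hnot ⟨h ▸ hv, hbQ⟩, hvb⟩)
          ⟨w, hwQ, hwab.2.2.1, hUS hwU⟩ v hv hvb
    · by_cases hvw : v = w
      · exact hvw ▸ hUS hwU
      · have hne : ∀ v ∈ Q, v ≠ a ∧ v ≠ b := fun v hv =>
          ⟨fun h => haQ (h ▸ hv), fun h => hbQ (h ▸ hv)⟩
        obtain ⟨p, y, z, q, hQe, h1, -⟩ := hQ.rotate hwQ
        have hp : p ∈ Q := by rw [hQe]; simp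
        exact hub w hwQ (fun v hv _ => hne v hv) ⟨p, hp, h1.ne', step w hwQ p hp
          (hne w hwQ).1 (hne w hwQ).2 (hne p hp).1 (hne p hp).2 h1 (hUS hwU)⟩ v hv hvw

/-- The numbers of paths of length three from `a` to `b` and from `a` to a neighbour `z` of `b`
are compatible with each other. -/
theorem PT.compat (hG : PT G) {x y z : V} (ha : a ∈ S) (hb : b ∈ S) (hx : x ∈ S) (hy : y ∈ S)
    (hz : z ∈ S) (hxa : G.Adj x a) (hbx : G.Adj b x) (hay : G.Adj a y) (hyz : G.Adj y z)
    (hzb : G.Adj z b) : pp G S a b + pp G S a z + 3 ≤ S.card := by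
  obtain ⟨hab, hnab⟩ := 
    hG.ne hxa.symm hbx.symm hzb.symm hyz.symm hay.symm
  obtain ⟨haz, hnaz⟩ := hG.ne hay hyz hzb hbx hxa
  set X := nb G S a with hX
  set N := (nb G S b ∪ nb G S z) \ X with hN
  set Y := N \ {b, z} with hY
  have hXX : ∀ u ∈ X, ∀ v ∈ X, ¬ G.Adj u v := fun u hu v hv =>
    hG.indep (mem_nb.1 hu).2 (mem_nb.1 hv).2
  have hbz : b ≠ z := hzb.ne'
  have hsum : pp G S a b + pp G S a z = ee G X N := by
    have hd : Disjoint (nb G S b) (nb G S z) := by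
      rw [Finset.disjoint_left]
      intro v hv hv'
      rw [mem_nb] at hv hv'
      exact hG.tri b v z hv.2 hv'.2.symm hzb
    rw [pp, pp, ← ee_union_right _ hd]
    unfold ee
    congr 1
    ext ⟨u, v⟩
    simp only [Finset.mem_filter, Finset.mem_product, hN, Finset.mem_sdiff]
    constructor
    · rintro ⟨⟨hu, hv⟩, huv⟩
      exact ⟨⟨hu, hv, fun hvX => hXX u hu v hvX huv⟩, huv⟩
    · rintro ⟨⟨hu, hv, -⟩, huv⟩
      exact ⟨⟨hu, hv⟩, huv⟩
  have hNY : N ⊆ {b, z} ∪ Y := by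
    intro v hv
    rw [hY, Finset.union_sdiff_self_eq_union]
    exact Finset.mem_union_right _ hv
  have hdY : Disjoint {b, z} Y := Finset.disjoint_sdiff
  have hnX : ∀ v, v ∈ X → v ≠ a ∧ v ≠ b ∧ v ≠ z := by
    intro v hv
    rw [hX, mem_nb] at hv
    exact ⟨hv.2.ne', fun h => hnab (h ▸ hv.2), fun h => hnaz (h ▸ hv.2)⟩
  have haN : a ∉ N := by
    rw [hN, Finset.mem_sdiff, Finset.mem_union, mem_nb, mem_nb]
    rintro ⟨h | h, -⟩
    · exact hnab h.2.symm
    · exact hnaz h.2.symm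
  have haZ : a ∉ ({b, z} ∪ Y : Finset V) := by
    simp only [Finset.mem_union, Finset.mem_insert, Finset.mem_singleton, hY, Finset.mem_sdiff]
    tauto
  have hdX : Disjoint X (insert a ({b, z} ∪ Y)) := by
    rw [Finset.disjoint_left]
    intro v hv
    have := hnX v hv
    simp only [Finset.mem_union, Finset.mem_insert, Finset.mem_singleton, hY, Finset.mem_sdiff, hN]
    tauto
  have hcard : (X ∪ insert a ({b, z} ∪ Y)).card = X.card + (3 + Y.card) := by
    rw [Finset.card_union_of_disjoint hdX, Finset.card_insert_of_notMem haZ,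
      Finset.card_union_of_disjoint hdY, Finset.card_pair hbz]
    ring
  have hsub : X ∪ insert a ({b, z} ∪ Y) ⊆ S := by
    have hNS : N ⊆ S := Finset.sdiff_subset.trans
      (Finset.union_subset (Finset.filter_subset _ _) (Finset.filter_subset _ _))
    refine Finset.union_subset (Finset.filter_subset _ _) ?_
    refine Finset.insert_subset ha (Finset.union_subset ?_ (Finset.sdiff_subset.trans hNS))
    exact Finset.insert_subset hb (Finset.singleton_subset_iff.2 hz)
  have hyX : y ∈ X := mem_nb.2 ⟨hy, hay⟩
  have hxX : x ∈ X := mem_nb.2 ⟨hx, hxa.symm⟩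
  -- the edge bound for the set spanned by `a`, `b`, `z` and their neighbours, which contains the
  -- pentagon `x a y z b` and so is not bipartite
  obtain ⟨-, h1⟩ := hG.cut.deg2_le hG.tri (S := X ∪ insert a ({b, z} ∪ Y)) (by omega)
  have h2 := h1.resolve_left (by
    rintro ⟨s, hs⟩
    exact no_two_coloring (s := s) (hs x (by simp [hxX]) a (by simp) hxa)
      (hs a (by simp) y (by simp [hyX]) hay) (hs y (by simp [hyX]) z (by simp) hyz)
      (hs z (by simp) b (by simp) hzb) (hs b (by simp) x (by simp [hxX]) hbx))
  rw [hcard, deg2_union hdX, deg2_insert haZ, deg2_union hdY] at h2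
  have h3 : ee G X (insert a ({b, z} ∪ Y)) = ee G X {a} + ee G X ({b, z} ∪ Y) := by
    rw [Finset.insert_eq, ee_union_right _ (Finset.disjoint_singleton_left.2 haZ)]
  have h4 : X.card ≤ ee G X {a} := by
    rw [ee_symm]
    exact card_le_ee fun v hv => ⟨a, by simp, (mem_nb.1 hv).2⟩
  have h5 : ee G X N ≤ ee G X ({b, z} ∪ Y) := ee_mono (Finset.Subset.refl _) hNY
  have h6 : Y.card ≤ ee G {b, z} Y := by
    refine card_le_ee fun v hv => ?_
    rw [hY, Finset.mem_sdiff, hN, Finset.mem_sdiff, Finset.mem_union, mem_nb, mem_nb] at hv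
    rcases hv.1.1 with h | h
    · exact ⟨b, by simp, h.2⟩
    · exact ⟨z, by simp, h.2⟩
  have h7 : 2 ≤ deg2 G {b, z} := by
    rw [deg2_insert (by simpa using hbz)]
    have : 0 < (nb G {z} b).card := Finset.card_pos.2 ⟨z, mem_nb.2 ⟨by simp, hzb.symm⟩⟩
    omega
  have h8 := Finset.card_le_card hsub
  omega

end

section
variable {V : Type} [Fintype V] {G : SimpleGraph V} {S : Finset V} {a b : V}

/-! ### Attachments of connected sets to the frame -/

/-- `K₃,₃` is not a minor, with the disjointness of the branch sets spelled out pointwise. -/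
theorem PT.noK33 (hG : PT G) {X₁ X₂ X₃ Y₁ Y₂ Y₃ : Finset V}
    (hd : ∀ v, (v ∈ X₁ → v ∉ X₂ ∧ v ∉ X₃ ∧ v ∉ Y₁ ∧ v ∉ Y₂ ∧ v ∉ Y₃) ∧
      (v ∈ X₂ → v ∉ X₃ ∧ v ∉ Y₁ ∧ v ∉ Y₂ ∧ v ∉ Y₃) ∧ (v ∈ X₃ → v ∉ Y₁ ∧ v ∉ Y₂ ∧ v ∉ Y₃) ∧
      (v ∈ Y₁ → v ∉ Y₂ ∧ v ∉ Y₃) ∧ (v ∈ Y₂ → v ∉ Y₃))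
    (l₁ : Linked G X₁) (l₂ : Linked G X₂) (l₃ : Linked G X₃) (m₁ : Linked G Y₁) (m₂ : Linked G Y₂)
    (m₃ : Linked G Y₃) (t₁₁ : Touch G X₁ Y₁) (t₁₂ : Touch G X₁ Y₂) (t₁₃ : Touch G X₁ Y₃)
    (t₂₁ : Touch G X₂ Y₁) (t₂₂ : Touch G X₂ Y₂) (t₂₃ : Touch G X₂ Y₃)
    (t₃₁ : Touch G X₃ Y₁) (t₃₂ : Touch G X₃ Y₂) (t₃₃ : Touch G X₃ Y₃) : False := by
  refine hG.cut.noK33 (X₁ := X₁) (X₂ := X₂) (X₃ := X₃) (Y₁ := Y₁) (Y₂ := Y₂) (Y₃ := Y₃) ?_ ?_ ?_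
  · simp only [List.pairwise_cons, List.mem_cons, List.not_mem_nil, or_false, forall_eq_or_imp,
      forall_eq, Finset.disjoint_left, List.Pairwise.nil, and_true, IsEmpty.forall_iff,
      implies_true]
    refine ⟨⟨fun v h => ((hd v).1 h).1, fun v h => ((hd v).1 h).2.1, fun v h => ((hd v).1 h).2.2.1,
      fun v h => ((hd v).1 h).2.2.2.1, fun v h => ((hd v).1 h).2.2.2.2⟩,
      ⟨fun v h => ((hd v).2.1 h).1, fun v h => ((hd v).2.1 h).2.1,
      fun v h => ((hd v).2.1 h).2.2.1, fun v h => ((hd v).2.1 h).2.2.2⟩,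
      ⟨fun v h => ((hd v).2.2.1 h).1, fun v h => ((hd v).2.2.1 h).2.1,
      fun v h => ((hd v).2.2.1 h).2.2⟩,
      ⟨fun v h => ((hd v).2.2.2.1 h).1, fun v h => ((hd v).2.2.2.1 h).2⟩,
      fun v h => (hd v).2.2.2.2 h⟩
  · simp only [List.mem_cons, List.not_mem_nil, or_false, forall_eq_or_imp, forall_eq]
    exact ⟨l₁, l₂, l₃, m₁, m₂, m₃⟩
  · simp only [List.mem_cons, List.not_mem_nil, or_false, forall_eq_or_imp, forall_eq]
    exact ⟨⟨t₁₁, t₁₂, t₁₃⟩, ⟨t₂₁, t₂₂, t₂₃⟩, t₃₁, t₃₂, t₃₃⟩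

/-- A connected set outside the frame and adjacent to vertices on both sides of a tree of the frame
closes a cycle that together with the rest of the frame makes a `K₃,₃`. -/
theorem PT.attach_two_sides (hG : PT G) (g : Good G S a b) {D K : Finset V} (hD : D ⊆ sT G S a b)
    (hDl : Linked G D) (hKl : Linked G K) {x t t' : V} (hx : x ∈ cn G S a b)
    (hK : ∀ v ∈ K, v ∉ D ∧ v ≠ a ∧ v ≠ b ∧ v ≠ x) (ht : t ∈ sA G S a b) (ht' : t' ∈ sA G S b a)
    (htD : t ∈ D) (htD' : t' ∈ D) (hnadj : ¬ G.Adj t t') (hKt : ∃ k ∈ K, G.Adj k t)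
    (hKt' : ∃ k ∈ K, G.Adj k t') : False := by
  have htt : t ≠ t' := fun h => hG.not_sA_sB ht (h ▸ ht')
  obtain ⟨t₁, ht₁, htt₁⟩ := hDl.exists_adj_comp htD' htD htt.symm
  have hD₁ := comp_subset (G := G) (D.erase t) t'
  have ht₁D := Finset.mem_erase.1 (hD₁ ht₁)
  have ht'D₁ : t' ∈ comp G (D.erase t) t' := mem_comp_self (Finset.mem_erase.2 ⟨htt.symm, htD'⟩)
  have hside : ∀ {u v}, u ∈ D → v ∈ D → G.Adj u v →
      (u ∈ sA G S a b ∧ v ∈ sA G S b a) ∨ (u ∈ sA G S b a ∧ v ∈ sA G S a b) := fun hu hv huv =>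
    hG.adj_sI (sT_sub_sI _ _ _ (hD hu)) (sT_sub_sI _ _ _ (hD hv)) huv
  have ht₁B : t₁ ∈ sA G S b a := by
    rcases hside htD ht₁D.2 htt₁ with h | h
    · exact h.2
    · exact absurd h.1 (hG.not_sA_sB ht)
  have hne : t₁ ≠ t' := fun h => hnadj (h ▸ htt₁)
  obtain ⟨M, hM, hM1, hM2, hMl, ⟨m₁, hm₁, h₁⟩, m₂, hm₂, h₂⟩ := (linked_comp (D.erase t) t').exists_mid
    ht₁ ht'D₁ hne (hG.indep (mem_sA.1 ht₁B).2.1 (mem_sA.1 ht').2.1)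
  have hMD : ∀ v ∈ M, v ∈ D ∧ v ≠ t ∧ v ≠ t₁ ∧ v ≠ t' := fun v hv =>
    ⟨Finset.mem_of_mem_erase (hD₁ (hM hv)), Finset.ne_of_mem_erase (hD₁ (hM hv)),
      fun h => hM1 (h ▸ hv), fun h => hM2 (h ▸ hv)⟩
  have hm₂A : m₂ ∈ sA G S a b := by
    rcases hside htD' (hMD m₂ hm₂).1 h₂ with h | h
    · exact absurd ht' (hG.not_sA_sB h.1)
    · exact h.2
  have hxI := hG.sI_ne g (cn_sub_sI _ _ _ hx)
  have hDn : ∀ v ∈ D, v ≠ a ∧ v ≠ b ∧ v ≠ x := fun v hv =>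
    ⟨(hG.sI_ne g (sT_sub_sI _ _ _ (hD hv))).1, (hG.sI_ne g (sT_sub_sI _ _ _ (hD hv))).2,
      fun h => hG.not_cn_sT (hD hv) (h ▸ hx)⟩
  rw [mem_cn] at hx
  obtain ⟨k, hk, hkt⟩ := hKt
  obtain ⟨k', hk', hkt'⟩ := hKt'
  have hab := hG.good_ne g
  -- `t` with `K`, an inner path `M` from `t₁` to `t'`, and the edge `b x` are joined to `t₁`, `t'`
  -- and `a`
  refine hG.noK33 (X₁ := insert t K) (X₂ := M) (X₃ := {b, x}) (Y₁ := {t₁}) (Y₂ := {t'}) (Y₃ := {a})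
    ?_ (hKl.insert hk hkt.symm) hMl (linked_pair hx.2.2) (linked_singleton _) (linked_singleton _)
    (linked_singleton _) ⟨t, by simp, t₁, by simp, htt₁⟩ ⟨k', by simp [hk'], t', by simp, hkt'⟩
    ⟨t, by simp, a, by simp, (mem_sA.1 ht).2.1.symm⟩ ⟨m₁, hm₁, t₁, by simp, h₁.symm⟩
    ⟨m₂, hm₂, t', by simp, h₂.symm⟩ ⟨m₂, hm₂, a, by simp, (mem_sA.1 hm₂A).2.1.symm⟩
    ⟨b, by simp, t₁, by simp, (mem_sA.1 ht₁B).2.1⟩ ⟨b, by simp, t', by simp, (mem_sA.1 ht').2.1⟩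
    ⟨x, by simp, a, by simp, hx.2.1.symm⟩
  intro v
  have q1 := hMD v
  have q2 := hK v
  have q3 := hDn v
  have q4 := ht₁D.1
  clear hside hDn hMD hK
  simp only [Finset.mem_insert, Finset.mem_singleton]
  refine ⟨fun h => ?_, fun h => ?_, fun h => ?_, fun h => ?_, fun h => ?_⟩ <;> grind

/-- A connected set adjacent to two nonadjacent vertices of a tree of the frame finds them on the
same side, and with a common neighbour. -/
theorem PT.attach_same_side (hG : PT G) (g : Good G S a b) {D K : Finset V} (hD : D ⊆ sT G S a b)
    (hDl : Linked G D) (hKl : Linked G K) {x t t' : V} (hx : x ∈ cn G S a b)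
    (hK : ∀ v ∈ K, v ∉ D ∧ v ≠ a ∧ v ≠ b ∧ v ≠ x) (htD : t ∈ D) (htD' : t' ∈ D) (hne : t ≠ t')
    (hnadj : ¬ G.Adj t t') (hKt : ∃ k ∈ K, G.Adj k t) (hKt' : ∃ k ∈ K, G.Adj k t') :
    ∃ z ∈ D, G.Adj z t ∧ G.Adj z t' ∧
      ((t ∈ sA G S a b ∧ t' ∈ sA G S a b ∧ z ∈ sA G S b a) ∨
        (t ∈ sA G S b a ∧ t' ∈ sA G S b a ∧ z ∈ sA G S a b)) := by
  have key : ∀ a b, Good G S a b → D ⊆ sT G S a b → x ∈ cn G S a b →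
      (∀ v ∈ K, v ∉ D ∧ v ≠ a ∧ v ≠ b ∧ v ≠ x) → t ∈ sA G S a b → t' ∈ sA G S a b →
      ∃ z ∈ D, G.Adj z t ∧ G.Adj z t' ∧ z ∈ sA G S b a := by
    intro a b g hD hx hK ht ht'
    obtain ⟨z, hz, htz⟩ := hDl.exists_adj_comp htD htD' hne
    have hD₁ := comp_subset (G := G) (D.erase t') t
    have hzD := Finset.mem_erase.1 (hD₁ hz)
    have hzB : z ∈ sA G S b a := by
      rcases hG.adj_sI (sT_sub_sI _ _ _ (hD htD')) (sT_sub_sI _ _ _ (hD hzD.2)) htz with h | h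
      · exact h.2
      · exact absurd h.1 (hG.not_sA_sB ht')
    by_cases hzt : G.Adj t z
    · exact ⟨z, hzD.2, hzt.symm, htz.symm, hzB⟩
    -- otherwise `t'` may be added to `K`, which is then attached to `t` and `z` on opposite sides
    · exfalso
      obtain ⟨k, hk, hkt⟩ := hKt
      obtain ⟨k', hk', hkt'⟩ := hKt'
      have htn := hG.sI_ne g (sT_sub_sI _ _ _ (hD htD'))
      refine hG.attach_two_sides g (D := comp G (D.erase t') t) (K := insert t' K)
        (fun v hv => hD (Finset.mem_of_mem_erase (hD₁ hv))) (linked_comp _ _)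
        (hKl.insert hk' hkt'.symm) hx ?_ ht hzB (mem_comp_self (Finset.mem_erase.2 ⟨hne, htD⟩)) hz
        hzt ⟨k, by simp [hk], hkt⟩ ⟨t', by simp, htz⟩
      intro v hv
      rcases Finset.mem_insert.1 hv with rfl | hv
      · exact ⟨fun h => Finset.notMem_erase _ _ (hD₁ h), htn.1, htn.2,
          fun h => hG.not_cn_sT (hD htD') (h ▸ hx)⟩
      · exact ⟨fun h => (hK v hv).1 (Finset.mem_of_mem_erase (hD₁ h)), (hK v hv).2⟩
  rcases mem_sT.1 (hD htD) with h | h <;> rcases mem_sT.1 (hD htD') with h' | h'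
  · obtain ⟨z, hz⟩ := key a b g hD hx hK h h'
    exact ⟨z, hz.1, hz.2.1, hz.2.2.1, Or.inl ⟨h, h', hz.2.2.2⟩⟩
  · exact (hG.attach_two_sides g hD hDl hKl hx hK h h' htD htD' hnadj hKt hKt').elim
  · exact (hG.attach_two_sides g hD hDl hKl hx hK h' h htD' htD (fun h => hnadj h.symm) hKt'
      hKt).elim
  · obtain ⟨z, hz⟩ := key b a g.symm (sT_symm (G := G) S a b ▸ hD) (cn_symm (G := G) S a b ▸ hx)
      (fun v hv => ⟨(hK v hv).1, (hK v hv).2.2.1, (hK v hv).2.1, (hK v hv).2.2.2⟩) h h'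
    exact ⟨z, hz.1, hz.2.1, hz.2.2.1, Or.inr ⟨h, h', hz.2.2.2⟩⟩

/-! ### Blow-ups of the pentagon inside a graph -/

/-- `S` spans a blow-up of the pentagon: the frame of some pair is all of `S`, and has a tree as its
tree part. This is what equality in `PT.cn_add_pp_le` amounts to. -/
def Blow (G : SimpleGraph V) (S : Finset V) (u v : V) : Prop :=
  Good G S u v ∧ (cn G S u v).card + pp G S u v + 3 = S.card

variable {u v : V}

omit [Fintype V] in
theorem Blow.symm (h : Blow G S u v) : Blow G S v u := by
  refine ⟨h.1.symm, ?_⟩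
  rw [cn_symm, pp_symm]
  exact h.2

theorem PT.blow_of_le (hG : PT G) (g : Good G S u v)
    (h : S.card ≤ (cn G S u v).card + pp G S u v + 3) : Blow G S u v :=
  ⟨g, le_antisymm (hG.cn_add_pp_le g) h⟩

theorem PT.blow_sW (hG : PT G) (h : Blow G S u v) : sW G S u v = ∅ := by
  have h1 := hG.card_eq h.1
  have h2 := hG.pp_lt h.1
  have h3 := h.2
  exact Finset.card_eq_zero.1 (by omega)

theorem PT.blow_linked (hG : PT G) (h : Blow G S u v) : Linked G (sT G S u v) := by
  rw [hG.linked_sT_iff h.1]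
  have h1 := hG.card_eq h.1
  have h2 := hG.pp_lt h.1
  have h3 := h.2
  omega

theorem PT.blow_mem (hG : PT G) (h : Blow G S u v) {w : V} (hw : w ∈ S) :
    w = u ∨ w = v ∨ w ∈ cn G S u v ∨ w ∈ sA G S u v ∨ w ∈ sA G S v u := by
  rcases mem_cases (G := G) (a := u) (b := v) hw with h' | h' | h' | h'
  · tauto
  · tauto
  · rw [mem_sI, mem_sT] at h'; tauto
  · rw [hG.blow_sW h] at h'; simp at h'

theorem PT.blow_adj_cn (hG : PT G) (h : Blow G S u v) {x w : V} (hx : x ∈ cn G S u v) (hw : w ∈ S)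
    (hxw : G.Adj x w) : w = u ∨ w = v := by
  have hx' := mem_cn.1 hx
  rcases hG.blow_mem h hw with h' | h' | h' | h' | h'
  · tauto
  · tauto
  · exact absurd hxw (hG.indep hx'.2.1 (mem_cn.1 h').2.1)
  · exact absurd hxw (hG.indep hx'.2.1 (mem_sA.1 h').2.1)
  · exact absurd hxw (hG.indep hx'.2.2 (mem_sA.1 h').2.1)

theorem PT.blow_adj_sB (hG : PT G) (h : Blow G S u v) {z w : V} (hz : z ∈ sA G S v u) (hw : w ∈ S)
    (hzw : G.Adj z w) : w = v ∨ w ∈ sA G S u v := by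
  have hz' := mem_sA.1 hz
  rcases hG.blow_mem h hw with rfl | h' | h' | h' | h'
  · exact absurd hzw.symm (hG.sA_nadj hz)
  · tauto
  · exact absurd hzw (hG.indep hz'.2.1 (mem_cn.1 h').2.2)
  · tauto
  · exact absurd hzw (hG.indep hz'.2.1 (mem_sA.1 h').2.1)

/-- The pairs of a blow-up that are joined by a path of length three without being adjacent. -/
theorem PT.blow_cases (hG : PT G) (h : Blow G S u v) {p q : V} (hp : p ∈ S) (hq : q ∈ S)
    (hpq : ¬ G.Adj p q) (hpp : 0 < pp G S p q) : ∃ u' v', Blow G S u' v' ∧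
      ((u' = u ∧ v' = v) ∨ (u' = v ∧ v' = u)) ∧
      ((p = u' ∧ q = v') ∨ (p = u' ∧ q ∈ sA G S v' u') ∨ (q = u' ∧ p ∈ sA G S v' u') ∨
        (p ∈ cn G S u' v' ∧ q ∈ sA G S v' u') ∨ (q ∈ cn G S u' v' ∧ p ∈ sA G S v' u') ∨
        (p ∈ sA G S u' v' ∧ q ∈ sA G S v' u')) := by
  have e1 : (u = u ∧ v = v) ∨ (u = v ∧ v = u) := Or.inl ⟨rfl, rfl⟩
  have e2 : (v = u ∧ u = v) ∨ (v = v ∧ u = u) := Or.inr ⟨rfl, rfl⟩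
  obtain ⟨y, hy, z, hz, hpy, hyz, hzq⟩ := exists_of_pp_pos hpp
  have hne : p ≠ q := by
    rintro rfl
    rw [hG.pp_self] at hpp
    exact lt_irrefl _ hpp
  have hnuv := hG.good_nadj h.1
  have hAA : ∀ u v, Blow G S u v → p ∈ sA G S u v → q ∈ sA G S u v → False := by
    intro u v h hp' hq'
    rcases hG.blow_adj_sB h.symm hp' hy hpy with rfl | h1
    · exact hG.tri _ _ _ hyz hzq (mem_sA.1 hq').2.1.symm
    · rcases hG.blow_adj_sB h.symm hq' hz hzq.symm with rfl | h2
      · exact hG.tri _ _ _ hpy hyz (mem_sA.1 hp').2.1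
      · exact hG.indep (mem_sA.1 h1).2.1 (mem_sA.1 h2).2.1 hyz
  have hcn : cn G S u v = cn G S v u := cn_symm S u v
  rcases hG.blow_mem h hp with rfl | rfl | h1 | h1 | h1 <;>
    rcases hG.blow_mem h hq with rfl | rfl | h2 | h2 | h2
  · exact absurd rfl hne
  · exact ⟨_, _, h, e1, Or.inl ⟨rfl, rfl⟩⟩
  · exact absurd (mem_cn.1 h2).2.1 hpq
  · exact absurd (mem_sA.1 h2).2.1 hpq
  · exact ⟨_, _, h, e1, Or.inr (Or.inl ⟨rfl, h2⟩)⟩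
  · exact ⟨_, _, h.symm, e2, Or.inl ⟨rfl, rfl⟩⟩
  · exact absurd rfl hne
  · exact absurd (mem_cn.1 h2).2.2 hpq
  · exact ⟨_, _, h.symm, e2, Or.inr (Or.inl ⟨rfl, h2⟩)⟩
  · exact absurd (mem_sA.1 h2).2.1 hpq
  · exact absurd (mem_cn.1 h1).2.1.symm hpq
  · exact absurd (mem_cn.1 h1).2.2.symm hpq
  · exfalso
    rcases hG.blow_adj_cn h h1 hy hpy with rfl | rfl <;>
      rcases hG.blow_adj_cn h h2 hz hzq.symm with rfl | rfl
    · exact G.irrefl hyz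
    · exact hnuv hyz
    · exact hnuv hyz.symm
    · exact G.irrefl hyz
  · exact ⟨_, _, h.symm, e2, Or.inr (Or.inr (Or.inr (Or.inl ⟨hcn ▸ h1, h2⟩)))⟩
  · exact ⟨_, _, h, e1, Or.inr (Or.inr (Or.inr (Or.inl ⟨h1, h2⟩)))⟩
  · exact absurd (mem_sA.1 h1).2.1.symm hpq
  · exact ⟨_, _, h.symm, e2, Or.inr (Or.inr (Or.inl ⟨rfl, h1⟩))⟩
  · exact ⟨_, _, h.symm, e2, Or.inr (Or.inr (Or.inr (Or.inr (Or.inl ⟨hcn ▸ h2, h1⟩))))⟩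
  · exact (hAA u v h h1 h2).elim
  · exact ⟨_, _, h, e1, Or.inr (Or.inr (Or.inr (Or.inr (Or.inr ⟨h1, h2⟩))))⟩
  · exact ⟨_, _, h, e1, Or.inr (Or.inr (Or.inl ⟨rfl, h1⟩))⟩
  · exact absurd (mem_sA.1 h1).2.1.symm hpq
  · exact ⟨_, _, h, e1, Or.inr (Or.inr (Or.inr (Or.inr (Or.inl ⟨h2, h1⟩))))⟩
  · exact ⟨_, _, h.symm, e2, Or.inr (Or.inr (Or.inr (Or.inr (Or.inr ⟨h1, h2⟩))))⟩
  · exact (hAA v u h.symm h1 h2).elim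

/-- The good pairs of a blow-up, up to its symmetry: the two hubs; a hub and a tree vertex adjacent
to the other hub; a common neighbour of the hubs and a tree vertex. -/
theorem PT.good_blow_cases (hG : PT G) (h : Blow G S u v) (g : Good G S a b) :
    ∃ u' v', Blow G S u' v' ∧ ((u' = u ∧ v' = v) ∨ (u' = v ∧ v' = u)) ∧
      ((a = u' ∧ b = v') ∨ (a = u' ∧ b ∈ sA G S v' u') ∨ (b = u' ∧ a ∈ sA G S v' u') ∨
        (a ∈ cn G S u' v' ∧ b ∈ sA G S v' u') ∨ (b ∈ cn G S u' v' ∧ a ∈ sA G S v' u')) := by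
  obtain ⟨u', v', h', he, hc⟩ := hG.blow_cases h g.ha g.hb (hG.good_nadj g) g.p
  refine ⟨u', v', h', he, ?_⟩
  rcases hc with hc | hc | hc | hc | hc | hc
  · tauto
  · tauto
  · tauto
  · tauto
  · tauto
  · exfalso
    obtain ⟨x, hx⟩ := g.c
    rw [mem_cn] at hx
    rcases hG.blow_adj_sB h'.symm hc.1 hx.1 hx.2.1 with rfl | h1
    · exact hG.sA_nadj hc.2 hx.2.2.symm
    · exact hG.indep (mem_sA.1 h1).2.1 (mem_sA.1 hc.2).2.1 hx.2.2.symm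

theorem PT.blow_sT_left (hG : PT G) (h : Blow G S u v) {z : V} (hz : z ∈ sA G S v u) :
    sT G S u z = insert v (cn G S u v) := by
  have hz' := mem_sA.1 hz
  ext w
  rw [mem_sT, mem_sA, mem_sA, Finset.mem_insert]
  constructor
  · rintro (⟨hw, huw, z', hz'S, hwz, hzz⟩ | ⟨hw, hzw, y, hy, hwy, hyu⟩)
    · rcases hG.blow_adj_sB h hz hz'S hzz.symm with rfl | h1
      · exact Or.inr (mem_cn.2 ⟨hw, huw, hwz.symm⟩)
      · exact absurd hwz (hG.indep huw (mem_sA.1 h1).2.1)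
    · rcases hG.blow_adj_sB h hz hw hzw with rfl | h1
      · exact Or.inl rfl
      · exact absurd hwy (hG.indep (mem_sA.1 h1).2.1 hyu.symm)
  · rintro (rfl | hw)
    · obtain ⟨x, hx⟩ := h.1.c
      have hx' := mem_cn.1 hx
      exact Or.inr ⟨h.1.hb, hz'.2.1.symm, x, hx'.1, hx'.2.2, hx'.2.1.symm⟩
    · have hw' := mem_cn.1 hw
      exact Or.inl ⟨hw'.1, hw'.2.1, v, h.1.hb, hw'.2.2.symm, hz'.2.1⟩

theorem PT.blow_sT_cn (hG : PT G) (h : Blow G S u v) {x z : V} (hx : x ∈ cn G S u v)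
    (hz : z ∈ sA G S v u) : sT G S x z = insert u (nb G (sA G S u v) z) := by
  have hz' := mem_sA.1 hz
  have hx' := mem_cn.1 hx
  ext w
  rw [mem_sT, mem_sA, mem_sA, Finset.mem_insert, mem_nb]
  constructor
  · rintro (⟨hw, hxw, z', hz'S, hwz, hzz⟩ | ⟨hw, hzw, y, hy, hwy, hyx⟩)
    · rcases hG.blow_adj_cn h hx hw hxw with rfl | rfl
      · exact Or.inl rfl
      · exact (hG.tri _ _ _ hwz hzz hz'.2.1.symm).elim
    · rcases hG.blow_adj_sB h hz hw hzw with rfl | h1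
      · exact (hG.tri _ _ _ hwy hyx hx'.2.2.symm).elim
      · exact Or.inr ⟨h1, hzw⟩
  · rintro (rfl | ⟨hw, hzw⟩)
    · obtain ⟨y, hy, hzy⟩ := exists_sB hz
      exact Or.inl ⟨h.1.ha, hx'.2.1.symm, y, sA_sub _ _ _ hy, (mem_sA.1 hy).2.1, hzy.symm⟩
    · exact Or.inr ⟨sA_sub _ _ _ hw, hzw, u, h.1.ha, (mem_sA.1 hw).2.1.symm, hx'.2.1⟩

/-- In a blow-up the tree part of every frame is connected. -/
theorem PT.blow_linked_sT (hG : PT G) (h : Blow G S u v) (g : Good G S a b) :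
    Linked G (sT G S a b) := by
  obtain ⟨u', v', h', -, hc⟩ := hG.good_blow_cases h g
  have hstar1 : Linked G (insert v' (cn G S u' v')) :=
    linked_star fun y hy => (mem_cn.1 hy).2.2
  have hstar2 : ∀ z, Linked G (insert u' (nb G (sA G S u' v') z)) := fun z =>
    linked_star fun y hy => (mem_sA.1 (mem_nb.1 hy).1).2.1
  rcases hc with ⟨rfl, rfl⟩ | ⟨rfl, h1⟩ | ⟨rfl, h1⟩ | ⟨h1, h2⟩ | ⟨h1, h2⟩
  · exact hG.blow_linked h'
  · rw [hG.blow_sT_left h' h1]; exact hstar1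
  · rw [sT_symm, hG.blow_sT_left h' h1]; exact hstar1
  · rw [hG.blow_sT_cn h' h1 h2]; exact hstar2 _
  · rw [sT_symm, hG.blow_sT_cn h' h1 h2]; exact hstar2 _

/-- A tree has a leaf outside each closed neighbourhood that is not everything. -/
theorem PT.exists_leaf_away (hG : PT G) (g : Good G S a b) (hl : Linked G (sT G S a b)) {z : V}
    (hz : z ∈ sT G S a b) (hne : ∃ w ∈ sT G S a b, w ≠ z ∧ ¬ G.Adj z w) :
    ∃ w ∈ sT G S a b, w ≠ z ∧ ¬ G.Adj z w ∧ (nb G (sT G S a b) w).card ≤ 1 := by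
  by_contra hcon
  push Not at hcon
  set T := sT G S a b with hT
  set N := nb G T z with hN
  set Z := T.filter fun w => w ≠ z ∧ ¬ G.Adj z w with hZ
  have hTe : T = insert z (N ∪ Z) := by
    ext w
    rw [Finset.mem_insert, Finset.mem_union, hN, mem_nb, hZ, Finset.mem_filter]
    constructor
    · intro hw; tauto
    · rintro (rfl | h | h)
      · exact hz
      · exact h.1
      · exact h.1
  have hzNZ : z ∉ N ∪ Z := by
    rw [Finset.mem_union, hN, mem_nb, hZ, Finset.mem_filter]
    rintro (h | h)
    · exact G.irrefl h.2
    · exact h.2.1 rfl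
  have hdNZ : Disjoint N Z := by
    rw [Finset.disjoint_left]
    intro w hw hw'
    exact (Finset.mem_filter.1 hw').2.2 (mem_nb.1 hw).2
  have h1 := (hG.linked_sT_iff g).1 hl
  have h2 := hG.deg2_sT S a b
  rw [← hT] at h1 h2
  have hcard : T.card = N.card + Z.card + 1 := by
    rw [hTe, Finset.card_insert_of_notMem hzNZ, Finset.card_union_of_disjoint hdNZ]
  have hdeg : deg2 G T = deg2 G Z + 2 * ee G N Z + 2 * N.card := by
    conv_lhs => rw [hTe]
    rw [deg2_insert hzNZ, deg2_union hdNZ, deg2_of_indep (X := N)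
      fun u hu v hv => hG.indep (mem_nb.1 hu).2 (mem_nb.1 hv).2]
    have : nb G (N ∪ Z) z = N := by
      ext w
      rw [mem_nb, Finset.mem_union]
      constructor
      · rintro ⟨h | h, hzw⟩
        · exact h
        · exact absurd hzw (Finset.mem_filter.1 h).2.2
      · intro h
        exact ⟨Or.inl h, (mem_nb.1 h).2⟩
    rw [this]
    ring
  have hsum : Z.card * 2 ≤ ee G Z T := by
    rw [ee_eq_sum, ← smul_eq_mul]
    refine Finset.card_nsmul_le_sum _ _ _ fun w hw => ?_
    rw [Finset.mem_filter] at hw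
    exact hcon w hw.1 hw.2.1 hw.2.2
  have hZT : ee G Z T = ee G N Z + deg2 G Z := by
    rw [hTe, Finset.insert_eq, ee_union_right _ (Finset.disjoint_singleton_left.2 hzNZ),
      ee_union_right _ hdNZ, ee_symm Z N, deg2_eq_ee, ee_eq_zero, zero_add]
    intro w hw w' hw' h
    rw [Finset.mem_singleton] at hw'
    subst hw'
    exact (Finset.mem_filter.1 hw).2.2 h.symm
  have hZne : Z.Nonempty := by
    obtain ⟨w, hw, h⟩ := hne
    exact ⟨w, Finset.mem_filter.2 ⟨hw, h⟩⟩
  have h3 := hG.deg2_forest g (Y := Z) (Finset.filter_subset _ _) hZne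
  omega

/-- In a blow-up, frames that leave out a vertex leave out one of degree at most two. -/
theorem PT.blow_exists_small (hG : PT G) (h : Blow G S u v) (g : Good G S a b)
    (hW : (sW G S a b).Nonempty) : ∃ w ∈ sW G S a b, (nb G S w).card ≤ 2 := by
  obtain ⟨u, v, h, -, hc⟩ := hG.good_blow_cases h g
  -- a tree vertex has one neighbour among the hubs, so a leaf of the tree has degree at most two
  have hsmall : ∀ w ∈ sT G S u v, (nb G (sT G S u v) w).card ≤ 1 → (nb G S w).card ≤ 2 := by
    intro w hw hc
    have hsub : ∃ r, nb G S w ⊆ insert r (nb G (sT G S u v) w) := by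
      rcases mem_sT.1 hw with h1 | h1
      · refine ⟨u, fun s hs => ?_⟩
        rw [mem_nb] at hs
        rw [Finset.mem_insert, mem_nb, mem_sT]
        have := hG.blow_adj_sB h.symm h1 hs.1 hs.2
        tauto
      · refine ⟨v, fun s hs => ?_⟩
        rw [mem_nb] at hs
        rw [Finset.mem_insert, mem_nb, mem_sT]
        have := hG.blow_adj_sB h h1 hs.1 hs.2
        tauto
    obtain ⟨r, hr⟩ := hsub
    have := Finset.card_le_card hr
    have := Finset.card_insert_le r (nb G (sT G S u v) w)
    omega
  have hl := hG.blow_linked h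
  have caseL : ∀ z ∈ sA G S v u, (sW G S u z).Nonempty → ∃ w ∈ sW G S u z, (nb G S w).card ≤ 2 := by
    rintro z hz ⟨w₀, hw₀⟩
    have hzT := sB_sub_sT S u v hz
    have hW : ∀ w, w ∈ sW G S u z ↔ w ∈ sT G S u v ∧ w ≠ z ∧ ¬ G.Adj z w := by
      intro w
      rw [mem_sW, mem_sI, hG.blow_sT_left h hz, mem_cn, Finset.mem_insert]
      constructor
      · rintro ⟨hw, hwu, hwz, hn⟩
        push Not at hn
        rcases hG.blow_mem h hw with h1 | h1 | h1 | h1 | h1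
        · exact absurd h1 hwu
        · exact absurd h1 hn.2.1
        · exact absurd h1 hn.2.2
        · exact ⟨sA_sub_sT _ _ _ h1, hwz, hn.1 hw (mem_sA.1 h1).2.1⟩
        · exact ⟨sB_sub_sT _ _ _ h1, hwz, hG.indep (mem_sA.1 hz).2.1 (mem_sA.1 h1).2.1⟩
      · rintro ⟨hw, hwz, hzw⟩
        have hne := hG.sI_ne h.1 (sT_sub_sI _ _ _ hw)
        refine ⟨sT_sub _ _ _ hw, hne.1, hwz, ?_⟩
        rintro (h1 | h1 | h1)
        · exact hzw h1.2.2
        · exact hne.2 h1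
        · exact hG.not_cn_sT hw h1
    obtain ⟨w, hw, hwz, hzw, hwc⟩ := hG.exists_leaf_away h.1 hl hzT ⟨w₀, (hW w₀).1 hw₀⟩
    exact ⟨w, (hW w).2 ⟨hw, hwz, hzw⟩, hsmall w hw hwc⟩
  have caseC : ∀ x ∈ cn G S u v, ∀ z ∈ sA G S v u, (sW G S x z).Nonempty →
      ∃ w ∈ sW G S x z, (nb G S w).card ≤ 2 := by
    rintro x hx z hz ⟨w₀, hw₀⟩
    have hx' := mem_cn.1 hx
    have hzT := sB_sub_sT S u v hz
    have hcn : ∀ w, w ∈ cn G S x z → w = v := by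
      intro w hw
      rw [mem_cn] at hw
      rcases hG.blow_adj_cn h hx hw.1 hw.2.1 with rfl | h1
      · exact absurd hw.2.2.symm (hG.sA_nadj hz)
      · exact h1
    have hvcn : v ∈ cn G S x z := mem_cn.2 ⟨h.1.hb, hx'.2.2.symm, (mem_sA.1 hz).2.1.symm⟩
    by_cases hC : ∃ x' ∈ cn G S u v, x' ≠ x
    · obtain ⟨x', hx₁, hne⟩ := hC
      have hne' := hG.sI_ne h.1 (cn_sub_sI _ _ _ hx₁)
      refine ⟨x', ?_, ?_⟩
      · rw [mem_sW, mem_sI, hG.blow_sT_cn h hx hz, Finset.mem_insert, mem_nb]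
        refine ⟨cn_sub _ _ _ hx₁, hne, fun hh => hG.not_cn_sT hzT (hh ▸ hx₁), ?_⟩
        rintro (h1 | h1 | h1)
        · exact hne'.2 (hcn _ h1)
        · exact hne'.1 h1
        · exact hG.not_cn_sT (sA_sub_sT _ _ _ h1.1) hx₁
      · have : nb G S x' ⊆ {u, v} := by
          intro s hs
          rw [mem_nb] at hs
          have := hG.blow_adj_cn h hx₁ hs.1 hs.2
          simpa using this
        exact (Finset.card_le_card this).trans Finset.card_le_two
    · push Not at hC
      have hW : ∀ w, w ∈ sW G S x z ↔ w ∈ sT G S u v ∧ w ≠ z ∧ ¬ G.Adj z w := by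
        intro w
        rw [mem_sW, mem_sI, hG.blow_sT_cn h hx hz, Finset.mem_insert, mem_nb]
        constructor
        · rintro ⟨hw, hwx, hwz, hn⟩
          push Not at hn
          rcases hG.blow_mem h hw with h1 | h1 | h1 | h1 | h1
          · exact absurd h1 hn.2.1
          · exact absurd (h1 ▸ hvcn) hn.1
          · exact absurd (hC w h1) hwx
          · exact ⟨sA_sub_sT _ _ _ h1, hwz, hn.2.2 h1⟩
          · exact ⟨sB_sub_sT _ _ _ h1, hwz, hG.indep (mem_sA.1 hz).2.1 (mem_sA.1 h1).2.1⟩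
        · rintro ⟨hw, hwz, hzw⟩
          have hne := hG.sI_ne h.1 (sT_sub_sI _ _ _ hw)
          refine ⟨sT_sub _ _ _ hw, fun hh => hG.not_cn_sT hw (hh ▸ hx), hwz, ?_⟩
          rintro (h1 | h1 | h1)
          · exact hne.2 (hcn _ h1)
          · exact hne.1 h1
          · exact hzw h1.2
      obtain ⟨w, hw, hwz, hzw, hwc⟩ := hG.exists_leaf_away h.1 hl hzT ⟨w₀, (hW w₀).1 hw₀⟩
      exact ⟨w, (hW w).2 ⟨hw, hwz, hzw⟩, hsmall w hw hwc⟩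
  rcases hc with ⟨rfl, rfl⟩ | ⟨rfl, h1⟩ | ⟨rfl, h1⟩ | ⟨h1, h2⟩ | ⟨h1, h2⟩
  · rw [hG.blow_sW h] at hW
    simp at hW
  · exact caseL _ h1 hW
  · rw [sW_symm] at hW ⊢
    exact caseL _ h1 hW
  · exact caseC _ h1 _ h2 hW
  · rw [sW_symm] at hW ⊢
    exact caseC _ h1 _ h2 hW

omit [Fintype V] in
theorem pp_succ_le {S' : Finset V} (hS : S' ⊆ S) {y z : V} (hy : y ∈ S) (hz : z ∈ S)
    (hay : G.Adj a y) (hyz : G.Adj y z) (hzb : G.Adj z b) (hn : y ∉ S' ∨ z ∉ S') :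
    pp G S' a b + 1 ≤ pp G S a b := by
  unfold pp ee
  refine Finset.card_lt_card ⟨Finset.filter_subset_filter _
    (Finset.product_subset_product (nb_mono hS a) (nb_mono hS b)), fun h => ?_⟩
  have := h (show (y, z) ∈ _ from Finset.mem_filter.2 ⟨Finset.mem_product.2
    ⟨mem_nb.2 ⟨hy, hay⟩, mem_nb.2 ⟨hz, hzb.symm⟩⟩, hyz⟩)
  simp only [Finset.mem_filter, Finset.mem_product, mem_nb] at this
  tauto

theorem PT.blow_pp_left (hG : PT G) (h : Blow G S u v) {z : V} (hz : z ∈ sA G S v u) :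
    pp G S u z = (cn G S u v).card := by
  unfold pp ee
  refine le_antisymm ?_ ?_
  · refine (Finset.card_le_card (t := (cn G S u v).image fun x => (x, v)) ?_).trans
      Finset.card_image_le
    rintro ⟨p, q⟩ hpq
    simp only [Finset.mem_filter, Finset.mem_product, mem_nb] at hpq
    obtain ⟨⟨⟨hp, hup⟩, hq, hzq⟩, hpq⟩ := hpq
    rw [Finset.mem_image]
    rcases hG.blow_adj_sB h hz hq hzq with rfl | h1
    · exact ⟨p, mem_cn.2 ⟨hp, hup, hpq.symm⟩, rfl⟩
    · exact absurd hpq (hG.indep hup (mem_sA.1 h1).2.1)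
  · rw [← Finset.card_image_of_injective (cn G S u v)
      (f := fun x => (x, v)) fun _ _ h => (Prod.ext_iff.1 h).1]
    refine Finset.card_le_card ?_
    intro p hp
    obtain ⟨x, hx, rfl⟩ := Finset.mem_image.1 hp
    rw [mem_cn] at hx
    simp only [Finset.mem_filter, Finset.mem_product, mem_nb]
    exact ⟨⟨⟨hx.1, hx.2.1⟩, h.1.hb, (mem_sA.1 hz).2.1.symm⟩, hx.2.2.symm⟩

theorem PT.blow_pp_cn_le (hG : PT G) (h : Blow G S u v) {x z : V} (hx : x ∈ cn G S u v)
    (hz : z ∈ sA G S v u) : pp G S x z ≤ (cn G S u z).card := by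
  unfold pp ee
  refine (Finset.card_le_card (t := (cn G S u z).image fun y => (u, y)) ?_).trans
    Finset.card_image_le
  rintro ⟨p, q⟩ hpq
  simp only [Finset.mem_filter, Finset.mem_product, mem_nb] at hpq
  obtain ⟨⟨⟨hp, hxp⟩, hq, hzq⟩, hpq⟩ := hpq
  rw [Finset.mem_image]
  rcases hG.blow_adj_cn h hx hp hxp with rfl | rfl
  · exact ⟨q, mem_cn.2 ⟨hq, hpq, hzq⟩, rfl⟩
  · exact (hG.tri _ _ _ hpq hzq.symm (mem_sA.1 hz).2.1.symm).elim

/-- A vertex of degree two joined to two vertices with sufficiently many paths of length three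
between them extends a blow-up. -/
theorem PT.blow_extend (hG : PT G) {w p q : V} (hw : w ∈ S) (h : Blow G (S.erase w) u v)
    (hp : p ∈ S.erase w) (hq : q ∈ S.erase w) (hwp : G.Adj w p) (hwq : G.Adj w q)
    (ht : pp G (S.erase w) u v ≤ pp G (S.erase w) p q ∨
      ∀ u' v' x z, Blow G (S.erase w) u' v' → ((u' = u ∧ v' = v) ∨ (u' = v ∧ v' = u)) →
        x ∈ cn G (S.erase w) u' v' → z ∈ sA G (S.erase w) v' u' → ((p = x ∧ q = z) ∨
        (q = x ∧ p = z)) → False) (hpos : 0 < pp G (S.erase w) p q) :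
    ∃ u v, Blow G S u v := by
  have hsub := Finset.erase_subset w S
  have hcard := Finset.card_erase_of_mem hw
  have hSpos := Finset.card_pos.2 ⟨w, hw⟩
  have hnw := Finset.notMem_erase w S
  obtain ⟨u', v', h', he, hc⟩ := hG.blow_cases h hp hq (hG.indep hwp hwq) hpos
  have hg : ∀ {r s}, Good G (S.erase w) r s → Good G S r s := fun g =>
    ⟨hsub g.ha, hsub g.hb, g.c.mono (cn_mono hsub _ _), lt_of_lt_of_le g.p (pp_mono hsub _ _)⟩
  -- if `w` is adjacent to a hub and a tree vertex, it joins the tree and adds a path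
  have hpath : ∀ z, z ∈ sA G (S.erase w) v' u' → G.Adj w u' → G.Adj w z → ∃ u v, Blow G S u v := by
    intro z hz hwu hwz
    refine ⟨u', v', hG.blow_of_le (hg h'.1) ?_⟩
    have h1 := pp_succ_le (S := S) hsub (a := u') (b := v') hw (hsub (sA_sub _ _ _ hz)) hwu.symm
      hwz (mem_sA.1 hz).2.1.symm (Or.inl hnw)
    have h2 := Finset.card_le_card (cn_mono (G := G) hsub u' v')
    have h3 := h'.2
    omega
  -- if `w` is adjacent to `x` and `z`, then `(u', z)` is a pair for which `w` joins the tree part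
  have hstar : ∀ x z, x ∈ cn G (S.erase w) u' v' → z ∈ sA G (S.erase w) v' u' → G.Adj w x →
      G.Adj w z → pp G (S.erase w) u v ≤ pp G (S.erase w) x z → ∃ u v, Blow G S u v := by
    intro x z hx hz hwx hwz ht
    have hx' := mem_cn.1 hx
    have h1 := hG.blow_pp_cn_le h' hx hz
    have h2 := hG.blow_pp_left h' hz
    have h3 := h'.2
    have h4 : pp G (S.erase w) u v = pp G (S.erase w) u' v' := by
      rcases he with ⟨rfl, rfl⟩ | ⟨rfl, rfl⟩
      · rfl
      · exact pp_symm _ _ _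
    have h5 := pp_succ_le (S := S) hsub (a := u') (b := z) (hsub hx'.1) hw hx'.2.1 hwx.symm hwz
      (Or.inr hnw)
    have h6 := Finset.card_le_card (cn_mono (G := G) hsub u' z)
    obtain ⟨y, hy, hzy⟩ := exists_sB hz
    refine ⟨u', z, hG.blow_of_le ⟨hsub h'.1.ha, hsub (sA_sub _ _ _ hz), ⟨y, mem_cn.2
      ⟨hsub (sA_sub _ _ _ hy), (mem_sA.1 hy).2.1, hzy⟩⟩, by omega⟩ (by omega)⟩
  have hps : pp G (S.erase w) q p = pp G (S.erase w) p q := pp_symm _ _ _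
  rcases hc with ⟨rfl, rfl⟩ | ⟨rfl, h1⟩ | ⟨rfl, h1⟩ | ⟨h1, h2⟩ | ⟨h1, h2⟩ | ⟨h1, h2⟩
  · refine ⟨p, q, hG.blow_of_le (hg h'.1) ?_⟩
    have h2 := pp_mono (G := G) hsub p q
    have h3 := h'.2
    have h4 : (cn G (S.erase w) p q).card + 1 ≤ (cn G S p q).card := by
      refine Finset.card_lt_card ⟨cn_mono hsub _ _, fun hh => ?_⟩
      have := hh (mem_cn.2 ⟨hw, hwp.symm, hwq.symm⟩)
      exact hnw (mem_cn.1 this).1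
    omega
  · exact hpath q h1 hwp hwq
  · exact hpath p h1 hwq hwp
  · rcases ht with ht | ht
    · exact hstar p q h1 h2 hwp hwq ht
    · exact (ht u' v' p q h' he h1 h2 (Or.inl ⟨rfl, rfl⟩)).elim
  · rcases ht with ht | ht
    · exact hstar q p h1 h2 hwq hwp (hps ▸ ht)
    · exact (ht u' v' q p h' he h1 h2 (Or.inr ⟨rfl, rfl⟩)).elim
  · exfalso
    obtain ⟨x, hx⟩ := h'.1.c
    refine hG.attach_two_sides h'.1 (D := sT G (S.erase w) u' v') (K := {w}) (Finset.Subset.refl _)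
      (hG.blow_linked h') (linked_singleton w) hx ?_ h1 h2 (sA_sub_sT _ _ _ h1)
      (sB_sub_sT _ _ _ h2) (hG.indep hwp hwq) ⟨w, by simp, hwp⟩ ⟨w, by simp, hwq⟩
    intro k hk
    rw [Finset.mem_singleton] at hk
    subst hk
    exact ⟨fun hh => hnw (sT_sub _ _ _ hh), fun hh => hnw (hh ▸ h'.1.ha),
      fun hh => hnw (hh ▸ h'.1.hb), fun hh => hnw (hh ▸ (mem_cn.1 hx).1)⟩

end

/-! ### Minimal counterexamples and their reductions -/

section
variable {V : Type} {G : SimpleGraph V} {S S' : Finset V} {a b : V} {M : ℕ}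

/-- `M` is the largest number of paths of length three between the vertices of a good pair. -/
structure MaxPaths (G : SimpleGraph V) (S : Finset V) (M : ℕ) : Prop where
  le : ∀ a b, Good G S a b → pp G S a b ≤ M
  ex : ∃ a b, Good G S a b ∧ pp G S a b = M

/-- The bound `M * (|S| - 3 - M)` for the number of pentagons. As long as `|S|` is small in terms
of `M`, equality is attained by blow-ups only. -/
def Concl (G : SimpleGraph V) (S : Finset V) (M : ℕ) : Prop :=
  (pents G S).card + M * M + 3 * M ≤ M * S.card ∧
    ((pents G S).card + M * M + 3 * M = M * S.card → S.card ≤ 2 * M + 4 → ∃ u v, Blow G S u v)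

/-- `S` is a minimal counterexample to `Concl`. -/
structure Irr (G : SimpleGraph V) (S : Finset V) (M : ℕ) : Prop where
  ih : ∀ S' ⊂ S, ∀ M', MaxPaths G S' M' → Concl G S' M'
  max : MaxPaths G S M
  nc : ¬ Concl G S M

theorem Good.mono (hS : S' ⊆ S) (g : Good G S' a b) : Good G S a b :=
  ⟨hS g.ha, hS g.hb, g.c.mono (cn_mono hS _ _), g.p.trans_le (pp_mono hS _ _)⟩

theorem MaxPaths.pos (h : MaxPaths G S M) : 1 ≤ M := by
  obtain ⟨a, b, g, rfl⟩ := h.ex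
  exact g.p

theorem MaxPaths.of_sub (h : MaxPaths G S M) (hS : S' ⊆ S) (g : Good G S' a b)
    (hp : pp G S' a b = M) : MaxPaths G S' M :=
  ⟨fun u v g' => (pp_mono hS u v).trans (h.le u v (g'.mono hS)), a, b, g, hp⟩

theorem exists_maxPaths (hle : ∀ u v, Good G S u v → pp G S u v ≤ M) (g : Good G S a b) :
    ∃ M', MaxPaths G S M' ∧ M' ≤ M ∧ pp G S a b ≤ M' := by
  let P : ℕ → Prop := fun k => ∃ u v, Good G S u v ∧ pp G S u v = k
  have h1 : P (Nat.findGreatest P M) :=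
    Nat.findGreatest_spec (P := P) (hle a b g) ⟨a, b, g, rfl⟩
  exact ⟨_, ⟨fun u v g' => Nat.le_findGreatest (P := P) (hle u v g') ⟨u, v, g', rfl⟩, h1⟩,
    Nat.findGreatest_le _, Nat.le_findGreatest (P := P) (hle a b g) ⟨a, b, g, rfl⟩⟩

/-- The induction hypothesis for a proper subset that still has a good pair. -/
theorem Irr.sub_good (h : Irr G S M) (hS : S' ⊂ S) (g : Good G S' a b) :
    ∃ M', MaxPaths G S' M' ∧ M' ≤ M ∧ pp G S' a b ≤ M' ∧ Concl G S' M' := by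
  obtain ⟨M', h1, h2, h3⟩ := exists_maxPaths (M := M)
    (fun u v g' => (pp_mono hS.1 u v).trans (h.max.le u v (g'.mono hS.1))) g
  exact ⟨M', h1, h2, h3, h.ih S' hS M' h1⟩

/-- If the bound holds for a counterexample, it is an equality, `|S|` is small, and there is no
blow-up. -/
theorem Irr.not_concl (h : Irr G S M) (hle : (pents G S).card + M * M + 3 * M ≤ M * S.card) :
    (pents G S).card + M * M + 3 * M = M * S.card ∧ S.card ≤ 2 * M + 4 ∧
      ∀ u v, ¬ Blow G S u v := by
  by_contra hcon
  refine h.nc ⟨hle, fun h1 h2 => ?_⟩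
  by_contra h3
  push Not at h3
  exact hcon ⟨h1, h2, h3⟩

/-- A pentagon in `S` provides a good pair. -/
theorem IsPent.good {Q : Finset V} (hQ : IsPent G Q) (hQS : Q ⊆ S) : ∃ a b, Good G S a b := by
  obtain ⟨a, b, c, d, e, rfl, h1, h2, h3, h4, h5⟩ := hQ
  have hs : ∀ v ∈ ({a, b, c, d, e} : Finset V), v ∈ S := fun v hv => hQS hv
  exact ⟨a, c, hs a (by simp), hs c (by simp), ⟨b, mem_cn.2 ⟨hs b (by simp), h1, h2.symm⟩⟩,
    pp_pos (hs e (by simp)) (hs d (by simp)) h5.symm h4.symm h3.symm⟩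

/-- The induction hypothesis for a proper subset, whether or not it spans a pentagon. -/
theorem Irr.sub (h : Irr G S M) (hS : S' ⊂ S) : (pents G S').card = 0 ∨
    ∃ M', 1 ≤ M' ∧ M' ≤ M ∧ Concl G S' M' := by
  rcases (pents G S').eq_empty_or_nonempty with h0 | ⟨Q, hQ⟩
  · exact Or.inl (by rw [h0, Finset.card_empty])
  · rw [mem_pents] at hQ
    obtain ⟨a, b, g⟩ := hQ.2.good hQ.1
    obtain ⟨M', h1, h2, -, h3⟩ := h.sub_good hS g
    exact Or.inr ⟨M', h1.pos, h2, h3⟩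

theorem exists_nb_pair {w : V} (hd : (nb G S w).card ≤ 2) : ∃ p q, nb G S w ⊆ {p, q} ∧
    (p = q ∨ (p ∈ S ∧ G.Adj w p ∧ q ∈ S ∧ G.Adj w q)) := by
  rcases (nb G S w).eq_empty_or_nonempty with h0 | ⟨p, hp⟩
  · exact ⟨w, w, by simp [h0], Or.inl rfl⟩
  · by_cases hq : ∃ q ∈ nb G S w, q ≠ p
    · obtain ⟨q, hq, hne⟩ := hq
      refine ⟨p, q, ?_, Or.inr ⟨(mem_nb.1 hp).1, (mem_nb.1 hp).2, (mem_nb.1 hq).1, (mem_nb.1 hq).2⟩⟩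
      have h2 : ({p, q} : Finset V) ⊆ nb G S w :=
        Finset.insert_subset hp (Finset.singleton_subset_iff.2 hq)
      rw [← Finset.eq_of_subset_of_card_le h2 (by rw [Finset.card_pair hne.symm]; exact hd)]
    · push Not at hq
      exact ⟨p, p, fun q h => by simp [hq q h], Or.inl rfl⟩

variable [Fintype V]

/-- The pentagons lost by deleting a vertex of degree at most two number at most `M`. -/
theorem Irr.card_pents_le (hG : PT G) (h : Irr G S M) {w p q : V} (hn : nb G S w ⊆ {p, q})
    (hw : w ∈ S) (hpq : p = q ∨ (p ∈ S ∧ G.Adj w p ∧ q ∈ S ∧ G.Adj w q)) :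
    (pents G S).card ≤ (pents G (S.erase w)).card + pp G (S.erase w) p q ∧
      pp G (S.erase w) p q ≤ M := by
  refine ⟨hG.card_pents_erase hn, ?_⟩
  rcases Nat.eq_zero_or_pos (pp G (S.erase w) p q) with h0 | h0
  · omega
  · have h1 := pp_mono (G := G) (Finset.erase_subset w S) p q
    rcases hpq with rfl | ⟨hp, hwp, hq, hwq⟩
    · rw [hG.pp_self] at h0
      omega
    · exact h1.trans (h.max.le p q ⟨hp, hq, ⟨w, mem_cn.2 ⟨hw, hwp.symm, hwq.symm⟩⟩, by omega⟩)

/-- Deleting a vertex of degree at most two destroys every pair attaining the maximum. -/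
theorem Irr.no_light_vertex (hG : PT G) (h : Irr G S M) {w : V} (hw : w ∈ S)
    (hd : (nb G S w).card ≤ 2) (g : Good G (S.erase w) a b) (hp : pp G (S.erase w) a b = M) : False := by
  have hss := Finset.erase_ssubset hw
  have hmax := h.max.of_sub hss.1 g hp
  obtain ⟨h1, h2⟩ := h.ih _ hss M hmax
  have hcard := Finset.card_erase_add_one hw
  obtain ⟨p, q, hn, hpq⟩ := exists_nb_pair hd
  obtain ⟨h3, h4⟩ := h.card_pents_le hG hn hw hpq
  have h5 : M * S.card = M * (S.erase w).card + M := by rw [← hcard]; ring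
  obtain ⟨h6, h7, h8⟩ := h.not_concl (by omega)
  have h9 : pp G (S.erase w) p q = M := by omega
  obtain ⟨u, v, hb⟩ := h2 (by omega) (by omega)
  have h10 := hmax.le u v hb.1
  have hM := h.max.pos
  rcases hpq with rfl | ⟨hpS, hwp, hqS, hwq⟩
  · rw [hG.pp_self] at h9
    omega
  · obtain ⟨u', v', hb'⟩ := hG.blow_extend hw hb (Finset.mem_erase.2 ⟨hwp.ne', hpS⟩)
      (Finset.mem_erase.2 ⟨hwq.ne', hqS⟩) hwp hwq (Or.inl (by omega)) (by omega)
    exact h8 u' v' hb'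

theorem PT.blow_card_pents (hG : PT G) {u v : V} (h : Blow G S u v) :
    (pents G S).card = (cn G S u v).card * pp G S u v := by
  rw [hG.card_pents_eq h.1, hG.blow_sW h]
  simp [meet]

omit [Fintype V] in
/-- In a blow-up the neighbourhoods of adjacent vertices of the tree share one edge of the tree. -/
theorem card_star_le {u v y z : V} (hy : y ∈ sA G S u v)
    (hz : z ∈ sA G S v u) :
    (cn G S v y).card + (cn G S u z).card ≤ pp G S u v + 1 := by
  have e1 : ((cn G S v y).image fun q => (y, q)).card = (cn G S v y).card :=
    Finset.card_image_of_injective _ fun _ _ h => (Prod.ext_iff.1 h).2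
  have e2 : ((cn G S u z).image fun q => (q, z)).card = (cn G S u z).card :=
    Finset.card_image_of_injective _ fun _ _ h => (Prod.ext_iff.1 h).1
  rw [← e1, ← e2, ← Finset.card_union_add_card_inter]
  have hy' := mem_sA.1 hy
  have hz' := mem_sA.1 hz
  refine Nat.add_le_add ?_ ?_
  · unfold pp ee
    refine Finset.card_le_card ?_
    intro e he
    simp only [Finset.mem_union, Finset.mem_image, mem_cn] at he
    simp only [Finset.mem_filter, Finset.mem_product, mem_nb]
    rcases he with ⟨q, ⟨hq, hvq, hyq⟩, rfl⟩ | ⟨q, ⟨hq, huq, hzq⟩, rfl⟩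
    · exact ⟨⟨⟨hy'.1, hy'.2.1⟩, hq, hvq⟩, hyq⟩
    · exact ⟨⟨⟨hq, huq⟩, hz'.1, hz'.2.1⟩, hzq.symm⟩
  · rw [← Finset.card_singleton (y, z)]
    refine Finset.card_le_card ?_
    intro e he
    simp only [Finset.mem_inter, Finset.mem_image, mem_cn] at he
    obtain ⟨⟨q, -, rfl⟩, q', -, h⟩ := he
    simp only [Prod.mk.injEq] at h
    simp [h.2]

/-- Every leaf of a maximal frame has a neighbour outside the frame. -/
theorem Irr.exists_adj_leaf (hG : PT G) (h : Irr G S M) (hM : 2 ≤ M) (g : Good G S a b)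
    (hp : pp G S a b = M) {y : V} (hy : y ∈ sT G S a b) (hl : (nb G (sT G S a b) y).card ≤ 1) :
    ∃ w ∈ sW G S a b, G.Adj y w := by
  have key : ∀ a b, Good G S a b → pp G S a b = M → (nb G (sT G S a b) y).card ≤ 1 →
      y ∈ sA G S a b → ∃ w ∈ sW G S a b, G.Adj y w := by
    intro a b g hp hl hy
    by_contra hW
    push Not at hW
    have hy' := mem_sA.1 hy
    have hnb := hG.sA_nadj hy
    obtain ⟨z, hz, hyz⟩ := exists_sB hy
    have hz' := mem_sA.1 hz
    obtain ⟨x, hx⟩ := g.c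
    have hx' := mem_cn.1 hx
    have hnS : ∀ s ∈ S, G.Adj y s → s = a ∨ s = z := by
      intro s hs hys
      rcases mem_cases (G := G) (a := a) (b := b) hs with h1 | h1 | h1 | h1
      · exact Or.inl h1
      · exact absurd (h1 ▸ hys.symm) hnb
      · rcases hG.adj_sI (sT_sub_sI _ _ _ (sA_sub_sT _ _ _ hy)) h1 hys with h2 | h2
        · exact Or.inr (Finset.card_le_one.1 hl s (mem_nb.2 ⟨sB_sub_sT _ _ _ h2.2, hys⟩) z
            (mem_nb.2 ⟨sB_sub_sT _ _ _ hz, hyz⟩))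
        · exact absurd h2.1 (hG.not_sA_sB hy)
      · exact absurd hys (hW s h1)
    have hn : nb G S y ⊆ {a, z} := by
      intro s hs
      rw [mem_nb] at hs
      simpa using hnS s hs.1 hs.2
    have hd : (nb G S y).card ≤ 2 := (Finset.card_le_card hn).trans Finset.card_le_two
    have hss := Finset.erase_ssubset hy'.1
    have hmem : ∀ {v}, v ∈ S → v ≠ y → v ∈ S.erase y := fun h1 h2 => Finset.mem_erase.2 ⟨h2, h1⟩
    have haS := hmem g.ha hy'.2.1.ne
    have hbS := hmem g.hb (hG.sI_ne g (sT_sub_sI _ _ _ (sA_sub_sT _ _ _ hy))).2.symm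
    have hzS := hmem hz'.1 hyz.ne'
    have hxy : x ≠ y := fun e => hG.not_cn_sT (sA_sub_sT _ _ _ hy) (e ▸ hx)
    have hp1 : M ≤ pp G (S.erase y) a b + 1 := by
      rw [← hp]
      unfold pp ee
      refine (Finset.card_le_card (t := insert (y, z) _) ?_).trans (Finset.card_insert_le _ _)
      rintro ⟨p, q⟩ hpq
      simp only [Finset.mem_filter, Finset.mem_product, mem_nb] at hpq
      simp only [Finset.mem_insert, Finset.mem_filter, Finset.mem_product, mem_nb, Prod.mk.injEq]
      obtain ⟨⟨⟨hp, hap⟩, hq, hbq⟩, hpq⟩ := hpq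
      by_cases hpy : p = y
      · subst hpy
        rcases hnS q hq hpq with rfl | rfl
        · exact absurd hbq.symm (hG.good_nadj g)
        · exact Or.inl ⟨rfl, rfl⟩
      · refine Or.inr ⟨⟨⟨hmem hp hpy, hap⟩, hmem hq ?_, hbq⟩, hpq⟩
        rintro rfl
        exact hnb hbq
    have g' : Good G (S.erase y) a b :=
      ⟨haS, hbS, ⟨x, mem_cn.2 ⟨hmem hx'.1 hxy, hx'.2⟩⟩, by omega⟩
    -- delete `y`; this loses a single path, so the maximum drops by at most one, and it does drop
    -- by `Irr.no_light_vertex`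
    obtain ⟨M', hmax', hM'M, hpM', hc1, hc2⟩ := h.sub_good hss g'
    by_cases hMM : M' = M
    · subst hMM
      obtain ⟨a', b', ga, hpa⟩ := hmax'.ex
      exact h.no_light_vertex hG hy'.1 hd ga hpa
    obtain rfl : M = M' + 1 := by omega
    obtain ⟨h3, h4⟩ := h.card_pents_le hG hn hy'.1
      (Or.inr ⟨g.ha, hy'.2.1.symm, hz'.1, hyz⟩)
    have hcard := Finset.card_erase_add_one hy'.1
    have hcompat := hG.compat g.ha g.hb hx'.1 hy'.1 hz'.1 hx'.2.1.symm hx'.2.2 hy'.2.1 hyz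
      hz'.2.1.symm
    have htt := pp_mono (G := G) hss.1 a z
    set t := pp G (S.erase y) a z with ht
    obtain ⟨N, hN⟩ : ∃ N, S.card = N + M' + 1 + 3 := ⟨S.card - (M' + 1 + 3), by omega⟩
    have hSe : (S.erase y).card = N + M' + 3 := by omega
    have htN : t ≤ N := by omega
    have e1 : (M' + 1) * S.card = M' * (S.erase y).card + N + (M' * 2 + 4) := by
      rw [hN, hSe]; ring
    have e2 : (M' + 1) * (M' + 1) = M' * M' + 2 * M' + 1 := by ring
    obtain ⟨h6, h7, h8⟩ := h.not_concl (by omega)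
    have htN' : t = N := by omega
    obtain ⟨u, v, hb⟩ := hc2 (by omega) (by omega)
    have hbp := hG.blow_card_pents hb
    have hbc := hb.2
    have hble := hmax'.le u v hb.1
    have hcpos : 1 ≤ (cn G S a b).card := Finset.card_pos.2 g.c
    have hN2 : 2 ≤ N := by
      by_contra hN2
      exact h8 a b (hG.blow_of_le g (by omega))
    have hext : ∃ u v, Blow G S u v := by
      refine hG.blow_extend hy'.1 hb haS hzS hy'.2.1.symm hyz ?_ (by omega)
      by_cases hpt : pp G (S.erase y) u v ≤ t
      · exact Or.inl hpt
      right
      -- the two numbers of the blow-up are `M'` and `N`, and `pp u v` is the larger one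
      have hroot : ((pp G (S.erase y) u v : ℤ) - M') * ((pp G (S.erase y) u v : ℤ) - N) = 0 := by
        have e3 : ((cn G (S.erase y) u v).card : ℤ) = N + M' - pp G (S.erase y) u v := by omega
        have e4 : ((pents G (S.erase y)).card : ℤ) + M' * M' + 3 * M' = M' * (N + M' + 3) := by
          have : (pents G (S.erase y)).card + M' * M' + 3 * M' = M' * (S.erase y).card := by omega
          rw [hSe] at this
          exact_mod_cast this
        rw [hbp, Nat.cast_mul, e3] at e4
        linear_combination -e4
      have hp' : pp G (S.erase y) u v = M' := by
        rcases mul_eq_zero.1 hroot with h9 | h9 <;> omega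
      intro u' v' x' z' hb' he hx1 hz1 hc
      have hpe : pp G (S.erase y) u' v' = M' := by
        rcases he with ⟨rfl, rfl⟩ | ⟨rfl, rfl⟩
        · exact hp'
        · rw [pp_symm]; exact hp'
      have hx2 := mem_cn.1 hx1
      have hz2 := mem_sA.1 hz1
      rcases hc with ⟨rfl, rfl⟩ | ⟨rfl, rfl⟩
      · rcases hG.blow_adj_sB hb' hz1 hbS hz'.2.1.symm with rfl | hbA
        · exact hG.good_nadj g hx2.2.2.symm
        · have k1 := hG.blow_pp_cn_le hb'.symm (cn_symm (G := G) _ u' v' ▸ hx1) hbA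
          have k2 := card_star_le hbA hz1
          have k3 := hG.blow_pp_cn_le hb' hx1 hz1
          omega
      · rcases hG.blow_adj_cn hb' hx1 hbS hz'.2.1.symm with rfl | rfl
        · have k1 := hG.blow_pp_left hb' hz1
          rw [pp_symm] at k1
          have k2 := hb'.2
          omega
        · exact hG.good_nadj g hz2.2.1.symm
    obtain ⟨u', v', hb'⟩ := hext
    exact h8 u' v' hb'
  rcases mem_sT.1 hy with h1 | h1
  · exact key a b g hp hl h1
  · rw [sW_symm]
    exact key b a g.symm (by rw [pp_symm]; exact hp) (by rw [sT_symm]; exact hl) h1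

/-- In a counterexample some vertex lies outside the frame: otherwise all pentagons contain both
hubs, and there are `c * M` of them, where `c + M + 3 ≤ |S|`. -/
theorem Irr.sW_nonempty (hG : PT G) (h : Irr G S M) (g : Good G S a b) (hp : pp G S a b = M) :
    (sW G S a b).Nonempty := by
  by_contra hW
  rw [Finset.not_nonempty_iff_eq_empty] at hW
  have h1 := hG.card_eq g
  have h2 := hG.pp_lt g
  have h3 := hG.card_pents_eq g
  have h4 : (meet G S (sW G S a b)).card = 0 := by rw [hW]; simp [meet]
  rw [h4, hp] at h3
  rw [hW, Finset.card_empty] at h1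
  set c := (cn G S a b).card
  obtain ⟨k, hk⟩ : ∃ k, S.card = c + M + 3 + k := ⟨S.card - (c + M + 3), by omega⟩
  have e1 : M * S.card = c * M + M * M + 3 * M + M * k := by rw [hk]; ring
  obtain ⟨h6, h7, h8⟩ := h.not_concl (by omega)
  have h9 : M * k = 0 := by omega
  have := h.max.pos
  have : k = 0 := by
    rcases Nat.mul_eq_zero.1 h9 with h | h <;> omega
  exact h8 a b (hG.blow_of_le g (by omega))

omit [Fintype V] in
/-- A subset that contains the hubs, a common neighbour and the tree part keeps the tree part. -/
theorem Good.sub (hS : S' ⊆ S) (g : Good G S a b) (ha : a ∈ S') (hb : b ∈ S')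
    (hT : sT G S a b ⊆ S') (hc : (cn G S' a b).Nonempty) :
    Good G S' a b ∧ pp G S' a b = pp G S a b ∧ sT G S' a b = sT G S a b ∧
      sW G S' a b = sW G S a b ∩ S' := by
  have hcl : ∀ y ∈ S', y ∈ sT G S a b → ∀ z ∈ sT G S a b, G.Adj y z → z ∈ S' :=
    fun _ _ _ z hz _ => hT hz
  have h1 : pp G S' a b = pp G S a b := by
    rw [pp_eq_ee, pp_eq_ee, sA_inter hS hcl, sA_inter hS (sT_symm (G := G) S a b ▸ hcl),
      Finset.inter_eq_left.2 ((sA_sub_sT _ _ _).trans hT),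
      Finset.inter_eq_left.2 ((sB_sub_sT _ _ _).trans hT)]
  exact ⟨⟨ha, hb, hc, h1 ▸ g.p⟩, h1, by rw [sT_inter hS hcl, Finset.inter_eq_left.2 hT],
    sW_inter hS hcl⟩

/-- Deleting a vertex outside the frame keeps the maximum `M`, so such a vertex has degree at least
three. -/
theorem Irr.deg_sW (hG : PT G) (h : Irr G S M) (g : Good G S a b) (hp : pp G S a b = M) {w : V}
    (hw : w ∈ sW G S a b) : 3 ≤ (nb G S w).card := by
  by_contra hcon
  obtain ⟨hwS, hwa, hwb, hwI⟩ := mem_sW.1 hw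
  obtain ⟨x, hx⟩ := g.c
  have hx' := mem_cn.1 hx
  obtain ⟨g', hp', -⟩ := g.sub (Finset.erase_subset w S) (Finset.mem_erase.2 ⟨hwa.symm, g.ha⟩)
    (Finset.mem_erase.2 ⟨hwb.symm, g.hb⟩)
    (fun t ht => Finset.mem_erase.2 ⟨fun e => hwI (e ▸ sT_sub_sI _ _ _ ht), sT_sub _ _ _ ht⟩)
    ⟨x, mem_cn.2 ⟨Finset.mem_erase.2 ⟨fun e => hwI (e ▸ cn_sub_sI _ _ _ hx), hx'.1⟩, hx'.2⟩⟩
  exact h.no_light_vertex hG hwS (by omega) g' (hp'.trans hp)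

theorem PT.nb_cn_sub (hG : PT G) {x : V} (hx : x ∈ cn G S a b)
    (hxW : ∀ w ∈ sW G S a b, ¬ G.Adj x w) : nb G S x ⊆ {a, b} := by
  intro s hs
  rw [mem_nb] at hs
  rw [Finset.mem_insert, Finset.mem_singleton]
  rcases mem_cases (G := G) (a := a) (b := b) hs.1 with h1 | h1 | h1 | h1
  · exact Or.inl h1
  · exact Or.inr h1
  · rcases hG.adj_sI (cn_sub_sI _ _ _ hx) h1 hs.2 with h2 | h2
    · exact absurd hx (hG.not_cn_sT (sA_sub_sT _ _ _ h2.1))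
    · exact absurd hx (hG.not_cn_sT (sB_sub_sT _ _ _ h2.1))
  · exact absurd hs.2 (hxW s h1)

/-- Deleting one of several common neighbours keeps the maximum `M`, so each of them has a neighbour
outside the frame. -/
theorem Irr.deg_cn (hG : PT G) (h : Irr G S M) (g : Good G S a b) (hp : pp G S a b = M) {x : V}
    (hx : x ∈ cn G S a b) (hc : 2 ≤ (cn G S a b).card) : ∃ w ∈ sW G S a b, G.Adj x w := by
  by_contra hcon
  push Not at hcon
  have hx' := mem_cn.1 hx
  have hn := hG.nb_cn_sub hx hcon
  obtain ⟨x₂, hx₂, hne⟩ := Finset.exists_mem_ne (show 1 < (cn G S a b).card by omega) x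
  have hx₂' := mem_cn.1 hx₂
  have hxI := hG.sI_ne g (cn_sub_sI _ _ _ hx)
  obtain ⟨g', hp', -⟩ := g.sub (Finset.erase_subset x S) (Finset.mem_erase.2 ⟨hxI.1.symm, g.ha⟩)
    (Finset.mem_erase.2 ⟨hxI.2.symm, g.hb⟩)
    (fun t ht => Finset.mem_erase.2 ⟨fun e => hG.not_cn_sT ht (e ▸ hx), sT_sub _ _ _ ht⟩)
    ⟨x₂, mem_cn.2 ⟨Finset.mem_erase.2 ⟨hne, hx₂'.1⟩, hx₂'.2⟩⟩
  exact h.no_light_vertex hG hx'.1 ((Finset.card_le_card hn).trans Finset.card_le_two) g'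
    (hp'.trans hp)

end

section
variable {V : Type} {G : SimpleGraph V} {S S' U : Finset V} {a b : V} {M : ℕ} [Fintype V]

/-- In a minimal counterexample, no union of components outside a maximal frame that is respected by
all pentagons attaches to at most two common neighbours and one tree, unless it is everything. -/
theorem Irr.no_small_attachment (hG : PT G) (h : Irr G S M) (g : Good G S a b) (hp : pp G S a b = M)
    {C Y : Finset V} (hU : Closed G (sW G S a b) U) (hUne : U.Nonempty)
    (hpc : PentClosed G S a b U) (hC : C ⊆ cn G S a b) (hCne : C.Nonempty) (hC2 : C.card ≤ 2)
    (hY : Y ⊆ sT G S a b) (hYne : Y.Nonempty) (hYl : Linked G Y)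
    (hYcl : ∀ y ∈ Y, ∀ z ∈ sT G S a b, G.Adj y z → z ∈ Y)
    (hJ : ∀ u ∈ U, ∀ r ∈ sI G S a b, G.Adj u r → r ∈ C ∨ r ∈ Y)
    (hne : U ≠ sW G S a b ∨ ¬ Linked G (sT G S a b)) : False := by
  have hCI : ∀ v ∈ C, v ∈ sI G S a b := fun v hv => cn_sub_sI _ _ _ (hC hv)
  have hYI : ∀ v ∈ Y, v ∈ sI G S a b := fun v hv => sT_sub_sI _ _ _ (hY hv)
  have hUI : ∀ v ∈ U, v ∈ S ∧ v ≠ a ∧ v ≠ b ∧ v ∉ sI G S a b := fun v hv => mem_sW.1 (hU.1 hv)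
  -- the bound for the hubs, `C`, `Y` and `U` gives at most `M * |U|` pentagons meeting `U`
  set S₁ : Finset V := {a, b} ∪ (C ∪ (Y ∪ U)) with hS₁
  have hmem : ∀ v, v ∈ S₁ ↔ v = a ∨ v = b ∨ v ∈ C ∨ v ∈ Y ∨ v ∈ U := by
    intro v
    rw [hS₁]
    simp only [Finset.mem_union, Finset.mem_insert, Finset.mem_singleton]
    tauto
  have hsub : S₁ ⊆ S := by
    intro v hv
    rcases (hmem v).1 hv with rfl | rfl | h1 | h1 | h1
    · exact g.ha
    · exact g.hb
    · exact sI_sub _ _ _ (hCI v h1)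
    · exact sI_sub _ _ _ (hYI v h1)
    · exact (hUI v h1).1
  have hTS : ∀ v ∈ sT G S a b, v ∈ S₁ → v ∈ Y := by
    intro v hv hvS
    have hvI := sT_sub_sI _ _ _ hv
    have h0 := hG.sI_ne g hvI
    rcases (hmem v).1 hvS with h1 | h1 | h1 | h1 | h1
    · exact absurd h1 h0.1
    · exact absurd h1 h0.2
    · exact absurd (hC h1) (hG.not_cn_sT hv)
    · exact h1
    · exact absurd hvI (hUI v h1).2.2.2
  have hcl : ∀ y ∈ S₁, y ∈ sT G S a b → ∀ z ∈ sT G S a b, G.Adj y z → z ∈ S₁ :=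
    fun y hy hyT z hz hyz =>
      (hmem z).2 (Or.inr (Or.inr (Or.inr (Or.inl (hYcl y (hTS y hyT hy) z hz hyz)))))
  have hsT : sT G S₁ a b = Y := by
    rw [sT_inter hsub hcl]
    ext v
    rw [Finset.mem_inter]
    exact ⟨fun hv => hTS v hv.1 hv.2, fun hv => ⟨hY hv, (hmem v).2 (by tauto)⟩⟩
  have hcn : cn G S₁ a b = C := by
    rw [cn_inter hsub]
    ext v
    rw [Finset.mem_inter]
    refine ⟨fun hv => ?_, fun hv => ⟨hC hv, (hmem v).2 (by tauto)⟩⟩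
    have hvI := cn_sub_sI _ _ _ hv.1
    have h0 := hG.sI_ne g hvI
    rcases (hmem v).1 hv.2 with h1 | h1 | h1 | h1 | h1
    · exact absurd h1 h0.1
    · exact absurd h1 h0.2
    · exact h1
    · exact absurd hv.1 (hG.not_cn_sT (hY h1))
    · exact absurd hvI (hUI v h1).2.2.2
  have hsW : sW G S₁ a b = U := by
    rw [sW_inter hsub hcl]
    ext v
    rw [Finset.mem_inter]
    refine ⟨fun hv => ?_, fun hv => ⟨hU.1 hv, (hmem v).2 (by tauto)⟩⟩
    have h0 := mem_sW.1 hv.1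
    rcases (hmem v).1 hv.2 with h1 | h1 | h1 | h1 | h1
    · exact absurd h1 h0.2.1
    · exact absurd h1 h0.2.2.1
    · exact absurd (hCI v h1) h0.2.2.2
    · exact absurd (hYI v h1) h0.2.2.2
    · exact h1
  have g₁ : Good G S₁ a b := by
    refine ⟨(hmem a).2 (by tauto), (hmem b).2 (by tauto), by rw [hcn]; exact hCne, ?_⟩
    obtain ⟨y, hy⟩ := hYne
    rw [← hsT, mem_sT] at hy
    rw [pp_eq_ee]
    rcases hy with hy | hy
    · obtain ⟨z, hz, hyz⟩ := exists_sB hy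
      exact ee_pos hy hz hyz
    · obtain ⟨z, hz, hyz⟩ := exists_sB hy
      exact ee_pos hz hy hyz.symm
  have hss : S₁ ⊂ S := by
    refine ⟨hsub, fun hS => ?_⟩
    have hSS := Finset.Subset.antisymm hsub hS
    rw [hSS] at hsW hsT
    rcases hne with h1 | h1
    · exact h1 hsW.symm
    · exact h1 (hsT ▸ hYl)
  obtain ⟨M', hm', hMM, hpM, hc1, -⟩ := h.sub_good hss g₁
  have hk1 := hG.card_eq g₁
  have hk2 := (hG.linked_sT_iff g₁).1 (hsT.symm ▸ hYl)
  have hk3 := hG.card_pents_eq g₁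
  have hpos := g₁.p
  rw [hcn, hsW] at hk1 hk3
  have hmeet := hG.meet_eq g hU.1 hpc hsub g₁.ha g₁.hb
    (fun u hu => (hmem u).2 (by tauto))
    (fun u hu r hr hur => (hmem r).2 (by have := hJ u hu r hr hur; tauto)) hcl
  -- the pentagons meeting `U` number at most `M * |U|`
  have hbound : (meet G S U).card ≤ M * U.card := by
    rw [hmeet]
    set p := pp G S₁ a b
    set m := (meet G S₁ U).card
    rw [hk3, hk1, hk2] at hc1
    have h1 : (m : ℤ) + C.card * p + M' * M' + 3 * M' ≤ M' * (2 + C.card + (p + 1) + U.card) := by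
      have : C.card * p + m + M' * M' + 3 * M' ≤ M' * (2 + C.card + (p + 1) + U.card) := hc1
      zify at this
      linarith
    have h2 : ((M' : ℤ) - p) * ((C.card : ℤ) - M') ≤ 0 := by
      rcases Nat.lt_or_ge M' 2 with h3 | h3
      · have : M' = p := by omega
        rw [this]; simp
      · exact mul_nonpos_of_nonneg_of_nonpos (by omega) (by omega)
    have h3 : (m : ℤ) ≤ M' * U.card := by nlinarith
    have h4 : m ≤ M' * U.card := by exact_mod_cast h3
    exact h4.trans (Nat.mul_le_mul_right _ hMM)
  have hUS : U ⊆ S := fun v hv => (hUI v hv).1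
  obtain ⟨x, hx⟩ := g.c
  have hx' := mem_cn.1 hx
  -- deleting `U` keeps the frame, so it leads to the equality case for `S \ U`, a blow-up, where
  -- some vertex outside the frame has degree at most two
  obtain ⟨g₂, hp₂, hT₂, hW₂⟩ := g.sub (S' := S \ U) Finset.sdiff_subset
    (Finset.mem_sdiff.2 ⟨g.ha, fun e => (hUI a e).2.1 rfl⟩)
    (Finset.mem_sdiff.2 ⟨g.hb, fun e => (hUI b e).2.2.1 rfl⟩)
    (fun t ht => Finset.mem_sdiff.2 ⟨sT_sub _ _ _ ht, fun e => (hUI t e).2.2.2 (sT_sub_sI _ _ _ ht)⟩)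
    ⟨x, mem_cn.2 ⟨Finset.mem_sdiff.2 ⟨hx'.1, fun e => (hUI x e).2.2.2 (cn_sub_sI _ _ _ hx)⟩, hx'.2⟩⟩
  have hss₂ : S \ U ⊂ S := Finset.sdiff_ssubset hUS hUne
  obtain ⟨hd1, hd2⟩ := h.ih _ hss₂ M (h.max.of_sub hss₂.1 g₂ (hp₂.trans hp))
  have hcs := card_pents_sdiff (G := G) S U
  have hcard := Finset.card_sdiff_add_card_eq_card hUS
  have e1 : M * S.card = M * (S \ U).card + M * U.card := by rw [← hcard]; ring
  obtain ⟨h6, h7, h8⟩ := h.not_concl (by omega)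
  obtain ⟨u, v, hb⟩ := hd2 (by omega) (by omega)
  have hTl : Linked G (sT G S a b) := hT₂ ▸ hG.blow_linked_sT hb g₂
  have hUW : U ≠ sW G S a b := hne.resolve_right (fun h => h hTl)
  obtain ⟨w, hw, hwU⟩ : ∃ w ∈ sW G S a b, w ∉ U := by
    by_contra hcon
    push Not at hcon
    exact hUW (Finset.Subset.antisymm hU.1 hcon)
  obtain ⟨w, hw, hdeg⟩ := hG.blow_exists_small hb g₂ ⟨w, by
    rw [hW₂, Finset.mem_inter, Finset.mem_sdiff]
    exact ⟨hw, (mem_sW.1 hw).1, hwU⟩⟩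
  rw [hW₂, Finset.mem_inter, Finset.mem_sdiff] at hw
  have h9 := h.deg_sW hG g hp hw.1
  have h10 : nb G S w ⊆ nb G (S \ U) w := by
    intro s hs
    rw [mem_nb] at hs ⊢
    exact ⟨Finset.mem_sdiff.2 ⟨hs.1, fun hsU => hw.2.2 (hU.2 s hsU w hw.1 hs.2.symm)⟩, hs.2⟩
  have := Finset.card_le_card h10
  omega

/-! ### The components of the inner part of a frame -/

/-- The union of the components of `sI` adjacent to `K`. -/
noncomputable def touched (G : SimpleGraph V) (S : Finset V) (a b : V) (K : Finset V) : Finset V :=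
  (sI G S a b).filter fun r => ∃ k ∈ K, ∃ r' ∈ comp G (sI G S a b) r, G.Adj k r'

omit [Fintype V] in
theorem mem_touched {K : Finset V} {r : V} : r ∈ touched G S a b K ↔ r ∈ sI G S a b ∧
    ∃ k ∈ K, ∃ r' ∈ comp G (sI G S a b) r, G.Adj k r' := Finset.mem_filter

omit [Fintype V] in
theorem mem_touched_of_adj {K : Finset V} {k r : V} (hr : r ∈ sI G S a b) (hk : k ∈ K)
    (h : G.Adj k r) : r ∈ touched G S a b K := mem_touched.2 ⟨hr, k, hk, r, mem_comp_self hr, h⟩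

omit [Fintype V] in
theorem mem_touched_of_comp {K : Finset V} {r s : V} (hr : r ∈ touched G S a b K)
    (hs : s ∈ comp G (sI G S a b) r) : s ∈ touched G S a b K := by
  rw [mem_touched] at hr ⊢
  rw [comp_eq_of_mem hr.1 hs]
  exact ⟨comp_subset _ _ hs, hr.2⟩

theorem PT.comp_cn (hG : PT G) {x s : V} (hx : x ∈ cn G S a b)
    (hs : s ∈ comp G (sI G S a b) x) : s = x := by
  have hxI := cn_sub_sI _ _ _ hx
  refine comp_induction (s := (· = x)) rfl (fun u hu v hv huv hux => ?_) hxI s hs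
  subst hux
  rcases hG.adj_sI hxI (_root_.comp_subset _ _ hv) huv with h1 | h1
  · exact absurd hx (hG.not_cn_sT (sA_sub_sT _ _ _ h1.1))
  · exact absurd hx (hG.not_cn_sT (sB_sub_sT _ _ _ h1.1))

theorem PT.comp_sT (hG : PT G) {t s : V} (ht : t ∈ sT G S a b)
    (hs : s ∈ comp G (sI G S a b) t) : s ∈ sT G S a b := by
  refine comp_induction (s := (· ∈ sT G S a b)) ht (fun u hu v hv huv _ => ?_)
    (sT_sub_sI _ _ _ ht) s hs
  rcases hG.adj_sI (_root_.comp_subset _ _ hu) (_root_.comp_subset _ _ hv) huv with h1 | h1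
  · exact sB_sub_sT _ _ _ h1.2
  · exact sA_sub_sT _ _ _ h1.2

omit [Fintype V] in
theorem comp_touch_left {r : V} (hr : r ∈ sI G S a b) :
    ∃ s ∈ comp G (sI G S a b) r, G.Adj a s := by
  rcases mem_sI.1 hr with h1 | h1
  · exact ⟨r, mem_comp_self hr, (mem_cn.1 h1).2.1⟩
  rcases mem_sT.1 h1 with h2 | h2
  · exact ⟨r, mem_comp_self hr, (mem_sA.1 h2).2.1⟩
  · obtain ⟨z, hz, hrz⟩ := exists_sB h2
    exact ⟨z, comp_closed (mem_comp_self hr) (sT_sub_sI _ _ _ (sA_sub_sT _ _ _ hz)) hrz,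
      (mem_sA.1 hz).2.1⟩

omit [Fintype V] in
theorem comp_touch_right {r : V} (hr : r ∈ sI G S a b) :
    ∃ s ∈ comp G (sI G S a b) r, G.Adj b s := by
  rw [sI_symm] at hr ⊢
  exact comp_touch_left hr

/-- A connected set outside the frame touches at most two components of `sI`. -/
theorem PT.three_items (hG : PT G) (g : Good G S a b) {K : Finset V} (hK : K ⊆ sW G S a b)
    (hKl : Linked G K) {r₁ r₂ r₃ : V} (h₁ : r₁ ∈ touched G S a b K) (h₂ : r₂ ∈ touched G S a b K)
    (h₃ : r₃ ∈ touched G S a b K) (h₁₂ : r₂ ∉ comp G (sI G S a b) r₁)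
    (h₁₃ : r₃ ∉ comp G (sI G S a b) r₁) (h₂₃ : r₃ ∉ comp G (sI G S a b) r₂) : False := by
  obtain ⟨m₁, k₁, hk₁, s₁, hs₁, t₁⟩ := mem_touched.1 h₁
  obtain ⟨m₂, k₂, hk₂, s₂, hs₂, t₂⟩ := mem_touched.1 h₂
  obtain ⟨m₃, k₃, hk₃, s₃, hs₃, t₃⟩ := mem_touched.1 h₃
  obtain ⟨a₁, ha₁, u₁⟩ := comp_touch_left m₁
  obtain ⟨a₂, ha₂, u₂⟩ := comp_touch_left m₂
  obtain ⟨a₃, ha₃, u₃⟩ := comp_touch_left m₃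
  obtain ⟨b₁, hb₁, v₁⟩ := comp_touch_right m₁
  obtain ⟨b₂, hb₂, v₂⟩ := comp_touch_right m₂
  obtain ⟨b₃, hb₃, v₃⟩ := comp_touch_right m₃
  refine hG.noK33 (X₁ := {a}) (X₂ := {b}) (X₃ := K) ?_ (linked_singleton a) (linked_singleton b) hKl
    (linked_comp _ r₁) (linked_comp _ r₂) (linked_comp _ r₃) ⟨a, by simp, a₁, ha₁, u₁⟩
    ⟨a, by simp, a₂, ha₂, u₂⟩ ⟨a, by simp, a₃, ha₃, u₃⟩ ⟨b, by simp, b₁, hb₁, v₁⟩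
    ⟨b, by simp, b₂, hb₂, v₂⟩ ⟨b, by simp, b₃, hb₃, v₃⟩ ⟨k₁, hk₁, s₁, hs₁, t₁⟩
    ⟨k₂, hk₂, s₂, hs₂, t₂⟩ ⟨k₃, hk₃, s₃, hs₃, t₃⟩
  intro v
  have d₁₂ : v ∈ _ → v ∉ _ := fun h => Finset.disjoint_left.1 (comp_disjoint m₁ m₂ h₁₂) h
  have d₁₃ : v ∈ _ → v ∉ _ := fun h => Finset.disjoint_left.1 (comp_disjoint m₁ m₃ h₁₃) h
  have d₂₃ : v ∈ _ → v ∉ _ := fun h => Finset.disjoint_left.1 (comp_disjoint m₂ m₃ h₂₃) h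
  have hab := hG.good_ne g
  have q₁ : ∀ r, v ∈ comp G (sI G S a b) r → v ≠ a ∧ v ≠ b ∧ v ∉ K := fun r hv =>
    have hvI := _root_.comp_subset _ _ hv
    ⟨(hG.sI_ne g hvI).1, (hG.sI_ne g hvI).2, fun hvK => (mem_sW.1 (hK hvK)).2.2.2 hvI⟩
  have q₂ : v ∈ K → v ≠ a ∧ v ≠ b := fun hv => ⟨(mem_sW.1 (hK hv)).2.1, (mem_sW.1 (hK hv)).2.2.1⟩
  have p₁ := q₁ r₁
  have p₂ := q₁ r₂
  have p₃ := q₁ r₃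
  clear q₁ u₁ u₂ u₃ v₁ v₂ v₃ t₁ t₂ t₃ hKl hK h₁ h₂ h₃ g hG
  simp only [Finset.mem_singleton]
  refine ⟨fun h => ?_, fun h => ?_, fun h => ?_, fun h => ?_, fun h => ?_⟩ <;> grind

/-- A connected set outside the frame that is adjacent to two nonadjacent vertices of a component of
`sI` touches no other component. -/
theorem PT.one_item (hG : PT G) (g : Good G S a b) {K : Finset V} (hK : K ⊆ sW G S a b)
    (hKl : Linked G K) {t t' r k k' : V} (ht : t ∈ sT G S a b) (ht' : t' ∈ comp G (sI G S a b) t)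
    (hne : t ≠ t') (hadj : ¬ G.Adj t t') (hk : k ∈ K) (hkt : G.Adj k t) (hk' : k' ∈ K)
    (hkt' : G.Adj k' t') (hr : r ∈ touched G S a b K) : r ∈ comp G (sI G S a b) t := by
  by_contra hrD
  obtain ⟨x, hx⟩ := g.c
  have htI := sT_sub_sI _ _ _ ht
  have hKn : ∀ v ∈ K, v ∉ sI G S a b ∧ v ≠ a ∧ v ≠ b := fun v hv =>
    ⟨(mem_sW.1 (hK hv)).2.2.2, (mem_sW.1 (hK hv)).2.1, (mem_sW.1 (hK hv)).2.2.1⟩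
  obtain ⟨z, hz, hzt, hzt', hside⟩ := hG.attach_same_side g (D := comp G (sI G S a b) t)
    (fun v hv => hG.comp_sT ht hv) (linked_comp _ _) hKl hx
    (fun v hv => ⟨fun h => (hKn v hv).1 (comp_subset _ _ h), (hKn v hv).2.1, (hKn v hv).2.2,
      fun h => (hKn v hv).1 (h ▸ cn_sub_sI _ _ _ hx)⟩) (mem_comp_self htI) ht' hne hadj
    ⟨k, hk, hkt⟩ ⟨k', hk', hkt'⟩
  obtain ⟨hrI, k₂, hk₂, s₂, hs₂, t₂⟩ := mem_touched.1 hr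
  have hdis := Finset.disjoint_left.1 (comp_disjoint htI hrI hrD)
  have hEI : ∀ v ∈ comp G (sI G S a b) r, v ∈ sI G S a b := fun v hv => comp_subset _ _ hv
  have hDI : ∀ v ∈ comp G (sI G S a b) t, v ∈ sI G S a b := fun v hv => comp_subset _ _ hv
  have key : ∀ a' b', a' ≠ b' → (∀ v ∈ sI G S a b, v ≠ a' ∧ v ≠ b') → (∀ v ∈ K, v ≠ a' ∧ v ≠ b') →
      (∃ s ∈ comp G (sI G S a b) r, G.Adj a' s) → (∃ s ∈ comp G (sI G S a b) r, G.Adj b' s) →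
      G.Adj a' t → G.Adj a' t' → G.Adj b' z → False := by
    rintro a' b' hab hI hKn' ⟨s, hs, has⟩ ⟨s', hs', hbs⟩ hat hat' hbz
    refine hG.noK33 (X₁ := {a'}) (X₂ := {z}) (X₃ := K) (Y₁ := {t}) (Y₂ := {t'})
      (Y₃ := insert b' (comp G (sI G S a b) r)) ?_ (linked_singleton _) (linked_singleton _) hKl
      (linked_singleton _) (linked_singleton _) ((linked_comp _ _).insert hs' hbs)
      ⟨a', by simp, t, by simp, hat⟩ ⟨a', by simp, t', by simp, hat'⟩ ⟨a', by simp, s, by simp [hs], has⟩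
      ⟨z, by simp, t, by simp, hzt⟩ ⟨z, by simp, t', by simp, hzt'⟩ ⟨z, by simp, b', by simp, hbz.symm⟩
      ⟨k, hk, t, by simp, hkt⟩ ⟨k', hk', t', by simp, hkt'⟩ ⟨k₂, hk₂, s₂, by simp [hs₂], t₂⟩
    intro v
    have q1 := hI v
    have q2 := hKn' v
    have q3 : v ∈ K → v ∉ sI G S a b := fun hv => (hKn v hv).1
    have q4 := hEI v
    have q5 := hDI z hz
    have q6 := hDI t' ht'
    have q7 := @hdis v
    have q8 := hzt.ne
    have q9 := hzt'.ne
    have q10 := mem_comp_self (G := G) htI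
    clear hI hKn' hKn hEI hDI hdis has hbs hat hat' hbz hside hs₂ t₂ hkt hkt' hk hk' hk₂ g hG hx
    simp only [Finset.mem_insert, Finset.mem_singleton]
    refine ⟨fun h => ?_, fun h => ?_, fun h => ?_, fun h => ?_, fun h => ?_⟩ <;> grind
  have hab := hG.good_ne g
  have hA : ∀ {a b v : V}, v ∈ sA G S a b → G.Adj a v := fun hv => (mem_sA.1 hv).2.1
  rcases hside with ⟨h1, h2, h3⟩ | ⟨h1, h2, h3⟩
  · exact key a b hab (fun v hv => hG.sI_ne g hv) (fun v hv => (hKn v hv).2) (comp_touch_left hrI)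
      (comp_touch_right hrI) (hA h1) (hA h2) (hA h3)
  · exact key b a hab.symm (fun v hv => (hG.sI_ne g hv).symm) (fun v hv => (hKn v hv).2.symm)
      (comp_touch_right hrI) (comp_touch_left hrI) (hA h1) (hA h2) (hA h3)

/-- A connected set attached to two nonadjacent inner vertices touches exactly their components. -/
theorem PT.touched_eq (hG : PT G) (g : Good G S a b) {K : Finset V} (hK : K ⊆ sW G S a b)
    (hKl : Linked G K) {r r' k k' : V} (hr : r ∈ sI G S a b) (hr' : r' ∈ sI G S a b)
    (hne : r ≠ r') (hadj : ¬ G.Adj r r') (hk : k ∈ K) (hkr : G.Adj k r) (hk' : k' ∈ K)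
    (hkr' : G.Adj k' r') :
    touched G S a b K = comp G (sI G S a b) r ∪ comp G (sI G S a b) r' := by
  have m := mem_touched_of_adj hr hk hkr
  have m' := mem_touched_of_adj hr' hk' hkr'
  ext s
  rw [Finset.mem_union]
  constructor
  · intro hs
    by_contra hcon
    push Not at hcon
    by_cases hrr : r' ∈ comp G (sI G S a b) r
    · rcases mem_sI.1 hr with h1 | h1
      · exact hne (hG.comp_cn h1 hrr).symm
      · exact hcon.1 (hG.one_item g hK hKl h1 hrr hne hadj hk hkr hk' hkr' hs)
    · exact hG.three_items g hK hKl m m' hs hrr hcon.1 hcon.2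
  · rintro (hs | hs)
    · exact mem_touched_of_comp m hs
    · exact mem_touched_of_comp m' hs

omit [Fintype V] in
theorem comp_sW_eq {W : Finset V} {u v : V} (hu : u ∈ W) (hv : v ∈ W) (h : G.Adj u v) :
    comp G W v = comp G W u :=
  comp_eq_of_mem hu (comp_closed (mem_comp_self hu) hv h)

/-- Every pentagon stays within components that touch the same part of the frame. -/
theorem PT.pentClosed_touched (hG : PT G) (g : Good G S a b) (X : Finset V) :
    Closed G (sW G S a b) ((sW G S a b).filter fun w =>
      touched G S a b (comp G (sW G S a b) w) = X) ∧
    PentClosed G S a b ((sW G S a b).filter fun w =>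
      touched G S a b (comp G (sW G S a b) w) = X) := by
  set W := sW G S a b with hW
  set U := W.filter fun w => touched G S a b (comp G W w) = X with hU
  have hcl : Closed G W U := by
    refine ⟨Finset.filter_subset _ _, fun u hu v hv huv => ?_⟩
    rw [hU, Finset.mem_filter] at hu ⊢
    rw [comp_sW_eq hu.1 hv huv]
    exact ⟨hv, hu.2⟩
  refine ⟨hcl, fun Q hQS hQ hQU w hwQ hwW => ?_⟩
  by_contra hwU
  obtain ⟨w, hw, w', hw', r, hr, hwr, hwr', hc⟩ := hG.cross g hcl hQS hQ hQU ⟨w, hwQ, hwW, hwU⟩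
  rw [hU, Finset.mem_filter] at hw
  rw [Finset.mem_sdiff, hU, Finset.mem_filter] at hw'
  have hKw : ∀ w, comp G W w ⊆ sW G S a b := fun w => comp_subset _ _
  have m := mem_comp_self (G := G) hw.1
  have m' := mem_comp_self (G := G) hw'.1
  apply hw'.2
  refine ⟨hw'.1, ?_⟩
  rw [← hw.2]
  rcases hc with ⟨r', hr', hne, hnadj, ⟨h1, s, hs, h2, h3⟩ | ⟨h1, s, hs, h2, h3⟩⟩ |
    ⟨r₁, hr₁, r₂, hr₂, h1, h2, h3, h4, h5, h6, h7⟩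
  · have ms := comp_closed m' (Finset.mem_sdiff.1 hs).1 h2
    rw [hG.touched_eq g (hKw w) (linked_comp _ _) hr hr' hne.symm hnadj m hwr m h1,
      hG.touched_eq g (hKw w') (linked_comp _ _) hr hr' hne.symm hnadj m' hwr' ms h3]
  · have ms := comp_closed m (Finset.mem_filter.1 hs).1 h2
    rw [hG.touched_eq g (hKw w) (linked_comp _ _) hr hr' hne.symm hnadj m hwr ms h3,
      hG.touched_eq g (hKw w') (linked_comp _ _) hr hr' hne.symm hnadj m' hwr' m' h1]
  · rw [hG.touched_eq g (hKw w) (linked_comp _ _) hr hr₁ h6 h4 m hwr m h1,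
      hG.touched_eq g (hKw w') (linked_comp _ _) hr hr₂ h7 h5 m' hwr' m' h2,
      comp_sW_eq hr₁ hr₂ h3]

/-- Either the tree part is connected and all components outside the frame touch the same components
of the inner part, or the component of `w₀` touches two different trees. Otherwise the components
attached like one chosen component form a set excluded by `Irr.no_small_attachment`. -/
theorem Irr.touched_cases (hG : PT G) (h : Irr G S M) (g : Good G S a b) (hp : pp G S a b = M)
    {w₀ : V} (hw₀ : w₀ ∈ sW G S a b) :
    (Linked G (sT G S a b) ∧ ∀ w ∈ sW G S a b, touched G S a b (comp G (sW G S a b) w) =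
      touched G S a b (comp G (sW G S a b) w₀)) ∨
    ¬ Linked G (touched G S a b (comp G (sW G S a b) w₀) ∩ sT G S a b) := by
  by_contra hcon
  push Not at hcon
  obtain ⟨hcon1, hcon2⟩ := hcon
  set W := sW G S a b with hW
  set X := touched G S a b (comp G W w₀) with hX
  obtain ⟨hcl, hpc⟩ := hG.pentClosed_touched g X
  rw [← hW] at hcl hpc
  set U := W.filter fun w => touched G S a b (comp G W w) = X with hU
  have hUX : ∀ u ∈ U, ∀ r ∈ sI G S a b, G.Adj u r → r ∈ X := by
    intro u hu r hr hur
    rw [hU, Finset.mem_filter] at hu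
    rw [← hu.2]
    exact mem_touched_of_adj hr (mem_comp_self hu.1) hur
  obtain ⟨x, hx⟩ := g.c
  -- the common neighbours involved
  obtain ⟨C, hC, hCne, hC2, hCX⟩ : ∃ C ⊆ cn G S a b, C.Nonempty ∧ C.card ≤ 2 ∧
      ∀ r ∈ X, r ∈ cn G S a b → r ∈ C := by
    rcases (X ∩ cn G S a b).eq_empty_or_nonempty with h0 | h0
    · refine ⟨{x}, by simpa using hx, by simp, by simp, fun r hr hrc => ?_⟩
      have : r ∈ X ∩ cn G S a b := Finset.mem_inter.2 ⟨hr, hrc⟩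
      rw [h0] at this
      simp at this
    · refine ⟨_, Finset.inter_subset_right, h0, ?_, fun r hr hrc => Finset.mem_inter.2 ⟨hr, hrc⟩⟩
      by_contra hc
      obtain ⟨r₁, h₁, r₂, h₂, r₃, h₃, n₁₂, n₁₃, n₂₃⟩ := Finset.two_lt_card.1 (not_le.1 hc)
      rw [Finset.mem_inter] at h₁ h₂ h₃
      exact hG.three_items g (comp_subset _ _) (linked_comp _ _) h₁.1 h₂.1 h₃.1
        (fun e => n₁₂ (hG.comp_cn h₁.2 e).symm) (fun e => n₁₃ (hG.comp_cn h₁.2 e).symm)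
        (fun e => n₂₃ (hG.comp_cn h₂.2 e).symm)
  -- the tree involved
  obtain ⟨Y, hY, hYne, hYl, hYcl, hYX⟩ : ∃ Y ⊆ sT G S a b, Y.Nonempty ∧ Linked G Y ∧
      (∀ y ∈ Y, ∀ z ∈ sT G S a b, G.Adj y z → z ∈ Y) ∧ ∀ r ∈ X, r ∈ sT G S a b → r ∈ Y := by
    rcases (X ∩ sT G S a b).eq_empty_or_nonempty with h0 | h0
    · obtain ⟨y, hy, -⟩ := g.exists_path
      have hyT := sA_sub_sT _ _ _ hy
      refine ⟨comp G (sI G S a b) y, fun v hv => hG.comp_sT hyT hv,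
        ⟨y, mem_comp_self (sT_sub_sI _ _ _ hyT)⟩, linked_comp _ _,
        fun u hu v hv huv => comp_closed hu (sT_sub_sI _ _ _ hv) huv, fun r hr hrc => ?_⟩
      have : r ∈ X ∩ sT G S a b := Finset.mem_inter.2 ⟨hr, hrc⟩
      rw [h0] at this
      simp at this
    · refine ⟨_, Finset.inter_subset_right, h0, hcon2, fun y hy z hz hyz => ?_,
        fun r hr hrc => Finset.mem_inter.2 ⟨hr, hrc⟩⟩
      rw [Finset.mem_inter] at hy ⊢
      exact ⟨mem_touched_of_comp hy.1 (comp_closed (mem_comp_self (sT_sub_sI _ _ _ hy.2))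
        (sT_sub_sI _ _ _ hz) hyz), hz⟩
  refine h.no_small_attachment hG g hp hcl ⟨w₀, Finset.mem_filter.2 ⟨hw₀, rfl⟩⟩ hpc hC hCne hC2
    hY hYne hYl hYcl
    (fun u hu r hr hur => ?_) ?_
  · rcases mem_sI.1 hr with h1 | h1
    · exact Or.inl (hCX r (hUX u hu r hr hur) h1)
    · exact Or.inr (hYX r (hUX u hu r hr hur) h1)
  · by_contra hne
    push Not at hne
    obtain ⟨w, hw, hwX⟩ := hcon1 hne.2
    have hwU : w ∈ U := hne.1.symm ▸ hw
    exact hwX (Finset.mem_filter.1 hwU).2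

theorem PT.exists_leaf (hG : PT G) (g : Good G S a b) :
    ∃ y ∈ sT G S a b, (nb G (sT G S a b) y).card ≤ 1 := by
  by_contra hcon
  push Not at hcon
  have h1 := hG.deg2_sT S a b
  have h2 := hG.pp_lt g
  have h3 : (sT G S a b).card * 2 ≤ deg2 G (sT G S a b) := by
    rw [← smul_eq_mul]
    exact Finset.card_nsmul_le_sum _ _ _ hcon
  omega

/-- If there are several common neighbours, only these have neighbours outside a linked frame. -/
theorem Irr.not_adj_sT (hG : PT G) (h : Irr G S M) (g : Good G S a b) (hp : pp G S a b = M)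
    (hl : Linked G (sT G S a b)) (hc : 2 ≤ (cn G S a b).card) {t w : V} (ht : t ∈ sT G S a b)
    (hw : w ∈ sW G S a b) : ¬ G.Adj t w := by
  intro htw
  have hu : ∀ w' ∈ sW G S a b, touched G S a b (comp G (sW G S a b) w') =
      touched G S a b (comp G (sW G S a b) w) := by
    rcases h.touched_cases hG g hp hw with h1 | h1
    · exact h1.2
    · exfalso
      have hTX : sT G S a b ⊆ touched G S a b (comp G (sW G S a b) w) := fun s hs =>
        mem_touched_of_comp (mem_touched_of_adj (sT_sub_sI _ _ _ ht) (mem_comp_self hw) htw.symm)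
          (hl.subset_comp (sT_sub_sI _ _ _) ht hs)
      rw [Finset.inter_eq_right.2 hTX] at h1
      exact h1 hl
  obtain ⟨x₁, h₁, x₂, h₂, hne⟩ := Finset.one_lt_card.1 (show 1 < (cn G S a b).card by omega)
  have hx : ∀ x ∈ cn G S a b, x ∈ touched G S a b (comp G (sW G S a b) w) := by
    intro x hx
    obtain ⟨w', hw', hxw⟩ := h.deg_cn hG g hp hx hc
    rw [← hu w' hw']
    exact mem_touched_of_adj (cn_sub_sI _ _ _ hx) (mem_comp_self hw') hxw.symm
  have hxt : ∀ x ∈ cn G S a b, t ∉ comp G (sI G S a b) x := fun x hx e =>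
    hG.not_cn_sT ht (hG.comp_cn hx e ▸ hx)
  exact hG.three_items g (comp_subset _ _) (linked_comp _ _) (hx x₁ h₁) (hx x₂ h₂)
    (mem_touched_of_adj (sT_sub_sI _ _ _ ht) (mem_comp_self hw) htw.symm)
    (fun e => hne (hG.comp_cn h₁ e).symm) (hxt x₁ h₁) (hxt x₂ h₂)

/-- Two different trees are touched if the tree part that is touched is not connected. -/
theorem PT.exists_two_items (hG : PT G) {K : Finset V}
    (hl : ¬ Linked G (touched G S a b K ∩ sT G S a b)) : ∃ t₁ ∈ sT G S a b, ∃ t₂ ∈ sT G S a b,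
      t₁ ∈ touched G S a b K ∧ t₂ ∈ touched G S a b K ∧ t₂ ∉ comp G (sI G S a b) t₁ := by
  by_contra hcon
  push Not at hcon
  apply hl
  rcases (touched G S a b K ∩ sT G S a b).eq_empty_or_nonempty with h0 | ⟨t, ht⟩
  · rw [h0]
    exact fun s _ u hu => by simp at hu
  · have ht' := Finset.mem_inter.1 ht
    have : touched G S a b K ∩ sT G S a b = comp G (sI G S a b) t := by
      ext s
      rw [Finset.mem_inter]
      exact ⟨fun hs => hcon t ht'.2 s hs.2 ht'.1 hs.1,
        fun hs => ⟨mem_touched_of_comp ht'.1 hs, hG.comp_sT ht'.2 hs⟩⟩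
    rw [this]
    exact linked_comp _ _

/-- A maximal pair of a minimal counterexample has a single common neighbour. -/
theorem Irr.card_cn (hG : PT G) (h : Irr G S M) (hM : 2 ≤ M) (g : Good G S a b)
    (hp : pp G S a b = M) : (cn G S a b).card = 1 := by
  by_contra hc
  have hc2 : 2 ≤ (cn G S a b).card := by
    have := Finset.card_pos.2 g.c
    omega
  by_cases hl : Linked G (sT G S a b)
  · obtain ⟨y, hy, hyl⟩ := hG.exists_leaf g
    obtain ⟨w, hw, hyw⟩ := h.exists_adj_leaf hG hM g hp hy hyl
    exact h.not_adj_sT hG g hp hl hc2 hy hw hyw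
  · obtain ⟨x, hx⟩ := g.c
    obtain ⟨w, hw, hxw⟩ := h.deg_cn hG g hp hx hc2
    obtain ⟨t₁, ht₁, t₂, ht₂, m₁, m₂, h12⟩ := hG.exists_two_items
      ((h.touched_cases hG g hp hw).resolve_left fun h1 => hl h1.1)
    have hxt : ∀ t ∈ sT G S a b, x ∉ comp G (sI G S a b) t := fun t ht e =>
      hG.not_cn_sT (hG.comp_sT ht e) hx
    exact hG.three_items g (comp_subset _ _) (linked_comp _ _) m₁ m₂
      (mem_touched_of_adj (cn_sub_sI _ _ _ hx) (mem_comp_self hw) hxw.symm) h12 (hxt t₁ ht₁)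
      (hxt t₂ ht₂)

end

/-! ### Maximal frames with a connected tree part -/

section
variable {V : Type} {G : SimpleGraph V} {S S' U : Finset V} {a b : V} {M : ℕ} [Fintype V]

/-- The tree part of a frame contains no cycle. -/
theorem PT.exists_deg_le_one (hG : PT G) (g : Good G S a b) {X : Finset V} (hX : X ⊆ sT G S a b)
    (hne : X.Nonempty) : ∃ v ∈ X, ∀ p ∈ X, ∀ q ∈ X, G.Adj v p → G.Adj v q → p = q := by
  by_contra hcon
  push Not at hcon
  have h1 := hG.deg2_forest g hX hne
  have h2 : X.card * 2 ≤ deg2 G X := by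
    rw [← smul_eq_mul]
    refine Finset.card_nsmul_le_sum _ _ _ fun v hv => ?_
    obtain ⟨p, hp, q, hq, h1, h2, h3⟩ := hcon v hv
    exact Finset.one_lt_card.2 ⟨p, mem_nb.2 ⟨hp, h1⟩, q, mem_nb.2 ⟨hq, h2⟩, h3⟩
  omega

theorem PT.comp_eq_sT (hG : PT G) (hl : Linked G (sT G S a b)) {t : V} (ht : t ∈ sT G S a b) :
    comp G (sI G S a b) t = sT G S a b :=
  Finset.Subset.antisymm (fun _ hv => hG.comp_sT ht hv) (hl.subset_comp (sT_sub_sI _ _ _) ht)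

/-- If the tree part is connected, all components outside the frame touch the same inner components.
-/
theorem Irr.touched_const (hG : PT G) (h : Irr G S M) (g : Good G S a b) (hp : pp G S a b = M)
    (hl : Linked G (sT G S a b)) {w w' : V} (hw : w ∈ sW G S a b) (hw' : w' ∈ sW G S a b) :
    touched G S a b (comp G (sW G S a b) w) = touched G S a b (comp G (sW G S a b) w') := by
  rcases h.touched_cases hG g hp hw' with h1 | h1
  · exact h1.2 w hw
  · obtain ⟨t₁, ht₁, t₂, ht₂, -, -, h12⟩ := hG.exists_two_items h1
    exact absurd (by rw [hG.comp_eq_sT hl ht₁]; exact ht₂) h12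

omit [Fintype V] in
theorem sW_facts {w : V} (hw : w ∈ sW G S a b) :
    w ∈ S ∧ w ≠ a ∧ w ≠ b ∧ w ∉ cn G S a b ∧ w ∉ sT G S a b := by
  obtain ⟨h1, h2, h3, h4⟩ := mem_sW.1 hw
  rw [mem_sI] at h4
  tauto

/-- In a maximal linked frame no component of the rest is adjacent to two vertices on the same side
of the tree. -/
theorem Irr.no_spread (hG : PT G) (h : Irr G S M) (hM : 2 ≤ M) (g : Good G S a b)
    (hp : pp G S a b = M) (hl : Linked G (sT G S a b)) {w₀ y y' k k' : V}
    (hw₀ : w₀ ∈ sW G S a b) (hy : y ∈ sA G S a b) (hy' : y' ∈ sA G S a b) (hne : y ≠ y')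
    (hk : k ∈ comp G (sW G S a b) w₀) (hky : G.Adj k y) (hk' : k' ∈ comp G (sW G S a b) w₀)
    (hky' : G.Adj k' y') : False := by
  set W := sW G S a b with hW
  set T := sT G S a b with hT
  obtain ⟨x, hx⟩ := g.c
  have hC : ∀ x' ∈ cn G S a b, x' = x := fun x' hx' =>
    Finset.card_le_one.1 (h.card_cn hG hM g hp).le x' hx' x hx
  have hx' := mem_cn.1 hx
  have hxI := hG.sI_ne g (cn_sub_sI _ _ _ hx)
  have hKW : ∀ w, comp G W w ⊆ W := fun w => comp_subset _ _
  have hKn : ∀ w, ∀ v ∈ comp G W w, v ∉ T ∧ v ≠ a ∧ v ≠ b ∧ v ≠ x := fun w v hv =>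
    have := sW_facts (hKW w hv)
    ⟨this.2.2.2.2, this.2.1, this.2.2.1, fun e => this.2.2.2.1 (e ▸ hx)⟩
  have hTn : ∀ v ∈ T, v ≠ a ∧ v ≠ b ∧ v ≠ x := fun v hv =>
    ⟨(hG.sI_ne g (sT_sub_sI _ _ _ hv)).1, (hG.sI_ne g (sT_sub_sI _ _ _ hv)).2,
      fun e => hG.not_cn_sT hv (e ▸ hx)⟩
  have hAT : ∀ v ∈ sA G S a b, v ∈ T := fun v hv => sA_sub_sT _ _ _ hv
  have hBT : ∀ v ∈ sA G S b a, v ∈ T := fun v hv => sB_sub_sT _ _ _ hv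
  have hA : ∀ {a b v : V}, v ∈ sA G S a b → G.Adj a v := fun hv => (mem_sA.1 hv).2.1
  have hAn : ∀ {u v : V}, u ∈ sA G S a b → v ∈ sA G S a b → ¬ G.Adj u v := fun hu hv =>
    hG.indep (hA hu) (hA hv)
  -- two nonadjacent attached vertices of the tree are on the same side, with a common neighbour
  have hside : ∀ w, ∀ t ∈ T, ∀ t' ∈ T, t ≠ t' → ¬ G.Adj t t' → (∃ k ∈ comp G W w, G.Adj k t) →
      (∃ k ∈ comp G W w, G.Adj k t') → ∃ z ∈ T, G.Adj z t ∧ G.Adj z t' ∧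
      ((t ∈ sA G S a b ∧ t' ∈ sA G S a b ∧ z ∈ sA G S b a) ∨
        (t ∈ sA G S b a ∧ t' ∈ sA G S b a ∧ z ∈ sA G S a b)) :=
    fun w t ht t' ht' hne hadj hkt hkt' => hG.attach_same_side g (Finset.Subset.refl _) hl
      (linked_comp _ _) hx (hKn w) ht ht' hne hadj hkt hkt'
  obtain ⟨z, hzT, hzy, hzy', hz⟩ := hside w₀ y (hAT y hy) y' (hAT y' hy') hne (hAn hy hy')
    ⟨k, hk, hky⟩ ⟨k', hk', hky'⟩
  have hzB : z ∈ sA G S b a := by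
    rcases hz with h1 | h1
    · exact h1.2.2
    · exact absurd h1.1 (hG.not_sA_sB hy)
  have hxW : ∀ w ∈ W, ¬ G.Adj w x := by
    intro w hw hwx
    have h1 := mem_touched_of_adj (cn_sub_sI _ _ _ hx) (mem_comp_self (G := G) hw) hwx
    rw [h.touched_const hG g hp hl hw hw₀] at h1
    have h2 := hG.one_item g (hKW w₀) (linked_comp _ _) (hAT y hy) (t' := y')
      (by rw [hG.comp_eq_sT hl (hAT y hy)]; exact hAT y' hy') hne (hAn hy hy') hk hky hk' hky' h1
    exact hG.not_cn_sT (hG.comp_sT (hAT y hy) h2) hx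
  -- two neighbours of `z` are not accompanied by a third connected set
  have hK33 : ∀ w, (∃ k ∈ comp G W w, G.Adj k y) → (∃ k ∈ comp G W w, G.Adj k y') →
      ∀ Y : Finset V, Linked G Y → (∀ v ∈ Y, v ∉ comp G W w ∧ v ≠ a ∧ v ≠ z ∧ v ≠ y ∧ v ≠ y') →
      (∃ v ∈ Y, G.Adj a v) → (∃ v ∈ Y, G.Adj z v) → (∃ k ∈ comp G W w, ∃ v ∈ Y, G.Adj k v) →
      False := by
    rintro w ⟨k, hk, hky⟩ ⟨k', hk', hky'⟩ Y hYl hYn ⟨v₁, hv₁, e₁⟩ ⟨v₂, hv₂, e₂⟩ ⟨k₃, hk₃, v₃, hv₃, e₃⟩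
    refine hG.noK33 (X₁ := {a}) (X₂ := {z}) (X₃ := comp G W w) (Y₁ := {y}) (Y₂ := {y'}) (Y₃ := Y) ?_
      (linked_singleton _) (linked_singleton _) (linked_comp _ _) (linked_singleton _)
      (linked_singleton _) hYl ⟨a, by simp, y, by simp, hA hy⟩ ⟨a, by simp, y', by simp, hA hy'⟩
      ⟨a, by simp, v₁, hv₁, e₁⟩ ⟨z, by simp, y, by simp, hzy⟩ ⟨z, by simp, y', by simp, hzy'⟩
      ⟨z, by simp, v₂, hv₂, e₂⟩ ⟨k, hk, y, by simp, hky⟩ ⟨k', hk', y', by simp, hky'⟩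
      ⟨k₃, hk₃, v₃, hv₃, e₃⟩
    intro v
    have q1 := hKn w v
    have q2 := hYn v
    have q3 := (hTn z hzT).1
    have q4 := hzy.ne
    have q5 := hzy'.ne
    have q6 := hAT y hy
    have q7 := hAT y' hy'
    have q8 := (hTn y q6).1
    have q9 := (hTn y' q7).1
    clear hKn hYn hTn hside hxW hC hKW hAT hBT hAn hk hky hk' hky' hA
    simp only [Finset.mem_singleton]
    refine ⟨fun h => ?_, fun h => ?_, fun h => ?_, fun h => ?_, fun h => ?_⟩ <;> grind
  have hbW : ∀ w, (∃ k ∈ comp G W w, G.Adj k y) → (∃ k ∈ comp G W w, G.Adj k y') →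
      ∀ k ∈ comp G W w, ¬ G.Adj k b := by
    intro w h1 h2 k hk hkb
    refine hK33 w h1 h2 {b, x} (linked_pair hx'.2.2) ?_ ⟨x, by simp, hx'.2.1⟩
      ⟨b, by simp, (hA hzB).symm⟩ ⟨k, hk, b, by simp, hkb⟩
    intro v hv
    rw [Finset.mem_insert, Finset.mem_singleton] at hv
    rcases hv with rfl | rfl
    · exact ⟨fun e => (hKn w _ e).2.2.1 rfl, (hG.good_ne g).symm, (hTn z hzT).2.1.symm,
        (hTn y (hAT y hy)).2.1.symm, (hTn y' (hAT y' hy')).2.1.symm⟩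
    · exact ⟨fun e => (hKn w _ e).2.2.2 rfl, hxI.1, (hTn z hzT).2.2.symm,
        (hTn y (hAT y hy)).2.2.symm, (hTn y' (hAT y' hy')).2.2.symm⟩
  -- only `y`, `y'` and `z` may be attached to a component attached to `y` and `y'`
  have hatt : ∀ w, (∃ k ∈ comp G W w, G.Adj k y) → (∃ k ∈ comp G W w, G.Adj k y') →
      ∀ r ∈ T, (∃ k ∈ comp G W w, G.Adj k r) → r = y ∨ r = y' ∨ r = z := by
    intro w h1 h2 r hr h3
    by_contra hcon
    push Not at hcon
    obtain ⟨hry, hry', hrz⟩ := hcon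
    have hyT := hAT y hy
    have hyT' := hAT y' hy'
    rcases mem_sT.1 hr with hrA | hrB
    · obtain ⟨z₁, hz₁T, e1, e2, -⟩ := hside w y hyT r hr hry.symm (hAn hy hrA) h1 h3
      obtain ⟨z₂, hz₂T, e3, e4, -⟩ := hside w y' hyT' r hr hry'.symm (hAn hy' hrA) h2 h3
      by_cases hzr : G.Adj z r
      · obtain ⟨k, hk, hkr⟩ := h3
        refine hK33 w h1 h2 {r} (linked_singleton r) ?_ ⟨r, by simp, hA hrA⟩ ⟨r, by simp, hzr⟩
          ⟨k, hk, r, by simp, hkr⟩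
        intro v hv
        rw [Finset.mem_singleton] at hv
        subst hv
        exact ⟨fun e => (hKn w _ e).1 hr, (hTn _ hr).1, hrz, hry, hry'⟩
      · have hz₁ : z₁ ≠ z := fun e => hzr (e ▸ e2)
        have hz₂ : z₂ ≠ z := fun e => hzr (e ▸ e4)
        by_cases hzz : z₁ = z₂
        · subst hzz
          obtain ⟨v, hv, hv'⟩ := hG.exists_deg_le_one g (X := {y, z, y', z₁}) (by
            intro v hv
            simp only [Finset.mem_insert, Finset.mem_singleton] at hv
            rcases hv with rfl | rfl | rfl | rfl <;> assumption) ⟨y, by simp⟩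
          simp only [Finset.mem_insert, Finset.mem_singleton] at hv
          rcases hv with rfl | rfl | rfl | rfl
          · exact hz₁ (hv' z₁ (by simp) z (by simp) e1.symm hzy.symm)
          · exact hne (hv' y (by simp) y' (by simp) hzy hzy')
          · exact hz₁ (hv' z₁ (by simp) z (by simp) e3.symm hzy'.symm)
          · exact hne (hv' y (by simp) y' (by simp) e1 e3)
        · obtain ⟨v, hv, hv'⟩ := hG.exists_deg_le_one g (X := {y, z, y', z₂, r, z₁}) (by
            intro v hv
            simp only [Finset.mem_insert, Finset.mem_singleton] at hv
            rcases hv with rfl | rfl | rfl | rfl | rfl | rfl <;> assumption) ⟨y, by simp⟩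
          simp only [Finset.mem_insert, Finset.mem_singleton] at hv
          rcases hv with rfl | rfl | rfl | rfl | rfl | rfl
          · exact hz₁ (hv' z₁ (by simp) z (by simp) e1.symm hzy.symm)
          · exact hne (hv' y (by simp) y' (by simp) hzy hzy')
          · exact hz₂ (hv' z₂ (by simp) z (by simp) e3.symm hzy'.symm)
          · exact hry' (hv' _ (by simp) y' (by simp) e4 e3)
          · exact hzz (hv' z₁ (by simp) z₂ (by simp) e2.symm e4.symm)
          · exact hry (hv' _ (by simp) y (by simp) e2 e1)
    · have hadj : ∀ t ∈ sA G S a b, t ≠ r → (∃ k ∈ comp G W w, G.Adj k t) → G.Adj r t := by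
        intro t ht htr h4
        by_contra hcon
        obtain ⟨_, _, _, _, h5⟩ := hside w t (hAT t ht) r hr htr (fun e => hcon e.symm) h4 h3
        rcases h5 with h5 | h5
        · exact hG.not_sA_sB h5.2.1 hrB
        · exact hG.not_sA_sB ht h5.1
      have e1 := hadj y hy hry.symm h1
      have e2 := hadj y' hy' hry'.symm h2
      obtain ⟨v, hv, hv'⟩ := hG.exists_deg_le_one g (X := {y, z, y', r}) (by
        intro v hv
        simp only [Finset.mem_insert, Finset.mem_singleton] at hv
        rcases hv with rfl | rfl | rfl | rfl <;> assumption) ⟨y, by simp⟩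
      simp only [Finset.mem_insert, Finset.mem_singleton] at hv
      rcases hv with rfl | rfl | rfl | rfl
      · exact hrz (hv' r (by simp) z (by simp) e1.symm hzy.symm)
      · exact hne (hv' y (by simp) y' (by simp) hzy hzy')
      · exact hrz (hv' r (by simp) z (by simp) e2.symm hzy'.symm)
      · exact hne (hv' y (by simp) y' (by simp) e1 e2)
  -- `U` consists of the components attached to `y` and `y'`; no pentagon leads from `U` to the
  -- other outside vertices
  set U := W.filter fun w => (∃ k ∈ comp G W w, G.Adj k y) ∧ ∃ k ∈ comp G W w, G.Adj k y' with hU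
  have hmU : ∀ w, w ∈ U ↔ w ∈ W ∧ (∃ k ∈ comp G W w, G.Adj k y) ∧ ∃ k ∈ comp G W w, G.Adj k y' :=
    fun w => Finset.mem_filter
  have hcl : Closed G W U := by
    refine ⟨Finset.filter_subset _ _, fun u hu v hv huv => ?_⟩
    rw [hmU] at hu ⊢
    rw [comp_sW_eq hu.1 hv huv]
    exact ⟨hv, hu.2⟩
  have hpc : PentClosed G S a b U := by
    intro Q hQS hQ hQU w hwQ hwW
    by_contra hwU
    obtain ⟨w, hw, w', hw', r, hr, hwr, hwr', hc⟩ := hG.cross g hcl hQS hQ hQU ⟨w, hwQ, hwW, hwU⟩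
    rw [hmU] at hw
    rw [Finset.mem_sdiff, hmU] at hw'
    have m := mem_comp_self (G := G) hw.1
    have m' := mem_comp_self (G := G) hw'.1
    have hIT : ∀ w ∈ W, ∀ r ∈ sI G S a b, G.Adj w r → r ∈ T := by
      intro w hw r hr hwr
      rcases mem_sI.1 hr with h1 | h1
      · exact absurd (hC r h1 ▸ hwr) (hxW w hw)
      · exact h1
    have hrT := hIT w hw.1 r hr hwr
    have hI : ∀ r' ∈ sI G S a b, r' ≠ r → ¬ G.Adj r r' → ∀ s ∈ comp G W w, G.Adj s r' →
        ∀ s' ∈ comp G W w', G.Adj s' r' → False := by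
      intro r' hr' hne' hnadj s hs hsr' s' hs' hsr''
      have hrT' := hIT s (hKW _ hs) r' hr' hsr'
      have e1 := hatt w hw.2.1 hw.2.2 r hrT ⟨w, m, hwr⟩
      have e2 := hatt w hw.2.1 hw.2.2 r' hrT' ⟨s, hs, hsr'⟩
      apply hw'.2
      refine ⟨hw'.1, ?_⟩
      rcases e1 with rfl | rfl | rfl <;> rcases e2 with rfl | rfl | rfl
      · exact absurd rfl hne'
      · exact ⟨⟨w', m', hwr'⟩, s', hs', hsr''⟩
      · exact absurd hzy.symm hnadj
      · exact ⟨⟨s', hs', hsr''⟩, w', m', hwr'⟩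
      · exact absurd rfl hne'
      · exact absurd hzy'.symm hnadj
      · exact absurd hzy hnadj
      · exact absurd hzy' hnadj
      · exact absurd rfl hne'
    rcases hc with ⟨r', hr', hne', hnadj, ⟨h1, s, hs, h2, h3⟩ | ⟨h1, s, hs, h2, h3⟩⟩ |
      ⟨r₁, hr₁, r₂, hr₂, h1, h2, h3, h4, h5, h6, h7⟩
    · exact hI r' hr' hne' hnadj w m h1 s (comp_closed m' (Finset.mem_sdiff.1 hs).1 h2) h3
    · exact hI r' hr' hne' hnadj s (comp_closed m ((hmU s).1 hs).1 h2) h3 w' m' h1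
    · obtain ⟨_, _, _, _, e1⟩ := hside w r hrT r₁ (hIT w hw.1 r₁ hr₁ h1) h6 h4 ⟨w, m, hwr⟩ ⟨w, m, h1⟩
      obtain ⟨_, _, _, _, e2⟩ := hside w' r hrT r₂ (hIT w' hw'.1 r₂ hr₂ h2) h7 h5 ⟨w', m', hwr'⟩
        ⟨w', m', h2⟩
      rcases e1 with e1 | e1 <;> rcases e2 with e2 | e2
      · exact hAn e1.2.1 e2.2.1 h3
      · exact hG.not_sA_sB e1.1 e2.1
      · exact hG.not_sA_sB e2.1 e1.1
      · exact hG.indep (hA e1.2.1) (hA e2.2.1) h3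
  have hUW : U = W := by
    by_contra hcon
    refine h.no_small_attachment hG g hp hcl ⟨w₀, (hmU w₀).2 ⟨hw₀, ⟨k, hk, hky⟩, k', hk', hky'⟩⟩ hpc
      (Finset.singleton_subset_iff.2 hx) (Finset.singleton_nonempty x) (by simp)
      (Finset.Subset.refl _) ⟨y, hAT y hy⟩ hl (fun _ _ z hz _ => hz) (fun u hu r hr hur => ?_)
      (Or.inl hcon)
    rcases mem_sI.1 hr with h1 | h1
    · exact absurd (hC r h1 ▸ hur) (hxW u (hcl.1 hu))
    · exact Or.inr h1
  have hall : ∀ w ∈ W, (∃ k ∈ comp G W w, G.Adj k y) ∧ ∃ k ∈ comp G W w, G.Adj k y' :=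
    fun w hw => ((hmU w).1 (hUW ▸ hw)).2
  -- the tree is the path `y z y'`
  have hleaf : ∀ t ∈ T, (nb G T t).card ≤ 1 → t = y ∨ t = y' := by
    intro t ht htl
    obtain ⟨w, hw, htw⟩ := h.exists_adj_leaf hG hM g hp ht htl
    rcases hatt w (hall w hw).1 (hall w hw).2 t ht ⟨w, mem_comp_self hw, htw.symm⟩ with e | e | rfl
    · exact Or.inl e
    · exact Or.inr e
    · exact absurd (Finset.card_le_one.1 htl y (mem_nb.2 ⟨hAT y hy, hzy⟩) y'
        (mem_nb.2 ⟨hAT y' hy', hzy'⟩)) hne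
  have hstar : ∀ t ∈ T, t ≠ z → G.Adj z t := by
    intro t ht htz
    by_contra hcon
    obtain ⟨l, hl1, hl2, hl3, hl4⟩ := hG.exists_leaf_away g hl hzT ⟨t, ht, htz, hcon⟩
    rcases hleaf l hl1 hl4 with rfl | rfl
    · exact hl3 hzy
    · exact hl3 hzy'
  have hBz : ∀ t ∈ sA G S b a, t = z := by
    intro t ht
    by_contra hcon
    exact hG.indep (hA hzB) (hA ht) (hstar t (hBT t ht) hcon)
  have hT3 : T ⊆ {z, y, y'} := by
    intro t ht
    simp only [Finset.mem_insert, Finset.mem_singleton]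
    by_cases htz : t = z
    · exact Or.inl htz
    · right
      refine hleaf t ht (Finset.card_le_one.2 ?_)
      have htA : t ∈ sA G S a b := by
        rcases mem_sT.1 ht with h1 | h1
        · exact h1
        · exact absurd (hBz t h1) htz
      have : ∀ s ∈ nb G T t, s = z := by
        intro s hs
        rw [mem_nb] at hs
        rcases mem_sT.1 hs.1 with h1 | h1
        · exact absurd hs.2 (hAn htA h1)
        · exact hBz s h1
      intro s hs s' hs'
      rw [this s hs, this s' hs']
  have hT3' := (Finset.card_le_card hT3).trans Finset.card_le_three
  have hTc : T.card = _ := (hG.linked_sT_iff g).1 hl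
  rw [hp] at hTc
  obtain rfl : M = 2 := by omega
  have hcard := hG.card_eq g
  rw [h.card_cn hG hM g hp, ← hT, hTc, ← hW] at hcard
  have hWpos : 0 < W.card := Finset.card_pos.2 ⟨w₀, hw₀⟩
  -- `x` and then `b` can be deleted at a loss of at most two pentagons
  have hnx := hG.nb_cn_sub hx fun w hw hxw => hxW w hw hxw.symm
  have hnb : nb G (S.erase x) b ⊆ {z, z} := by
    intro s hs
    rw [mem_nb, Finset.mem_erase] at hs
    rw [Finset.mem_insert, Finset.mem_singleton, or_self]
    rcases mem_cases (G := G) (a := a) (b := b) hs.1.2 with h1 | h1 | h1 | h1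
    · exact absurd (h1 ▸ hs.2.symm) (hG.good_nadj g)
    · exact absurd hs.2 (h1 ▸ G.irrefl)
    · rcases mem_sI.1 h1 with h2 | h2
      · exact absurd (hC s h2) hs.1.1
      · rcases mem_sT.1 h2 with h3 | h3
        · exact absurd hs.2 (hG.sA_nadj h3)
        · exact hBz s h3
    · exact absurd hs.2.symm (hbW s (hall s h1).1 (hall s h1).2 s (mem_comp_self h1))
  obtain ⟨c1, c2⟩ := h.card_pents_le hG hnx hx'.1 (Or.inr ⟨g.ha, hx'.2.1.symm, g.hb, hx'.2.2.symm⟩)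
  have c3 := hG.card_pents_erase hnb
  rw [hG.pp_self] at c3
  have hbS : b ∈ S.erase x := Finset.mem_erase.2 ⟨hxI.2.symm, g.hb⟩
  have c4 := Finset.card_erase_add_one hbS
  have c5 := Finset.card_erase_add_one hx'.1
  have hss : (S.erase x).erase b ⊂ S :=
    (Finset.erase_ssubset hbS).trans (Finset.erase_ssubset hx'.1)
  have c6 : (pents G S).card + 2 * 2 + 3 * 2 < 2 * S.card := by
    rcases h.sub hss with h0 | ⟨M', m1, m2, hc, -⟩
    · omega
    · obtain rfl | rfl : M' = 1 ∨ M' = 2 := by omega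
      · omega
      · omega
  have := h.not_concl c6.le
  omega

end

section
variable {V : Type} {G : SimpleGraph V} {S S' U : Finset V} {a b : V} {M : ℕ} [Fintype V]

/-- The two hubs as seen from a vertex `z` of the tree: `h'` is the adjacent one. -/
theorem PT.hubs (hG : PT G) (g : Good G S a b) {z : V} (hz : z ∈ sT G S a b) :
    ∃ h h', h ≠ h' ∧ h ∈ S ∧ h' ∈ S ∧ (∀ v ∈ sI G S a b, v ≠ h ∧ v ≠ h') ∧
      (∀ v ∈ sW G S a b, v ≠ h ∧ v ≠ h') ∧ (∀ x ∈ cn G S a b, G.Adj x h ∧ G.Adj x h') ∧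
      G.Adj h' z ∧ ∀ s ∈ sT G S a b, G.Adj z s → G.Adj h s ∧
        ∀ s' ∈ sT G S a b, G.Adj s s' → G.Adj h' s' := by
  have hA : ∀ {a b v : V}, v ∈ sA G S a b → G.Adj a v := fun hv => (mem_sA.1 hv).2.1
  have hadj : ∀ r ∈ sT G S a b, ∀ s ∈ sT G S a b, G.Adj r s →
      (r ∈ sA G S a b ∧ s ∈ sA G S b a) ∨ (r ∈ sA G S b a ∧ s ∈ sA G S a b) := fun r hr s hs =>
    hG.adj_sI (sT_sub_sI _ _ _ hr) (sT_sub_sI _ _ _ hs)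
  rcases mem_sT.1 hz with h1 | h1
  · refine ⟨b, a, (hG.good_ne g).symm, g.hb, g.ha, fun v hv => (hG.sI_ne g hv).symm,
      fun v hv => ⟨(mem_sW.1 hv).2.2.1, (mem_sW.1 hv).2.1⟩,
      fun x hx => ⟨(mem_cn.1 hx).2.2.symm, (mem_cn.1 hx).2.1.symm⟩, hA h1, fun s hs hzs => ?_⟩
    have h2 := ((hadj z hz s hs hzs).resolve_right fun e => hG.not_sA_sB h1 e.1).2
    exact ⟨hA h2, fun s' hs' hss =>
      hA ((hadj s hs s' hs' hss).resolve_left fun e => hG.not_sA_sB e.1 h2).2⟩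
  · refine ⟨a, b, hG.good_ne g, g.ha, g.hb, fun v hv => hG.sI_ne g hv,
      fun v hv => ⟨(mem_sW.1 hv).2.1, (mem_sW.1 hv).2.2.1⟩,
      fun x hx => ⟨(mem_cn.1 hx).2.1.symm, (mem_cn.1 hx).2.2.symm⟩, hA h1, fun s hs hzs => ?_⟩
    have h2 := ((hadj z hz s hs hzs).resolve_left fun e => hG.not_sA_sB e.1 h1).2
    exact ⟨hA h2, fun s' hs' hss =>
      hA ((hadj s hs s' hs' hss).resolve_right fun e => hG.not_sA_sB h2 e.1).2⟩

/-- The paths from the common neighbour `x` to a vertex `z` of the tree: one for each neighbour of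
`z` in the tree, and those through the outside. -/
theorem PT.succ_deg_le_pp (hG : PT G) (g : Good G S a b) {x z p q : V} (hx : x ∈ cn G S a b)
    (hz : z ∈ sT G S a b) (hp : p ∈ sW G S a b) (hq : q ∈ S) (hxp : G.Adj x p) (hpq : G.Adj p q)
    (hqz : G.Adj q z) : (nb G (sT G S a b) z).card + 1 ≤ pp G S x z ∧
      ∃ h', h' ∉ sW G S a b ∧ h' ∈ cn G S x z := by
  obtain ⟨h, h', hhh, hhS, hhS', hI, hW, hx', hz', hs⟩ := hG.hubs g hz
  refine ⟨?_, h', fun e => (hW _ e).2 rfl, mem_cn.2 ⟨hhS', (hx' x hx).2, hz'.symm⟩⟩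
  have hcard : (insert (p, q) ((nb G (sT G S a b) z).image fun s => (h, s))).card =
      (nb G (sT G S a b) z).card + 1 := by
    rw [Finset.card_insert_of_notMem, Finset.card_image_of_injective _
      fun _ _ e => (Prod.ext_iff.1 e).2]
    rw [Finset.mem_image]
    rintro ⟨s, -, e⟩
    exact (hW p hp).1 (Prod.ext_iff.1 e).1.symm
  rw [← hcard]
  unfold pp ee
  refine Finset.card_le_card ?_
  intro e he
  simp only [Finset.mem_filter, Finset.mem_product, mem_nb]
  rw [Finset.mem_insert, Finset.mem_image] at he
  rcases he with rfl | ⟨s, hs', rfl⟩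
  · exact ⟨⟨⟨(mem_sW.1 hp).1, hxp⟩, hq, hqz.symm⟩, hpq⟩
  · rw [mem_nb] at hs'
    exact ⟨⟨⟨hhS, (hx' x hx).1⟩, sT_sub _ _ _ hs'.1, hs'.2⟩, (hs s hs'.1 hs'.2).1⟩

/-- In a minimal counterexample with `M ≥ 2`, the tree part of a maximal frame is not connected. -/
theorem Irr.not_linked (hG : PT G) (h : Irr G S M) (hM : 2 ≤ M) (g : Good G S a b)
    (hp : pp G S a b = M) : ¬ Linked G (sT G S a b) := by
  intro hl
  set W := sW G S a b with hW
  set T := sT G S a b with hT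
  obtain ⟨x, hx⟩ := g.c
  have hC : ∀ x' ∈ cn G S a b, x' = x := fun x' hx' =>
    Finset.card_le_one.1 (h.card_cn hG hM g hp).le x' hx' x hx
  have hx' := mem_cn.1 hx
  have hKW : ∀ w, comp G W w ⊆ W := fun w => comp_subset _ _
  have hTn : ∀ v ∈ T, v ≠ x := fun v hv e => hG.not_cn_sT hv (e ▸ hx)
  have hWn : ∀ v ∈ W, v ∉ T ∧ v ≠ x := fun v hv =>
    ⟨(sW_facts hv).2.2.2.2, fun e => (sW_facts hv).2.2.2.1 (e ▸ hx)⟩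
  have hxI := cn_sub_sI _ _ _ hx
  -- the attached vertices of the tree are pairwise adjacent for each component
  have hclq : ∀ w ∈ W, ∀ t ∈ T, ∀ t' ∈ T, ∀ k ∈ comp G W w, ∀ k' ∈ comp G W w, G.Adj k t →
      G.Adj k' t' → t = t' ∨ G.Adj t t' := by
    intro w hw t ht t' ht' k hk k' hk' hkt hkt'
    by_contra hcon
    push Not at hcon
    obtain ⟨_, _, _, _, hz⟩ := hG.attach_same_side g (Finset.Subset.refl _) hl
      (linked_comp W w) hx (fun v hv => ⟨(hWn v (hKW w hv)).1, (sW_facts (hKW w hv)).2.1,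
        (sW_facts (hKW w hv)).2.2.1, (hWn v (hKW w hv)).2⟩) ht ht' hcon.1 hcon.2 ⟨k, hk, hkt⟩
        ⟨k', hk', hkt'⟩
    rcases hz with h1 | h1
    · exact h.no_spread hG hM g hp hl hw h1.1 h1.2.1 hcon.1 hk hkt hk' hkt'
    · refine h.no_spread hG hM g.symm (by rw [pp_symm]; exact hp) (by rw [sT_symm]; exact hl)
        (w₀ := w) (by rw [sW_symm]; exact hw) h1.1 h1.2.1 hcon.1 (by rw [sW_symm]; exact hk) hkt
        (by rw [sW_symm]; exact hk') hkt'
  have hmcl : ∀ L : Finset V, Closed G W (W.filter fun w => ∃ k ∈ comp G W w, ∃ s ∈ L, G.Adj k s) :=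
    fun L => ⟨Finset.filter_subset _ _, fun u hu v hv huv => by
      rw [Finset.mem_filter] at hu ⊢
      rw [comp_sW_eq hu.1 hv huv]
      exact ⟨hv, hu.2⟩⟩
  -- pentagons crossing a cut pass through `x`
  have hcross : ∀ U, Closed G W U → U.Nonempty → (∃ w ∈ W, w ∉ U) → ∃ w ∈ U, ∃ w' ∈ W, w' ∉ U ∧
      ∃ t ∈ T, ∃ t' ∈ T, (∃ k ∈ comp G W w, G.Adj k t) ∧ (∃ k ∈ comp G W w', G.Adj k t') ∧
      (∃ k ∈ comp G W w, G.Adj k x) ∧ ((t = t' ∧ (∃ v ∈ W, G.Adj v x ∧ G.Adj v t) ∧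
        ∃ p ∈ W, ∃ q ∈ S, G.Adj x p ∧ G.Adj p q ∧ G.Adj q t) ∨
      (G.Adj t t' ∧ G.Adj w x ∧ G.Adj w t ∧ G.Adj w' x ∧ G.Adj w' t')) := by
    intro U hcl hUne ⟨w₁, hw₁, hwU₁⟩
    have hpc : ¬ PentClosed G S a b U := by
      intro hpc
      obtain ⟨y, hy, -⟩ := g.exists_path
      refine h.no_small_attachment hG g hp hcl hUne hpc
        (Finset.singleton_subset_iff.2 hx) (Finset.singleton_nonempty x) (by simp)
        (Finset.Subset.refl _) ⟨y, sA_sub_sT _ _ _ hy⟩ hl (fun _ _ z hz _ => hz)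
        (fun u hu r hr hur => ?_) (Or.inl fun e => hwU₁ (e ▸ hw₁))
      rcases mem_sI.1 hr with h1 | h1
      · exact Or.inl (by rw [hC r h1]; simp)
      · exact Or.inr h1
    unfold PentClosed at hpc
    push Not at hpc
    obtain ⟨Q, hQS, hQ, hQU, w, hwQ, hwW, hwU⟩ := hpc
    obtain ⟨w, hw, w', hw', r, hr, hwr, hwr', hc⟩ := hG.cross g hcl hQS hQ hQU ⟨w, hwQ, hwW, hwU⟩
    rw [Finset.mem_sdiff] at hw'
    have hwW := hcl.1 hw
    have hwS := (mem_sW.1 hwW).1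
    have hwS' := (mem_sW.1 hw'.1).1
    have m := mem_comp_self (G := G) hwW
    have m' := mem_comp_self (G := G) hw'.1
    have hIc : ∀ r ∈ sI G S a b, r = x ∨ r ∈ T := fun r hr => (mem_sI.1 hr).imp (hC r) id
    refine ⟨w, hw, w', hw'.1, hw'.2, ?_⟩
    rcases hc with ⟨r', hr', hne, hnadj, ⟨h1, s, hs, h2, h3⟩ | ⟨h1, s, hs, h2, h3⟩⟩ |
      ⟨r₁, hr₁, r₂, hr₂, h1, h2, h3, h4, h5, h6, h7⟩
    · rw [Finset.mem_sdiff] at hs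
      have ms := comp_closed m' hs.1 h2
      have hsS := (mem_sW.1 hs.1).1
      rcases hIc r hr with rfl | hrT
      · have hrT' := (hIc r' hr').resolve_left hne
        exact ⟨r', hrT', r', hrT', ⟨w, m, h1⟩, ⟨s, ms, h3⟩, ⟨w, m, hwr⟩,
          Or.inl ⟨rfl, ⟨w, hwW, hwr, h1⟩, w', hw'.1, s, hsS, hwr'.symm, h2, h3⟩⟩
      · rcases hIc r' hr' with rfl | hrT'
        · exact ⟨r, hrT, r, hrT, ⟨w, m, hwr⟩, ⟨w', m', hwr'⟩, ⟨w, m, h1⟩, Or.inl ⟨rfl,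
            ⟨w, hwW, h1, hwr⟩, s, hs.1, w', hwS', h3.symm, h2.symm, hwr'⟩⟩
        · rcases hclq w hwW r hrT r' hrT' w m w m hwr h1 with e | e
          · exact absurd e.symm hne
          · exact absurd e hnadj
    · have ms := comp_closed m (hcl.1 hs) h2
      have hsS := (mem_sW.1 (hcl.1 hs)).1
      rcases hIc r hr with rfl | hrT
      · have hrT' := (hIc r' hr').resolve_left hne
        exact ⟨r', hrT', r', hrT', ⟨s, ms, h3⟩, ⟨w', m', h1⟩, ⟨w, m, hwr⟩,
          Or.inl ⟨rfl, ⟨w', hw'.1, hwr', h1⟩, w, hwW, s, hsS, hwr.symm, h2, h3⟩⟩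
      · rcases hIc r' hr' with rfl | hrT'
        · exact ⟨r, hrT, r, hrT, ⟨w, m, hwr⟩, ⟨w', m', hwr'⟩, ⟨s, ms, h3⟩, Or.inl ⟨rfl,
            ⟨w', hw'.1, h1, hwr'⟩, s, hcl.1 hs, w, hwS, h3.symm, h2.symm, hwr⟩⟩
        · rcases hclq w hwW r hrT r' hrT' w m s ms hwr h3 with e | e
          · exact absurd e.symm hne
          · exact absurd e hnadj
    · have hT12 : r₁ ∈ T ∧ r₂ ∈ T := by
        rcases hG.adj_sI hr₁ hr₂ h3 with e | e
        · exact ⟨sA_sub_sT _ _ _ e.1, sB_sub_sT _ _ _ e.2⟩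
        · exact ⟨sB_sub_sT _ _ _ e.1, sA_sub_sT _ _ _ e.2⟩
      rcases hIc r hr with rfl | hrT
      · exact ⟨r₁, hT12.1, r₂, hT12.2, ⟨w, m, h1⟩, ⟨w', m', h2⟩, ⟨w, m, hwr⟩,
          Or.inr ⟨h3, hwr, h1, hwr', h2⟩⟩
      · rcases hclq w hwW r hrT r₁ hT12.1 w m w m hwr h1 with e | e
        · exact absurd e h6
        · exact absurd e h4
  have hTc : T.card = _ := (hG.linked_sT_iff g).1 hl
  rw [hp] at hTc
  -- each leaf has a leaf to which it is not adjacent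
  have hfar : ∀ l ∈ T, (nb G T l).card ≤ 1 → ∃ l' ∈ T, l' ≠ l ∧ ¬ G.Adj l l' ∧
      (nb G T l').card ≤ 1 := by
    intro l hlT hl1
    refine hG.exists_leaf_away g hl hlT ?_
    by_contra hcon
    push Not at hcon
    have : T ⊆ insert l (nb G T l) := by
      intro v hv
      rw [Finset.mem_insert, mem_nb]
      by_cases hvl : v = l
      · exact Or.inl hvl
      · exact Or.inr ⟨hv, hcon v hv hvl⟩
    have := (Finset.card_le_card this).trans (Finset.card_insert_le _ _)
    omega
  have hleafW : ∀ l ∈ T, (nb G T l).card ≤ 1 → ∃ w ∈ W, G.Adj l w := fun l hlT hl1 =>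
    h.exists_adj_leaf hG hM g hp hlT hl1
  -- a leaf `l`, its neighbour `z`
  have hleaf : ∀ l ∈ T, (nb G T l).card ≤ 1 → ∀ z ∈ T, G.Adj l z → (∃ w ∈ W, G.Adj w z) ∧
      (∃ w ∈ W, ∃ k ∈ comp G W w, G.Adj k x) ∧ ∃ p ∈ W, ∃ q ∈ S, G.Adj x p ∧ G.Adj p q ∧ G.Adj q z := by
    intro l hlT hl1 z hzT hlz
    obtain ⟨w₁, hw₁, hlw₁⟩ := hleafW l hlT hl1
    obtain ⟨l', hlT', hne, hnadj, hl1'⟩ := hfar l hlT hl1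
    obtain ⟨w₂, hw₂, hlw₂⟩ := hleafW l' hlT' hl1'
    have hz : ∀ s ∈ T, G.Adj l s → s = z := fun s hs hls =>
      Finset.card_le_one.1 hl1 s (mem_nb.2 ⟨hs, hls⟩) z (mem_nb.2 ⟨hzT, hlz⟩)
    obtain ⟨w, hw, w', hw', hwU', t, ht, t', ht', ⟨k, hk, hkt⟩, ⟨k', hk', hkt'⟩, ⟨k₂, hk₂, hkx⟩, hc⟩ :=
      hcross _ (hmcl {l})
        ⟨w₁, Finset.mem_filter.2 ⟨hw₁, w₁, mem_comp_self hw₁, l, by simp, hlw₁.symm⟩⟩ ⟨w₂, hw₂, by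
          rw [Finset.mem_filter]
          rintro ⟨-, k, hk, s, hs, hks⟩
          rw [Finset.mem_singleton] at hs
          subst hs
          rcases hclq w₂ hw₂ _ hlT l' hlT' k hk w₂ (mem_comp_self hw₂) hks hlw₂.symm with e | e
          · exact hne e.symm
          · exact hnadj e⟩
    rw [Finset.mem_filter] at hw hwU'
    obtain ⟨hwW, k₁, hk₁, s, hs, hks⟩ := hw
    rw [Finset.mem_singleton] at hs
    subst hs
    have htl' : t' ≠ s := fun e => hwU' ⟨hw', k', hk', s, by simp, e ▸ hkt'⟩
    have htz : t = s ∨ t = z := by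
      rcases hclq w hwW s hlT t ht k₁ hk₁ k hk hks hkt with e | e
      · exact Or.inl e.symm
      · exact Or.inr (hz t ht e)
    refine ⟨?_, ⟨w, hwW, k₂, hk₂, hkx⟩, ?_⟩
    · rcases hc with ⟨rfl, hc⟩ | ⟨hc, -⟩
      · exact ⟨k, hKW _ hk, (htz.resolve_left htl') ▸ hkt⟩
      · rcases htz with rfl | rfl
        · exact ⟨k', hKW _ hk', hz t' ht' hc ▸ hkt'⟩
        · exact ⟨k, hKW _ hk, hkt⟩
    · rcases hc with ⟨rfl, -, hc⟩ | ⟨hc, e1, e2, e3, e4⟩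
      · rw [htz.resolve_left htl'] at hc
        exact hc
      · rcases htz with rfl | rfl
        · exact ⟨w, hwW, t, sT_sub _ _ _ ht, e1.symm, e2, hlz⟩
        · exact ⟨w', hw', t', sT_sub _ _ _ ht', e3.symm, e4, hc.symm⟩
  obtain ⟨l, hlT, hl1⟩ := hG.exists_leaf g
  rw [← hT] at hlT hl1
  have hexz : ∀ t ∈ T, ∃ z ∈ T, G.Adj t z := by
    intro t ht
    rcases mem_sT.1 ht with h1 | h1
    · obtain ⟨z, hz, htz⟩ := exists_sB h1
      exact ⟨z, sB_sub_sT _ _ _ hz, htz⟩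
    · obtain ⟨z, hz, htz⟩ := exists_sB h1
      exact ⟨z, sA_sub_sT _ _ _ hz, htz⟩
  obtain ⟨z, hzT, hlz⟩ := hexz l hlT
  obtain ⟨hzW, ⟨w₀, hw₀, k₀, hk₀, hkx₀⟩, hzpath⟩ := hleaf l hlT hl1 z hzT hlz
  -- every component is attached to `x`
  have hxK : ∀ w ∈ W, ∃ k ∈ comp G W w, G.Adj k x := by
    intro w hw
    have h1 := mem_touched_of_adj hxI hk₀ hkx₀
    rw [h.touched_const hG g hp hl hw₀ hw] at h1
    obtain ⟨-, k, hk, r, hr, hkr⟩ := mem_touched.1 h1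
    exact ⟨k, hk, hG.comp_cn hx hr ▸ hkr⟩
  have hWl : Linked G (insert x W) := by
    have hxm : x ∈ insert x W := Finset.mem_insert_self _ _
    refine (linked_iff_comp hxm).2 (Finset.Subset.antisymm (comp_subset _ _) fun v hv => ?_)
    rcases Finset.mem_insert.1 hv with rfl | hvW
    · exact mem_comp_self hxm
    · obtain ⟨k, hk, hkx⟩ := hxK v hvW
      exact ((linked_comp W v).insert hk hkx.symm).subset_comp (Finset.insert_subset_insert _ (hKW v))
        (Finset.mem_insert_self _ _) (Finset.mem_insert_of_mem (mem_comp_self hvW))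
  -- at most two neighbours of a vertex of the tree have neighbours outside
  have hatt2 : ∀ z ∈ T, ((nb G T z).filter fun t => ∃ w ∈ W, G.Adj t w).card ≤ 2 := by
    intro z hzT
    by_contra hcon
    obtain ⟨t₁, h₁, t₂, h₂, t₃, h₃, n₁₂, n₁₃, n₂₃⟩ := Finset.two_lt_card.1 (not_le.1 hcon)
    simp only [Finset.mem_filter, mem_nb] at h₁ h₂ h₃
    obtain ⟨⟨m₁, e₁⟩, w₁, hw₁, f₁⟩ := h₁
    obtain ⟨⟨m₂, e₂⟩, w₂, hw₂, f₂⟩ := h₂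
    obtain ⟨⟨m₃, e₃⟩, w₃, hw₃, f₃⟩ := h₃
    obtain ⟨p, q, hpq, -, -, hI, hWpq, hxpq, hq, hs⟩ := hG.hubs g hzT
    refine hG.noK33 (X₁ := {p}) (X₂ := {z}) (X₃ := insert x W) (Y₁ := {t₁}) (Y₂ := {t₂}) (Y₃ := {t₃})
      ?_ (linked_singleton _) (linked_singleton _) hWl (linked_singleton _) (linked_singleton _)
      (linked_singleton _) ⟨p, by simp, t₁, by simp, (hs t₁ m₁ e₁).1⟩
      ⟨p, by simp, t₂, by simp, (hs t₂ m₂ e₂).1⟩ ⟨p, by simp, t₃, by simp, (hs t₃ m₃ e₃).1⟩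
      ⟨z, by simp, t₁, by simp, e₁⟩ ⟨z, by simp, t₂, by simp, e₂⟩ ⟨z, by simp, t₃, by simp, e₃⟩
      ⟨w₁, by simp [hw₁], t₁, by simp, f₁.symm⟩ ⟨w₂, by simp [hw₂], t₂, by simp, f₂.symm⟩
      ⟨w₃, by simp [hw₃], t₃, by simp, f₃.symm⟩
    intro v
    have q1 := hWn v
    have q2 := (hI z (sT_sub_sI _ _ _ hzT)).1
    have q3 := (hI x hxI).1
    have q4 := (hI t₁ (sT_sub_sI _ _ _ m₁)).1
    have q5 := (hI t₂ (sT_sub_sI _ _ _ m₂)).1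
    have q6 := (hI t₃ (sT_sub_sI _ _ _ m₃)).1
    have q7 : v ∈ W → v ≠ p := fun hv => (hWpq v hv).1
    have q8 := hTn v
    have r1 := e₁.ne
    have r2 := e₂.ne
    have r3 := e₃.ne
    clear hI hWpq hxpq hs hcross hclq hmcl hfar hleafW hleaf hexz hxK hWl hWn hTn hC hKW hzW hzpath
      hcon
    simp only [Finset.mem_insert, Finset.mem_singleton]
    refine ⟨fun h => ?_, fun h => ?_, fun h => ?_, fun h => ?_, fun h => ?_⟩ <;> grind
  -- an attached vertex of the tree has at most one neighbour that is not a leaf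
  have hnl : ∀ z ∈ T, (∃ w ∈ W, G.Adj w z) → ∀ z₁ ∈ T, ∀ z₂ ∈ T, ∀ y₁ ∈ T, ∀ y₂ ∈ T, G.Adj z z₁ →
      G.Adj z z₂ → z₁ ≠ z₂ → G.Adj z₁ y₁ → G.Adj z₂ y₂ → y₁ ≠ z → y₂ ≠ z → False := by
    rintro z hzT ⟨w, hw, hwz⟩ z₁ m₁ z₂ m₂ y₁ n₁ y₂ n₂ e₁ e₂ hne f₁ f₂ hy₁ hy₂
    obtain ⟨p, q, hpq, -, -, hI, hWpq, hxpq, hq, hs⟩ := hG.hubs g hzT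
    have hqy : ∀ v ∈ ({y₁, y₂} : Finset V), G.Adj q v := by
      intro v hv
      rw [Finset.mem_insert, Finset.mem_singleton] at hv
      rcases hv with rfl | rfl
      · exact (hs z₁ m₁ e₁).2 _ n₁ f₁
      · exact (hs z₂ m₂ e₂).2 _ n₂ f₂
    refine hG.noK33 (X₁ := {z}) (X₂ := {p}) (X₃ := insert q {y₁, y₂}) (Y₁ := {z₁}) (Y₂ := {z₂})
      (Y₃ := insert x W) ?_ (linked_singleton _) (linked_singleton _) (linked_star hqy)
      (linked_singleton _) (linked_singleton _) hWl ⟨z, by simp, z₁, by simp, e₁⟩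
      ⟨z, by simp, z₂, by simp, e₂⟩ ⟨z, by simp, w, by simp [hw], hwz.symm⟩
      ⟨p, by simp, z₁, by simp, (hs z₁ m₁ e₁).1⟩ ⟨p, by simp, z₂, by simp, (hs z₂ m₂ e₂).1⟩
      ⟨p, by simp, x, by simp, (hxpq x hx).1.symm⟩ ⟨y₁, by simp, z₁, by simp, f₁.symm⟩
      ⟨y₂, by simp, z₂, by simp, f₂.symm⟩ ⟨q, by simp, x, by simp, (hxpq x hx).2.symm⟩
    have p₁ := (hqy y₁ (by simp))
    have p₂ := (hqy y₂ (by simp))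
    have u₁ : z₁ ≠ y₁ ∧ z₁ ≠ y₂ := ⟨f₁.ne, fun e =>
      hG.tri p z₁ z₂ (hs z₁ m₁ e₁).1 (e ▸ f₂.symm) (hs z₂ m₂ e₂).1.symm⟩
    have u₂ : z₂ ≠ y₁ ∧ z₂ ≠ y₂ := ⟨fun e =>
      hG.tri p z₁ z₂ (hs z₁ m₁ e₁).1 (e ▸ f₁) (hs z₂ m₂ e₂).1.symm, f₂.ne⟩
    intro v
    have q1 := hWn v
    have q2 := hI z (sT_sub_sI _ _ _ hzT)
    have q3 := hI x hxI
    have q4 := hI z₁ (sT_sub_sI _ _ _ m₁)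
    have q5 := hI z₂ (sT_sub_sI _ _ _ m₂)
    have q6 := hI y₁ (sT_sub_sI _ _ _ n₁)
    have q6' := hI y₂ (sT_sub_sI _ _ _ n₂)
    have q7 : v ∈ W → v ≠ p ∧ v ≠ q := fun hv => hWpq v hv
    have q8 := hTn v
    have r1 := e₁.ne
    have r2 := e₂.ne
    clear hI hWpq hxpq hs hcross hclq hmcl hfar hleafW hleaf hexz hxK hWl hWn hTn hC hKW hzW hzpath
      hatt2 f₁ f₂ e₁ e₂ hqy p₁ p₂ hw hwz hq
    simp only [Finset.mem_insert, Finset.mem_singleton]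
    refine ⟨fun h => ?_, fun h => ?_, fun h => ?_, fun h => ?_, fun h => ?_⟩ <;> grind
  have hpp : ∀ z ∈ T, (∃ p ∈ W, ∃ q ∈ S, G.Adj x p ∧ G.Adj p q ∧ G.Adj q z) →
      (nb G T z).card + 1 ≤ pp G S x z ∧ pp G S x z ≤ M ∧
      (M ≤ pp G S x z → (∃ v ∈ W, G.Adj v x ∧ G.Adj v z) → False) := by
    rintro z hzT ⟨p, hpW, q, hq, hxp, hpq, hqz⟩
    obtain ⟨h1, h', hh, hh'⟩ := hG.succ_deg_le_pp g hx hzT hpW hq hxp hpq hqz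
    have gz : Good G S x z := ⟨hx'.1, sT_sub _ _ _ hzT, ⟨h', hh'⟩, by omega⟩
    have h2 := h.max.le x z gz
    refine ⟨h1, h2, fun h3 ⟨v, hv, hvx, hvz⟩ => ?_⟩
    have h4 := h.card_cn hG hM gz (le_antisymm h2 h3)
    exact hh (Finset.card_le_one.1 h4.le v (mem_cn.2 ⟨(mem_sW.1 hv).1, hvx.symm, hvz.symm⟩) h' hh' ▸ hv)
  have hzp := hpp z hzT hzpath
  -- the tree is not a star
  obtain ⟨t, htT, hzt, y₁, hy₁T, hty₁, hy₁z⟩ : ∃ t ∈ T, G.Adj z t ∧ ∃ y ∈ T, G.Adj t y ∧ y ≠ z := by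
    by_contra hcon
    push Not at hcon
    have hTz : T ⊆ insert z (nb G T z) := by
      intro v hv
      refine hl (· ∈ insert z (nb G T z)) (fun p hp q hq hpq hpN => ?_) z hzT v hv
        (Finset.mem_insert_self _ _)
      rw [Finset.mem_insert, mem_nb] at hpN ⊢
      rcases hpN with rfl | hpN
      · exact Or.inr ⟨hq, hpq⟩
      · exact Or.inl (hcon p hpN.1 hpN.2 q hq hpq)
    have := (Finset.card_le_card hTz).trans (Finset.card_insert_le _ _)
    omega
  -- neighbours of an attached vertex with a nonleaf neighbour `t` are leaves, except for `t`
  have hoth : ∀ z ∈ T, (∃ w ∈ W, G.Adj w z) → ∀ t ∈ T, G.Adj z t → (∃ y ∈ T, G.Adj t y ∧ y ≠ z) →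
      ∀ s ∈ T, G.Adj z s → s ≠ t → ∀ r ∈ T, G.Adj s r → r = z := by
    rintro z hzT hzW t htT hzt ⟨y, hyT, hty, hyz⟩ s hsT hzs hst r hrT hsr
    by_contra hrz
    exact hnl z hzT hzW t htT s hsT y hyT r hrT hzt hzs hst.symm hty hsr hyz hrz
  have hleaf1 : ∀ s ∈ T, ∀ z, (∀ r ∈ T, G.Adj s r → r = z) → (nb G T s).card ≤ 1 := by
    intro s _ z hs
    refine Finset.card_le_one.2 fun r hr r' hr' => ?_
    rw [mem_nb] at hr hr'
    rw [hs r hr.1 hr.2, hs r' hr'.1 hr'.2]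
  have hzo := hoth z hzT hzW t htT hzt ⟨y₁, hy₁T, hty₁, hy₁z⟩
  have hlt : l ≠ t := by
    rintro rfl
    exact hy₁z (Finset.card_le_one.1 hl1 y₁ (mem_nb.2 ⟨hy₁T, hty₁⟩) z (mem_nb.2 ⟨hzT, hlz⟩))
  -- the cut around `z` and its leaves shows that `t` is attached, too
  obtain ⟨htW, hcn2⟩ : (∃ w ∈ W, G.Adj w t) ∧
      ((∃ v ∈ W, G.Adj v x ∧ G.Adj v t) ∨ ∃ v ∈ W, G.Adj v x ∧ G.Adj v z) := by
    set L := insert z ((nb G T z).erase t) with hL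
    have hmL : ∀ s, s ∈ L ↔ s = z ∨ (s ≠ t ∧ s ∈ T ∧ G.Adj z s) := by
      intro s
      rw [hL, Finset.mem_insert, Finset.mem_erase, mem_nb]
    have hLT : ∀ s ∈ L, s ∈ T := by
      intro s hs
      rcases (hmL s).1 hs with rfl | h1
      · exact hzT
      · exact h1.2.1
    obtain ⟨w₁, hw₁, hlw₁⟩ := hleafW l hlT hl1
    obtain ⟨l', hlT', hne, hnadj, hl1'⟩ := hG.exists_leaf_away g hl hzT ⟨y₁, hy₁T, hy₁z, fun e =>
      G.irrefl ((hzo y₁ hy₁T e hty₁.ne' t htT hty₁.symm) ▸ hzt)⟩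
    obtain ⟨w₂, hw₂, hlw₂⟩ := hleafW l' hlT' hl1'
    obtain ⟨w, hw, w', hw', hwU', t₀, ht₀, t₁, ht₁, ⟨k, hk, hkt⟩, ⟨k', hk', hkt'⟩, -, hc⟩ :=
      hcross _ (hmcl L)
        ⟨w₁, Finset.mem_filter.2 ⟨hw₁, w₁, mem_comp_self hw₁, l, (hmL l).2 (Or.inr
          ⟨hlt, hlT, hlz.symm⟩), hlw₁.symm⟩⟩ ⟨w₂, hw₂, by
          rw [Finset.mem_filter]
          rintro ⟨-, k, hk, s, hs, hks⟩
          have h1 := hclq w₂ hw₂ s (hLT s hs) l' hlT' k hk w₂ (mem_comp_self hw₂) hks hlw₂.symm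
          rcases (hmL s).1 hs with rfl | h2
          · rcases h1 with rfl | h1
            · exact hne rfl
            · exact hnadj h1
          · rcases h1 with rfl | h1
            · exact hnadj h2.2.2
            · exact hne (hzo s h2.2.1 h2.2.2 h2.1 l' hlT' h1)⟩
    rw [Finset.mem_filter] at hw hwU'
    obtain ⟨hwW, k₁, hk₁, s, hs, hks⟩ := hw
    have htL : t₁ ∉ L := fun e => hwU' ⟨hw', k', hk', t₁, e, hkt'⟩
    have hst := hclq w hwW s (hLT s hs) t₀ ht₀ k₁ hk₁ k hk hks hkt
    have hLadj : ∀ s ∈ L, ∀ r ∈ T, r ∉ L → G.Adj s r → s = z ∧ r = t := by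
      intro s hs r hr hrL hsr
      rcases (hmL s).1 hs with rfl | h2
      · refine ⟨rfl, ?_⟩
        by_contra hrt
        exact hrL ((hmL r).2 (Or.inr ⟨hrt, hr, hsr⟩))
      · exact absurd ((hmL r).2 (Or.inl (hzo s h2.2.1 h2.2.2 h2.1 r hr hsr))) hrL
    have ht₀t : t₀ ∉ L → t₀ = t := by
      intro hn
      rcases hst with rfl | h1
      · exact absurd hs hn
      · exact (hLadj s hs t₀ ht₀ hn h1).2
    rcases hc with ⟨rfl, hv, -⟩ | ⟨hadj, e1, e2, e3, e4⟩
    · have := ht₀t htL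
      rw [this] at hv hkt
      exact ⟨⟨k, hKW _ hk, hkt⟩, Or.inl hv⟩
    · by_cases h0 : t₀ ∈ L
      · obtain ⟨rfl, rfl⟩ := hLadj t₀ h0 t₁ ht₁ htL hadj
        exact ⟨⟨w', hw', e4⟩, Or.inr ⟨w, hwW, e1, e2⟩⟩
      · rw [ht₀t h0] at e2
        exact ⟨⟨w, hwW, e2⟩, Or.inl ⟨w, hwW, e1, e2⟩⟩
  have hto := hoth t htT htW z hzT hzt.symm ⟨l, hlT, hlz.symm, hlt⟩
  -- all neighbours of `z` and of `t` have neighbours outside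
  have hall : ∀ z ∈ T, ∀ t, (∃ w ∈ W, G.Adj w t) →
      (∀ s ∈ T, G.Adj z s → s ≠ t → ∀ r ∈ T, G.Adj s r → r = z) → (nb G T z).card ≤ 2 := by
    intro z hzT t ⟨w, hw, hwt⟩ hzo
    refine (Finset.card_le_card fun s hs => ?_).trans (hatt2 z hzT)
    rw [Finset.mem_filter]
    refine ⟨hs, ?_⟩
    rw [mem_nb] at hs
    by_cases hst : s = t
    · exact ⟨w, hw, hst ▸ hwt.symm⟩
    · exact hleafW s hs.1 (hleaf1 s hs.1 z (hzo s hs.1 hs.2 hst))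
  have hdz := hall z hzT t htW hzo
  have hdt := hall t htT z hzW hto
  have hdz2 : 2 ≤ (nb G T z).card :=
    Finset.one_lt_card.2 ⟨l, mem_nb.2 ⟨hlT, hlz.symm⟩, t, mem_nb.2 ⟨htT, hzt⟩, hlt⟩
  have hy₁1 := hleaf1 y₁ hy₁T t (hto y₁ hy₁T hty₁ hy₁z)
  have htp := hpp t htT (hleaf y₁ hy₁T hy₁1 t htT hty₁.symm).2.2
  have hnzl : nb G T z ⊆ {l, t} := by
    have h2 : ({l, t} : Finset V) ⊆ nb G T z := Finset.insert_subset (mem_nb.2 ⟨hlT, hlz.symm⟩)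
      (Finset.singleton_subset_iff.2 (mem_nb.2 ⟨htT, hzt⟩))
    rw [Finset.eq_of_subset_of_card_le h2 (by rw [Finset.card_pair hlt]; exact hdz)]
  have hTsub : T ⊆ insert l (insert t (nb G T t)) := by
    intro v hv
    refine hl (· ∈ insert l (insert t (nb G T t))) (fun p hp q hq hpq hpN => ?_) l hlT v hv
      (Finset.mem_insert_self _ _)
    have hz' : z ∈ nb G T t := mem_nb.2 ⟨hzT, hzt.symm⟩
    rw [Finset.mem_insert, Finset.mem_insert] at hpN ⊢
    rcases hpN with rfl | rfl | hpN
    · rw [Finset.card_le_one.1 hl1 q (mem_nb.2 ⟨hq, hpq⟩) z (mem_nb.2 ⟨hzT, hlz⟩)]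
      exact Or.inr (Or.inr hz')
    · exact Or.inr (Or.inr (mem_nb.2 ⟨hq, hpq⟩))
    · rw [mem_nb] at hpN
      by_cases hpz : p = z
      · subst hpz
        have := hnzl (mem_nb.2 ⟨hq, hpq⟩)
        rw [Finset.mem_insert, Finset.mem_singleton] at this
        tauto
      · exact Or.inr (Or.inl (hto p hpN.1 hpN.2 hpz q hq hpq))
  have hc1 := Finset.card_le_card hTsub
  have hc2 := Finset.card_insert_le l (insert t (nb G T t))
  have hc3 := Finset.card_insert_le t (nb G T t)
  rcases hcn2 with hv | hv
  · exact htp.2.2 (by omega) hv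
  · exact hzp.2.2 (by omega) hv

end

/-! ### Maximal frames with a disconnected tree part -/

section
variable {V : Type} {G : SimpleGraph V} {S S' U : Finset V} {a b : V} {M : ℕ} [Fintype V]

omit [Fintype V] in
/-- If `D` minus `I₁` is connected then `I₂` and `I₃` are joined, possibly through a component of
what remains of `D`. -/
theorem exists_bridge {D I₁ I₂ I₃ R : Finset V} (hl : Linked G (D \ I₁)) (h₂ : I₂ ⊆ D) (h₃ : I₃ ⊆ D)
    (h₁₂ : Disjoint I₁ I₂) (h₁₃ : Disjoint I₁ I₃) (h₂₃ : Disjoint I₂ I₃) (hn₂ : I₂.Nonempty)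
    (hn₃ : I₃.Nonempty) (hl₂ : Linked G I₂) (hR : ∀ v, v ∈ R ↔ v ∈ D ∧ v ∉ I₁ ∧ v ∉ I₂ ∧ v ∉ I₃) :
    ∃ L ⊆ R, Linked G (I₂ ∪ L) ∧ Touch G (I₂ ∪ L) I₃ ∧
      ∀ v ∈ L, Touch G (comp G R v) I₂ ∧ Touch G (comp G R v) I₃ := by
  by_cases h0 : Touch G I₂ I₃
  · exact ⟨∅, Finset.empty_subset _, by simpa using hl₂, by simpa using h0, by simp⟩
  by_cases h1 : ∃ w ∈ R, Touch G (comp G R w) I₂ ∧ Touch G (comp G R w) I₃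
  · obtain ⟨w, hw, t₂, t₃⟩ := h1
    exact ⟨comp G R w, comp_subset _ _, hl₂.union (linked_comp _ _) (Or.inr t₂.symm),
      t₃.mono Finset.subset_union_right (Finset.Subset.refl _), fun v hv => by
        rw [comp_eq_of_mem hw hv]; exact ⟨t₂, t₃⟩⟩
  push Not at h1
  exfalso
  obtain ⟨y, hy⟩ := hn₂
  obtain ⟨z, hz⟩ := hn₃
  have hy' : y ∈ D \ I₁ := Finset.mem_sdiff.2 ⟨h₂ hy, fun e => Finset.disjoint_left.1 h₁₂ e hy⟩
  have hz' : z ∈ D \ I₁ := Finset.mem_sdiff.2 ⟨h₃ hz, fun e => Finset.disjoint_left.1 h₁₃ e hz⟩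
  have hnz : ∀ u ∈ I₂, ∀ v ∈ I₃, ¬ G.Adj u v := fun u hu v hv huv => h0 ⟨u, hu, v, hv, huv⟩
  have := hl (fun v => v ∈ I₂ ∨ (v ∈ R ∧ Touch G (comp G R v) I₂)) ?_ y hy' z hz' (Or.inl hy)
  · rcases this with h2 | h2
    · exact Finset.disjoint_left.1 h₂₃ h2 hz
    · exact ((hR z).1 h2.1).2.2.2 hz
  · intro u hu v hv huv hs
    rw [Finset.mem_sdiff] at hu hv
    by_cases hv2 : v ∈ I₂
    · exact Or.inl hv2
    by_cases hv3 : v ∈ I₃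
    · exfalso
      rcases hs with h2 | ⟨h2, h3⟩
      · exact hnz u h2 v hv3 huv
      · exact h1 u h2 h3 ⟨u, mem_comp_self h2, v, hv3, huv⟩
    have hvR : v ∈ R := (hR v).2 ⟨hv.1, hv.2, hv2, hv3⟩
    refine Or.inr ⟨hvR, ?_⟩
    rcases hs with h2 | ⟨h2, h3⟩
    · exact ⟨v, mem_comp_self hvR, u, h2, huv.symm⟩
    · rw [comp_eq_of_mem h2 (comp_closed (mem_comp_self h2) hvR huv)]
      exact h3

/-- Three disjoint connected sets `Iᵢ` between two adjacent hubs `a` and `B` in a planar graph: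
some `Iᵢ` separates the remaining two. Otherwise there is a `K₃,₃` or a `K₅`. -/
theorem PT.theta (hG : PT G) {D B I₁ I₂ I₃ : Finset V} (ha : a ∉ D) (haB : a ∉ B)
    (hB : ∀ v ∈ B, v ∉ D) (hBl : Linked G B) (haBt : Touch G {a} B)
    (h₁ : I₁ ⊆ D) (h₂ : I₂ ⊆ D) (h₃ : I₃ ⊆ D) (h₁₂ : Disjoint I₁ I₂) (h₁₃ : Disjoint I₁ I₃)
    (h₂₃ : Disjoint I₂ I₃) (l₁ : Linked G I₁) (l₂ : Linked G I₂) (l₃ : Linked G I₃)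
    (a₁ : Touch G {a} I₁) (a₂ : Touch G {a} I₂) (a₃ : Touch G {a} I₃)
    (b₁ : Touch G B I₁) (b₂ : Touch G B I₂) (b₃ : Touch G B I₃)
    (d₁ : Linked G (D \ I₁)) (d₂ : Linked G (D \ I₂)) (d₃ : Linked G (D \ I₃)) : False := by
  set R := D \ (I₁ ∪ I₂ ∪ I₃) with hR
  have hmR : ∀ v, v ∈ R ↔ v ∈ D ∧ v ∉ I₁ ∧ v ∉ I₂ ∧ v ∉ I₃ := by
    intro v
    rw [hR]
    simp only [Finset.mem_sdiff, Finset.mem_union]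
    tauto
  have hne : ∀ {X Y : Finset V}, Touch G X Y → Y.Nonempty := fun ⟨_, _, z, hz, _⟩ => ⟨z, hz⟩
  have e₁₂ := fun v => @Finset.disjoint_left.1 h₁₂ v
  have e₁₃ := fun v => @Finset.disjoint_left.1 h₁₃ v
  have e₂₃ := fun v => @Finset.disjoint_left.1 h₂₃ v
  have hall : ∀ w ∈ R, Touch G (comp G R w) I₁ → Touch G (comp G R w) I₂ →
      Touch G (comp G R w) I₃ → False := by
    intro w hw t₁ t₂ t₃
    refine hG.noK33 ?_ (linked_singleton a) hBl (linked_comp R w) l₁ l₂ l₃ a₁ a₂ a₃ b₁ b₂ b₃ t₁ t₂ t₃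
    intro v
    have q1 : v ∈ comp G R w → v ∈ D ∧ v ∉ I₁ ∧ v ∉ I₂ ∧ v ∉ I₃ := fun h =>
      (hmR v).1 (comp_subset _ _ h)
    have q2 := hB v
    have q3 := @h₁ v
    have q4 := @h₂ v
    have q5 := @h₃ v
    have q6 := e₁₂ v
    have q7 := e₁₃ v
    have q8 := e₂₃ v
    clear e₁₂ e₁₃ e₂₃ hmR hR h₁₂ h₁₃ h₂₃ d₁ d₂ d₃ a₁ a₂ a₃ b₁ b₂ b₃ t₁ t₂ t₃ l₁ l₂ l₃ hne hB hBl
      haBt h₁ h₂ h₃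
    simp only [Finset.mem_singleton]
    refine ⟨fun h => ?_, fun h => ?_, fun h => ?_, fun h => ?_, fun h => ?_⟩ <;> grind
  obtain ⟨L₁, hL₁, k₁, t₁, c₁⟩ := exists_bridge (R := R) d₃ h₁ h₂ h₁₃.symm h₂₃.symm h₁₂ (hne a₁)
    (hne a₂) l₁ (fun v => by rw [hmR]; tauto)
  obtain ⟨L₂, hL₂, k₂, t₂, c₂⟩ := exists_bridge (R := R) d₁ h₂ h₃ h₁₂ h₁₃ h₂₃ (hne a₂)
    (hne a₃) l₂ (fun v => by rw [hmR])
  obtain ⟨L₃, hL₃, k₃, t₃, c₃⟩ := exists_bridge (R := R) d₂ h₃ h₁ h₂₃ h₁₂.symm h₁₃.symm (hne a₃)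
    (hne a₁) l₃ (fun v => by rw [hmR]; tauto)
  have f₁₂ : ∀ v, v ∈ L₁ → v ∉ L₂ := fun v h h' =>
    hall v (hL₁ h) (c₁ v h).1 (c₁ v h).2 (c₂ v h').2
  have f₁₃ : ∀ v, v ∈ L₁ → v ∉ L₃ := fun v h h' =>
    hall v (hL₁ h) (c₁ v h).1 (c₁ v h).2 (c₃ v h').1
  have f₂₃ : ∀ v, v ∈ L₂ → v ∉ L₃ := fun v h h' =>
    hall v (hL₂ h) (c₃ v h').2 (c₂ v h).1 (c₂ v h).2
  have hs := fun {X Y : Finset V} => Finset.subset_union_left (s₁ := X) (s₂ := Y)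
  have hr := fun X : Finset V => Finset.Subset.refl X
  -- the bridges `L₁`, `L₂`, `L₃` are disjoint and make the three trees pairwise adjacent
  refine hG.cut.noK5 (X₁ := {a}) (X₂ := B) (X₃ := I₁ ∪ L₁) (X₄ := I₂ ∪ L₂) (X₅ := I₃ ∪ L₃) ?_ ?_ ?_
  · have g1 : ∀ v, v ∈ L₁ → v ∈ D ∧ v ∉ I₁ ∧ v ∉ I₂ ∧ v ∉ I₃ := fun v h => (hmR v).1 (hL₁ h)
    have g2 : ∀ v, v ∈ L₂ → v ∈ D ∧ v ∉ I₁ ∧ v ∉ I₂ ∧ v ∉ I₃ := fun v h => (hmR v).1 (hL₂ h)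
    have g3 : ∀ v, v ∈ L₃ → v ∈ D ∧ v ∉ I₁ ∧ v ∉ I₂ ∧ v ∉ I₃ := fun v h => (hmR v).1 (hL₃ h)
    have q3 := fun v => @h₁ v
    have q4 := fun v => @h₂ v
    have q5 := fun v => @h₃ v
    clear hL₁ hL₂ hL₃ k₁ k₂ k₃ t₁ t₂ t₃ c₁ c₂ c₃ hmR hR h₁₂ h₁₃ h₂₃ d₁ d₂ d₃ a₁ a₂ a₃ b₁ b₂ b₃
      l₁ l₂ l₃ hne hBl haBt h₁ h₂ h₃ hall hs hr
    simp only [List.pairwise_cons, List.mem_cons, List.not_mem_nil, or_false, forall_eq_or_imp,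
      forall_eq, Finset.disjoint_left, List.Pairwise.nil, and_true, IsEmpty.forall_iff,
      implies_true, Finset.mem_singleton, Finset.mem_union, not_or]
    refine ⟨⟨haB, ⟨?_, ?_⟩, ⟨?_, ?_⟩, ?_, ?_⟩, ⟨?_, ?_, ?_⟩, ⟨?_, ?_⟩, ?_⟩
    all_goals grind
  · simp only [List.mem_cons, List.not_mem_nil, or_false, forall_eq_or_imp, forall_eq]
    exact ⟨linked_singleton a, hBl, k₁, k₂, k₃⟩
  · simp only [List.pairwise_cons, List.mem_cons, List.not_mem_nil, or_false, forall_eq_or_imp,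
      forall_eq, List.Pairwise.nil, and_true, IsEmpty.forall_iff, implies_true]
    exact ⟨⟨haBt, a₁.mono (hr _) hs, a₂.mono (hr _) hs, a₃.mono (hr _) hs⟩,
      ⟨b₁.mono (hr _) hs, b₂.mono (hr _) hs, b₃.mono (hr _) hs⟩,
      ⟨t₁.mono (hr _) hs, (t₃.mono (hr _) hs).symm⟩, t₂.mono (hr _) hs⟩

/-- The components outside a maximal frame with a disconnected tree part: each of them is adjacent
to exactly two trees, in at most two (adjacent) vertices each, and not to the common neighbour. -/
theorem Irr.outside (hG : PT G) (h : Irr G S M) (hM : 2 ≤ M) (g : Good G S a b)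
    (hp : pp G S a b = M) {w : V} (hw : w ∈ sW G S a b) :
    (∀ x ∈ cn G S a b, ¬ G.Adj w x) ∧
    (∃ t₁ ∈ sT G S a b, ∃ t₂ ∈ sT G S a b, t₂ ∉ comp G (sI G S a b) t₁ ∧
      (∃ k ∈ comp G (sW G S a b) w, G.Adj k t₁) ∧ ∃ k ∈ comp G (sW G S a b) w, G.Adj k t₂) ∧
    ∀ r ∈ sT G S a b, ∀ r' ∈ comp G (sI G S a b) r, r ≠ r' → ¬ G.Adj r r' →
      ∀ k ∈ comp G (sW G S a b) w, G.Adj k r → ∀ k' ∈ comp G (sW G S a b) w, G.Adj k' r' → False := by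
  have hl := h.not_linked hG hM g hp
  obtain ⟨t₁, ht₁, t₂, ht₂, m₁, m₂, h12⟩ := hG.exists_two_items
    ((h.touched_cases hG g hp hw).resolve_left fun h1 => hl h1.1)
  refine ⟨fun x hx hwx => ?_, ?_, fun r hr r' hr' hne hnadj k hk hkr k' hk' hkr' => ?_⟩
  · have hxt : ∀ t ∈ sT G S a b, x ∉ comp G (sI G S a b) t := fun t ht e =>
      hG.not_cn_sT (hG.comp_sT ht e) hx
    exact hG.three_items g (comp_subset _ _) (linked_comp _ _) m₁ m₂
      (mem_touched_of_adj (cn_sub_sI _ _ _ hx) (mem_comp_self hw) hwx) h12 (hxt t₁ ht₁)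
      (hxt t₂ ht₂)
  · obtain ⟨n₁, k₁, hk₁, s₁, hs₁, e₁⟩ := mem_touched.1 m₁
    obtain ⟨n₂, k₂, hk₂, s₂, hs₂, e₂⟩ := mem_touched.1 m₂
    refine ⟨s₁, hG.comp_sT ht₁ hs₁, s₂, hG.comp_sT ht₂ hs₂, fun e => h12 ?_, ⟨k₁, hk₁, e₁⟩,
      k₂, hk₂, e₂⟩
    rw [comp_eq_of_mem n₁ hs₁] at e
    rw [← comp_eq_of_mem n₁ e, comp_eq_of_mem n₂ hs₂]
    exact mem_comp_self n₂
  · have h1 := hG.one_item g (comp_subset _ _) (linked_comp _ _) hr hr' hne hnadj hk hkr hk' hkr' m₁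
    have h2 := hG.one_item g (comp_subset _ _) (linked_comp _ _) hr hr' hne hnadj hk hkr hk' hkr' m₂
    rw [comp_eq_of_mem (sT_sub_sI _ _ _ hr) h1] at h12
    exact h12 h2

theorem PT.deg2_item (hG : PT G) (g : Good G S a b) {t : V} (ht : t ∈ sT G S a b) :
    deg2 G (comp G (sI G S a b) t) + 2 = 2 * (comp G (sI G S a b) t).card :=
  le_antisymm (hG.deg2_forest g (fun _ hv => hG.comp_sT ht hv)
    ⟨t, mem_comp_self (sT_sub_sI _ _ _ ht)⟩) (linked_comp _ _).card_le

/-- The arithmetic of `Irr.side_bound`. The hypothesis `h₁` is the bound for a smaller frame with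
one common neighbour, `p` paths, `y + τ` tree vertices and `ω` outside vertices, which `m` pentagons
meet; `d` is twice the number of edges among the `τ` tree vertices. -/
theorem side_arith {m p M' M y τ ω d : ℕ}
    (h₁ : 1 * p + m + M' * M' + 3 * M' ≤ M' * (2 + 1 + (y + τ) + ω)) (h₂ : 2 * p + 2 = 2 * y + d)
    (hp : 0 < p) (hpM' : p ≤ M') (hMM : M' ≤ M) (hpM : p + 1 ≤ M) (hd : d ≤ 2 * τ) (hM : 2 ≤ M) :
    2 * m + M * d ≤ M * (2 * ω + 2 * τ) ∧ (1 ≤ ω → 2 * m + M * d < M * (2 * ω + 2 * τ)) := by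
  zify at *
  have e3 : (2 * m : ℤ) ≤ M' * (2 * τ - d + 2 * ω) + 2 * ((M' - p) * (1 - M')) := by
    have : (M' : ℤ) * (2 * p + 2) = M' * (2 * y + d) := by rw [h₂]
    nlinarith
  have e4 : ((M' : ℤ) - p) * (1 - M') ≤ 0 :=
    mul_nonpos_of_nonneg_of_nonpos (by omega) (by omega)
  have e5 : (0 : ℤ) ≤ 2 * τ - d + 2 * ω := by omega
  constructor
  · have : (M' : ℤ) * (2 * τ - d + 2 * ω) ≤ M * (2 * τ - d + 2 * ω) :=
      mul_le_mul_of_nonneg_right (by omega) e5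
    linarith
  · intro hω1
    rcases lt_or_ge (M' : ℤ) M with h1 | h1
    · have : (M' : ℤ) * (2 * τ - d + 2 * ω) < M * (2 * τ - d + 2 * ω) :=
        mul_lt_mul_of_pos_right (by omega) (by omega)
      linarith
    · have h2 : (M' : ℤ) = M := by omega
      have : ((M' : ℤ) - p) * (1 - M') < 0 :=
        mul_neg_of_pos_of_neg (by omega) (by omega)
      rw [h2] at e3 this
      linarith

/-- The pentagons on one side `X` of a separation of everything but the hubs, the common neighbour
and one tree. -/
theorem Irr.side_bound (hG : PT G) (h : Irr G S M) (hM : 2 ≤ M) (g : Good G S a b)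
    (hp : pp G S a b = M) {t : V} (ht : t ∈ sT G S a b) {X X' : Finset V}
    (hX' : X'.Nonempty) (hd : Disjoint X X')
    (hu : X ∪ X' = (sT G S a b ∪ sW G S a b) \ comp G (sI G S a b) t)
    (hadj : ∀ u ∈ X, ∀ v ∈ X', ¬ G.Adj u v) :
    2 * (meet G S (X ∩ sW G S a b)).card + M * deg2 G (X ∩ sT G S a b) ≤
      M * (2 * (X ∩ sW G S a b).card + 2 * (X ∩ sT G S a b).card) ∧
    ((X ∩ sW G S a b).Nonempty →
      2 * (meet G S (X ∩ sW G S a b)).card + M * deg2 G (X ∩ sT G S a b) <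
      M * (2 * (X ∩ sW G S a b).card + 2 * (X ∩ sT G S a b).card)) := by
  set W := sW G S a b with hW
  set T := sT G S a b with hT
  set Y := comp G (sI G S a b) t with hY
  obtain ⟨x, hx⟩ := g.c
  have hC : ∀ x' ∈ cn G S a b, x' = x := fun x' hx' =>
    Finset.card_le_one.1 (h.card_cn hG hM g hp).le x' hx' x hx
  have hxI := hG.sI_ne g (cn_sub_sI _ _ _ hx)
  have htI := sT_sub_sI _ _ _ ht
  have hYT : ∀ v ∈ Y, v ∈ T := fun v hv => hG.comp_sT ht hv
  have hYcl : ∀ u ∈ Y, ∀ v ∈ T, G.Adj u v → v ∈ Y := fun u hu v hv huv =>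
    comp_closed hu (sT_sub_sI _ _ _ hv) huv
  have hYe : ∀ u ∈ Y, comp G (sI G S a b) u = Y := fun u hu => comp_eq_of_mem htI hu
  have hXX : ∀ v, (v ∈ X ∨ v ∈ X') ↔ (v ∈ T ∨ v ∈ W) ∧ v ∉ Y := by
    intro v
    rw [← Finset.mem_union, hu, Finset.mem_sdiff, Finset.mem_union]
  have hdis : ∀ v, v ∈ X → v ∉ X' := fun v h1 h2 => Finset.disjoint_left.1 hd h1 h2
  have hWT : ∀ v ∈ W, v ∉ T := fun v hv => (sW_facts hv).2.2.2.2
  have hTn : ∀ v ∈ T, v ≠ a ∧ v ≠ b ∧ v ≠ x := fun v hv =>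
    ⟨(hG.sI_ne g (sT_sub_sI _ _ _ hv)).1, (hG.sI_ne g (sT_sub_sI _ _ _ hv)).2,
      fun e => hG.not_cn_sT hv (e ▸ hx)⟩
  have hWn : ∀ v ∈ W, v ≠ a ∧ v ≠ b ∧ v ≠ x := fun v hv =>
    ⟨(sW_facts hv).2.1, (sW_facts hv).2.2.1, fun e => (sW_facts hv).2.2.2.1 (e ▸ hx)⟩
  -- each side contains the components of its vertices, and one of the trees
  have hK : ∀ X X' : Finset V, (∀ v, (v ∈ X ∨ v ∈ X') ↔ (v ∈ T ∨ v ∈ W) ∧ v ∉ Y) →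
      (∀ u ∈ X, ∀ v ∈ X', ¬ G.Adj u v) → ∀ w ∈ W, w ∈ X → ∀ k ∈ comp G W w, k ∈ X := by
    intro X X' hXX hadj w hw hwX
    refine comp_induction (s := (· ∈ X)) hwX (fun u hu v hv huv huX => ?_) hw
    have hvW := comp_subset _ _ hv
    exact ((hXX v).2 ⟨Or.inr hvW, fun e => hWT v hvW (hYT v e)⟩).resolve_right
      fun e => hadj u huX v e huv
  have hXT : ∀ X X' : Finset V, (∀ v, (v ∈ X ∨ v ∈ X') ↔ (v ∈ T ∨ v ∈ W) ∧ v ∉ Y) →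
      (∀ u ∈ X, ∀ v ∈ X', ¬ G.Adj u v) → X.Nonempty → ∃ s ∈ X, s ∈ T := by
    rintro X X' hXX hadj ⟨v, hv⟩
    rcases ((hXX v).1 (Or.inl hv)).1 with h1 | h1
    · exact ⟨v, hv, h1⟩
    · obtain ⟨-, ⟨t₁, ht₁, t₂, ht₂, h12, ⟨k₁, hk₁, e₁⟩, k₂, hk₂, e₂⟩, -⟩ := h.outside hG hM g hp h1
      have hk := hK X X' hXX hadj v h1 hv
      have hin : ∀ t ∈ T, ∀ k ∈ X, G.Adj k t → t ∉ Y → t ∈ X := fun t ht k hk hkt htY =>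
        ((hXX t).2 ⟨Or.inl ht, htY⟩).resolve_right fun e => hadj k hk t e hkt
      by_cases hY1 : t₁ ∈ Y
      · rw [hYe t₁ hY1] at h12
        exact ⟨t₂, hin t₂ ht₂ k₂ (hk k₂ hk₂) e₂ h12, ht₂⟩
      · exact ⟨t₁, hin t₁ ht₁ k₁ (hk k₁ hk₁) e₁ hY1, ht₁⟩
  have hXX' : ∀ v, (v ∈ X' ∨ v ∈ X) ↔ (v ∈ T ∨ v ∈ W) ∧ v ∉ Y := fun v => by rw [← hXX v, or_comm]
  have hadj' : ∀ u ∈ X', ∀ v ∈ X, ¬ G.Adj u v := fun u hu v hv e => hadj v hv u hu e.symm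
  have hK₁ := hK X X' hXX hadj
  have hK₂ := hK X' X hXX' hadj'
  obtain ⟨s', hsX', hsT'⟩ := hXT X' X hXX' hadj' hX'
  have hWX : ∀ v ∈ W, v ∈ X ∨ v ∈ X' := fun v hv => (hXX v).2 ⟨Or.inr hv, fun e => hWT v hv (hYT v e)⟩
  have hTX : ∀ v ∈ T, v ∈ Y ∨ v ∈ X ∨ v ∈ X' := by
    intro v hv
    by_cases hvY : v ∈ Y
    · exact Or.inl hvY
    · exact Or.inr ((hXX v).2 ⟨Or.inl hv, hvY⟩)
  set U := X ∩ W with hU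
  have hcl : Closed G W U := by
    refine ⟨Finset.inter_subset_right, fun u hu v hv huv => ?_⟩
    rw [hU, Finset.mem_inter] at hu ⊢
    exact ⟨hK₁ u hu.2 hu.1 v (comp_closed (mem_comp_self hu.2) hv huv), hv⟩
  have hIT : ∀ w ∈ W, ∀ r ∈ sI G S a b, G.Adj w r → r ∈ T := fun w hw r hr hwr =>
    (mem_sI.1 hr).resolve_left fun e => (h.outside hG hM g hp hw).1 r e hwr
  have hpc : PentClosed G S a b U := by
    intro Q hQS hQ hQU w hwQ hwW
    by_contra hwU
    obtain ⟨w, hw, w', hw', r, hr, hwr, hwr', hc⟩ := hG.cross g hcl hQS hQ hQU ⟨w, hwQ, hwW, hwU⟩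
    rw [hU, Finset.mem_inter] at hw
    rw [Finset.mem_sdiff] at hw'
    have hwX' : w' ∈ X' := (hWX w' hw'.1).resolve_left fun e =>
      hw'.2 (Finset.mem_inter.2 ⟨e, hw'.1⟩)
    have m := mem_comp_self (G := G) hw.2
    have m' := mem_comp_self (G := G) hw'.1
    have hrY : ∀ r ∈ T, ∀ k ∈ X, ∀ k' ∈ X', G.Adj k r → G.Adj k' r → r ∈ Y := by
      intro r hrT k hk k' hk' h1 h2
      rcases hTX r hrT with h3 | h3 | h3
      · exact h3
      · exact absurd h2.symm (hadj r h3 k' hk')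
      · exact absurd h1 (hadj k hk r h3)
    have hrT := hIT w hw.2 r hr hwr
    have hrY' := hrY r hrT w hw.1 w' hwX' hwr hwr'
    have hout := (h.outside hG hM g hp hw.2).2.2 r hrT
    have hI : ∀ r' ∈ sI G S a b, r' ≠ r → ¬ G.Adj r r' → ∀ s ∈ comp G W w, G.Adj s r' →
        ∀ s' ∈ comp G W w', G.Adj s' r' → False := by
      intro r' hr' hne' hnadj s hs hsr' s' hs' hsr''
      have h1 := hrY r' (hIT s (comp_subset _ _ hs) r' hr' hsr') s (hK₁ w hw.2 hw.1 s hs) s'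
        (hK₂ w' hw'.1 hwX' s' hs') hsr' hsr''
      exact hout r' (by rw [hYe r hrY']; exact h1) hne'.symm hnadj w m hwr s hs hsr'
    rcases hc with ⟨r', hr', hne', hnadj, ⟨h1, s, hs, h2, h3⟩ | ⟨h1, s, hs, h2, h3⟩⟩ |
      ⟨r₁, hr₁, r₂, hr₂, h1, h2, h3, h4, h5, h6, h7⟩
    · exact hI r' hr' hne' hnadj w m h1 s (comp_closed m' (Finset.mem_sdiff.1 hs).1 h2) h3
    · exact hI r' hr' hne' hnadj s (comp_closed m (hcl.1 hs) h2) h3 w' m' h1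
    · have hrT₁ := hIT w hw.2 r₁ hr₁ h1
      have hrT₂ := hIT w' hw'.1 r₂ hr₂ h2
      have hrY₁ : r₁ ∈ Y := by
        rcases hTX r₁ hrT₁ with e | e | e
        · exact e
        · rcases hTX r₂ hrT₂ with e' | e' | e'
          · exact hYcl r₂ e' r₁ hrT₁ h3.symm
          · exact absurd h2 (hadj' w' hwX' r₂ e')
          · exact absurd h3 (hadj r₁ e r₂ e')
        · exact absurd h1 (hadj w hw.1 r₁ e)
      exact hout r₁ (by rw [hYe r hrY']; exact hrY₁) h6 h4 w m hwr w m h1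
  -- the bound for the part of `S` without `X'`, whose frame has fewer paths as `X'` contains a tree
  set S₁ : Finset V := {a, b} ∪ ({x} ∪ (Y ∪ X)) with hS₁
  have hmem : ∀ v, v ∈ S₁ ↔ v = a ∨ v = b ∨ v = x ∨ v ∈ Y ∨ v ∈ X := by
    intro v
    rw [hS₁]
    simp only [Finset.mem_union, Finset.mem_insert, Finset.mem_singleton]
    tauto
  have hXS : ∀ v, v ∈ X ∨ v ∈ X' → v ∈ S ∧ v ≠ a ∧ v ≠ b ∧ v ≠ x ∧ v ∉ Y := by
    intro v hv
    obtain ⟨h1 | h1, h2⟩ := (hXX v).1 hv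
    · exact ⟨sT_sub _ _ _ h1, (hTn v h1).1, (hTn v h1).2.1, (hTn v h1).2.2, h2⟩
    · exact ⟨(mem_sW.1 h1).1, (hWn v h1).1, (hWn v h1).2.1, (hWn v h1).2.2, h2⟩
  have hsub : S₁ ⊆ S := by
    intro v hv
    rcases (hmem v).1 hv with rfl | rfl | rfl | h1 | h1
    · exact g.ha
    · exact g.hb
    · exact (mem_cn.1 hx).1
    · exact sT_sub _ _ _ (hYT v h1)
    · exact (hXS v (Or.inl h1)).1
  have hXS' : ∀ v ∈ X', v ∉ S₁ := by
    intro v hv hvS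
    have h1 := hXS v (Or.inr hv)
    rcases (hmem v).1 hvS with e | e | e | e | e
    · exact h1.2.1 e
    · exact h1.2.2.1 e
    · exact h1.2.2.2.1 e
    · exact h1.2.2.2.2 e
    · exact hdis v e hv
  have hTS : ∀ v ∈ T, v ∈ S₁ → v ∈ Y ∨ v ∈ X := by
    intro v hv hvS
    have h0 := hTn v hv
    have := (hmem v).1 hvS
    tauto
  have hcl₁ : ∀ y ∈ S₁, y ∈ T → ∀ z ∈ T, G.Adj y z → z ∈ S₁ := by
    intro y hy hyT z hz hyz
    rw [hmem]
    rcases hTS y hyT hy with h1 | h1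
    · have := hYcl y h1 z hz hyz
      tauto
    · rcases hTX z hz with h2 | h2 | h2
      · tauto
      · tauto
      · exact absurd hyz (hadj y h1 z h2)
  have hsT : sT G S₁ a b = Y ∪ (X ∩ T) := by
    rw [sT_inter hsub hcl₁, ← hT]
    apply Finset.ext
    intro v
    rw [Finset.mem_inter (s₁ := T), Finset.mem_union (s := Y), Finset.mem_inter (s₁ := X)]
    constructor
    · rintro ⟨h1, h2⟩
      rcases hTS v h1 h2 with h3 | h3
      · exact Or.inl h3
      · exact Or.inr ⟨h3, h1⟩
    · rintro (h1 | ⟨h1, h2⟩)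
      · exact ⟨hYT v h1, (hmem v).2 (by tauto)⟩
      · exact ⟨h2, (hmem v).2 (by tauto)⟩
  have hcn : cn G S₁ a b = {x} := by
    rw [cn_inter hsub]
    ext v
    rw [Finset.mem_inter, Finset.mem_singleton]
    exact ⟨fun hv => hC v hv.1, fun hv => ⟨hv ▸ hx, (hmem v).2 (by tauto)⟩⟩
  have hsW : sW G S₁ a b = U := by
    rw [sW_inter hsub hcl₁]
    ext v
    rw [Finset.mem_inter, hU, Finset.mem_inter]
    refine ⟨fun hv => ⟨?_, hv.1⟩, fun hv => ⟨hv.2, (hmem v).2 (by tauto)⟩⟩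
    have h0 := hWn v hv.1
    have h1 := hWT v hv.1
    have h2 := hYT v
    have := (hmem v).1 hv.2
    tauto
  have hTsub : T ⊆ sI G S a b := sT_sub_sI _ _ _
  have g₁ : Good G S₁ a b := by
    refine ⟨(hmem a).2 (by tauto), (hmem b).2 (by tauto), by rw [hcn]; simp, ?_⟩
    have hy : t ∈ sT G S₁ a b := by
      rw [hsT]
      exact Finset.mem_union_left _ (mem_comp_self htI)
    rw [mem_sT] at hy
    rw [pp_eq_ee]
    rcases hy with hy | hy
    · obtain ⟨z, hz, hyz⟩ := exists_sB hy
      exact ee_pos hy hz hyz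
    · obtain ⟨z, hz, hyz⟩ := exists_sB hy
      exact ee_pos hz hy hyz.symm
  have hss : S₁ ⊂ S := ⟨hsub, fun e => hXS' s' hsX' (e (sT_sub _ _ _ hsT'))⟩
  -- the other side contains a path of length three
  have hpM : pp G S₁ a b + 1 ≤ M := by
    rw [← hp]
    rcases mem_sT.1 hsT' with h1 | h1
    · obtain ⟨z, hz, hyz⟩ := exists_sB h1
      exact pp_succ_le hsub (sA_sub _ _ _ h1) (sA_sub _ _ _ hz) (mem_sA.1 h1).2.1 hyz
        (mem_sA.1 hz).2.1.symm (Or.inl (hXS' s' hsX'))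
    · obtain ⟨z, hz, hyz⟩ := exists_sB h1
      exact pp_succ_le hsub (sA_sub _ _ _ hz) (sA_sub _ _ _ h1) (mem_sA.1 hz).2.1 hyz.symm
        (mem_sA.1 h1).2.1.symm (Or.inr (hXS' s' hsX'))
  obtain ⟨M', hm', hMM, hpM', hc1, -⟩ := h.sub_good hss g₁
  have hk1 := hG.card_eq g₁
  have hk3 := hG.card_pents_eq g₁
  have hk4 := hG.deg2_sT S₁ a b
  have hYX : Disjoint Y (X ∩ T) := Finset.disjoint_left.2 fun v hv hv' =>
    (hXS v (Or.inl (Finset.mem_inter.1 hv').1)).2.2.2.2 hv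
  rw [hsT, deg2_union hYX, ee_eq_zero (fun u hu v hv huv => (hXS v (Or.inl
    (Finset.mem_inter.1 hv).1)).2.2.2.2 (hYcl u hu v (Finset.mem_inter.1 hv).2 huv))] at hk4
  rw [hcn, hsW, hsT, Finset.card_union_of_disjoint hYX, Finset.card_singleton] at hk1
  rw [hcn, hsW, Finset.card_singleton] at hk3
  have hk5 := hG.deg2_item g ht
  rw [← hY] at hk5
  have hmeet := hG.meet_eq g hcl.1 hpc hsub g₁.ha g₁.hb
    (fun u hu => (hmem u).2 (Or.inr (Or.inr (Or.inr (Or.inr (Finset.mem_inter.1 hu).1)))))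
    (fun u hu r hr hur => (hmem r).2 (by
      rw [hU, Finset.mem_inter] at hu
      have := hTX r (hIT u hu.2 r hr hur)
      have := hadj u hu.1 r
      tauto)) hcl₁
  have hk6 : deg2 G (X ∩ T) ≤ 2 * (X ∩ T).card := by
    rcases (X ∩ T).eq_empty_or_nonempty with h0 | h0
    · rw [h0]; simp [deg2]
    · have := hG.deg2_forest g (Y := X ∩ T) Finset.inter_subset_right h0
      omega
  rw [hmeet]
  rw [hk3, hk1] at hc1
  have hppos := g₁.p
  set p := pp G S₁ a b
  set m := (meet G S₁ U).card
  set d := deg2 G (X ∩ T)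
  set τ := (X ∩ T).card
  set ω := U.card with hω
  set y := Y.card
  have := side_arith hc1 (by omega : 2 * p + 2 = 2 * y + d) hppos hpM' hMM hpM hk6 hM
  exact ⟨this.1, fun hne => this.2 (Finset.card_pos.2 hne)⟩

/-- The bounds for the two sides of a tree add up to the bound for the whole frame. -/
theorem frame_arith {m m₁ m₂ d₁ d₂ w₁ w₂ u₁ u₂ y M : ℕ} (hm : m ≤ m₁ + m₂)
    (h : 2 * m₁ + M * d₁ + (2 * m₂ + M * d₂) < M * (2 * w₁ + 2 * u₁) + M * (2 * w₂ + 2 * u₂))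
    (f1 : d₁ + d₂ + 2 * y = 2 * M + 2) :
    1 * M + m + M * M + 3 * M < M * (2 + 1 + (y + (u₁ + u₂)) + (w₁ + w₂)) := by
  have f2 : M * (d₁ + d₂) + M * (2 * y) = M * (2 * M + 2) := by rw [← f1]; ring
  nlinarith

omit [Fintype V] in
/-- The outside vertices `W` split into two sides, and the tree part `T` into two sides and the tree
`Y`. -/
theorem split_parts {X₁ X₂ T W Y : Finset V}
    (hXX : ∀ v, (v ∈ X₁ ∨ v ∈ X₂) ↔ (v ∈ T ∨ v ∈ W) ∧ v ∉ Y) (hWT : ∀ v ∈ W, v ∉ T)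
    (hYT : ∀ v ∈ Y, v ∈ T) :
    W = X₁ ∩ W ∪ X₂ ∩ W ∧ T = Y ∪ (X₁ ∩ T ∪ X₂ ∩ T) ∧ Disjoint Y (X₁ ∩ T ∪ X₂ ∩ T) := by
  refine ⟨?_, ?_, Finset.disjoint_left.2 fun v => ?_⟩
  · ext v
    have := hXX v
    have := hWT v
    have := hYT v
    simp only [Finset.mem_union, Finset.mem_inter]
    tauto
  · ext v
    have := hXX v
    have := hYT v
    simp only [Finset.mem_union, Finset.mem_inter]
    tauto
  · have := hXX v
    simp only [Finset.mem_union, Finset.mem_inter]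
    tauto

/-- Removing the hubs, the common neighbour and one of the trees of a maximal frame with a
disconnected tree part leaves a connected graph. -/
theorem Irr.linked_compl (hG : PT G) (h : Irr G S M) (hM : 2 ≤ M) (g : Good G S a b)
    (hp : pp G S a b = M) {t : V} (ht : t ∈ sT G S a b) :
    Linked G ((sT G S a b ∪ sW G S a b) \ comp G (sI G S a b) t) := by
  by_contra hl
  obtain ⟨X₁, X₂, hn1, hn2, hd, hu, hadj⟩ := exists_split hl
  -- otherwise the rest splits into two sides, whose bounds add up to a strict bound for `S`
  obtain ⟨b1, c1⟩ := h.side_bound hG hM g hp ht hn2 hd hu hadj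
  obtain ⟨b2, c2⟩ := h.side_bound hG hM g hp ht hn1 hd.symm (by rw [Finset.union_comm]; exact hu)
    fun u hu v hv e => hadj v hv u hu e.symm
  obtain ⟨w, hw⟩ := h.sW_nonempty hG g hp
  have hYT : ∀ v ∈ comp G (sI G S a b) t, v ∈ sT G S a b := fun v hv => hG.comp_sT ht hv
  have hWT : ∀ v ∈ sW G S a b, v ∉ sT G S a b := fun v hv => (sW_facts hv).2.2.2.2
  have hcard := hG.card_eq g
  have hpent := hG.card_pents_eq g
  rw [h.card_cn hG hM g hp, hp] at hpent
  rw [h.card_cn hG hM g hp] at hcard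
  have hY := hG.deg2_item g ht
  have hdT := hG.deg2_sT S a b
  rw [hp] at hdT
  set W := sW G S a b with hW
  set T := sT G S a b with hT
  set Y := comp G (sI G S a b) t with hY'
  have hXX : ∀ v, (v ∈ X₁ ∨ v ∈ X₂) ↔ (v ∈ T ∨ v ∈ W) ∧ v ∉ Y := by
    intro v
    rw [← Finset.mem_union, hu, Finset.mem_sdiff, Finset.mem_union]
  obtain ⟨hWe, hTe, hdY⟩ := split_parts hXX hWT hYT
  have hdW : Disjoint (X₁ ∩ W) (X₂ ∩ W) := hd.mono Finset.inter_subset_left Finset.inter_subset_left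
  have hdT' : Disjoint (X₁ ∩ T) (X₂ ∩ T) :=
    hd.mono Finset.inter_subset_left Finset.inter_subset_left
  have hm : (meet G S W).card ≤ (meet G S (X₁ ∩ W)).card + (meet G S (X₂ ∩ W)).card := by
    refine (Finset.card_le_card ?_).trans (Finset.card_union_le _ _)
    intro Q hQ
    rw [mem_meet] at hQ
    rw [Finset.mem_union, mem_meet, mem_meet]
    obtain ⟨h1, h2, w, hwQ, hwW⟩ := hQ
    rw [hWe, Finset.mem_union] at hwW
    rcases hwW with h3 | h3
    · exact Or.inl ⟨h1, h2, w, hwQ, h3⟩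
    · exact Or.inr ⟨h1, h2, w, hwQ, h3⟩
  have cW : W.card = (X₁ ∩ W).card + (X₂ ∩ W).card := by
    conv_lhs => rw [hWe]
    exact Finset.card_union_of_disjoint hdW
  have cT : T.card = Y.card + ((X₁ ∩ T).card + (X₂ ∩ T).card) := by
    conv_lhs => rw [hTe]
    rw [Finset.card_union_of_disjoint hdY, Finset.card_union_of_disjoint hdT']
  have dT : deg2 G T = deg2 G Y + (deg2 G (X₁ ∩ T) + deg2 G (X₂ ∩ T)) := by
    conv_lhs => rw [hTe]
    rw [deg2_union hdY, deg2_union hdT', ee_eq_zero, ee_eq_zero]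
    · ring
    · intro u hu v hv huv
      have hvT : v ∈ T := by
        simp only [Finset.mem_union, Finset.mem_inter] at hv
        tauto
      exact Finset.disjoint_left.1 hdY (comp_closed hu (sT_sub_sI _ _ _ hvT) huv) hv
    · intro u hu v hv huv
      rw [Finset.mem_inter] at hu hv
      exact hadj u hu.1 v hv.1 huv
  have hstrict : 2 * (meet G S (X₁ ∩ W)).card + M * deg2 G (X₁ ∩ T) +
      (2 * (meet G S (X₂ ∩ W)).card + M * deg2 G (X₂ ∩ T)) <
      M * (2 * (X₁ ∩ W).card + 2 * (X₁ ∩ T).card) +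
        M * (2 * (X₂ ∩ W).card + 2 * (X₂ ∩ T).card) := by
    rw [hWe, Finset.mem_union] at hw
    rcases hw with h1 | h1
    · have := c1 ⟨w, h1⟩
      omega
    · have := c2 ⟨w, h1⟩
      omega
  have key : (pents G S).card + M * M + 3 * M < M * S.card := by
    rw [hcard, hpent, cW, cT]
    have f1 : deg2 G (X₁ ∩ T) + deg2 G (X₂ ∩ T) + 2 * Y.card = 2 * M + 2 := by omega
    exact frame_arith hm hstrict f1
  have := h.not_concl key.le
  omega

end

section
variable {V : Type} {G : SimpleGraph V} {S S' U : Finset V} {a b : V} {M : ℕ} [Fintype V]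

/-- Two vertices `t`, `t'` of the frame with common neighbours `a` and `z` cannot both be adjacent to
a connected set outside that is adjacent to `b`. -/
theorem PT.no_star_attach (hG : PT G) (g : Good G S a b) {K : Finset V} (hKl : Linked G K)
    {x t t' z : V} (hx : x ∈ cn G S a b) (ht : t ∈ sA G S a b) (ht' : t' ∈ sA G S a b) (hne : t ≠ t')
    (hz : z ∈ sA G S b a) (hzt : G.Adj z t) (hzt' : G.Adj z t')
    (hK : ∀ v ∈ K, v ≠ a ∧ v ≠ b ∧ v ≠ x ∧ v ≠ t ∧ v ≠ t' ∧ v ≠ z)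
    (hKt : ∃ k ∈ K, G.Adj k t) (hKt' : ∃ k ∈ K, G.Adj k t') (hKb : ∃ k ∈ K, G.Adj b k) : False := by
  obtain ⟨k₁, hk₁, e₁⟩ := hKt
  obtain ⟨k₂, hk₂, e₂⟩ := hKt'
  obtain ⟨k₃, hk₃, e₃⟩ := hKb
  have n1 := hG.sI_ne g (sT_sub_sI _ _ _ (sA_sub_sT _ _ _ ht))
  have n2 := hG.sI_ne g (sT_sub_sI _ _ _ (sA_sub_sT _ _ _ ht'))
  have n3 := hG.sI_ne g (sT_sub_sI _ _ _ (sB_sub_sT _ _ _ hz))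
  have n4 := hG.sI_ne g (cn_sub_sI _ _ _ hx)
  have n5 : t ≠ x := fun e => hG.not_cn_sT (sA_sub_sT _ _ _ ht) (e ▸ hx)
  have n6 : t' ≠ x := fun e => hG.not_cn_sT (sA_sub_sT _ _ _ ht') (e ▸ hx)
  have n7 : z ≠ x := fun e => hG.not_cn_sT (sB_sub_sT _ _ _ hz) (e ▸ hx)
  have n8 := hG.good_ne g
  have n9 := hzt.ne
  have n10 := hzt'.ne
  rw [mem_cn] at hx
  rw [mem_sA] at ht ht' hz
  refine hG.noK33 (X₁ := {a}) (X₂ := {z}) (X₃ := K) (Y₁ := {t}) (Y₂ := {t'}) (Y₃ := {b, x}) ?_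
    (linked_singleton _) (linked_singleton _) hKl (linked_singleton _) (linked_singleton _)
    (linked_pair hx.2.2) ⟨a, by simp, t, by simp, ht.2.1⟩ ⟨a, by simp, t', by simp, ht'.2.1⟩
    ⟨a, by simp, x, by simp, hx.2.1⟩ ⟨z, by simp, t, by simp, hzt⟩ ⟨z, by simp, t', by simp, hzt'⟩
    ⟨z, by simp, b, by simp, hz.2.1.symm⟩ ⟨k₁, hk₁, t, by simp, e₁⟩ ⟨k₂, hk₂, t', by simp, e₂⟩
    ⟨k₃, hk₃, b, by simp, e₃.symm⟩
  intro v
  have q1 := hK v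
  clear hK ht ht' hz hx hzt hzt' e₁ e₂ e₃ hKl
  simp only [Finset.mem_insert, Finset.mem_singleton]
  refine ⟨fun h => ?_, fun h => ?_, fun h => ?_, fun h => ?_, fun h => ?_⟩ <;> grind

theorem PT.exists_adj_item (hG : PT G) {t v : V} (ht : t ∈ sT G S a b)
    (hv : v ∈ comp G (sI G S a b) t) : ∃ w ∈ comp G (sI G S a b) t, G.Adj v w := by
  rcases mem_sT.1 (hG.comp_sT ht hv) with h1 | h1
  · obtain ⟨w, hw, hvw⟩ := exists_sB h1
    exact ⟨w, comp_closed hv (sT_sub_sI _ _ _ (sB_sub_sT _ _ _ hw)) hvw, hvw⟩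
  · obtain ⟨w, hw, hvw⟩ := exists_sB h1
    exact ⟨w, comp_closed hv (sT_sub_sI _ _ _ (sA_sub_sT _ _ _ hw)) hvw, hvw⟩

/-- Each tree of the frame has two leaves, as its average degree is less than two. -/
theorem PT.exists_two_leaves (hG : PT G) (g : Good G S a b) {t : V} (ht : t ∈ sT G S a b) :
    ∃ l ∈ comp G (sI G S a b) t, ∃ l' ∈ comp G (sI G S a b) t, l ≠ l' ∧
      (nb G (comp G (sI G S a b) t) l).card = 1 ∧ (nb G (comp G (sI G S a b) t) l').card = 1 := by
  have hd := hG.deg2_item g ht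
  have h1 : ∀ v ∈ comp G (sI G S a b) t, 1 ≤ (nb G (comp G (sI G S a b) t) v).card := by
    intro v hv
    obtain ⟨w, hw, hvw⟩ := hG.exists_adj_item ht hv
    exact Finset.card_pos.2 ⟨w, mem_nb.2 ⟨hw, hvw⟩⟩
  set Y := comp G (sI G S a b) t
  have h2 : 2 * Y.card ≤ deg2 G Y + (Y.filter fun v => (nb G Y v).card = 1).card := by
    rw [deg2_eq_ee, ee_eq_sum, Finset.card_filter, ← Finset.sum_add_distrib, mul_comm,
      ← smul_eq_mul, ← Finset.sum_const]
    refine Finset.sum_le_sum fun v hv => ?_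
    have := h1 v hv
    split_ifs <;> omega
  obtain ⟨l, hl, l', hl', hne⟩ := Finset.one_lt_card.1
    (by omega : 1 < (Y.filter fun v => (nb G Y v).card = 1).card)
  rw [Finset.mem_filter] at hl hl'
  exact ⟨l, hl.1, l', hl'.1, hne, hl.2, hl'.2⟩

/-- If a maximal frame has just two trees then each of them is a single edge. -/
theorem Irr.item_edge (hG : PT G) (h : Irr G S M) (hM : 2 ≤ M) (g : Good G S a b)
    (hp : pp G S a b = M) {t₁ t₂ : V} (h₁ : t₁ ∈ sT G S a b) (h₂ : t₂ ∈ sT G S a b)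
    (h12 : t₂ ∉ comp G (sI G S a b) t₁) :
    ∃ l l' w w', comp G (sI G S a b) t₁ = {l, l'} ∧ G.Adj l l' ∧ w ∈ sW G S a b ∧
      w' ∈ sW G S a b ∧ G.Adj l w ∧ G.Adj l' w' := by
  obtain ⟨l, hl, l', hl', hne, hd, hd'⟩ := hG.exists_two_leaves g h₁
  have hout : ∀ l ∈ comp G (sI G S a b) t₁, (nb G (comp G (sI G S a b) t₁) l).card = 1 →
      ∃ w ∈ sW G S a b, G.Adj l w := by
    intro l hl hd
    refine h.exists_adj_leaf hG hM g hp (hG.comp_sT h₁ hl) ((Finset.card_le_card fun v hv => ?_).trans hd.le)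
    rw [mem_nb] at hv ⊢
    exact ⟨comp_closed hl (sT_sub_sI _ _ _ hv.1) hv.2, hv.2⟩
  obtain ⟨w, hw, hlw⟩ := hout l hl hd
  obtain ⟨w', hw', hlw'⟩ := hout l' hl' hd'
  by_cases hadj : G.Adj l l'
  · refine ⟨l, l', w, w', ?_, hadj, hw, hw', hlw, hlw'⟩
    have hone : ∀ u v, (nb G (comp G (sI G S a b) t₁) u).card = 1 →
        v ∈ comp G (sI G S a b) t₁ → G.Adj u v → ∀ s ∈ comp G (sI G S a b) t₁, G.Adj u s → s = v :=
      fun u v hu hv huv s hs hus =>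
        Finset.card_le_one.1 hu.le s (mem_nb.2 ⟨hs, hus⟩) v (mem_nb.2 ⟨hv, huv⟩)
    apply Finset.Subset.antisymm
    · intro v hv
      rw [Finset.mem_insert, Finset.mem_singleton]
      refine linked_comp (G := G) (sI G S a b) t₁ (fun v => v = l ∨ v = l') ?_ l hl v hv (Or.inl rfl)
      rintro u - v hv huv (rfl | rfl)
      · exact Or.inr (hone u l' hd hl' hadj v hv huv)
      · exact Or.inl (hone u l hd' hl hadj.symm v hv huv)
    · intro v hv
      rw [Finset.mem_insert, Finset.mem_singleton] at hv
      rcases hv with rfl | rfl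
      · exact hl
      · exact hl'
  · exfalso
    obtain ⟨x, hx⟩ := g.c
    -- everything outside the tree, the hubs and `x` is connected
    have hKl := h.linked_compl hG hM g hp h₁
    set K := (sT G S a b ∪ sW G S a b) \ comp G (sI G S a b) t₁ with hK
    have hmK : ∀ v, v ∈ K ↔ (v ∈ sT G S a b ∨ v ∈ sW G S a b) ∧ v ∉ comp G (sI G S a b) t₁ := by
      intro v
      rw [hK, Finset.mem_sdiff, Finset.mem_union]
    have hWK : ∀ w ∈ sW G S a b, w ∈ K := fun w hw => (hmK w).2 ⟨Or.inr hw, fun e =>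
      (sW_facts hw).2.2.2.2 (hG.comp_sT h₁ e)⟩
    have hKn : ∀ v ∈ K, v ∉ comp G (sI G S a b) t₁ ∧ v ≠ a ∧ v ≠ b ∧ v ≠ x := by
      intro v hv
      obtain ⟨h1 | h1, h2⟩ := (hmK v).1 hv
      · exact ⟨h2, (hG.sI_ne g (sT_sub_sI _ _ _ h1)).1, (hG.sI_ne g (sT_sub_sI _ _ _ h1)).2,
          fun e => hG.not_cn_sT h1 (e ▸ hx)⟩
      · exact ⟨h2, (sW_facts h1).2.1, (sW_facts h1).2.2.1, fun e => (sW_facts h1).2.2.2.1 (e ▸ hx)⟩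
    have hY₂ : ∀ s ∈ comp G (sI G S a b) t₂, s ∈ K := fun s hs => (hmK s).2
      ⟨Or.inl (hG.comp_sT h₂ hs), fun e => Finset.disjoint_left.1
        (comp_disjoint (sT_sub_sI _ _ _ h₁) (sT_sub_sI _ _ _ h₂) h12) e hs⟩
    obtain ⟨s, hs, has⟩ := comp_touch_left (sT_sub_sI _ _ _ h₂)
    obtain ⟨s', hs', hbs'⟩ := comp_touch_right (sT_sub_sI _ _ _ h₂)
    have e1 : ∃ k ∈ K, G.Adj k l := ⟨w, hWK w hw, hlw.symm⟩
    have e2 : ∃ k ∈ K, G.Adj k l' := ⟨w', hWK w' hw', hlw'.symm⟩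
    obtain ⟨z, hz, hzl, hzl', ⟨f1, f2, f3⟩ | ⟨f1, f2, f3⟩⟩ := hG.attach_same_side g
      (fun v hv => hG.comp_sT h₁ hv) (linked_comp _ _) hKl hx hKn hl hl' hne hadj e1 e2
    · refine hG.no_star_attach g hKl hx f1 f2 hne f3 hzl hzl' (fun v hv => ?_) e1 e2
        ⟨s', hY₂ s' hs', hbs'⟩
      have := hKn v hv
      exact ⟨this.2.1, this.2.2.1, this.2.2.2, fun e => this.1 (e ▸ hl), fun e => this.1 (e ▸ hl'),
        fun e => this.1 (e ▸ hz)⟩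
    · refine hG.no_star_attach g.symm hKl (cn_symm (G := G) S a b ▸ hx) f1 f2 hne f3 hzl hzl'
        (fun v hv => ?_) e1 e2 ⟨s, hY₂ s hs, has⟩
      have := hKn v hv
      exact ⟨this.2.2.1, this.2.1, this.2.2.2, fun e => this.1 (e ▸ hl), fun e => this.1 (e ▸ hl'),
        fun e => this.1 (e ▸ hz)⟩

/-- There is no minimal counterexample with `M ≥ 2`. Three trees contradict `PT.theta`. If there are
two, each is a single edge, so `M = 2`, and deleting the common neighbour gives the bound. -/
theorem Irr.false_of_two_le (hG : PT G) (h : Irr G S M) (hM : 2 ≤ M) : False := by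
  obtain ⟨a, b, g, hp⟩ := h.max.ex
  have hl := h.not_linked hG hM g hp
  obtain ⟨y, hy, -⟩ := g.exists_path
  have h₁ : y ∈ sT G S a b := sA_sub_sT _ _ _ hy
  have hsub : ∀ t ∈ sT G S a b, ∀ v ∈ comp G (sI G S a b) t, v ∈ sT G S a b := fun t ht v hv =>
    hG.comp_sT ht hv
  obtain ⟨t, h₂, h12⟩ : ∃ t ∈ sT G S a b, t ∉ comp G (sI G S a b) y := by
    by_contra hcon
    push Not at hcon
    rw [← Finset.Subset.antisymm (hsub y h₁) hcon] at hl
    exact hl (linked_comp _ _)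
  have h21 : y ∉ comp G (sI G S a b) t := fun e =>
    h12 (by rw [comp_eq_of_mem (sT_sub_sI _ _ _ h₂) e]; exact mem_comp_self (sT_sub_sI _ _ _ h₂))
  have i₁ := sT_sub_sI _ _ _ h₁
  have i₂ := sT_sub_sI _ _ _ h₂
  obtain ⟨x, hx⟩ := g.c
  have hx' := mem_cn.1 hx
  have hxI := hG.sI_ne g (cn_sub_sI _ _ _ hx)
  -- three trees form a theta graph with the hubs; otherwise there are two trees, each an edge
  by_cases h3 : ∃ s ∈ sT G S a b, s ∉ comp G (sI G S a b) y ∧ s ∉ comp G (sI G S a b) t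
  · obtain ⟨s, h₃, h13, h23⟩ := h3
    have i₃ := sT_sub_sI _ _ _ h₃
    have hin : ∀ t ∈ sT G S a b, comp G (sI G S a b) t ⊆ sT G S a b ∪ sW G S a b :=
      fun t ht v hv => Finset.mem_union_left _ (hsub t ht v hv)
    have hleft : ∀ t ∈ sI G S a b, Touch G {a} (comp G (sI G S a b) t) := fun t ht => by
      obtain ⟨s, hs, has⟩ := comp_touch_left ht
      exact ⟨a, by simp, s, hs, has⟩
    have hright : ∀ t ∈ sI G S a b, Touch G {b, x} (comp G (sI G S a b) t) := fun t ht => by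
      obtain ⟨s, hs, has⟩ := comp_touch_right ht
      exact ⟨b, by simp, s, hs, has⟩
    have hD : ∀ v ∈ sT G S a b ∪ sW G S a b, v ≠ a ∧ v ≠ b ∧ v ≠ x := by
      intro v hv
      rcases Finset.mem_union.1 hv with h1 | h1
      · exact ⟨(hG.sI_ne g (sT_sub_sI _ _ _ h1)).1, (hG.sI_ne g (sT_sub_sI _ _ _ h1)).2,
          fun e => hG.not_cn_sT h1 (e ▸ hx)⟩
      · exact ⟨(sW_facts h1).2.1, (sW_facts h1).2.2.1, fun e => (sW_facts h1).2.2.2.1 (e ▸ hx)⟩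
    refine hG.theta (a := a) (B := {b, x}) (D := sT G S a b ∪ sW G S a b) (fun e => (hD a e).1 rfl)
      ?_ ?_ (linked_pair hx'.2.2) ⟨a, by simp, x, by simp, hx'.2.1⟩ (hin y h₁) (hin t h₂) (hin s h₃)
      (comp_disjoint i₁ i₂ h12) (comp_disjoint i₁ i₃ h13) (comp_disjoint i₂ i₃ h23)
      (linked_comp _ _) (linked_comp _ _) (linked_comp _ _) (hleft y i₁) (hleft t i₂) (hleft s i₃)
      (hright y i₁) (hright t i₂) (hright s i₃) (h.linked_compl hG hM g hp h₁)
      (h.linked_compl hG hM g hp h₂) (h.linked_compl hG hM g hp h₃)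
    · rw [Finset.mem_insert, Finset.mem_singleton, not_or]
      exact ⟨hG.good_ne g, hxI.1.symm⟩
    · intro v hv e
      rw [Finset.mem_insert, Finset.mem_singleton] at hv
      rcases hv with rfl | rfl
      · exact (hD v e).2.1 rfl
      · exact (hD v e).2.2 rfl
  · push Not at h3
    obtain ⟨l₁, l₁', w, w', hY₁, e₁, hw, hw', f₁, f₁'⟩ := h.item_edge hG hM g hp h₁ h₂ h12
    obtain ⟨l₂, l₂', -, -, hY₂, e₂, -⟩ := h.item_edge hG hM g hp h₂ h₁ h21
    have hT : sT G S a b = comp G (sI G S a b) y ∪ comp G (sI G S a b) t := by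
      ext v
      rw [Finset.mem_union]
      refine ⟨fun hv => or_iff_not_imp_left.2 (h3 v hv), ?_⟩
      rintro (h1 | h1)
      · exact hsub y h₁ v h1
      · exact hsub t h₂ v h1
    have hdis := comp_disjoint i₁ i₂ h12
    have c₁ : (comp G (sI G S a b) y).card = 2 := by rw [hY₁, Finset.card_pair e₁.ne]
    have c₂ : (comp G (sI G S a b) t).card = 2 := by rw [hY₂, Finset.card_pair e₂.ne]
    have d₁ := hG.deg2_item g h₁
    have d₂ := hG.deg2_item g h₂
    have hd := hG.deg2_sT S a b
    rw [hT, deg2_union hdis, ee_eq_zero (fun u hu v hv huv => Finset.disjoint_left.1 hdis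
      (comp_closed hu (comp_subset _ _ hv) huv) hv), hp] at hd
    have hcard := hG.card_eq g
    rw [h.card_cn hG hM g hp, hT, Finset.card_union_of_disjoint hdis, c₁, c₂] at hcard
    have hM2 : M = 2 := by omega
    have hww : w ≠ w' := fun e => hG.tri l₁ l₁' w e₁ (e ▸ f₁') f₁.symm
    have hW : 1 < (sW G S a b).card := Finset.one_lt_card.2 ⟨w, hw, w', hw', hww⟩
    -- deleting `x` loses at most two pentagons
    have hnx := hG.nb_cn_sub hx fun w hw hxw => (h.outside hG hM g hp hw).1 x hx hxw.symm
    obtain ⟨c3, c4⟩ :=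
      h.card_pents_le hG hnx hx'.1 (Or.inr ⟨g.ha, hx'.2.1.symm, g.hb, hx'.2.2.symm⟩)
    have c5 := Finset.card_erase_add_one hx'.1
    subst hM2
    have c6 : (pents G S).card + 2 * 2 + 3 * 2 ≤ 2 * S.card := by
      rcases h.sub (Finset.erase_ssubset hx'.1) with h0 | ⟨M', m1, m2, hc, -⟩
      · omega
      · obtain rfl | rfl : M' = 1 ∨ M' = 2 := by omega
        · omega
        · omega
    have := h.not_concl c6
    omega

end

/-! ### Graphs without two pentagons on a nonadjacent pair -/

section
variable {V : Type} {G : SimpleGraph V} {S S' U Q : Finset V} {a b : V} {M : ℕ} [Fintype V]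

omit [Fintype V] in
/-- If there is only one path of length three then the frame has a single edge as its tree part. -/
theorem frame_one (hp : pp G S a b = 1) : ∃ y z, sA G S a b = {y} ∧ sA G S b a = {z} ∧
    G.Adj y z := by
  have h1 : (sA G S a b).card ≤ 1 := by
    rw [← hp, pp_symm, pp_eq_ee]
    exact card_le_ee fun y hy => (exists_sB hy).imp fun z hz => ⟨hz.1, hz.2.symm⟩
  have h2 : (sA G S b a).card ≤ 1 := by
    rw [← hp, pp_eq_ee]
    exact card_le_ee fun y hy => (exists_sB hy).imp fun z hz => ⟨hz.1, hz.2.symm⟩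
  obtain ⟨y, hy, z, hz, hyz⟩ := exists_of_ee_pos
    (show 0 < ee G (sA G S a b) (sA G S b a) by rw [← pp_eq_ee, hp]; exact one_pos)
  exact ⟨y, z, Finset.eq_singleton_iff_unique_mem.2 ⟨hy, fun v hv => Finset.card_le_one.1 h1 v hv y hy⟩,
    Finset.eq_singleton_iff_unique_mem.2 ⟨hz, fun v hv => Finset.card_le_one.1 h2 v hv z hz⟩, hyz⟩

omit [Fintype V] in
theorem Irr.pp_eq_one (h : Irr G S 1) (g : Good G S a b) : pp G S a b = 1 :=
  le_antisymm (h.max.le a b g) g.p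

/-- For `M = 1` a good pair has a single common neighbour, and so lies in a single pentagon. -/
theorem Irr.cn_one (hG : PT G) (h : Irr G S 1) (g : Good G S a b) : (cn G S a b).card = 1 := by
  have hp := h.pp_eq_one g
  by_contra hc1
  have hc : 2 ≤ (cn G S a b).card := by
    have := Finset.card_pos.2 g.c
    omega
  obtain ⟨y, z, hA, hB, hyz⟩ := frame_one hp
  have hy : y ∈ sA G S a b := by simp [hA]
  have hz : z ∈ sA G S b a := by simp [hB]
  have hTc : (sT G S a b).card = 2 := by rw [hG.card_sT, hA, hB]; simp
  have hl : Linked G (sT G S a b) := (hG.linked_sT_iff g).2 (by rw [hTc, hp])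
  have hn := fun t w => h.not_adj_sT hG g hp hl hc (t := t) (w := w)
  have hyS := sA_sub _ _ _ hy
  have hzS := sA_sub _ _ _ hz
  -- `y` and then `z` can be deleted at a loss of at most one pentagon
  have hny : nb G S y ⊆ {a, z} := by
    intro v hv
    rw [mem_nb] at hv
    rw [Finset.mem_insert, Finset.mem_singleton]
    rcases mem_cases (G := G) (a := a) (b := b) hv.1 with h1 | rfl | h1 | h1
    · exact Or.inl h1
    · exact absurd hv.2.symm (hG.sA_nadj hy)
    · rcases hG.adj_sI (sT_sub_sI _ _ _ (sA_sub_sT _ _ _ hy)) h1 hv.2 with h2 | h2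
      · rw [hB, Finset.mem_singleton] at h2
        exact Or.inr h2.2
      · exact absurd h2.1 (hG.not_sA_sB hy)
    · exact absurd hv.2 (hn y v (sA_sub_sT _ _ _ hy) h1)
  have hnz : nb G (S.erase y) z ⊆ {b, b} := by
    intro v hv
    rw [mem_nb, Finset.mem_erase] at hv
    rw [Finset.mem_insert, Finset.mem_singleton, or_self]
    rcases mem_cases (G := G) (a := a) (b := b) hv.1.2 with rfl | h1 | h1 | h1
    · exact absurd hv.2.symm (hG.sA_nadj hz)
    · exact h1
    · rcases hG.adj_sI (sT_sub_sI _ _ _ (sB_sub_sT _ _ _ hz)) h1 hv.2 with h2 | h2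
      · exact absurd hz (hG.not_sA_sB h2.1)
      · rw [hA, Finset.mem_singleton] at h2
        exact absurd h2.2 hv.1.1
    · exact absurd hv.2 (hn z v (sB_sub_sT _ _ _ hz) h1)
  obtain ⟨c1, c2⟩ := h.card_pents_le hG hny hyS
    (Or.inr ⟨g.ha, (mem_sA.1 hy).2.1.symm, hzS, hyz⟩)
  have c3 := hG.card_pents_erase hnz
  rw [hG.pp_self] at c3
  have hzS' : z ∈ S.erase y := Finset.mem_erase.2 ⟨hyz.ne', hzS⟩
  have c4 := Finset.card_erase_add_one hzS'
  have c5 := Finset.card_erase_add_one hyS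
  have hcard := hG.card_eq g
  have hW := Finset.card_pos.2 (h.sW_nonempty hG g hp)
  have c6 : (pents G S).card + 1 * 1 + 3 * 1 < 1 * S.card := by
    rcases h.sub ((Finset.erase_ssubset hzS').trans (Finset.erase_ssubset hyS)) with
      h0 | ⟨M', m1, m2, hc, -⟩
    · omega
    · obtain rfl : M' = 1 := by omega
      omega
  have := h.not_concl c6.le
  omega

/-- When no nonadjacent pair lies in two pentagons, pentagons of a minimal counterexample do not
separate it. -/
theorem Irr.linked_sW (hG : PT G) (h : Irr G S 1) (g : Good G S a b) : Linked G (sW G S a b) := by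
  have hp := h.pp_eq_one g
  obtain ⟨y, z, hA, hB, hyz⟩ := frame_one hp
  obtain ⟨x, hx⟩ := g.c
  have hC : ∀ v ∈ cn G S a b, v = x := fun v hv =>
    Finset.card_le_one.1 (h.cn_one hG g).le v hv x hx
  have hTc : (sT G S a b).card = 2 := by rw [hG.card_sT, hA, hB]; simp
  have hl : Linked G (sT G S a b) := (hG.linked_sT_iff g).2 (by rw [hTc, hp])
  obtain ⟨w, hw⟩ := h.sW_nonempty hG g hp
  rw [linked_iff_comp hw]
  by_contra hne
  have hcl := closed_comp (G := G) (sW G S a b) w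
  -- two vertices of the frame cannot have a common neighbour in it and another outside
  have htwo : ∀ r ∈ S, ∀ r' ∈ S, ∀ u ∈ sI G S a b ∪ {a, b}, ∀ w ∈ sW G S a b, G.Adj r u →
      G.Adj r' u → G.Adj r w → G.Adj r' w → ∀ s ∈ S, ∀ s' ∈ S, G.Adj r s → G.Adj s s' →
      G.Adj s' r' → False := by
    intro r hr r' hr' u hu w hw e1 e2 e3 e4 s hs s' hs' f1 f2 f3
    have huS : u ∈ S := by
      simp only [Finset.mem_union, Finset.mem_insert, Finset.mem_singleton] at hu
      rcases hu with h1 | rfl | rfl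
      · exact sI_sub _ _ _ h1
      · exact g.ha
      · exact g.hb
    have m1 : u ∈ cn G S r r' := mem_cn.2 ⟨huS, e1, e2⟩
    have m2 : w ∈ cn G S r r' := mem_cn.2 ⟨sW_sub _ _ _ hw, e3, e4⟩
    have := Finset.card_le_one.1 (h.cn_one hG ⟨hr, hr', ⟨u, m1⟩, pp_pos hs hs' f1 f2 f3⟩).le u m1 w m2
    subst this
    simp only [Finset.mem_union, Finset.mem_insert, Finset.mem_singleton] at hu
    rcases hu with h1 | h1 | h1
    · exact not_mem_sI_of_sW hw h1
    · exact (sW_facts hw).2.1 h1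
    · exact (sW_facts hw).2.2.1 h1
  have hIS : ∀ r ∈ sI G S a b, r ∈ S := fun r hr => sI_sub _ _ _ hr
  -- distinct nonadjacent inner vertices of the frame have a common neighbour among the hubs
  have hhub : ∀ r ∈ sI G S a b, ∀ r' ∈ sI G S a b, r' ≠ r → ¬ G.Adj r r' →
      ∃ u ∈ sI G S a b ∪ {a, b}, G.Adj r u ∧ G.Adj r' u := by
    intro r hr r' hr' hne hnadj
    have hx' := mem_cn.1 hx
    have hya : G.Adj a y := (mem_sA.1 (by rw [hA]; simp : y ∈ sA G S a b)).2.1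
    have hzb : G.Adj b z := (mem_sA.1 (by rw [hB]; simp : z ∈ sA G S b a)).2.1
    have hcase : ∀ r ∈ sI G S a b, r = x ∨ r = y ∨ r = z := by
      intro r hr
      rcases mem_sI.1 hr with h1 | h1
      · exact Or.inl (hC r h1)
      · rw [mem_sT, hA, hB, Finset.mem_singleton, Finset.mem_singleton] at h1
        exact Or.inr h1
    have ma : a ∈ sI G S a b ∪ {a, b} := by simp
    have mb : b ∈ sI G S a b ∪ {a, b} := by simp
    rcases hcase r hr with e1 | e1 | e1 <;> rcases hcase r' hr' with e2 | e2 | e2 <;> subst e1 <;>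
      subst e2
    · exact absurd rfl hne
    · exact ⟨a, ma, hx'.2.1.symm, hya.symm⟩
    · exact ⟨b, mb, hx'.2.2.symm, hzb.symm⟩
    · exact ⟨a, ma, hya.symm, hx'.2.1.symm⟩
    · exact absurd rfl hne
    · exact absurd hyz hnadj
    · exact ⟨b, mb, hzb.symm, hx'.2.2.symm⟩
    · exact absurd hyz.symm hnadj
    · exact absurd rfl hne
  have hpc : PentClosed G S a b (comp G (sW G S a b) w) := by
    intro Q hQS hQ hQU v hvQ hvW
    by_contra hvU
    obtain ⟨k, hk, k', hk', r, hr, e1, e2, hc⟩ := hG.cross g hcl hQS hQ hQU ⟨v, hvQ, hvW, hvU⟩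
    have hkW := comp_subset _ _ hk
    rw [Finset.mem_sdiff] at hk'
    rcases hc with ⟨r', hr', hne', hnadj, ⟨h1, s, hs, h2, h3⟩ | ⟨h1, s, hs, h2, h3⟩⟩ |
      ⟨r₁, hr₁, r₂, hr₂, h1, h2, h3, h4, h5, h6, h7⟩
    · obtain ⟨u, hu, f1, f2⟩ := hhub r hr r' hr' hne' hnadj
      exact htwo r (hIS r hr) r' (hIS r' hr') u hu k hkW f1 f2 e1.symm h1.symm k'
        (sW_sub _ _ _ hk'.1) s (sW_sub _ _ _ (Finset.mem_sdiff.1 hs).1) e2.symm h2 h3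
    · obtain ⟨u, hu, f1, f2⟩ := hhub r hr r' hr' hne' hnadj
      exact htwo r (hIS r hr) r' (hIS r' hr') u hu k' hk'.1 f1 f2 e2.symm h1.symm k
        (sW_sub _ _ _ hkW) s (sW_sub _ _ _ (comp_subset _ _ hs)) e1.symm h2 h3
    · obtain ⟨u, hu, f1, f2⟩ := hhub r hr r₁ hr₁ h6.symm h4
      exact htwo r (hIS r hr) r₁ (hIS r₁ hr₁) u hu k hkW f1 f2 e1.symm h1.symm k'
        (sW_sub _ _ _ hk'.1) r₂ (hIS r₂ hr₂) e2.symm h2 h3.symm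
  refine h.no_small_attachment hG g hp (C := cn G S a b) (Y := sT G S a b) hcl ⟨w, mem_comp_self hw⟩ hpc
    (Finset.Subset.refl _) g.c (by rw [h.cn_one hG g]; norm_num) (Finset.Subset.refl _)
    (Finset.card_pos.1 (by omega)) hl (fun _ _ v hv _ => hv) (fun u _ r hr _ => mem_sI.1 hr)
    (Or.inl hne)

/-- For `M = 1`, deleting the vertices of a pentagon does not disconnect the rest: a part of it
could be split off by `Irr.no_small_attachment`. -/
theorem Irr.linked_sdiff (hG : PT G) (h : Irr G S 1) (hQ : Q ∈ pents G S) : Linked G (S \ Q) := by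
  rw [mem_pents] at hQ
  obtain ⟨hQS, x, a, y, z, b, rfl, h1, h2, h3, h4, h5⟩ := hQ
  have hs : ∀ v ∈ ({x, a, y, z, b} : Finset V), v ∈ S := fun v hv => hQS hv
  have hx : x ∈ cn G S a b := mem_cn.2 ⟨hs x (by simp), h1.symm, h5⟩
  have g : Good G S a b := ⟨hs a (by simp), hs b (by simp), ⟨x, hx⟩,
    pp_pos (hs y (by simp)) (hs z (by simp)) h2 h3 h4⟩
  obtain ⟨y', z', hA, hB, -⟩ := frame_one (h.pp_eq_one g)
  obtain ⟨m1, m2⟩ := sB_of_adj (hs y (by simp)) (hs z (by simp)) h2 h3 h4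
  have hC : cn G S a b = {x} := Finset.eq_singleton_iff_unique_mem.2
    ⟨hx, fun v hv => Finset.card_le_one.1 (h.cn_one hG g).le v hv x hx⟩
  rw [hA, Finset.mem_singleton] at m1
  rw [hB, Finset.mem_singleton] at m2
  subst m1; subst m2
  convert h.linked_sW hG g using 1
  ext v
  rw [Finset.mem_sdiff, mem_sW, mem_sI, mem_sT, hA, hB, hC]
  simp only [Finset.mem_insert, Finset.mem_singleton]
  tauto

/-- A nonadjacent pair lies in at most one pentagon. -/
theorem Irr.pent_unique (hG : PT G) (h : Irr G S 1) {Q Q' : Finset V} (hQ : Q ∈ pents G S)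
    (hQ' : Q' ∈ pents G S) (ha : a ∈ Q) (hb : b ∈ Q) (hab : a ≠ b) (hadj : ¬ G.Adj a b)
    (ha' : a ∈ Q') (hb' : b ∈ Q') : Q = Q' := by
  have hQ₀ := hQ
  rw [mem_pents] at hQ
  obtain ⟨x, y, z, he, h1, h2, h3, h4, h5⟩ := hQ.2.pair ha hb hab hadj
  have hs : ∀ v ∈ ({x, a, y, z, b} : Finset V), v ∈ S := fun v hv => hQ.1 (he ▸ hv)
  have g : Good G S a b := ⟨hs a (by simp), hs b (by simp), ⟨x, mem_cn.2 ⟨hs x (by simp), h1, h2⟩⟩,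
    pp_pos (hs y (by simp)) (hs z (by simp)) h3 h4 h5⟩
  have hc := hG.card_pents_pair g.ha g.hb hab g.c
  rw [h.cn_one hG g, h.pp_eq_one g] at hc
  exact Finset.card_le_one.1 hc.le Q (Finset.mem_filter.2 ⟨hQ₀, ha, hb⟩) Q'
    (Finset.mem_filter.2 ⟨hQ', ha', hb'⟩)

/-- Removing an edge from a pentagon leaves a path through the other three vertices. -/
theorem IsPent.sdiff_edge (hG : PT G) (hQ : IsPent G Q) {u v : V} (hu : u ∈ Q) (hv : v ∈ Q)
    (huv : G.Adj u v) : ∃ p q r, Q \ {u, v} = {p, q, r} ∧ G.Adj u p ∧ G.Adj p q ∧ G.Adj q r ∧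
      G.Adj r v := by
  have key : ∀ p y z q, G.Adj u p → G.Adj p y → G.Adj y z → G.Adj z q → G.Adj q u →
      ({u, p, y, z, q} : Finset V) \ {u, q} = {p, y, z} := by
    intro p y z q h1 h2 h3 h4 h5
    have n1 := (hG.ne h1 h2 h3 h4 h5).1
    have n2 := (hG.ne h2 h3 h4 h5 h1).1
    have n3 := (hG.ne h3 h4 h5 h1 h2).1
    have n4 := (hG.ne h4 h5 h1 h2 h3).1
    have n5 := (hG.ne h5 h1 h2 h3 h4).1
    have m1 := h1.ne
    have m4 := h4.ne
    ext v
    simp only [Finset.mem_sdiff, Finset.mem_insert, Finset.mem_singleton]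
    grind
  obtain ⟨p, y, z, q, rfl, h1, h2, h3, h4, h5⟩ := hQ.rotate hu
  simp only [Finset.mem_insert, Finset.mem_singleton] at hv
  have n2 := (hG.ne h1 h2 h3 h4 h5).2
  have n3 := (hG.ne h4 h5 h1 h2 h3).2
  rcases hv with rfl | rfl | rfl | rfl | rfl
  · exact absurd huv G.irrefl
  · refine ⟨q, z, y, ?_, h5.symm, h4.symm, h3.symm, h2.symm⟩
    rw [← key q z y v h5.symm h4.symm h3.symm h2.symm h1.symm]
    congr 1
    ext w
    simp only [Finset.mem_insert, Finset.mem_singleton]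
    tauto
  · exact absurd huv n2
  · exact absurd huv.symm n3
  · exact ⟨p, y, z, key p y z v h1 h2 h3 h4 h5, h1, h2, h3, h4⟩

/-- Each edge lies in at most two pentagons. -/
theorem Irr.card_pents_edge (hG : PT G) (h : Irr G S 1) {u v : V} (hu : u ∈ S) (hv : v ∈ S)
    (huv : G.Adj u v) : ((pents G S).filter fun Q => u ∈ Q ∧ v ∈ Q).card ≤ 2 := by
  by_contra hc
  obtain ⟨Q₁, hQ₁, Q₂, hQ₂, Q₃, hQ₃, n12, n13, n23⟩ := Finset.two_lt_card.1 (not_le.1 hc)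
  rw [Finset.mem_filter] at hQ₁ hQ₂ hQ₃
  have hint : ∀ Q ∈ pents G S, ∀ Q' ∈ pents G S, u ∈ Q ∧ v ∈ Q → u ∈ Q' ∧ v ∈ Q' → Q ≠ Q' →
      Disjoint (Q \ {u, v}) (Q' \ {u, v}) := by
    intro Q hQ Q' hQ' ⟨h1, h2⟩ ⟨h1', h2'⟩ hne
    rw [Finset.disjoint_left]
    intro w hw hw'
    rw [Finset.mem_sdiff, Finset.mem_insert, Finset.mem_singleton, not_or] at hw hw'
    by_cases hwu : G.Adj w u
    · exact hne (h.pent_unique hG hQ hQ' hw.1 h2 hw.2.2 (fun e => hG.tri w u v hwu huv e.symm)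
        hw'.1 h2')
    · exact hne (h.pent_unique hG hQ hQ' hw.1 h1 hw.2.1 hwu hw'.1 h1')
  have hpath : ∀ Q ∈ pents G S, u ∈ Q ∧ v ∈ Q → Q \ {u, v} ⊆ S \ {u, v} ∧
      Linked G (Q \ {u, v}) ∧ Touch G {u} (Q \ {u, v}) ∧ Touch G {v} (Q \ {u, v}) ∧
      Linked G ((S \ {u, v}) \ (Q \ {u, v})) := by
    intro Q hQ ⟨h1, h2⟩
    have hlin := h.linked_sdiff hG hQ
    rw [mem_pents] at hQ
    obtain ⟨p, q, r, he, e1, e2, e3, e4⟩ := hQ.2.sdiff_edge hG h1 h2 huv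
    refine ⟨Finset.sdiff_subset_sdiff hQ.1 (Finset.Subset.refl _), ?_, ?_, ?_, ?_⟩
    · rw [he]
      exact (linked_pair e3).insert (by simp) e2
    · rw [he]
      exact ⟨u, by simp, p, by simp, e1⟩
    · rw [he]
      exact ⟨v, by simp, r, by simp, e4.symm⟩
    · convert hlin using 1
      ext w
      simp only [Finset.mem_sdiff, Finset.mem_insert, Finset.mem_singleton]
      constructor
      · tauto
      · rintro ⟨hwS, hwQ⟩
        have : ¬ (w = u ∨ w = v) := by
          rintro (rfl | rfl)
          · exact hwQ h1
          · exact hwQ h2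
        tauto
  obtain ⟨a1, a2, a3, a4, a5⟩ := hpath Q₁ hQ₁.1 hQ₁.2
  obtain ⟨b1, b2, b3, b4, b5⟩ := hpath Q₂ hQ₂.1 hQ₂.2
  obtain ⟨c1, c2, c3, c4, c5⟩ := hpath Q₃ hQ₃.1 hQ₃.2
  exact hG.theta (by simp) (by simpa using huv.ne) (by simp) (linked_singleton v)
    ⟨u, by simp, v, by simp, huv⟩ a1 b1 c1 (hint _ hQ₁.1 _ hQ₂.1 hQ₁.2 hQ₂.2 n12)
    (hint _ hQ₁.1 _ hQ₃.1 hQ₁.2 hQ₃.2 n13) (hint _ hQ₂.1 _ hQ₃.1 hQ₂.2 hQ₃.2 n23) a2 b2 c2 a3 b3 c3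
    a4 b4 c4 a5 b5 c5

theorem IsPent.le_deg2 (hG : PT G) (hQ : IsPent G Q) : 10 ≤ deg2 G Q := by
  rw [deg2_eq_ee, ee_eq_sum]
  have : ∑ _v ∈ Q, 2 ≤ ∑ v ∈ Q, (nb G Q v).card := by
    refine Finset.sum_le_sum fun v hv => ?_
    obtain ⟨p, y, z, q, he, h1, h2, h3, h4, h5⟩ := hQ.rotate hv
    have hpq : p ≠ q := (hG.ne h5 h1 h2 h3 h4).1.symm
    rw [← Finset.card_pair hpq]
    refine Finset.card_le_card ?_
    intro w hw
    rw [Finset.mem_insert, Finset.mem_singleton] at hw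
    rw [mem_nb]
    rcases hw with rfl | rfl
    · exact ⟨by rw [he]; simp, h1⟩
    · exact ⟨by rw [he]; simp, h5.symm⟩
  rw [Finset.sum_const, hG.card_pent hQ] at this
  exact this

/-- Each edge lies in at most two pentagons, and each pentagon has five edges. -/
theorem Irr.card_pents_one (hG : PT G) (h : Irr G S 1) :
    10 * (pents G S).card ≤ 2 * deg2 G S := by
  have h1 : 10 * (pents G S).card ≤ ∑ Q ∈ pents G S, deg2 G Q := by
    rw [mul_comm, ← smul_eq_mul, ← Finset.sum_const]
    exact Finset.sum_le_sum fun Q hQ => (mem_pents.1 hQ).2.le_deg2 hG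
  refine h1.trans ?_
  -- count pairs of a pentagon and an ordered pair of adjacent vertices of it
  have h2 : ∀ Q ∈ pents G S, deg2 G Q =
      ∑ e ∈ (S ×ˢ S).filter fun e => G.Adj e.1 e.2, if e.1 ∈ Q ∧ e.2 ∈ Q then 1 else 0 := by
    intro Q hQ
    rw [← Finset.card_filter, deg2_eq_ee, ee]
    congr 1
    ext e
    have := @(mem_pents.1 hQ).1
    have h3 := @this e.1
    have h4 := @this e.2
    simp only [Finset.mem_filter, Finset.mem_product]
    tauto
  rw [Finset.sum_congr rfl h2, Finset.sum_comm, deg2_eq_ee, ee, mul_comm, ← smul_eq_mul,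
    ← Finset.sum_const]
  refine Finset.sum_le_sum fun e he => ?_
  rw [Finset.mem_filter, Finset.mem_product] at he
  rw [← Finset.card_filter]
  exact h.card_pents_edge hG he.1.1 he.1.2 he.2

/-- There is no minimal counterexample with `M = 1`: counting edges of pentagons leaves only a
pentagon with one further vertex, which has three neighbours on it. -/
theorem Irr.false_of_one (hG : PT G) (h : Irr G S 1) : False := by
  obtain ⟨a, b, g, hp⟩ := h.max.ex
  obtain ⟨x, hx⟩ := g.c
  have hx' := mem_cn.1 hx
  obtain ⟨y, z, hA, hB, hyz⟩ := frame_one hp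
  have hy : y ∈ sA G S a b := by simp [hA]
  have hz : z ∈ sA G S b a := by simp [hB]
  have hcard := hG.card_eq g
  rw [h.cn_one hG g, hG.card_sT, hA, hB, Finset.card_singleton, Finset.card_singleton] at hcard
  obtain ⟨w, hw⟩ := h.sW_nonempty hG g hp
  have hW := Finset.card_pos.2 ⟨w, hw⟩
  have hodd : ¬ ∃ s : V → ZMod 2, ∀ u ∈ S, ∀ v ∈ S, G.Adj u v → s u ≠ s v := by
    rintro ⟨s, hs⟩
    have hyS := sA_sub _ _ _ hy
    have hzS := sA_sub _ _ _ hz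
    exact no_two_coloring (hs x hx'.1 a g.ha hx'.2.1.symm) (hs a g.ha y hyS (mem_sA.1 hy).2.1)
      (hs y hyS z hzS hyz) (hs z hzS b g.hb (mem_sA.1 hz).2.1.symm) (hs b g.hb x hx'.1 hx'.2.2)
  have h1 := ((hG.cut.deg2_le hG.tri (S := S) (by omega)).2).resolve_left hodd
  have h2 := h.card_pents_one hG
  obtain ⟨-, h3, -⟩ := h.not_concl (by omega)
  have hW1 : (sW G S a b).card = 1 := by omega
  -- the remaining vertex has three neighbours on a pentagon
  have hWw : ∀ v ∈ sW G S a b, v = w := fun v hv => Finset.card_le_one.1 hW1.le v hv w hw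
  have h4 := h.deg_sW hG g hp hw
  obtain ⟨r₁, hr₁, r₂, hr₂, r₃, hr₃, n12, n13, n23⟩ := Finset.two_lt_card.1 h4
  rw [mem_nb] at hr₁ hr₂ hr₃
  have hn : ∀ r, G.Adj w r → r ∉ sW G S a b := fun r hwr hr =>
    absurd (hWw r hr ▸ hwr) G.irrefl
  have t12 := hG.sW_two_nbrs g hw hr₁.1 (hn _ hr₁.2) hr₂.1 (hn _ hr₂.2) n12 hr₁.2 hr₂.2
  have t13 := hG.sW_two_nbrs g hw hr₁.1 (hn _ hr₁.2) hr₃.1 (hn _ hr₃.2) n13 hr₁.2 hr₃.2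
  have hcase : ∀ r ∈ sI G S a b, r = x ∨ r = y ∨ r = z := by
    intro r hr
    rcases mem_sI.1 hr with h1 | h1
    · exact Or.inl (Finset.card_le_one.1 (h.cn_one hG g).le r h1 x hx)
    · rw [mem_sT, hA, hB, Finset.mem_singleton, Finset.mem_singleton] at h1
      exact Or.inr h1
  have key : G.Adj w y → G.Adj w z → False := fun e1 e2 => hG.tri w y z e1 hyz e2.symm
  have c1 := hcase r₁ t12.1
  have c2 := hcase r₂ t12.2
  have c3 := hcase r₃ t13.2
  have := hr₁.2
  have := hr₂.2
  have := hr₃.2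
  clear hA hB hcase hn hWw
  grind

/-- The number of pentagons in `S` is at most `M * (|S| - 3 - M)`, where `M` is the largest number of
paths of length three between two vertices with a common neighbour. -/
theorem PT.concl (hG : PT G) (S : Finset V) : ∀ M, MaxPaths G S M → Concl G S M := by
  induction S using Finset.strongInduction with
  | H S ih =>
    intro M hM
    by_contra hc
    have h : Irr G S M := ⟨ih, hM, hc⟩
    rcases hM.pos.eq_or_lt with rfl | h2
    · exact h.false_of_one hG
    · exact h.false_of_two_le hG h2

end

/-! ### Pentagons as copies of the five-cycle -/

section
variable {V : Type} [Fintype V] {G : SimpleGraph V}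

omit [Fintype V] in
theorem cycleGraph_three_free_iff :
    (SimpleGraph.cycleGraph 3).Free G ↔ ∀ u v w, G.Adj u v → G.Adj v w → G.Adj w u → False := by
  constructor
  · intro h u v w huv hvw hwu
    refine h ⟨⟨⟨![u, v, w], ?_⟩, ?_⟩⟩
    · intro i j hij
      fin_cases i <;> fin_cases j <;> first | exact absurd hij (by decide) | skip
      exacts [huv, hwu.symm, huv.symm, hvw, hwu, hvw.symm]
    · intro i j hij
      have h1 := huv.ne
      have h2 := hvw.ne
      have h3 := hwu.ne
      fin_cases i <;> fin_cases j <;> first | rfl | skip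
      exacts [absurd hij h1, absurd hij h3.symm, absurd hij h1.symm, absurd hij h2, absurd hij h3,
        absurd hij h2.symm]
  · rintro h ⟨f⟩
    exact h _ _ _ (f.toHom.map_adj (show (SimpleGraph.cycleGraph 3).Adj 0 1 by decide))
      (f.toHom.map_adj (show (SimpleGraph.cycleGraph 3).Adj 1 2 by decide))
      (f.toHom.map_adj (show (SimpleGraph.cycleGraph 3).Adj 2 0 by decide))

theorem five_cycle_dist : ∀ i j : Fin 5, (SimpleGraph.cycleGraph 5).Adj i j ∨ i = j ∨
    ∃ k, (SimpleGraph.cycleGraph 5).Adj i k ∧ (SimpleGraph.cycleGraph 5).Adj k j := by decide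

/-- In a triangle-free graph a copy of the five-cycle is induced. -/
theorem PT.copy_adj (hG : PT G) (f : (SimpleGraph.cycleGraph 5).Copy G) (p q : V) :
    f.toSubgraph.Adj p q ↔ p ∈ f.toSubgraph.verts ∧ q ∈ f.toSubgraph.verts ∧ G.Adj p q := by
  constructor
  · intro h
    exact ⟨h.fst_mem, h.snd_mem, h.adj_sub⟩
  · rintro ⟨hp, hq, h⟩
    simp only [SimpleGraph.Copy.toSubgraph, SimpleGraph.Subgraph.map_verts,
      SimpleGraph.Subgraph.verts_top, Set.image_univ, Set.mem_range] at hp hq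
    obtain ⟨i, rfl⟩ := hp
    obtain ⟨j, rfl⟩ := hq
    rcases five_cycle_dist i j with h1 | h1 | ⟨k, h1, h2⟩
    · exact ⟨i, j, h1, rfl, rfl⟩
    · subst h1
      exact absurd h G.irrefl
    · exact (hG.tri _ _ _ (f.toHom.map_adj h1) (f.toHom.map_adj h2) h.symm).elim

/-- Copies of the pentagon correspond to their vertex sets, since they are induced. -/
theorem PT.copyCount_eq (hG : PT G) :
    G.copyCount (SimpleGraph.cycleGraph 5) = (pents G Finset.univ).card := by
  rw [SimpleGraph.copyCount_eq_card_image_copyToSubgraph]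
  refine Finset.card_bij (fun H _ => H.verts.toFinset) ?_ ?_ ?_
  · intro H hH
    obtain ⟨f, -, rfl⟩ := Finset.mem_image.1 hH
    have e : ∀ i j, (SimpleGraph.cycleGraph 5).Adj i j → G.Adj (f i) (f j) :=
      fun i j h => f.toHom.map_adj h
    refine mem_pents.2 ⟨Finset.subset_univ _, f 0, f 1, f 2, f 3, f 4, ?_, e 0 1 (by decide),
      e 1 2 (by decide), e 2 3 (by decide), e 3 4 (by decide), e 4 0 (by decide)⟩
    ext v
    simp only [SimpleGraph.Copy.toSubgraph, SimpleGraph.Subgraph.map_verts,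
      SimpleGraph.Subgraph.verts_top, Set.image_univ, Set.mem_toFinset, Set.mem_range,
      Finset.mem_insert, Finset.mem_singleton]
    constructor
    · rintro ⟨i, rfl⟩
      fin_cases i <;> simp
    · rintro (rfl | rfl | rfl | rfl | rfl)
      exacts [⟨0, rfl⟩, ⟨1, rfl⟩, ⟨2, rfl⟩, ⟨3, rfl⟩, ⟨4, rfl⟩]
  · intro H hH H' hH' he
    obtain ⟨f, -, rfl⟩ := Finset.mem_image.1 hH
    obtain ⟨f', -, rfl⟩ := Finset.mem_image.1 hH'
    have he' : f.toSubgraph.verts = f'.toSubgraph.verts := Set.toFinset_inj.1 he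
    refine SimpleGraph.Subgraph.ext he' ?_
    ext p q
    rw [hG.copy_adj, hG.copy_adj, he']
  · intro Q hQ
    obtain ⟨a, b, c, d, e, rfl, h1, h2, h3, h4, h5⟩ := (mem_pents.1 hQ).2
    have n1 := (hG.ne h1 h2 h3 h4 h5).1
    have n2 := (hG.ne h2 h3 h4 h5 h1).1
    have n3 := (hG.ne h3 h4 h5 h1 h2).1
    have n4 := (hG.ne h4 h5 h1 h2 h3).1
    have n5 := (hG.ne h5 h1 h2 h3 h4).1
    have m1 := h1.ne
    have m2 := h2.ne
    have m3 := h3.ne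
    have m4 := h4.ne
    have m5 := h5.ne
    let f : (SimpleGraph.cycleGraph 5).Copy G := ⟨⟨![a, b, c, d, e], by
      intro i j hij
      fin_cases i <;> fin_cases j <;> first | exact absurd hij (by decide) | skip
      exacts [h1, h5.symm, h1.symm, h2, h2.symm, h3, h3.symm, h4, h5, h4.symm]⟩, by
      intro i j hij
      fin_cases i <;> fin_cases j <;> first | rfl | skip
      all_goals
        exfalso
        simp at hij
        grind⟩
    refine ⟨f.toSubgraph, Finset.mem_image_of_mem _ (Finset.mem_univ _), ?_⟩
    ext v
    simp only [SimpleGraph.Copy.toSubgraph, SimpleGraph.Subgraph.map_verts,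
      SimpleGraph.Subgraph.verts_top, Set.image_univ, Set.mem_toFinset, Set.mem_range,
      Finset.mem_insert, Finset.mem_singleton]
    constructor
    · rintro ⟨i, rfl⟩
      fin_cases i <;> simp [f]
    · rintro (rfl | rfl | rfl | rfl | rfl)
      exacts [⟨0, rfl⟩, ⟨1, rfl⟩, ⟨2, rfl⟩, ⟨3, rfl⟩, ⟨4, rfl⟩]

end

/-! ### A planar blow-up of the pentagon -/

namespace BlowStar

/-- The oriented edges of `blowStar`. -/
def arc (c : ℕ) (p q : ℕ) : Prop :=
  (p = 0 ∧ 3 ≤ q) ∨ (p = 1 ∧ 3 ≤ q ∧ q < 3 + c) ∨ (p = 2 ∧ 3 + c ≤ q) ∨ (p = 1 ∧ q = 2)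

/-- The blow-up of the pentagon by `c` copies of one vertex and a star with `k` leaves in place of
the opposite edge. The hubs are `0` and `1`, the center of the star is `2`, and the other vertices
have degree two and are all adjacent to `0`: the copies come first, followed by the leaves. -/
def blowStar (c k : ℕ) : SimpleGraph (Fin (3 + (c + k))) where
  Adj p q := arc c p q ∨ arc c q p
  symm := ⟨fun _ _ h => h.symm⟩
  loopless := ⟨fun p h => by unfold arc at h; omega⟩

theorem adj_iff {c k : ℕ} {p q : Fin (3 + (c + k))} :
    (blowStar c k).Adj p q ↔ arc c p q ∨ arc c q p := Iff.rfl

/-- The neighbour of `p` that follows `r` around `p` in a plane drawing of `blowStar`. -/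
def next (c k p r : ℕ) : ℕ :=
  if p = 0 then (if r + 1 = 3 + (c + k) then 3 else r + 1)
  else if p = 1 then (if r = 2 then c + 2 else r - 1)
  else if p = 2 then (if r = 1 then 2 + (c + k) else if r = 3 + c then 1 else r - 1)
  else if r = 0 then (if p < 3 + c then 1 else 2) else 0

/-- The inverse of `next`. -/
def prev (c k p r : ℕ) : ℕ :=
  if p = 0 then (if r = 3 then 2 + (c + k) else r - 1)
  else if p = 1 then (if r = c + 2 then 2 else r + 1)
  else if p = 2 then (if r = 1 then 3 + c else if r = 2 + (c + k) then 1 else r + 1)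
  else if r = 0 then (if p < 3 + c then 1 else 2) else 0

variable {c k : ℕ}

theorem next_spec (hc : 1 ≤ c) (hk : 1 ≤ k) {p r : ℕ} (hp : p < 3 + (c + k))
    (hr : r < 3 + (c + k)) (h : arc c p r ∨ arc c r p) : next c k p r < 3 + (c + k) ∧
      (arc c p (next c k p r) ∨ arc c (next c k p r) p) ∧ prev c k p (next c k p r) = r := by
  generalize hm : next c k p r = m
  unfold next at hm
  unfold arc at *
  unfold prev
  refine ⟨?_, ?_, ?_⟩ <;> split_ifs at hm ⊢ <;> omega

theorem prev_spec (hc : 1 ≤ c) (hk : 1 ≤ k) {p r : ℕ} (hp : p < 3 + (c + k))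
    (hr : r < 3 + (c + k)) (h : arc c p r ∨ arc c r p) : prev c k p r < 3 + (c + k) ∧
      (arc c p (prev c k p r) ∨ arc c (prev c k p r) p) ∧ next c k p (prev c k p r) = r := by
  generalize hm : prev c k p r = m
  unfold prev at hm
  unfold arc at *
  unfold next
  refine ⟨?_, ?_, ?_⟩ <;> split_ifs at hm ⊢ <;> omega

/-- A plane drawing of `blowStar`. -/
def rot (hc : 1 ≤ c) (hk : 1 ≤ k) : Equiv.Perm (blowStar c k).Dart where
  toFun d := ⟨⟨d.fst, next c k d.fst d.snd, (next_spec hc hk d.fst.2 d.snd.2 d.adj).1⟩,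
    (next_spec hc hk d.fst.2 d.snd.2 d.adj).2.1⟩
  invFun d := ⟨⟨d.fst, prev c k d.fst d.snd, (prev_spec hc hk d.fst.2 d.snd.2 d.adj).1⟩,
    (prev_spec hc hk d.fst.2 d.snd.2 d.adj).2.1⟩
  left_inv d := SimpleGraph.Dart.ext _ _
    (Prod.ext rfl (Fin.ext (next_spec hc hk d.fst.2 d.snd.2 d.adj).2.2))
  right_inv d := SimpleGraph.Dart.ext _ _
    (Prod.ext rfl (Fin.ext (prev_spec hc hk d.fst.2 d.snd.2 d.adj).2.2))

theorem rot_eq (hc : 1 ≤ c) (hk : 1 ≤ k) {d e : (blowStar c k).Dart} (h1 : (e.fst : ℕ) = d.fst)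
    (h2 : (e.snd : ℕ) = next c k d.fst d.snd) : rot hc hk d = e :=
  SimpleGraph.Dart.ext _ _ (Prod.ext (Fin.ext h1.symm) (Fin.ext h2.symm))

/-- The rotation at each vertex is one cycle. For two darts with the same tail this is shown by
induction on the larger head: of the heads at this tail, the largest one below it precedes or
follows it in the rotation. -/
theorem sameCycle_rot (hc : 1 ≤ c) (hk : 1 ≤ k) (d e : (blowStar c k).Dart) (hde : d.fst = e.fst) :
    (rot hc hk).SameCycle d e := by
  have step : ∀ d e : (blowStar c k).Dart, (e.fst : ℕ) = d.fst →
      (e.snd : ℕ) = next c k d.fst d.snd → (rot hc hk).SameCycle d e := fun d e h1 h2 => by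
    rw [← rot_eq hc hk h1 h2]
    exact (Equiv.Perm.SameCycle.refl _ _).apply_right
  have key : ∀ m, ∀ d e : (blowStar c k).Dart, (d.fst : ℕ) = e.fst → (d.snd : ℕ) ≤ e.snd →
      (e.snd : ℕ) = m → (rot hc hk).SameCycle d e := by
    intro m
    induction m using Nat.strong_induction_on with
    | _ m ih =>
      intro d e h1 h2 h3
      rcases h2.eq_or_lt with h2 | h2
      · rw [show d = e from SimpleGraph.Dart.ext _ _ (Prod.ext (Fin.ext h1) (Fin.ext h2))]
      have hd := d.adj
      have he := e.adj
      rw [adj_iff] at hd he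
      have b1 := d.fst.2
      have b2 := d.snd.2
      have b3 := e.fst.2
      have b4 := e.snd.2
      -- the largest head below that of `e`
      obtain ⟨r, hr⟩ : ∃ r, r = if (e.fst : ℕ) = 0 then (e.snd : ℕ) - 1
          else if (e.fst : ℕ) = 1 then (e.snd : ℕ) - 1
          else if (e.fst : ℕ) = 2 then (if (e.snd : ℕ) = 3 + c then 1 else (e.snd : ℕ) - 1)
          else 0 := ⟨_, rfl⟩
      have hr' : r < e.snd ∧ (d.snd : ℕ) ≤ r ∧ (arc c e.fst r ∨ arc c r e.fst) ∧
          (next c k e.fst r = e.snd ∨ next c k e.fst e.snd = r) := by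
        rw [h1] at hd
        clear step ih h1
        unfold arc at *
        unfold next
        refine ⟨?_, ?_, ?_, ?_⟩ <;> split_ifs at * <;> omega
      obtain ⟨r1, r2, r3, r4⟩ := hr'
      let e' : (blowStar c k).Dart := ⟨⟨e.fst, r, by omega⟩, r3⟩
      refine (ih r (by omega) d e' h1 r2 rfl).trans ?_
      rcases r4 with r4 | r4
      · exact step e' e rfl r4.symm
      · exact (step e e' rfl r4.symm).symm
  rcases le_total (d.snd : ℕ) e.snd with h | h
  · exact key _ d e (by rw [hde]) h rfl
  · exact (key _ e d (by rw [hde]) h rfl).symm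

/-- The number of the face on a given side of the dart from `p` to `r`: the face `i` lies between the
`i`-th vertex of degree two and the preceding one. -/
def face (c k p r : ℕ) : ℕ :=
  if p = 0 then r - 3
  else if p = 1 then r - 2
  else if p = 2 then (if r = 1 then c else if r = 2 + (c + k) then 0 else r - 2)
  else if r = 0 then (if p = 2 + (c + k) then 0 else p - 2) else p - 3

theorem face_lt (hc : 1 ≤ c) (hk : 1 ≤ k) {p r : ℕ} (hp : p < 3 + (c + k))
    (hr : r < 3 + (c + k)) (h : arc c p r ∨ arc c r p) : face c k p r < c + k := by
  unfold arc at *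
  unfold face
  split_ifs <;> omega

/-- The number of the face of a dart is constant along face tracing: after the dart from `p` to `r`
comes the dart from `r` to its head next to `p` in the rotation at `r`. -/
theorem face_next (hc : 1 ≤ c) (hk : 1 ≤ k) {p r : ℕ} (hp : p < 3 + (c + k))
    (hr : r < 3 + (c + k)) (h : arc c p r ∨ arc c r p) :
    face c k r (next c k r p) = face c k p r := by
  generalize hm : next c k r p = m
  unfold next at hm
  unfold arc at *
  unfold face
  split_ifs at hm ⊢ <;> omega

/-- Euler's inequality holds for every rotation system, so it is enough to count faces, edges and
components for the reverse inequality. -/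
theorem isPlanar (hc : 1 ≤ c) (hk : 1 ≤ k) : IsPlanar (blowStar c k) := by
  let R : RotationSystem (blowStar c k) := ⟨rot hc hk, fun _ => rfl, sameCycle_rot hc hk⟩
  refine ⟨R, le_antisymm R.euler_le ?_⟩
  have hV : Nat.card (Fin (3 + (c + k))) = 3 + (c + k) := by simp
  have hadj0 : ∀ p : Fin (3 + (c + k)), 3 ≤ (p : ℕ) → (blowStar c k).Adj ⟨0, by omega⟩ p :=
    fun p hp => Or.inl (Or.inl ⟨rfl, hp⟩)
  have hC : Nat.card (blowStar c k).ConnectedComponent ≤ 1 := by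
    have h0 : ∀ p : Fin (3 + (c + k)), (blowStar c k).Reachable ⟨0, by omega⟩ p := by
      intro p
      have hp := p.2
      by_cases h3 : 3 ≤ (p : ℕ)
      · exact (hadj0 p h3).reachable
      by_cases h1 : (p : ℕ) = 1
      · exact (hadj0 ⟨3, by omega⟩ le_rfl).reachable.trans
          (SimpleGraph.Adj.reachable (Or.inr (Or.inr (Or.inl ⟨h1, le_rfl, by simp; omega⟩))))
      by_cases h2 : (p : ℕ) = 2
      · exact (hadj0 ⟨3 + c, by omega⟩ (by simp)).reachable.trans
          (SimpleGraph.Adj.reachable (Or.inr (Or.inr (Or.inr (Or.inl ⟨h2, by simp⟩)))))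
      · rw [show p = ⟨0, by omega⟩ from Fin.ext (by show (p : ℕ) = 0; omega)]
    have : (blowStar c k).Preconnected := fun p q => (h0 p).symm.trans (h0 q)
    have := this.subsingleton_connectedComponent
    exact Finite.card_le_one_iff_subsingleton.2 this
  have hE : Nat.card (blowStar c k).edgeSet ≤ 2 * (c + k) + 1 := by
    let g : Option (Fin (c + k) × Bool) → Sym2 (Fin (3 + (c + k))) := fun o => match o with
      | none => s(⟨1, by omega⟩, ⟨2, by omega⟩)
      | some (i, false) => s(⟨0, by omega⟩, ⟨3 + i, by omega⟩)
      | some (i, true) => s(⟨if (i : ℕ) < c then 1 else 2, by split_ifs <;> omega⟩, ⟨3 + i, by omega⟩)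
    have harc : ∀ p q : Fin (3 + (c + k)), arc c p q → s(p, q) ∈ Finset.univ.image g := by
      intro p q h
      have hq := q.2
      rw [Finset.mem_image]
      rcases h with h | h | h | h
      · refine ⟨some (⟨q - 3, by omega⟩, false), Finset.mem_univ _, ?_⟩
        exact congrArg₂ (fun a b => s(a, b)) (Fin.ext h.1.symm) (Fin.ext (by simp; omega))
      · refine ⟨some (⟨q - 3, by omega⟩, true), Finset.mem_univ _, ?_⟩
        refine congrArg₂ (fun a b => s(a, b)) (Fin.ext ?_) (Fin.ext (by simp; omega))
        simp only
        rw [if_pos (by omega), h.1]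
      · refine ⟨some (⟨q - 3, by omega⟩, true), Finset.mem_univ _, ?_⟩
        refine congrArg₂ (fun a b => s(a, b)) (Fin.ext ?_) (Fin.ext (by simp; omega))
        simp only
        rw [if_neg (by omega), h.1]
      · exact ⟨none, Finset.mem_univ _,
          congrArg₂ (fun a b => s(a, b)) (Fin.ext h.1.symm) (Fin.ext h.2.symm)⟩
    have hsub : (blowStar c k).edgeFinset ⊆ Finset.univ.image g := by
      intro e he
      rw [SimpleGraph.mem_edgeFinset] at he
      induction e using Sym2.ind with
      | _ p q =>
        rcases he with h | h
        · exact harc p q h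
        · rw [Sym2.eq_swap]
          exact harc q p h
    rw [← card_edgeFinset_eq_natCard]
    refine (Finset.card_le_card hsub).trans (Finset.card_image_le.trans ?_)
    simp [mul_comm]
  have hF : c + k ≤ Nat.card R.Face := by
    let f : (blowStar c k).Dart → Fin (c + k) := fun d =>
      ⟨face c k d.fst d.snd, face_lt hc hk d.fst.2 d.snd.2 d.adj⟩
    have hf : ∀ d, f (R.facePerm d) = f d := fun d =>
      Fin.ext (face_next hc hk d.fst.2 d.snd.2 d.adj)
    have hinv : ∀ d e, R.facePerm.SameCycle d e → f d = f e := by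
      rintro d e ⟨i, rfl⟩
      induction i using Int.induction_on with
      | zero => rfl
      | succ i ih =>
        refine ih.trans ?_
        rw [← hf ((R.facePerm ^ (i : ℤ)) d), ← Equiv.Perm.mul_apply, ← zpow_one_add, add_comm (i : ℤ) 1]
      | pred i ih =>
        refine ih.trans ?_
        rw [← hf ((R.facePerm ^ (-(i : ℤ) - 1)) d), ← Equiv.Perm.mul_apply, ← zpow_one_add,
          add_sub_cancel]
    let φ : Quotient (Equiv.Perm.SameCycle.setoid R.facePerm) → Fin (c + k) :=
      Quotient.lift f hinv
    have hφ : Function.Surjective φ := by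
      intro i
      refine ⟨Quotient.mk _ ⟨(⟨0, by omega⟩, ⟨3 + i, by omega⟩), hadj0 _ (by simp)⟩, Fin.ext ?_⟩
      show face c k 0 (3 + i) = i
      simp [face]
    have h1 := Nat.card_le_card_of_surjective φ hφ
    rw [Nat.card_fin] at h1
    exact h1.trans (Nat.card_le_card_of_injective Sum.inl Sum.inl_injective)
  omega

/-- The hubs of the drawn graph are the hubs of a blow-up with `c` common neighbours. -/
theorem blow (hc : 1 ≤ c) (hk : 1 ≤ k) : PT (blowStar c k) ∧
    ∃ u v, Blow (blowStar c k) Finset.univ u v ∧ (cn (blowStar c k) Finset.univ u v).card = c := by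
  have hG : PT (blowStar c k) := ⟨(isPlanar hc hk).hasCutSystem, fun u v w h1 h2 h3 => by
    rw [adj_iff] at h1 h2 h3
    unfold arc at h1 h2 h3
    omega⟩
  let e : Fin (c + k) → Fin (3 + (c + k)) := fun i => ⟨3 + i, by omega⟩
  have he : Function.Injective e := fun i j h => by
    have := congrArg Fin.val h
    simp only [e] at this
    exact Fin.ext (by omega)
  have hu : ∀ i, (blowStar c k).Adj ⟨0, by omega⟩ (e i) := fun i =>
    Or.inl (Or.inl ⟨rfl, by simp [e]⟩)
  have hz : (blowStar c k).Adj ⟨1, by omega⟩ ⟨2, by omega⟩ := by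
    left; right; right; right; exact ⟨rfl, rfl⟩
  set C : Finset (Fin (3 + (c + k))) := Finset.univ.image fun i : Fin c => e (Fin.castAdd k i)
    with hC
  set A : Finset (Fin (3 + (c + k))) := Finset.univ.image fun i : Fin k => e (Fin.natAdd c i) with hA
  have cC : C.card = c := by
    rw [hC, Finset.card_image_of_injective _ fun i j h => Fin.castAdd_injective c k (he h),
      Finset.card_univ, Fintype.card_fin]
  have cA : A.card = k := by
    rw [hA, Finset.card_image_of_injective _ fun i j h => Fin.natAdd_injective k c (he h),
      Finset.card_univ, Fintype.card_fin]
  have hcn : C = cn (blowStar c k) Finset.univ ⟨0, by omega⟩ ⟨1, by omega⟩ := by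
    ext v
    rw [mem_cn, hC, Finset.mem_image]
    constructor
    · rintro ⟨i, -, rfl⟩
      refine ⟨Finset.mem_univ _, hu _, ?_⟩
      left; right; left
      exact ⟨rfl, by simp [e], by simp [e]⟩
    · rintro ⟨-, h1, h2⟩
      rw [adj_iff] at h1 h2
      unfold arc at h1 h2
      simp only at h1 h2
      have hv : 3 ≤ (v : ℕ) ∧ (v : ℕ) < 3 + c := by omega
      exact ⟨⟨v - 3, by omega⟩, Finset.mem_univ _, Fin.ext (by simp [e]; omega)⟩
  have hpp : k ≤ pp (blowStar c k) Finset.univ ⟨0, by omega⟩ ⟨1, by omega⟩ := by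
    have h1 : A ⊆ nb (blowStar c k) (nb (blowStar c k) Finset.univ ⟨0, by omega⟩) ⟨2, by omega⟩ := by
      intro v hv
      obtain ⟨i, -, rfl⟩ := Finset.mem_image.1 hv
      refine mem_nb.2 ⟨mem_nb.2 ⟨Finset.mem_univ _, hu _⟩, ?_⟩
      left; right; right; left
      exact ⟨rfl, by simp [e]⟩
    have h2 := Finset.card_le_card h1
    rw [cA] at h2
    refine h2.trans ?_
    rw [← ee_singleton, pp_symm, pp]
    exact ee_mono (Finset.singleton_subset_iff.2 (mem_nb.2 ⟨Finset.mem_univ _, hz⟩))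
      (Finset.Subset.refl _)
  refine ⟨hG, ⟨0, by omega⟩, ⟨1, by omega⟩, hG.blow_of_le ⟨Finset.mem_univ _, Finset.mem_univ _, ?_,
    by omega⟩ ?_, by rw [← hcn, cC]⟩
  · rw [← hcn]
    exact Finset.card_pos.1 (by omega)
  · rw [← hcn, cC, Finset.card_univ, Fintype.card_fin]
    omega

end BlowStar

/-! ### Blow-ups of the pentagon up to isomorphism -/

section
variable {V W C : Type} {G : SimpleGraph V} {T : SimpleGraph W} {col : T.Coloring Bool}

theorem blowup_hub_hub (p q : Bool) : ¬ (pentagonBlowup T col C).Adj (.inl p) (.inl q) := by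
  simp [pentagonBlowup]

theorem blowup_hub_tree (p : Bool) (w : W) :
    (pentagonBlowup T col C).Adj (.inl p) (.inr (.inl w)) ↔ col w = p := by
  simp [pentagonBlowup]

theorem blowup_hub_copy (p : Bool) (x : C) :
    (pentagonBlowup T col C).Adj (.inl p) (.inr (.inr x)) := by
  simp [pentagonBlowup]

theorem blowup_tree_tree (w w' : W) :
    (pentagonBlowup T col C).Adj (.inr (.inl w)) (.inr (.inl w')) ↔ T.Adj w w' := by
  simp only [pentagonBlowup, SimpleGraph.fromRel_adj, ne_eq, Sum.inr.injEq, Sum.inl.injEq]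
  exact ⟨fun h => h.2.elim id SimpleGraph.Adj.symm, fun h => ⟨h.ne, Or.inl h⟩⟩

theorem blowup_tree_copy (w : W) (x : C) :
    ¬ (pentagonBlowup T col C).Adj (.inr (.inl w)) (.inr (.inr x)) := by
  simp [pentagonBlowup]

theorem blowup_copy_copy (x x' : C) :
    ¬ (pentagonBlowup T col C).Adj (.inr (.inr x)) (.inr (.inr x')) := by
  simp [pentagonBlowup]

theorem blowup_triangle_free : ∀ x y z, (pentagonBlowup T col C).Adj x y →
    (pentagonBlowup T col C).Adj y z → (pentagonBlowup T col C).Adj z x → False := by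
  -- no triangle contains a hub
  have hub : ∀ p y z, (pentagonBlowup T col C).Adj (.inl p) y → (pentagonBlowup T col C).Adj y z →
      (pentagonBlowup T col C).Adj z (.inl p) → False := by
    rintro p (q | w | x) (r | w' | x') h1 h2 h3
    · exact blowup_hub_hub _ _ h1
    · exact blowup_hub_hub _ _ h1
    · exact blowup_hub_hub _ _ h1
    · exact blowup_hub_hub _ _ h3
    · rw [blowup_hub_tree] at h1
      have h3' := (blowup_hub_tree _ _).1 h3.symm
      exact col.valid ((blowup_tree_tree _ _).1 h2) (h1.trans h3'.symm)
    · exact blowup_tree_copy _ _ h2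
    · exact blowup_hub_hub _ _ h3
    · exact blowup_tree_copy _ _ h2.symm
    · exact blowup_copy_copy _ _ h2
  rintro (p | w | x) (q | w' | x') (r | w'' | x'') h1 h2 h3
  any_goals exact hub _ _ _ h1 h2 h3
  any_goals exact hub _ _ _ h2 h3 h1
  any_goals exact hub _ _ _ h3 h1 h2
  any_goals exact blowup_tree_copy _ _ h1
  any_goals exact blowup_tree_copy _ _ h1.symm
  any_goals exact blowup_tree_copy _ _ h2
  any_goals exact blowup_tree_copy _ _ h2.symm
  any_goals exact blowup_copy_copy _ _ h1
  rw [blowup_tree_tree] at h1 h2 h3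
  have n1 := col.valid h1
  have n2 := col.valid h2
  have n3 := col.valid h3
  cases e1 : col w <;> cases e2 : col w' <;> cases e3 : col w'' <;> simp_all

variable [Fintype V]

/-- A graph that is all frame, and has a tree as its tree part, is a blow-up of the pentagon. -/
theorem PT.blow_iso (hG : PT G) {u v : V} (h : Blow G Finset.univ u v) :
    ∃ (T : SimpleGraph (Fin (pp G Finset.univ u v + 1))) (col : T.Coloring Bool), T.IsTree ∧
      Nonempty (G ≃g pentagonBlowup T col (Fin (cn G Finset.univ u v).card)) := by
  have hl := hG.blow_linked h
  have hTc := (hG.linked_sT_iff h.1).1 hl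
  have hcard := hG.card_eq h.1
  rw [hG.blow_sW h, Finset.card_empty] at hcard
  let eT : Fin (pp G Finset.univ u v + 1) ≃ sT G Finset.univ u v :=
    (Finset.equivFinOfCardEq hTc).symm
  let eC : Fin (cn G Finset.univ u v).card ≃ cn G Finset.univ u v := (Finset.equivFin _).symm
  let T : SimpleGraph (Fin (pp G Finset.univ u v + 1)) := G.comap fun i => (eT i : V)
  let iT : T ≃g G.induce (sT G Finset.univ u v : Set V) := ⟨eT, Iff.rfl⟩
  have hside : ∀ i j, G.Adj (eT i) (eT j) →
      ((eT i : V) ∈ sA G Finset.univ u v ∧ (eT j : V) ∈ sA G Finset.univ v u) ∨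
      ((eT i : V) ∈ sA G Finset.univ v u ∧ (eT j : V) ∈ sA G Finset.univ u v) := fun i j hij =>
    hG.adj_sI (sT_sub_sI _ _ _ (eT i).2) (sT_sub_sI _ _ _ (eT j).2) hij
  let col : T.Coloring Bool := SimpleGraph.Coloring.mk
    (fun i => decide ((eT i : V) ∉ sA G Finset.univ u v)) (by
      intro i j hij
      have h1 := hG.not_sA_sB (S := Finset.univ) (a := u) (b := v) (y := eT i)
      have h2 := hG.not_sA_sB (S := Finset.univ) (a := u) (b := v) (y := eT j)
      have := hside i j hij
      simp only [ne_eq, decide_eq_decide]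
      tauto)
  have hcol : ∀ i p, col i = p ↔ G.Adj (if p then v else u) (eT i) := by
    intro i p
    have h0 : col i = decide ((eT i : V) ∉ sA G Finset.univ u v) := rfl
    rw [h0]
    rcases mem_sT.1 (eT i).2 with h1 | h1
    · cases p
      · simpa [h1] using (mem_sA.1 h1).2.1
      · simpa [h1] using hG.sA_nadj h1
    · have h2 : (eT i : V) ∉ sA G Finset.univ u v := fun e => hG.not_sA_sB e h1
      cases p
      · simpa [h2] using hG.sA_nadj h1
      · simpa [h2] using (mem_sA.1 h1).2.1
  have hcn : ∀ j (p : Bool), G.Adj (if p then v else u) (eC j) := by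
    intro j p
    have := mem_cn.1 (eC j).2
    cases p
    · exact this.2.1
    · exact this.2.2
  have huv := hG.good_nadj h.1
  have hCI : ∀ j, ∀ w ∈ sI G Finset.univ u v, ¬ G.Adj (eC j) w := by
    intro j w hw hjw
    rcases hG.adj_sI (cn_sub_sI _ _ _ (eC j).2) hw hjw with h1 | h1
    · exact hG.not_cn_sT (sA_sub_sT _ _ _ h1.1) (eC j).2
    · exact hG.not_cn_sT (sB_sub_sT _ _ _ h1.1) (eC j).2
  let f : Bool ⊕ Fin (pp G Finset.univ u v + 1) ⊕ Fin (cn G Finset.univ u v).card → V :=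
    Sum.elim (fun p => if p then v else u) (Sum.elim (fun i => eT i) (fun j => eC j))
  have hsurj : Function.Surjective f := by
    intro w
    rcases mem_cases (G := G) (a := u) (b := v) (Finset.mem_univ w) with h1 | h1 | h1 | h1
    · exact ⟨.inl false, h1.symm⟩
    · exact ⟨.inl true, h1.symm⟩
    · rcases mem_sI.1 h1 with h2 | h2
      · exact ⟨.inr (.inr (eC.symm ⟨w, h2⟩)), by simp [f]⟩
      · exact ⟨.inr (.inl (eT.symm ⟨w, h2⟩)), by simp [f]⟩
    · rw [hG.blow_sW h] at h1
      exact absurd h1 (Finset.notMem_empty w)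
  -- `f` is onto since the frame is everything, and the numbers of vertices agree
  have hbij : Function.Bijective f := by
    rw [Fintype.bijective_iff_surjective_and_card]
    refine ⟨hsurj, ?_⟩
    rw [Fintype.card_sum, Fintype.card_sum, Fintype.card_bool, Fintype.card_fin, Fintype.card_fin,
      ← Finset.card_univ (α := V)]
    omega
  have hadj : ∀ x y, G.Adj (f x) (f y) ↔ (pentagonBlowup T col
      (Fin (cn G Finset.univ u v).card)).Adj x y := by
    have hhub : ∀ p y, G.Adj (f (.inl p)) (f y) ↔ (pentagonBlowup T col
        (Fin (cn G Finset.univ u v).card)).Adj (.inl p) y := by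
      rintro p (q | i | j)
      · refine iff_of_false (fun e => ?_) (blowup_hub_hub p q)
        cases p <;> cases q
        exacts [G.irrefl e, huv e, huv e.symm, G.irrefl e]
      · rw [blowup_hub_tree, hcol]
        rfl
      · exact iff_of_true (hcn j p) (blowup_hub_copy p j)
    rintro (p | i | j) (q | i' | j')
    · exact hhub _ _
    · exact hhub _ _
    · exact hhub _ _
    · rw [G.adj_comm, hhub, SimpleGraph.adj_comm]
    · exact (Iff.rfl : _ ↔ T.Adj i i').trans (blowup_tree_tree i i').symm
    · exact iff_of_false (fun e => hCI j' _ (sT_sub_sI _ _ _ (eT i).2) e.symm)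
        (blowup_tree_copy i j')
    · rw [G.adj_comm, hhub, SimpleGraph.adj_comm]
    · exact iff_of_false (fun e => hCI j _ (sT_sub_sI _ _ _ (eT i').2) e)
        fun e => blowup_tree_copy i' j e.symm
    · exact iff_of_false (fun e => hCI j _ (cn_sub_sI _ _ _ (eC j').2) e) (blowup_copy_copy j j')
  refine ⟨T, col, ?_, ⟨(⟨Equiv.ofBijective f hbij, fun {x y} => hadj x y⟩ :
    pentagonBlowup T col (Fin (cn G Finset.univ u v).card) ≃g G).symm⟩⟩
  rw [SimpleGraph.isTree_iff_connected_and_card]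
  constructor
  · have : T.Preconnected := by
      intro i j
      have h1 := hl (fun w => ∃ k, (eT k : V) = w ∧ T.Reachable i k) ?_ (eT i) (eT i).2 (eT j)
        (eT j).2 ⟨i, rfl, SimpleGraph.Reachable.refl _⟩
      · obtain ⟨k, hk, h2⟩ := h1
        rwa [eT.injective (Subtype.ext hk)] at h2
      · rintro w - w' hw' hww ⟨k, rfl, h2⟩
        refine ⟨eT.symm ⟨w', hw'⟩, by simp, h2.trans (SimpleGraph.Adj.reachable ?_)⟩
        show G.Adj _ _
        simpa using hww
    exact ⟨this⟩
  · have h1 := hG.deg2_sT Finset.univ u v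
    rw [deg2_eq, card_edgeFinset_eq_natCard] at h1
    rw [Nat.card_congr iT.mapEdgeSet, Nat.card_fin]
    omega

/-- The converse of `PT.blow_iso`. -/
theorem PT.blow_of_iso (hG : PT G) {m c : ℕ} {T : SimpleGraph (Fin m)} {col : T.Coloring Bool}
    (hT : T.IsTree) (hm : 2 ≤ m) (hc : 1 ≤ c) (φ : G ≃g pentagonBlowup T col (Fin c)) :
    ∃ u v, Blow G Finset.univ u v ∧ (cn G Finset.univ u v).card = c ∧
      pp G Finset.univ u v + 1 = m := by
  have hf : ∀ x y, G.Adj (φ.symm x) (φ.symm y) ↔ (pentagonBlowup T col (Fin c)).Adj x y :=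
    fun x y => φ.symm.map_adj_iff
  set u := φ.symm (.inl false) with hu
  set v := φ.symm (.inl true) with hv
  have hcard : (Finset.univ : Finset V).card = 2 + (m + c) := by
    rw [Finset.card_univ, Fintype.card_congr φ.toEquiv]
    simp
  set A : Finset V := Finset.univ.image fun i : Fin m => φ.symm (.inr (.inl i)) with hA
  set C : Finset V := Finset.univ.image fun j : Fin c => φ.symm (.inr (.inr j)) with hC
  have cA : A.card = m := by
    rw [hA, Finset.card_image_of_injective _ fun i j h => by simpa using h,
      Finset.card_univ, Fintype.card_fin]
  have cC : C.card = c := by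
    rw [hC, Finset.card_image_of_injective _ fun i j h => by simpa using h,
      Finset.card_univ, Fintype.card_fin]
  have hCcn : C ⊆ cn G Finset.univ u v := by
    intro w hw
    obtain ⟨j, -, rfl⟩ := Finset.mem_image.1 hw
    exact mem_cn.2 ⟨Finset.mem_univ _, (hf _ _).2 (blowup_hub_copy _ _),
      (hf _ _).2 (blowup_hub_copy _ _)⟩
  have hAT : A ⊆ sT G Finset.univ u v := by
    intro w hw
    obtain ⟨i, -, rfl⟩ := Finset.mem_image.1 hw
    have : Nontrivial (Fin m) := Fin.nontrivial_iff_two_le.2 hm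
    obtain ⟨j, hj⟩ := hT.connected.preconnected.exists_adj_of_nontrivial i
    have hij := (hf (.inr (.inl i)) (.inr (.inl j))).2 ((blowup_tree_tree _ _).2 hj)
    have hn := col.valid hj
    cases h1 : col i <;> cases h2 : col j <;> rw [h1, h2] at hn
    · exact absurd rfl hn
    · exact mem_sT.2 (Or.inl (mem_sA.2 ⟨Finset.mem_univ _, (hf _ _).2 ((blowup_hub_tree _ _).2 h1),
        _, Finset.mem_univ _, hij, ((hf _ _).2 ((blowup_hub_tree _ _).2 h2)).symm⟩))
    · exact mem_sT.2 (Or.inr (mem_sA.2 ⟨Finset.mem_univ _, (hf _ _).2 ((blowup_hub_tree _ _).2 h1),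
        _, Finset.mem_univ _, hij, ((hf _ _).2 ((blowup_hub_tree _ _).2 h2)).symm⟩))
    · exact absurd rfl hn
  have hAl : Linked G A := by
    intro s hs w hw w' hw' hsw
    obtain ⟨i, -, rfl⟩ := Finset.mem_image.1 hw
    obtain ⟨j, -, rfl⟩ := Finset.mem_image.1 hw'
    obtain ⟨walk⟩ := hT.connected.preconnected i j
    induction walk with
    | nil => exact hsw
    | cons hadj _ ih =>
      exact ih (Finset.mem_image_of_mem _ (Finset.mem_univ _))
        (hs _ hw _ (Finset.mem_image_of_mem _ (Finset.mem_univ _))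
          ((hf _ _).2 ((blowup_tree_tree _ _).2 hadj)) hsw) hw'
  have h1 := hAl.card_le
  have h2 : deg2 G A ≤ deg2 G (sT G Finset.univ u v) := by
    rw [deg2_eq_ee, deg2_eq_ee]
    exact ee_mono hAT hAT
  rw [hG.deg2_sT] at h2
  have h3 := Finset.card_le_card hCcn
  have g : Good G Finset.univ u v := ⟨Finset.mem_univ _, Finset.mem_univ _,
    Finset.card_pos.1 (by omega), by omega⟩
  have hB := hG.blow_of_le g (by omega)
  have h4 := hB.2
  exact ⟨u, v, hB, by omega, by omega⟩

end

/-! ### Maximizing the product -/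

section

/-- A product with given sum is largest when its factors are as equal as possible. -/
theorem mul_le_half_mul_half (x y : ℕ) : x * y ≤ (x + y) / 2 * ((x + y + 1) / 2) ∧
    (x * y = (x + y) / 2 * ((x + y + 1) / 2) ↔ |(x : ℤ) - y| ≤ 1) := by
  wlog h : x ≤ y generalizing x y
  · have := this y x (by omega)
    rwa [mul_comm y x, add_comm y x, abs_sub_comm] at this
  obtain ⟨d, rfl⟩ := Nat.exists_eq_add_of_le h
  have e1 : (x + (x + d)) / 2 = x + d / 2 := by omega
  have e2 : (x + (x + d) + 1) / 2 = x + (d + 1) / 2 := by omega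
  have e3 : d / 2 + (d + 1) / 2 = d := by omega
  have e4 : x * (x + d) + d / 2 * ((d + 1) / 2) = (x + d / 2) * (x + (d + 1) / 2) := by
    conv_lhs => rw [← e3]
    rw [e3]
    nlinarith
  rw [e1, e2, ← e4]
  refine ⟨Nat.le_add_right _ _, ?_⟩
  have e5 : |(x : ℤ) - ((x + d : ℕ) : ℤ)| = d := by
    push_cast
    rw [sub_add_cancel_left, abs_neg, Nat.abs_cast]
  rw [e5]
  constructor
  · intro h0
    have h1 : d / 2 * ((d + 1) / 2) = 0 := by omega
    rcases Nat.mul_eq_zero.1 h1 with h2 | h2 <;> omega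
  · intro h0
    have : d / 2 = 0 := by omega
    rw [this, zero_mul, add_zero]

theorem floor_mul_ceil (n : ℕ) (hn : 3 ≤ n) :
    ⌊((n : ℚ) - 3) / 2⌋₊ * ⌈((n : ℚ) - 3) / 2⌉₊ = (n - 3) / 2 * ((n - 3 + 1) / 2) := by
  obtain ⟨N, rfl⟩ := Nat.exists_eq_add_of_le hn
  have e1 : (((3 + N : ℕ) : ℚ) - 3) / 2 = (N : ℚ) / 2 := by push_cast; ring
  have e2 : ⌊(N : ℚ) / 2⌋₊ = N / 2 := by exact_mod_cast Nat.floor_div_eq_div (K := ℚ) N 2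
  have e3 : ⌈(N : ℚ) / 2⌉₊ = (N + 1) / 2 := by
    apply le_antisymm
    · rw [Nat.ceil_le, div_le_iff₀ two_pos]
      exact_mod_cast (by omega : N ≤ (N + 1) / 2 * 2)
    · by_contra hlt
      have h1 := Nat.le_ceil ((N : ℚ) / 2)
      rw [div_le_iff₀ two_pos] at h1
      have h2 : N ≤ ⌈(N : ℚ) / 2⌉₊ * 2 := by exact_mod_cast h1
      omega
  rw [e1, e2, e3]
  congr 1
  all_goals congr 1
  all_goals omega

variable {V : Type} [Fintype V] {G : SimpleGraph V}

/-- The number of pentagons of a planar triangle-free graph, and the graphs that attain it. -/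
theorem PT.card_pents_le (hG : PT G) (hV : 5 ≤ Fintype.card V) :
    (pents G Finset.univ).card ≤ (Fintype.card V - 3) / 2 * ((Fintype.card V - 3 + 1) / 2) ∧
      ((pents G Finset.univ).card =
          (Fintype.card V - 3) / 2 * ((Fintype.card V - 3 + 1) / 2) →
        ∃ u v, Blow G Finset.univ u v ∧
          |((cn G Finset.univ u v).card : ℤ) - (pp G Finset.univ u v : ℤ)| ≤ 1) := by
  have hpos : 0 < (Fintype.card V - 3) / 2 * ((Fintype.card V - 3 + 1) / 2) :=
    Nat.mul_pos (by omega) (by omega)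
  rcases (pents G Finset.univ).eq_empty_or_nonempty with h0 | ⟨Q, hQ⟩
  · rw [h0, Finset.card_empty]
    exact ⟨Nat.zero_le _, fun h => absurd h (by omega)⟩
  rw [mem_pents] at hQ
  obtain ⟨a, b, g⟩ := hQ.2.good hQ.1
  obtain ⟨M, hM, -⟩ := exists_maxPaths (M := Fintype.card V)
    (fun u v g' => by
      have := hG.cn_add_pp_le g'
      rw [Finset.card_univ] at this
      omega) g
  obtain ⟨h1, h2⟩ := hG.concl _ M hM
  rw [Finset.card_univ] at h1 h2
  have hMpos := hM.pos
  have hMN : M + 3 ≤ Fintype.card V := by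
    by_contra hlt
    have : M * Fintype.card V < M * (M + 3) := Nat.mul_lt_mul_of_pos_left (by omega) hMpos
    nlinarith
  obtain ⟨y, hy⟩ := Nat.exists_eq_add_of_le hMN
  have hN : Fintype.card V - 3 = M + y := by omega
  have h3 : (pents G Finset.univ).card ≤ M * y := by
    rw [hy] at h1
    nlinarith
  obtain ⟨h4, h5⟩ := mul_le_half_mul_half M y
  rw [hN]
  refine ⟨h3.trans h4, fun he => ?_⟩
  have h6 : M * y = (pents G Finset.univ).card := le_antisymm (h4.trans he.ge) h3
  have h7 := abs_le.1 (h5.1 (h6.trans he))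
  obtain ⟨u, v, hB⟩ := h2 (by rw [← h6, hy]; ring) (by omega)
  refine ⟨u, v, hB, ?_⟩
  have h8 := hB.2
  rw [Finset.card_univ] at h8
  obtain ⟨-, h9⟩ := mul_le_half_mul_half (cn G Finset.univ u v).card (pp G Finset.univ u v)
  rw [← h9, ← hG.blow_card_pents hB, he, show M + y = (cn G Finset.univ u v).card +
    pp G Finset.univ u v by omega]

/-- A balanced blow-up attains the maximum. -/
theorem Blow.balanced (hG : PT G) {u v : V} (h : Blow G Finset.univ u v)
    (hb : |((cn G Finset.univ u v).card : ℤ) - (pp G Finset.univ u v : ℤ)| ≤ 1) :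
    (pents G Finset.univ).card = (Fintype.card V - 3) / 2 * ((Fintype.card V - 3 + 1) / 2) := by
  have h8 := h.2
  rw [Finset.card_univ] at h8
  rw [hG.blow_card_pents h, (mul_le_half_mul_half _ _).2.2 hb, show Fintype.card V - 3 =
    (cn G Finset.univ u v).card + pp G Finset.univ u v by omega]

/-- Equality in `PT.card_pents_le` characterises the balanced blow-ups. -/
theorem PT.isJ_iff {n : ℕ} (hn : 5 ≤ n) {G : SimpleGraph (Fin n)} (hG : PT G) (hp : IsPlanar G) :
    IsJ n G ↔ (pents G Finset.univ).card = (n - 3) / 2 * ((n - 3 + 1) / 2) := by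
  constructor
  · rintro ⟨-, m, c, T, col, hT, hb, ⟨φ⟩⟩
    have hcard := Fintype.card_congr φ.toEquiv
    simp only [Fintype.card_fin, Fintype.card_sum, Fintype.card_bool] at hcard
    have hb' := abs_le.1 hb
    obtain ⟨u, v, hB, h1, h2⟩ := hG.blow_of_iso hT (by omega) (by omega) φ
    have := Blow.balanced hG hB (by rw [h1]; convert hb using 2; omega)
    rwa [Fintype.card_fin] at this
  · intro he
    obtain ⟨u, v, hB, hb⟩ := (hG.card_pents_le (by rwa [Fintype.card_fin])).2
      (by rwa [Fintype.card_fin])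
    obtain ⟨T, col, hT, hφ⟩ := hG.blow_iso hB
    exact ⟨hp, _, _, T, col, hT, by push_cast; rwa [add_sub_cancel_right], hφ⟩

theorem triangle_free_of_isJ {n : ℕ} {G : SimpleGraph (Fin n)} (h : IsJ n G) :
    (SimpleGraph.cycleGraph 3).Free G := by
  obtain ⟨-, m, c, T, col, -, -, ⟨φ⟩⟩ := h
  rw [cycleGraph_three_free_iff]
  exact fun u v w h1 h2 h3 => blowup_triangle_free _ _ _ (φ.map_adj_iff.2 h1) (φ.map_adj_iff.2 h2)
    (φ.map_adj_iff.2 h3)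

theorem exists_planar_extremal {n : ℕ} (hn : 5 ≤ n) : ∃ G : SimpleGraph (Fin n), IsPlanar G ∧ PT G ∧
    (pents G Finset.univ).card = (n - 3) / 2 * ((n - 3 + 1) / 2) := by
  obtain ⟨N, rfl⟩ := Nat.exists_eq_add_of_le (by omega : 3 ≤ n)
  obtain ⟨c, k, hc, hk, rfl, hb⟩ : ∃ c k : ℕ, 1 ≤ c ∧ 1 ≤ k ∧ N = c + k ∧ |(c : ℤ) - k| ≤ 1 :=
    ⟨N / 2, N - N / 2, by omega, by omega, by omega, by rw [abs_le]; omega⟩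
  obtain ⟨hG, u, v, hB, h1⟩ := BlowStar.blow hc hk
  have h2 := hB.2
  rw [Finset.card_univ, Fintype.card_fin] at h2
  have h3 : pp (BlowStar.blowStar c k) Finset.univ u v = k := by omega
  have := Blow.balanced hG hB (by rwa [h1, h3])
  rw [Fintype.card_fin] at this
  exact ⟨_, BlowStar.isPlanar hc hk, hG, this⟩

theorem isGreatest_planarCopyCounts {n : ℕ} (hn : 5 ≤ n) :
    IsGreatest (planarCopyCounts n (SimpleGraph.cycleGraph 5) (SimpleGraph.cycleGraph 3))
      ((n - 3) / 2 * ((n - 3 + 1) / 2)) := by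
  constructor
  · obtain ⟨G, hp, hG, h⟩ := exists_planar_extremal hn
    exact ⟨G, hp, cycleGraph_three_free_iff.2 hG.tri, by rw [hG.copyCount_eq, h]⟩
  · rintro k ⟨G, hp, hf, rfl⟩
    have hG : PT G := ⟨hp.hasCutSystem, cycleGraph_three_free_iff.1 hf⟩
    have := (hG.card_pents_le (by rwa [Fintype.card_fin])).1
    rwa [Fintype.card_fin, ← hG.copyCount_eq] at this

end

end

theorem mainTheorem2 (n : ℕ) (hn : 5 ≤ n) :
    IsGreatest (planarCopyCounts n (SimpleGraph.cycleGraph 5) (SimpleGraph.cycleGraph 3))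
        (planarTuran n (SimpleGraph.cycleGraph 5) (SimpleGraph.cycleGraph 3)) ∧
      planarTuran n (SimpleGraph.cycleGraph 5) (SimpleGraph.cycleGraph 3) =
        ⌊((n : ℚ) - 3) / 2⌋₊ * ⌈((n : ℚ) - 3) / 2⌉₊ ∧
      {G : SimpleGraph (Fin n) |
          IsPlanarExtremal (SimpleGraph.cycleGraph 5) (SimpleGraph.cycleGraph 3) G} =
        {G : SimpleGraph (Fin n) | IsJ n G} := by
  have hmax := isGreatest_planarCopyCounts hn
  have hex : planarTuran n (SimpleGraph.cycleGraph 5) (SimpleGraph.cycleGraph 3) =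
      (n - 3) / 2 * ((n - 3 + 1) / 2) := hmax.csSup_eq
  refine ⟨hex ▸ hmax, by rw [hex, floor_mul_ceil n (by omega)], ?_⟩
  ext G
  rw [Set.mem_ofPred_eq, Set.mem_ofPred_eq, IsPlanarExtremal, hex]
  constructor
  · rintro ⟨hp, hf, hc⟩
    have hG : PT G := ⟨hp.hasCutSystem, cycleGraph_three_free_iff.1 hf⟩
    rw [hG.isJ_iff hn hp, ← hG.copyCount_eq, hc]
  · intro hJ
    have hf := triangle_free_of_isJ hJ
    have hG : PT G := ⟨hJ.1.hasCutSystem, cycleGraph_three_free_iff.1 hf⟩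
    exact ⟨hJ.1, hf, by rw [hG.copyCount_eq, (hG.isJ_iff hn hJ.1).1 hJ]⟩
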